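/- **Definitions.** A QPT algorithm is a polynomial-time uniform family of quantum circuits (one deterministic polynomial-time classical program prints, on input $1^\lambda$, the $\lambda$-th circuit over a fixed universal gate set); all lengths are polynomials in the security parameter $\lambda$. Let $\ell=\ell(\lambda)$ be the message length. A *quantum SKE (QSKE)* scheme consists of QPT algorithms $\mathsf{KeyGen}(1^\lambda)\to sk$ (classical), $\mathsf{Enc}(sk,x)\to ct$ (a quantum state) and $\mathsf{Dec}(sk,ct)\to x'$, with $x,x'\in\{0,1\}^{\ell}$. It is *correct* if for every $x\in\{0,1\}^\ell$, $\Pr[\mathsf{Dec}(sk,\mathsf{Enc}(sk,x))=x]\ge 1-\mathrm{negl}(\lambda)$ for $sk\gets\mathsf{KeyGen}(1^\lambda)$. It is *IND-CPA secure* if for every QPT adversary $(\mathcal A_1,\mathcal A_2)$, $$\Big|\Pr[1\gets\mathcal A_2^{\mathsf{Enc}(sk,\cdot)}(st,ct^*) : ct^*\gets \mathsf{Enc}(sk,x_0)]-\Pr[1\gets\mathcal A_2^{\mathsf{Enc}(sk,\cdot)}(st,ct^*) : ct^*\gets \mathsf{Enc}(sk,x_1)]\Big|\le \mathrm{negl}(\lambda),$$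 where in both probabilities $sk\gets\mathsf{KeyGen}(1^\lambda)$ and $(x_0,x_1,st)\gets\mathcal A_1^{\mathsf{Enc}(sk,\cdot)}(1^\lambda)$ with $x_0,x_1$ classical and $st$ a quantum state, and the oracle $\mathsf{Enc}(sk,\cdot)$ is queried classically and returns $\mathsf{Enc}(sk,x)$ on query $x$. A *quantum PKE (QPKE)* scheme with quantum public keys consists of QPT algorithms $\mathsf{SKGen}(1^\lambda)\to sk$ (classical), $\mathsf{PKGen}(sk)\to pk$ (a quantum state, possibly mixed), $\mathsf{Enc}(pk,x)\to ct$ (a quantum state) and $\mathsf{Dec}(sk,ct)\to x'$. It is *correct* if for every $x\in\{0,1\}^\ell$, $\Pr[\mathsf{Dec}(sk,\mathsf{Enc}(pk,x))=x]\ge1-\mathrm{negl}(\lambda)$ for $sk\gets\mathsf{SKGen}(1^\lambda)$, $pk\gets\mathsf{PKGen}(sk)$. It is *IND-CPA secure* if for every polynomial $t$ and every QPT adversary $(\mathcal A_1,\mathcal A_2)$, $$\Big|\Pr[1\gets\mathcal A_2(st,ct^*) : ct^*\gets \mathsf{Enc}(pk,x_0)]-\Pr[1\gets\mathcal A_2(st,ct^*)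 : ct^*\gets \mathsf{Enc}(pk,x_1)]\Big|\le \mathrm{negl}(\lambda),$$ where $sk\gets\mathsf{SKGen}(1^\lambda)$, $pk\gets\mathsf{PKGen}(sk)$, $(x_0,x_1,st)\gets\mathcal A_1(pk^{\otimes t})$, and the challenge is encrypted under one further copy of $pk$. **Theorem.** 1. There exists a correct and IND-CPA secure QPKE scheme if and only if there exists a correct and IND-CPA secure QSKE scheme. This holds for all message lengths: if $\ell,\ell'$ are polynomials in $\lambda$ with $\ell(\lambda),\ell'(\lambda)\ge 1$ for $\lambda\ge1$, then such a QPKE scheme with $\ell$-bit messages exists if and only if such a QSKE scheme with $\ell'$-bit messages exists. 2. Moreover, if $(\mathsf{KeyGen},\mathsf{Enc},\mathsf{Dec})$ is a correct and IND-CPA secure QSKE scheme with one-bit messages, then there is a correct and IND-CPA secure QPKE scheme with one-bit messages with $\mathsf{SKGen}=\mathsf{KeyGen}$, the same decryption algorithm, public key $pk=\mathsf{Enc}(sk,0)\otimes\mathsf{Enc}(sk,1)$, and encryption of $x\in\{0,1\}$ under $pk=ct_0\otimes ct_1$ outputting $ct_x$. -/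

import Mathlib

namespace QCrypto

/-! ### Quantum states on `n` qubits -/

/-- Operators on `n` qubits, as matrices in the computational basis `{0,1}ⁿ`. (Sub)normalised density
operators are the positive semidefinite ones. -/
abbrev QState (n : ℕ) : Type := Matrix (Fin n → Bool) (Fin n → Bool) ℂ

open scoped ComplexOrder in
/-- Density operators. -/
def IsDensity {n : ℕ} (ρ : QState n) : Prop := ρ.PosSemidef ∧ ρ.trace = 1

/-- The basis state `|x⟩⟨x|`. -/
noncomputable def basis {n : ℕ} (x : Fin n → Bool) : QState n := Matrix.single x x 1

/-- The tensor product `ρ ⊗ σ` (first `m` qubits: `ρ`, last `n` qubits: `σ`). -/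
noncomputable def tens {m n : ℕ} (ρ : QState m) (σ : QState n) : QState (m + n) := fun x y =>
  ρ (fun j => x (Fin.castAdd n j)) (fun j => y (Fin.castAdd n j)) *
    σ (fun j => x (Fin.natAdd m j)) (fun j => y (Fin.natAdd m j))

/-- `t` copies `ρ^{⊗ t}`. -/
noncomputable def copies {n : ℕ} (t : ℕ) (ρ : QState n) : QState (t * n) := fun x y =>
  ∏ i : Fin t, ρ (fun j => x (finProdFinEquiv (i, j))) (fun j => y (finProdFinEquiv (i, j)))

/-- The probability that measuring all qubits of `ρ` in the computational basis yields `x`. -/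
noncomputable def prob {n : ℕ} (ρ : QState n) (x : Fin n → Bool) : ℝ := (ρ x x).re

/-- Measure the first `a` qubits of `τ`; the unnormalised state of the last `b` qubits on outcome
`x` (its trace is the probability of `x`). -/
def onOutcome {a b : ℕ} (τ : QState (a + b)) (x : Fin a → Bool) : QState b := fun u v =>
  τ (Fin.append x u) (Fin.append x v)

/-! ### Circuits -/

/-- Elementary gates, with wire addresses in `α`. The set Hadamard, `T`, CNOT, Toffoli is
universal. -/
inductive Gate (α : Type) : Type
  | hadamard (i : α)
  | tgate (i : α)
  | cnot (c t : α)
  | toffoli (a b t : α)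

/-- The operations of an oracle circuit: elementary gates, and queries. `query a b` sends the
block of wires starting at `a` to the oracle and receives the reply on the block starting at `b`. -/
inductive Op (α : Type) : Type
  | gate (g : Gate α)
  | query (a b : α)

/-- Change of addresses. -/
def Gate.map {α β : Type} (f : α → β) : Gate α → Gate β
  | .hadamard i => .hadamard (f i)
  | .tgate i => .tgate (f i)
  | .cnot c t => .cnot (f c) (f t)
  | .toffoli a b t => .toffoli (f a) (f b) (f t)

/-- Change of addresses. -/
def Op.map {α β : Type} (f : α → β) : Op α → Op β
  | .gate g => .gate (g.map f)
  | .query a b => .query (f a) (f b)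

/-- The gate acts on distinct wires among `0, …, N - 1`. -/
def Gate.Valid (N : ℕ) : Gate ℕ → Prop
  | .hadamard i => i < N
  | .tgate i => i < N
  | .cnot c t => c < N ∧ t < N ∧ c ≠ t
  | .toffoli a b t => a < N ∧ b < N ∧ t < N ∧ a ≠ b ∧ a ≠ t ∧ b ≠ t

/-- Validity of an operation on `N` wires, for an oracle that takes `q` bits and returns `m` qubits:
the two blocks of a query must lie inside the `N` wires and be disjoint. -/
def Op.Valid (N q m : ℕ) : Op ℕ → Prop
  | .gate g => g.Valid N
  | .query a b => a + q ≤ N ∧ b + m ≤ N ∧ (a + q ≤ b ∨ b + m ≤ a)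

/-- The value on wire `i` (`false` beyond the last wire). -/
def bitAt {N : ℕ} (x : Fin N → Bool) (i : ℕ) : Bool := if h : i < N then x ⟨i, h⟩ else false

/-- Flip wire `t` if `b` is true. -/
def flipIf {N : ℕ} (b : Bool) (t : ℕ) (x : Fin N → Bool) : Fin N → Bool := fun j =>
  if (j : ℕ) = t then xor (x j) b else x j

/-- The unitary that a (valid) gate applies to `N` wires. -/
noncomputable def Gate.unitary (N : ℕ) : Gate ℕ → QState N
  | .hadamard i => Matrix.of fun x y =>
      if ∀ j : Fin N, (j : ℕ) ≠ i → x j = y j then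
        (if bitAt x i && bitAt y i then -1 else 1) / (Real.sqrt 2 : ℂ)
      else 0
  | .tgate i => Matrix.diagonal fun x =>
      if bitAt x i then Complex.exp (Complex.I * Real.pi / 4) else 1
  | .cnot c t => Matrix.of fun x y => if x = flipIf (bitAt y c) t y then 1 else 0
  | .toffoli a b t => Matrix.of fun x y => if x = flipIf (bitAt y a && bitAt y b) t y then 1 else 0

/-- `ρ ↦ U ρ U†`. -/
noncomputable def Gate.apply {N : ℕ} (g : Gate ℕ) (ρ : QState N) : QState N :=
  g.unitary N * ρ * (g.unitary N).conjTranspose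

/-- The `k` wires starting at `a`. -/
def block {N : ℕ} (k a : ℕ) (x : Fin N → Bool) : Fin k → Bool := fun i => bitAt x (a + i)

/-- Replace the values on the `k` wires starting at `a` by `z`. -/
def overwrite {N k : ℕ} (a : ℕ) (z : Fin k → Bool) (x : Fin N → Bool) : Fin N → Bool := fun j =>
  if h : a ≤ j ∧ (j : ℕ) - a < k then z ⟨j - a, h.2⟩ else x j

/-- A query to a classically accessible oracle `O` with quantum replies: the `q` wires starting at
`a` are measured in the computational basis, the `m` wires starting at `b` are discarded and replaced
by the state `O x`, where `x` is the outcome. -/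
noncomputable def applyQuery {N q m : ℕ} (O : (Fin q → Bool) → QState m) (a b : ℕ) (ρ : QState N) :
    QState N := fun x y =>
  if block q a x = block q a y then
    O (block q a x) (block m b x) (block m b y) *
      ∑ z : Fin m → Bool, ρ (overwrite b z x) (overwrite b z y)
  else 0

/-- One operation of an oracle circuit. -/
noncomputable def Op.apply {N q m : ℕ} (O : (Fin q → Bool) → QState m) : Op ℕ → QState N → QState N
  | .gate g, ρ => g.apply ρ
  | .query a b, ρ => applyQuery O a b ρ

/-- Initial state of a circuit with `i` input, `o` output and `w` work wires (in this order). -/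
noncomputable def prepare {i : ℕ} (o w : ℕ) (ρ : QState i) : QState (i + o + w) :=
  tens (tens ρ (basis fun _ : Fin o => false)) (basis fun _ : Fin w => false)

/-- Final state of the output wires; all other wires are traced out. -/
noncomputable def readOut {i o w : ℕ} (τ : QState (i + o + w)) : QState o := fun u v =>
  ∑ x : Fin i → Bool, ∑ z : Fin w → Bool,
    τ (Fin.append (Fin.append x u) z) (Fin.append (Fin.append x v) z)

/-! ### The classical machine that writes the circuits -/

/-- Programs of a deterministic classical machine whose registers `0, 1, 2, …` are stacks of bits.
`emit` writes one operation on the output; an address is given by a list of registers and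
denotes the sum of their heights. -/
inductive Prog : Type
  | skip
  | push (r : ℕ) (b : Bool)
  | pop (r : ℕ)
  | emit (o : Op (List ℕ))
  | seq (P Q : Prog)
  /-- if the top of register `r` is `true` then `P` else `Q` -/
  | ite (r : ℕ) (P Q : Prog)
  /-- while register `r` is not empty do `P` -/
  | loop (r : ℕ) (P : Prog)

/-- The contents of the registers. -/
abbrev Store : Type := ℕ → List Bool

/-- The number denoted by an address. -/
def Store.addr (σ : Store) (rs : List ℕ) : ℕ := (rs.map fun r => (σ r).length).sum

/-- `Run P σ σ' out k`: started in store `σ`, the program `P` halts in store `σ'` after `k` steps,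
having written `out`. -/
inductive Run : Prog → Store → Store → List (Op ℕ) → ℕ → Prop
  | skip (σ : Store) : Run .skip σ σ [] 1
  | push (σ : Store) (r : ℕ) (b : Bool) :
      Run (.push r b) σ (Function.update σ r (b :: σ r)) [] 1
  | pop (σ : Store) (r : ℕ) : Run (.pop r) σ (Function.update σ r (σ r).tail) [] 1
  | emit (σ : Store) (o : Op (List ℕ)) : Run (.emit o) σ σ [o.map σ.addr] 1
  | seq {P Q : Prog} {σ σ' σ'' : Store} {u v : List (Op ℕ)} {k l : ℕ} :
      Run P σ σ' u k → Run Q σ' σ'' v l → Run (.seq P Q) σ σ'' (u ++ v) (k + l)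
  | iteTrue {r : ℕ} {P Q : Prog} {σ σ' : Store} {u : List (Op ℕ)} {k : ℕ} :
      (σ r).head? = some true → Run P σ σ' u k → Run (.ite r P Q) σ σ' u (k + 1)
  | iteFalse {r : ℕ} {P Q : Prog} {σ σ' : Store} {u : List (Op ℕ)} {k : ℕ} :
      (σ r).head? ≠ some true → Run Q σ σ' u k → Run (.ite r P Q) σ σ' u (k + 1)
  | loopDone {r : ℕ} {P : Prog} {σ : Store} : σ r = [] → Run (.loop r P) σ σ [] 1
  | loopStep {r : ℕ} {P : Prog} {σ σ' σ'' : Store} {u v : List (Op ℕ)} {k l : ℕ} :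
      σ r ≠ [] → Run P σ σ' u k → Run (.loop r P) σ' σ'' v l →
        Run (.loop r P) σ σ'' (u ++ v) (k + l + 1)

/-- The input `1ⁿ`: `n` ones in register `0`, all other registers empty. -/
def unaryInput (n : ℕ) : Store := Function.update (fun _ => []) 0 (List.replicate n true)

/-- The family of circuits is polynomial-time uniform: one program writes the `n`-th circuit on
input `1ⁿ` within a number of steps polynomial in `n`. -/
def Uniform (C : ℕ → List (Op ℕ)) : Prop :=
  ∃ (P : Prog) (p : Polynomial ℕ), ∀ n : ℕ, ∃ (σ : Store) (k : ℕ),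
    Run P (unaryInput n) σ (C n) k ∧ k ≤ p.eval n

/-! ### Quantum polynomial-time algorithms -/

/-- `f` is a polynomial with natural-number coefficients. -/
def IsPoly (f : ℕ → ℕ) : Prop := ∃ p : Polynomial ℕ, ∀ n, f n = p.eval n

/-- A quantum polynomial-time (QPT) algorithm which, for security parameter `n`, takes `i n` qubits
to `o n` qubits: a polynomial-time uniform family of quantum circuits. (Classical inputs are given
as basis states; classical outputs are obtained by measuring in the computational basis.) -/
structure QPT (i o : ℕ → ℕ) where
  /-- number of work wires -/
  work : ℕ → ℕ
  work_poly : IsPoly work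
  circ : ℕ → List (Gate ℕ)
  valid : ∀ n, ∀ g ∈ circ n, g.Valid (i n + o n + work n)
  uniform : Uniform fun n => (circ n).map Op.gate

/-- The quantum channel computed by a QPT algorithm for security parameter `n`. -/
noncomputable def QPT.run {i o : ℕ → ℕ} (A : QPT i o) (n : ℕ) (ρ : QState (i n)) : QState (o n) :=
  readOut ((A.circ n).foldl (fun τ g => g.apply τ) (prepare (o n) (A.work n) ρ))

/-- A QPT algorithm with access to an oracle that takes `q n` bits and returns `m n` qubits. -/
structure OracleQPT (q m i o : ℕ → ℕ) where
  /-- number of work wires -/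
  work : ℕ → ℕ
  work_poly : IsPoly work
  circ : ℕ → List (Op ℕ)
  valid : ∀ n, ∀ g ∈ circ n, g.Valid (i n + o n + work n) (q n) (m n)
  uniform : Uniform circ

/-- The quantum channel computed by an oracle algorithm with oracle `O`. -/
noncomputable def OracleQPT.run {q m i o : ℕ → ℕ} (A : OracleQPT q m i o) (n : ℕ)
    (O : (Fin (q n) → Bool) → QState (m n)) (ρ : QState (i n)) : QState (o n) :=
  readOut ((A.circ n).foldl (fun τ g => g.apply O τ) (prepare (o n) (A.work n) ρ))

/-- Negligible functions of the security parameter. -/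
def Negligible (f : ℕ → ℝ) : Prop :=
  Asymptotics.SuperpolynomialDecay Filter.atTop (fun n : ℕ => (n : ℝ)) f

/-! ### Quantum secret-key encryption -/

/-- A quantum SKE scheme with `ℓ`-bit messages, `κ`-bit classical keys and `c`-qubit ciphertexts. -/
structure QSKE (ℓ κ c : ℕ → ℕ) where
  keyGen : QPT (fun _ => 0) κ
  enc : QPT (fun n => κ n + ℓ n) c
  dec : QPT (fun n => κ n + c n) ℓ

namespace QSKE

variable {ℓ κ c : ℕ → ℕ}

/-- Probability that `KeyGen(1ⁿ)` outputs `sk`. -/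
noncomputable def keyProb (S : QSKE ℓ κ c) (n : ℕ) (sk : Fin (κ n) → Bool) : ℝ :=
  prob (S.keyGen.run n 1) sk

/-- The ciphertext state `Enc(sk, x)`. -/
noncomputable def ct (S : QSKE ℓ κ c) (n : ℕ) (sk : Fin (κ n) → Bool) (x : Fin (ℓ n) → Bool) :
    QState (c n) :=
  S.enc.run n (basis (Fin.append sk x))

/-- Every message is decrypted correctly except with negligible probability. -/
def Correct (S : QSKE ℓ κ c) : Prop :=
  ∃ ε : ℕ → ℝ, Negligible ε ∧ ∀ (n : ℕ) (x : Fin (ℓ n) → Bool),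
    1 - ε n ≤ ∑ sk, S.keyProb n sk * prob (S.dec.run n (tens (basis sk) (S.ct n sk x))) x

/-- Probability that the adversary `(A₁, A₂)` outputs `1` in the game in which the challenge is an
encryption of `x₀` (for `b = false`) or `x₁` (for `b = true`). `A₁` outputs `x₀, x₁` and the
`s`-qubit state `st`; both `A₁` and `A₂` have access to the oracle `Enc(sk, ·)`. -/
noncomputable def game (S : QSKE ℓ κ c) {s : ℕ → ℕ}
    (A₁ : OracleQPT ℓ c (fun _ => 0) (fun n => ℓ n + (ℓ n + s n)))
    (A₂ : OracleQPT ℓ c (fun n => s n + c n) (fun _ => 1)) (b : Bool) (n : ℕ) : ℝ :=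
  ∑ sk, S.keyProb n sk * ∑ x₀ : Fin (ℓ n) → Bool, ∑ x₁ : Fin (ℓ n) → Bool,
    prob (A₂.run n (S.ct n sk)
      (tens (onOutcome (onOutcome (A₁.run n (S.ct n sk) 1) x₀) x₁)
        (S.ct n sk (if b then x₁ else x₀)))) (fun _ => true)

/-- IND-CPA security against all QPT adversaries. -/
def INDCPA (S : QSKE ℓ κ c) : Prop :=
  ∀ s : ℕ → ℕ, IsPoly s →
    ∀ (A₁ : OracleQPT ℓ c (fun _ => 0) (fun n => ℓ n + (ℓ n + s n)))
      (A₂ : OracleQPT ℓ c (fun n => s n + c n) (fun _ => 1)),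
      Negligible fun n => |S.game A₁ A₂ false n - S.game A₁ A₂ true n|

/-- Correctness and IND-CPA security. -/
def Secure (S : QSKE ℓ κ c) : Prop := S.Correct ∧ S.INDCPA

end QSKE

/-- There exists an IND-CPA secure QSKE scheme for `ℓ`-bit messages. -/
def ExistsQSKE (ℓ : ℕ → ℕ) : Prop :=
  ∃ κ c : ℕ → ℕ, IsPoly κ ∧ IsPoly c ∧ ∃ S : QSKE ℓ κ c, S.Secure

/-! ### Quantum public-key encryption with quantum public keys -/

/-- A quantum PKE scheme with `ℓ`-bit messages, `κ`-bit classical secret keys, `p`-qubit public keys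
and `c`-qubit ciphertexts. -/
structure QPKE (ℓ κ p c : ℕ → ℕ) where
  skGen : QPT (fun _ => 0) κ
  pkGen : QPT κ p
  enc : QPT (fun n => p n + ℓ n) c
  dec : QPT (fun n => κ n + c n) ℓ

namespace QPKE

variable {ℓ κ p c : ℕ → ℕ}

/-- Probability that `SKGen(1ⁿ)` outputs `sk`. -/
noncomputable def keyProb (P : QPKE ℓ κ p c) (n : ℕ) (sk : Fin (κ n) → Bool) : ℝ :=
  prob (P.skGen.run n 1) sk

/-- The public-key state `PKGen(sk)`. -/
noncomputable def pk (P : QPKE ℓ κ p c) (n : ℕ) (sk : Fin (κ n) → Bool) : QState (p n) :=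
  P.pkGen.run n (basis sk)

/-- The ciphertext state `Enc(ρ, x)` under a public key in state `ρ`. -/
noncomputable def ct (P : QPKE ℓ κ p c) (n : ℕ) (ρ : QState (p n)) (x : Fin (ℓ n) → Bool) :
    QState (c n) :=
  P.enc.run n (tens ρ (basis x))

/-- Every message is decrypted correctly except with negligible probability. -/
def Correct (P : QPKE ℓ κ p c) : Prop :=
  ∃ ε : ℕ → ℝ, Negligible ε ∧ ∀ (n : ℕ) (x : Fin (ℓ n) → Bool),
    1 - ε n ≤ ∑ sk, P.keyProb n sk *
      prob (P.dec.run n (tens (basis sk) (P.ct n (P.pk n sk) x))) x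

/-- Probability that the adversary `(A₁, A₂)`, given `t` copies of the public key, outputs `1` in the
game in which the challenge is an encryption of `x₀` (for `b = false`) or `x₁` (for `b = true`) under
a further copy of the public key. -/
noncomputable def game (P : QPKE ℓ κ p c) {t s : ℕ → ℕ}
    (A₁ : QPT (fun n => t n * p n) (fun n => ℓ n + (ℓ n + s n)))
    (A₂ : QPT (fun n => s n + c n) (fun _ => 1)) (b : Bool) (n : ℕ) : ℝ :=
  ∑ sk, P.keyProb n sk * ∑ x₀ : Fin (ℓ n) → Bool, ∑ x₁ : Fin (ℓ n) → Bool,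
    prob (A₂.run n
      (tens (onOutcome (onOutcome (A₁.run n (copies (t n) (P.pk n sk))) x₀) x₁)
        (P.ct n (P.pk n sk) (if b then x₁ else x₀)))) (fun _ => true)

/-- IND-CPA security against all QPT adversaries, for every polynomial number of copies of the public
key. -/
def INDCPA (P : QPKE ℓ κ p c) : Prop :=
  ∀ t s : ℕ → ℕ, IsPoly t → IsPoly s →
    ∀ (A₁ : QPT (fun n => t n * p n) (fun n => ℓ n + (ℓ n + s n)))
      (A₂ : QPT (fun n => s n + c n) (fun _ => 1)),
      Negligible fun n => |P.game A₁ A₂ false n - P.game A₁ A₂ true n|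

/-- Correctness and IND-CPA security. -/
def Secure (P : QPKE ℓ κ p c) : Prop := P.Correct ∧ P.INDCPA

end QPKE

/-- There exists an IND-CPA secure QPKE scheme for `ℓ`-bit messages. -/
def ExistsQPKE (ℓ : ℕ → ℕ) : Prop :=
  ∃ κ p c : ℕ → ℕ, IsPoly κ ∧ IsPoly p ∧ IsPoly c ∧ ∃ P : QPKE ℓ κ p c, P.Secure

end QCrypto

namespace QCrypto

open Function List

/-! ### Bounded execution of programs -/

/-! A quantum public key may be a mixed state, it is available only in copies, and encrypting under
a copy uses it up. Hence holding copies of a public key and having access to an encryption oracle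
amount to the same thing.

From public to secret keys: `Enc(sk, x)` generates a public key from `sk` and encrypts `x` under it.
A reply of the oracle `Enc(sk, ·)` is then the output of one fixed algorithm on the query and one
copy of the public key, so an adversary with polynomially many queries can be run on that many
copies (`OracleQPT.exists_simulation`). The copies needed by the second stage are handed over inside
the state of the first stage. The two games have equal values (`ExistsQSKE.of_existsQPKE`).

From secret to public keys: `Enc(sk, 0) ⊗ Enc(sk, 1)` serves as a public key for one bit. Being a
mixed state, `t` copies of it are nothing but `2t` independent ciphertexts, which the oracle
supplies (`OracleQPT.exists_run_copies`), and the challenge is one more fresh ciphertext. Again the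
games have equal values (`QSKE.exists_qpke`). If the secret-key scheme has longer messages, the bit
`x` is encoded as `x0…0` and decryption keeps the first bit (`ExistsQPKE.of_existsQSKE`).

Message lengths: a one-bit public-key scheme extends to `ℓ` bits by encrypting each bit under its
own copy of the key. Correctness follows from a union bound (`QPKE.Correct.bitwise`), security from
a hybrid argument with a random position (`QPKE.INDCPA.bitwise`). The position is drawn with fair
coins, hence uniformly from a power of two `D ≥ ℓ`; positions beyond the message contribute equal
terms to both games, so the telescoping sum is not disturbed and the loss is the factor `D ≤ 2ℓ +
1`. All other passages between lengths are routed through one-bit public-key encryption.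

Most of the work lies in exhibiting the reductions as uniform circuit families and computing their
output states. Uniformity: `UNum` and `UGen` are the numbers and the lists of operations that a
program computes from the heights of its registers; they are closed under arithmetic, local
variables and loops, and `UGen.splice` runs the program that prints an adversary while replacing
every query that it prints. Semantics: an operator on `N` wires is a function of two bit strings, a
state on a block of wires is a function of the bits in that block, and a tensor product over
disjoint blocks becomes a pointwise product. `Tri` is a Hoare triple with a frame rule for this
product, so a circuit is verified by composing triples, and what remains are inequalities between
addresses and identities in a commutative ring. Resets: circuits may reset wires, in the guise of
queries to an oracle that always replies `|0⟩`, which lets subroutines return their scratch space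
clean; at the end the resets are replaced by swaps with fresh wires (`OracleQPT.exists_qpt`). -/

theorem eval_mono (p : Polynomial ℕ) {a b : ℕ} (h : a ≤ b) : p.eval a ≤ p.eval b := by
  rw [Polynomial.eval_eq_sum, Polynomial.eval_eq_sum]
  exact Finset.sum_le_sum fun i _ => Nat.mul_le_mul_left _ (Nat.pow_le_pow_left h i)

/-- `P` halts within `T` steps. -/
def Halts (P : Prog) (σ σ' : Store) (out : List (Op ℕ)) (T : ℕ) : Prop :=
  ∃ k ≤ T, Run P σ σ' out k

namespace Halts

variable {P Q : Prog} {σ σ' σ'' : Store} {u v : List (Op ℕ)} {S T : ℕ}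

theorem mono (h : Halts P σ σ' u S) (hST : S ≤ T) : Halts P σ σ' u T :=
  let ⟨k, hk, hr⟩ := h
  ⟨k, hk.trans hST, hr⟩

theorem cast {σ₂ : Store} {u₂ : List (Op ℕ)} (h : Halts P σ σ' u S) (hσ : σ' = σ₂) (hu : u = u₂)
    (hST : S ≤ T) : Halts P σ σ₂ u₂ T := by
  subst hσ hu
  exact h.mono hST

theorem seq (h : Halts P σ σ' u S) (h' : Halts Q σ' σ'' v T) :
    Halts (.seq P Q) σ σ'' (u ++ v) (S + T) :=
  let ⟨_, hk, hr⟩ := h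
  let ⟨_, hk', hr'⟩ := h'
  ⟨_, Nat.add_le_add hk hk', .seq hr hr'⟩

/-- Sequential composition of two programs of which the first prints nothing. -/
theorem seq' (h : Halts P σ σ' [] S) (h' : Halts Q σ' σ'' v T) :
    Halts (.seq P Q) σ σ'' v (S + T) := h.seq h'

theorem skip (σ : Store) : Halts .skip σ σ [] 1 := ⟨1, le_rfl, .skip σ⟩

theorem push (σ : Store) (r : ℕ) (b : Bool) :
    Halts (.push r b) σ (update σ r (b :: σ r)) [] 1 := ⟨1, le_rfl, .push σ r b⟩

theorem pop (σ : Store) (r : ℕ) : Halts (.pop r) σ (update σ r (σ r).tail) [] 1 :=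
  ⟨1, le_rfl, .pop σ r⟩

theorem ite_true {r : ℕ} (hr : (σ r).head? = some true) (h : Halts P σ σ' u T) :
    Halts (.ite r P Q) σ σ' u (T + 1) :=
  let ⟨_, hk, hr'⟩ := h
  ⟨_, Nat.succ_le_succ hk, .iteTrue hr hr'⟩

theorem ite_false {r : ℕ} (hr : (σ r).head? ≠ some true) (h : Halts Q σ σ' u T) :
    Halts (.ite r P Q) σ σ' u (T + 1) :=
  let ⟨_, hk, hr'⟩ := h
  ⟨_, Nat.succ_le_succ hk, .iteFalse hr hr'⟩

theorem loop_done {r : ℕ} (h : σ r = []) : Halts (.loop r P) σ σ [] 1 := ⟨1, le_rfl, .loopDone h⟩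

theorem loop_step {r : ℕ} (hr : σ r ≠ []) (h : Halts P σ σ' u S)
    (h' : Halts (.loop r P) σ' σ'' v T) : Halts (.loop r P) σ σ'' (u ++ v) (S + T + 1) :=
  let ⟨_, hk, hr1⟩ := h
  let ⟨_, hk', hr2⟩ := h'
  ⟨_, by omega, .loopStep hr hr1 hr2⟩

/-- A loop is verified by writing down the store before each iteration as a function of the
iteration number; the last store is the one in which the loop register is empty. -/
theorem loop {r : ℕ} (N : ℕ) (τ : ℕ → Store) (out : ℕ → List (Op ℕ)) (hend : τ N r = [])
    (hstep : ∀ j < N, τ j r ≠ [] ∧ Halts P (τ j) (τ (j + 1)) (out j) T) :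
    Halts (.loop r P) (τ 0) (τ N) ((List.range N).flatMap out) (N * (T + 1) + 1) := by
  induction N generalizing τ out with
  | zero => simpa using loop_done hend
  | succ N ih =>
    have h := ih (fun j => τ (j + 1)) (fun j => out (j + 1)) hend
      fun j hj => hstep (j + 1) (by omega)
    have h0 := hstep 0 (by omega)
    refine (loop_step h0.1 h0.2 h).cast rfl ?_ (by ring_nf; omega)
    simp [List.range_succ_eq_map, List.flatMap_map]

end Halts

/-- Empty register `r`. -/
def Prog.clear (r : ℕ) : Prog := .loop r (.pop r)

/-- Move the content of `r` to `s`, in reverse order. -/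
def Prog.move (r s : ℕ) : Prog :=
  .loop r (.seq (.ite r (.push s true) (.push s false)) (.pop r))

/-- Push the height of `r` in unary on `d`; `t` is scratch. -/
def Prog.count (r d t : ℕ) : Prog :=
  .seq (.loop r (.seq (.ite r (.push t true) (.push t false)) (.seq (.pop r) (.push d true))))
    (.move t r)

/-- `l` in unary. -/
abbrev unary (l : ℕ) : List Bool := replicate l true

theorem Halts.clear (σ : Store) (r : ℕ) :
    Halts (.clear r) σ (update σ r []) [] (2 * (σ r).length + 1) := by
  generalize hl : σ r = l
  induction l generalizing σ with
  | nil => exact (Halts.loop_done hl).cast (by rw [← hl, update_eq_self]) rfl (by simp)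
  | cons b l ih =>
    have h := ih (update σ r l) (by simp)
    have h1 := Halts.pop σ r
    rw [hl, List.tail_cons] at h1
    refine (Halts.loop_step (by simp [hl]) h1 h).cast (by simp) rfl ?_
    simp only [List.length_cons]; omega

theorem Halts.ite_push (σ : Store) (r s : ℕ) {b : Bool} {l : List Bool} (h : σ r = b :: l) :
    Halts (.ite r (.push s true) (.push s false)) σ (update σ s (b :: σ s)) [] 2 := by
  cases b with
  | true => exact Halts.ite_true (by simp [h]) (Halts.push σ s true)
  | false => exact Halts.ite_false (by simp [h]) (Halts.push σ s false)

theorem Halts.move (σ : Store) {r s : ℕ} (hrs : r ≠ s) :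
    Halts (.move r s) σ (update (update σ s ((σ r).reverse ++ σ s)) r []) []
      (4 * (σ r).length + 1) := by
  generalize hl : σ r = l
  induction l generalizing σ with
  | nil =>
    refine (Halts.loop_done hl).cast ?_ rfl (by simp)
    rw [List.reverse_nil, List.nil_append, update_eq_self, ← hl, update_eq_self]
  | cons b l ih =>
    have h1 := Halts.ite_push σ r s hl
    have h2 := Halts.pop (update σ s (b :: σ s)) r
    rw [update_of_ne hrs, hl, List.tail_cons] at h2
    have h3 := ih (update (update σ s (b :: σ s)) r l) (by simp)
    refine (Halts.loop_step (by simp [hl]) (h1.seq h2) h3).cast ?_ rfl ?_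
    · funext q
      simp only [update_apply]
      split_ifs <;> simp_all
    · simp only [List.length_cons]; omega

/-- Reading a register destroys it, so its content is saved on `t` in reverse order while `d` grows,
and `move` reverses it once more on the way back. -/
theorem Halts.count (σ : Store) {r d t : ℕ} (hrd : r ≠ d) (hrt : r ≠ t) (hdt : d ≠ t)
    (ht : σ t = []) :
    Halts (.count r d t) σ (update σ d (unary (σ r).length ++ σ d)) [] (9 * (σ r).length + 2) := by
  have key : ∀ (l : List Bool) (σ : Store), σ r = l → Halts
      (.loop r (.seq (.ite r (.push t true) (.push t false)) (.seq (.pop r) (.push d true)))) σ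
      (update (update (update σ t (l.reverse ++ σ t)) d (unary l.length ++ σ d)) r []) []
      (5 * l.length + 1) := by
    intro l
    induction l with
    | nil =>
      intro σ hl
      refine (Halts.loop_done hl).cast ?_ rfl (by simp)
      funext q
      simp only [update_apply]
      split_ifs <;> simp_all
    | cons b l ih =>
      intro σ hl
      have h1 := Halts.ite_push σ r t hl
      have h2 := Halts.pop (update σ t (b :: σ t)) r
      rw [update_of_ne hrt, hl, List.tail_cons] at h2
      have h3 := Halts.push (update (update σ t (b :: σ t)) r l) d true
      have h4 := ih (update (update (update σ t (b :: σ t)) r l) d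
        (true :: (update (update σ t (b :: σ t)) r l) d)) (by simp [update_of_ne hrd])
      refine (Halts.loop_step (by simp [hl]) (h1.seq (h2.seq h3)) h4).cast ?_ rfl ?_
      · funext q
        simp only [update_apply]
        split_ifs <;> simp_all
        simp [unary, List.replicate_succ']
      · simp only [List.length_cons]; omega
  have h1 := key _ σ rfl
  have h2 := Halts.move (update (update (update σ t ((σ r).reverse ++ σ t)) d
    (unary (σ r).length ++ σ d)) r []) (Ne.symm hrt)
  refine (h1.seq h2).cast ?_ rfl ?_
  · funext q
    simp only [update_apply]
    split_ifs <;> simp_all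
  · simp only [update_apply, if_neg (Ne.symm hrt), if_neg (Ne.symm hdt), ht]
    simp; omega

/-! ### Numbers computable in unary and printable lists of operations -/

/-- The heights of the registers. -/
def Store.heights (σ : Store) : ℕ → ℕ := fun r => (σ r).length

/-- The total height of the registers below `D`. -/
def Store.size (D : ℕ) (σ : Store) : ℕ := ∑ r ∈ Finset.range D, (σ r).length

/-- The registers from `D` on are empty. -/
def Store.EmptyFrom (D : ℕ) (σ : Store) : Prop := ∀ r, D ≤ r → σ r = []

/-- `f` depends only on the variables below `d`. -/
def DependsBelow {α : Type} (d : ℕ) (f : (ℕ → ℕ) → α) : Prop :=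
  ∀ e e' : ℕ → ℕ, (∀ r < d, e r = e' r) → f e = f e'

theorem DependsBelow.mono {α : Type} {d d' : ℕ} {f : (ℕ → ℕ) → α} (h : DependsBelow d f)
    (hd : d ≤ d') : DependsBelow d' f := fun e e' he => h e e' fun r hr => he r (hr.trans_le hd)

theorem Store.EmptyFrom.update {D D' r : ℕ} {σ : Store} (h : σ.EmptyFrom D) (l : List Bool)
    (hD : D ≤ D') (hr : r < D') : Store.EmptyFrom D' (update σ r l) := fun s hs => by
  rw [update_of_ne (by omega)]
  exact h s (by omega)

theorem Store.EmptyFrom.mono {D D' : ℕ} {σ : Store} (h : σ.EmptyFrom D) (hD : D ≤ D') :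
    σ.EmptyFrom D' := fun r hr => h r (hD.trans hr)

theorem Store.size_update_le (D : ℕ) (σ : Store) (r : ℕ) (l : List Bool) :
    Store.size D (update σ r l) ≤ σ.size D + l.length := by
  unfold Store.size
  by_cases hr : r ∈ Finset.range D
  · rw [Finset.sum_eq_sum_sdiff_singleton_add hr, Finset.sum_eq_sum_sdiff_singleton_add hr, update_self]
    have : ∑ x ∈ Finset.range D \ {r}, (update σ r l x).length
        = ∑ x ∈ Finset.range D \ {r}, (σ x).length := by
      refine Finset.sum_congr rfl fun x hx => ?_
      rw [update_of_ne]
      simp at hx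
      exact hx.2
    omega
  · rw [Finset.sum_congr rfl (g := fun x => (σ x).length)]
    · omega
    · intro x hx
      rw [update_of_ne]
      rintro rfl
      exact hr hx

theorem Store.EmptyFrom.size_eq {D D' : ℕ} {σ : Store} (h : σ.EmptyFrom D) (hD : D ≤ D') :
    σ.size D' = σ.size D := by
  unfold Store.size
  symm
  refine Finset.sum_subset (by simpa using hD) fun x _ hx => ?_
  rw [h x (by simpa using hx)]
  rfl

theorem Store.length_le_size {D r : ℕ} (σ : Store) (h : r < D) : (σ r).length ≤ σ.size D :=
  Finset.single_le_sum (f := fun r => (σ r).length) (fun _ _ => Nat.zero_le _)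
    (Finset.mem_range.2 h)

/-- `g` is computable in unary: for every `D` beyond the relevant registers some program writes the
value of `g` at the heights of the registers on register `D`, in time polynomial in the heights. -/
def UNum (g : (ℕ → ℕ) → ℕ) : Prop :=
  ∃ d, DependsBelow d g ∧ ∀ D, d ≤ D → ∃ (P : Prog) (p : Polynomial ℕ), ∀ σ : Store,
    σ.EmptyFrom D → g σ.heights ≤ p.eval (σ.size D) ∧
      Halts P σ (update σ D (unary (g σ.heights))) [] (p.eval (σ.size D))

/-- `f` is printable: for every `D` beyond the relevant registers some program prints the value of
`f` at the heights of the registers, in time polynomial in the heights, and restores the store. -/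
def UGen (f : (ℕ → ℕ) → List (Op ℕ)) : Prop :=
  ∃ d, DependsBelow d f ∧ ∀ D, d ≤ D → ∃ (P : Prog) (p : Polynomial ℕ), ∀ σ : Store,
    σ.EmptyFrom D → Halts P σ σ (f σ.heights) (p.eval (σ.size D))

theorem Store.heights_update (σ : Store) (r : ℕ) (l : List Bool) :
    Store.heights (update σ r l) = update σ.heights r l.length := by
  funext s
  simp only [Store.heights, update_apply]
  split_ifs <;> rfl

theorem DependsBelow.heights_update {α : Type} {d r : ℕ} {f : (ℕ → ℕ) → α} (h : DependsBelow d f)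
    (hr : d ≤ r) (σ : Store) (l : List Bool) :
    f (Store.heights (update σ r l)) = f σ.heights :=
  h _ _ fun s hs => by rw [Store.heights_update, update_of_ne (by omega)]

namespace UNum

variable {f g : (ℕ → ℕ) → ℕ}

theorem var (v : ℕ) : UNum fun e => e v := by
  refine ⟨v + 1, fun e e' h => h v (by omega), fun D hD =>
    ⟨.count v D (D + 1), 9 * Polynomial.X + 2, fun σ hσ => ?_⟩⟩
  have h1 := Store.length_le_size σ (show v < D by omega)
  have h := Halts.count σ (r := v) (d := D) (t := D + 1) (by omega) (by omega) (by omega)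
    (hσ _ (by omega))
  simp only [Polynomial.eval_add, Polynomial.eval_mul, Polynomial.eval_ofNat, Polynomial.eval_X,
    Store.heights]
  refine ⟨by omega, h.cast ?_ rfl (by omega)⟩
  rw [hσ D le_rfl, List.append_nil]

theorem const (k : ℕ) : UNum fun _ => k := by
  refine ⟨0, fun _ _ _ => rfl, fun D _ => ?_⟩
  induction k with
  | zero =>
    refine ⟨.skip, 1, fun σ hσ => ⟨by simp, (Halts.skip σ).cast ?_ rfl (by simp)⟩⟩
    exact ((congrArg _ (hσ D le_rfl).symm).trans (update_eq_self _ _)).symm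
  | succ k ih =>
    obtain ⟨P, p, h⟩ := ih
    refine ⟨.seq P (.push D true), p + 1, fun σ hσ => ?_⟩
    obtain ⟨h1, h2⟩ := h σ hσ
    simp only [Polynomial.eval_add, Polynomial.eval_one]
    refine ⟨Nat.succ_le_succ h1, (h2.seq' (Halts.push _ D true)).cast ?_ rfl le_rfl⟩
    simp [List.replicate_succ]

/-- Two numbers are computed one after the other. -/
theorem pair (hf : UNum f) (hg : UNum g) :
    ∃ d, DependsBelow d f ∧ DependsBelow d g ∧ ∀ D, d ≤ D → ∃ (P : Prog) (p : Polynomial ℕ),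
      ∀ σ : Store, σ.EmptyFrom D → f σ.heights ≤ p.eval (σ.size D) ∧
        g σ.heights ≤ p.eval (σ.size D) ∧
        Halts P σ (update (update σ D (unary (f σ.heights))) (D + 1) (unary (g σ.heights))) []
          (p.eval (σ.size D)) := by
  obtain ⟨d, hd, hf⟩ := hf
  obtain ⟨d', hd', hg⟩ := hg
  refine ⟨max d d', hd.mono (le_max_left _ _), hd'.mono (le_max_right _ _), fun D hD => ?_⟩
  obtain ⟨P, p, hP⟩ := hf D (by omega)
  obtain ⟨Q, q, hQ⟩ := hg (D + 1) (by omega)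
  refine ⟨.seq P Q, p + q.comp (Polynomial.X + p), fun σ hσ => ?_⟩
  obtain ⟨h1, h2⟩ := hP σ hσ
  obtain ⟨h3, h4⟩ := hQ (update σ D (unary (f σ.heights))) (hσ.update _ (by omega) (by omega))
  have hs : Store.size (D + 1) (update σ D (unary (f σ.heights))) ≤ σ.size D + p.eval (σ.size D) :=
    (Store.size_update_le _ _ _ _).trans (by
      rw [hσ.size_eq (Nat.le_succ D), List.length_replicate]; omega)
  have hq := eval_mono q hs
  rw [hd'.heights_update (by omega)] at h3 h4
  simp only [Polynomial.eval_add, Polynomial.eval_comp, Polynomial.eval_X]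
  exact ⟨by omega, by omega, (h2.seq' h4).mono (by omega)⟩

/-- Reduces an arithmetic operation to a program `Q` that combines two unary numbers standing on the
registers `D` and `D + 1`. The value bound is part of the hypothesis because later programs run in
time polynomial in it. -/
theorem binary (op : ℕ → ℕ → ℕ) (q : Polynomial ℕ)
    (tail : ∀ D, ∃ Q : Prog, ∀ (σ : Store), σ.EmptyFrom D → ∀ F G,
      op F G ≤ q.eval (F + G) ∧
      Halts Q (update (update σ D (unary F)) (D + 1) (unary G)) (update σ D (unary (op F G))) []
        (q.eval (F + G)))
    (hf : UNum f) (hg : UNum g) : UNum fun e => op (f e) (g e) := by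
  obtain ⟨d, hd, hd', h⟩ := pair hf hg
  refine ⟨d, fun e e' he => congrArg₂ op (hd e e' he) (hd' e e' he), fun D hD => ?_⟩
  obtain ⟨P, p, hP⟩ := h D hD
  obtain ⟨Q, hQ⟩ := tail D
  refine ⟨.seq P Q, p + q.comp (p + p), fun σ hσ => ?_⟩
  obtain ⟨h1, h2, h3⟩ := hP σ hσ
  obtain ⟨h4, h5⟩ := hQ σ hσ (f σ.heights) (g σ.heights)
  have hq := eval_mono q (show f σ.heights + g σ.heights ≤ p.eval (σ.size D) + p.eval (σ.size D) by
    omega)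
  simp only [Polynomial.eval_add, Polynomial.eval_comp]
  exact ⟨by omega, (h3.seq' h5).mono (by omega)⟩

theorem add (hf : UNum f) (hg : UNum g) : UNum fun e => f e + g e := by
  refine binary (· + ·) (4 * Polynomial.X + 1) (fun D => ⟨.move (D + 1) D, fun σ hσ F G => ?_⟩) hf hg
  simp only [Polynomial.eval_add, Polynomial.eval_mul, Polynomial.eval_ofNat, Polynomial.eval_X,
    Polynomial.eval_one]
  refine ⟨by omega, (Halts.move _ (by omega)).cast ?_ rfl ?_⟩
  · have := hσ (D + 1) (by omega)
    funext q
    simp only [update_apply]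
    split_ifs <;> first | (exfalso; omega) | rfl | (subst_vars; simp [*, Nat.add_comm])
  · simp only [update_apply]; simp

/-- Popping an empty register does nothing, so removing one bit from `D` for each bit of `D + 1` is
truncated subtraction. With it `1 - (1 - k)` is the minimum of `1` and `k`, which later replaces
case distinctions. -/
theorem sub (hf : UNum f) (hg : UNum g) : UNum fun e => f e - g e := by
  refine binary (· - ·) (3 * Polynomial.X + 1) (fun D =>
    ⟨.loop (D + 1) (.seq (.pop (D + 1)) (.pop D)), fun σ hσ F G => ?_⟩) hf hg
  simp only [Polynomial.eval_add, Polynomial.eval_mul, Polynomial.eval_ofNat, Polynomial.eval_X,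
    Polynomial.eval_one]
  refine ⟨by omega, ?_⟩
  have h := Halts.loop (r := D + 1) (P := .seq (.pop (D + 1)) (.pop D)) (T := 2) G
    (fun j => update (update σ D (unary (F - j))) (D + 1) (unary (G - j))) (fun _ => [])
    (by simp) (fun j hj => ⟨by simp; omega, by
      refine ((Halts.pop _ _).seq (Halts.pop _ _)).cast ?_ rfl le_rfl
      funext q
      simp only [update_apply]
      split_ifs <;> first | (exfalso; omega) | (subst_vars; simp [*]; try omega)⟩)
  refine h.cast ?_ (by simp) (by ring_nf; omega)
  have := hσ (D + 1) (by omega)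
  funext q
  simp only [update_apply]
  split_ifs <;> first | (exfalso; omega) | rfl | (subst_vars; simp [*])

theorem mul (hf : UNum f) (hg : UNum g) : UNum fun e => f e * g e := by
  refine binary (· * ·) (30 * Polynomial.X * Polynomial.X + 30 * Polynomial.X + 30) (fun D =>
    ⟨.seq (.loop D (.seq (.pop D) (.count (D + 1) (D + 2) (D + 3))))
      (.seq (.clear (D + 1)) (.move (D + 2) D)), fun σ hσ F G => ?_⟩) hf hg
  simp only [Polynomial.eval_add, Polynomial.eval_mul, Polynomial.eval_ofNat, Polynomial.eval_X]
  have hFG : F * G ≤ (F + G) * (F + G) := Nat.mul_le_mul (by omega) (by omega)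
  refine ⟨by nlinarith, ?_⟩
  have h1 := hσ (D + 1) (by omega)
  have h2 := hσ (D + 2) (by omega)
  have h3 := hσ (D + 3) (by omega)
  -- After `j` rounds register `D + 2` holds `j * G`.
  have h := Halts.loop (r := D) (P := .seq (.pop D) (.count (D + 1) (D + 2) (D + 3)))
    (T := 9 * G + 3) F
    (fun j => update (update (update σ D (unary (F - j))) (D + 1) (unary G)) (D + 2)
      (unary (j * G))) (fun _ => [])
    (by simp) (fun j hj => ⟨by simp; omega, by
      refine ((Halts.pop _ _).seq (Halts.count _ (by omega) (by omega) (by omega) ?_)).cast ?_ rfl ?_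
      · simp [h3]
      · funext q
        simp only [update_apply]
        split_ifs <;> first | (exfalso; omega) | (subst_vars; simp [*, Nat.add_mul, Nat.add_comm]; try omega)
      · simp; omega⟩)
  have hc := Halts.clear (update (update (update σ D (unary (F - F))) (D + 1) (unary G)) (D + 2)
      (unary (F * G))) (D + 1)
  have hm := Halts.move (update (update (update (update σ D (unary (F - F))) (D + 1) (unary G)) (D + 2)
      (unary (F * G))) (D + 1) []) (r := D + 2) (s := D) (by omega)
  have hs : update (update (update σ D (unary (F - 0))) (D + 1) (unary G)) (D + 2) (unary (0 * G)) =
      update (update σ D (unary F)) (D + 1) (unary G) := by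
    funext q
    simp only [update_apply]
    split_ifs <;> first | (exfalso; omega) | rfl | (subst_vars; simp [*])
  rw [hs] at h
  refine (h.seq (hc.seq hm)).cast ?_ (by simp) ?_
  · funext q
    simp only [update_apply]
    split_ifs <;> first | (exfalso; omega) | rfl | (subst_vars; simp [*])
  · simp
    nlinarith

theorem of_eq (hf : UNum f) (h : ∀ e, f e = g e) : UNum g := by
  rwa [← show f = g from funext h]

theorem polyEval (p : Polynomial ℕ) (hg : UNum g) : UNum fun e => p.eval (g e) := by
  induction p using Polynomial.induction_on' with
  | add p q hp hq => exact (hp.add hq).of_eq fun e => by simp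
  | monomial n a =>
    have hpow : UNum fun e => g e ^ n := by
      induction n with
      | zero => exact (const 1).of_eq fun e => by simp
      | succ n ih => exact (ih.mul hg).of_eq fun e => by rw [pow_succ]
    exact ((const a).mul hpow).of_eq fun e => by simp

theorem poly {h : ℕ → ℕ} (hh : IsPoly h) (hg : UNum g) : UNum fun e => h (g e) := by
  obtain ⟨p, hp⟩ := hh
  exact (polyEval p hg).of_eq fun e => (hp _).symm

end UNum

end QCrypto

namespace QCrypto

open Function List

/-! ### Local variables, iteration and loops -/

theorem DependsBelow.letVar {α : Type} {d d' : ℕ} {f : (ℕ → ℕ) → α} {g : (ℕ → ℕ) → ℕ}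
    (hf : DependsBelow d f) (hg : DependsBelow d' g) (v : ℕ) :
    DependsBelow (max d d') fun e => f (update e v (g e)) := fun e e' h => by
  refine hf _ _ fun r hr => ?_
  rw [hg e e' fun s hs => h s (by omega)]
  simp only [update_apply]
  split_ifs
  · rfl
  · exact h r (by omega)

/-- Entering a block in which the variable `v` has the value held by `D`. -/
theorem Halts.enter (σ : Store) {v D x : ℕ} (hv : v < D) (hσ : σ.EmptyFrom D) :
    Halts (.seq (.move v (D + 1)) (.move D v)) (update σ D (unary x))
      (update (update σ v (unary x)) (D + 1) (σ v).reverse) []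
      (4 * (σ v).length + 1 + (4 * x + 1)) := by
  have h0 := hσ D le_rfl
  have h1 := hσ (D + 1) (by omega)
  have a := Halts.move (update σ D (unary x)) (r := v) (s := D + 1) (by omega)
  have b := Halts.move (update (update (update σ D (unary x)) (D + 1)
    ((update σ D (unary x) v).reverse ++ update σ D (unary x) (D + 1))) v []) (r := D) (s := v)
    (by omega)
  refine (a.seq' b).cast ?_ rfl ?_
  · funext q
    simp only [update_apply]
    split_ifs <;> first | (exfalso; omega) | rfl | (subst_vars; simp [*])
  · simp only [update_apply]
    simp [show ¬ v = D by omega, show ¬ D = v by omega]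

/-- Leaving a block. -/
theorem Halts.leave (σ : Store) {v D x : ℕ} (hv : v < D) (hσ : σ.EmptyFrom D) :
    Halts (.seq (.clear v) (.move (D + 1) v))
      (update (update σ v (unary x)) (D + 1) (σ v).reverse) σ []
      (2 * x + 1 + (4 * (σ v).length + 1)) := by
  have h1 := hσ (D + 1) (by omega)
  have a := Halts.clear (update (update σ v (unary x)) (D + 1) (σ v).reverse) v
  have b := Halts.move (update (update (update σ v (unary x)) (D + 1) (σ v).reverse) v [])
    (r := D + 1) (s := v) (by omega)
  refine (a.seq' b).cast ?_ rfl ?_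
  · funext q
    simp only [update_apply]
    split_ifs <;> first | (exfalso; omega) | rfl | (subst_vars; simp [*])
  · simp only [update_apply]
    simp [show ¬ v = D + 1 by omega, show ¬ D + 1 = v by omega]

/-- The content of register `v` is parked on `D + 1` while the value of `g` takes its place; `f` is
then evaluated beyond `D + 1`, and `v` is restored. This makes the class closed under substitution.
-/
theorem UNum.letVar {f g : (ℕ → ℕ) → ℕ} (v : ℕ) (hg : UNum g) (hf : UNum f) :
    UNum fun e => f (update e v (g e)) := by
  obtain ⟨d', hd', hg⟩ := hg
  obtain ⟨d, hd, hf⟩ := hf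
  refine ⟨max (max d d') (v + 1), (hd.letVar hd' v).mono (le_max_left _ _), fun D hD => ?_⟩
  obtain ⟨P, p, hP⟩ := hg D (by omega)
  obtain ⟨Q, q, hQ⟩ := hf (D + 2) (by omega)
  refine ⟨.seq P (.seq (.seq (.move v (D + 1)) (.move D v)) (.seq Q
    (.seq (.seq (.clear v) (.move (D + 1) v)) (.move (D + 2) D)))),
    7 * p + 8 * Polynomial.X + 5 * q.comp (2 * Polynomial.X + p) + 5, fun σ hσ => ?_⟩
  obtain ⟨h1, h2⟩ := hP σ hσ
  set x := g σ.heights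
  set τ : Store := update (update σ v (unary x)) (D + 1) (σ v).reverse with hτ
  have hvs := Store.length_le_size σ (show v < D by omega)
  have hemp : τ.EmptyFrom (D + 2) := fun r hr => by
    rw [hτ, update_of_ne (by omega), update_of_ne (by omega), hσ r (by omega)]
  obtain ⟨h3, h4⟩ := hQ τ hemp
  have hval : f τ.heights = f (update σ.heights v x) := hd _ _ fun r hr => by
    rw [hτ, Store.heights_update, Store.heights_update, update_of_ne (by omega),
      List.length_replicate]
  -- The summand `2 * σ.size D` allows for the parked copy of `v`, the other one for the new value.
  have hsz : τ.size (D + 2) ≤ 2 * σ.size D + p.eval (σ.size D) := by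
    have a := Store.size_update_le (D + 2) (update σ v (unary x)) (D + 1) (σ v).reverse
    have b := Store.size_update_le (D + 2) σ v (unary x)
    rw [List.length_reverse, ← hτ] at a
    rw [List.length_replicate, hσ.size_eq (show D ≤ D + 2 by omega)] at b
    omega
  have hq := eval_mono q hsz
  rw [hval] at h3 h4
  set y := f (update σ.heights v x)
  have e2 := hσ (D + 2) (by omega)
  have e1 := hσ (D + 1) (by omega)
  have e0 := hσ D le_rfl
  have hl : Halts (.seq (.clear v) (.move (D + 1) v)) (update τ (D + 2) (unary y))
      (update σ (D + 2) (unary y)) [] (2 * x + 1 + (4 * (σ v).length + 1)) := by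
    have a := Halts.clear (update τ (D + 2) (unary y)) v
    have b := Halts.move (update (update τ (D + 2) (unary y)) v []) (r := D + 1) (s := v) (by omega)
    refine (a.seq' b).cast ?_ rfl ?_
    · rw [hτ]
      funext q
      simp only [update_apply]
      split_ifs <;> first | (exfalso; omega) | rfl | (subst_vars; simp [*])
    · simp only [hτ, update_apply]
      simp [show ¬ v = D + 1 by omega, show ¬ v = D + 2 by omega, show ¬ D + 1 = v by omega]
  have hm := Halts.move (update σ (D + 2) (unary y)) (r := D + 2) (s := D) (by omega)
  simp only [Polynomial.eval_add, Polynomial.eval_mul, Polynomial.eval_ofNat, Polynomial.eval_X,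
    Polynomial.eval_comp]
  refine ⟨show y ≤ _ by omega, show Halts _ σ (update σ D (unary y)) [] _ from
    (h2.seq' ((Halts.enter σ (by omega) hσ).seq' (h4.seq' (hl.seq' hm)))).cast ?_ rfl ?_⟩
  · funext q
    simp only [update_apply]
    split_ifs <;> first | (exfalso; omega) | rfl | (subst_vars; simp [*])
  · simp only [update_self, List.length_replicate]
    omega

/-- The number of iterations may depend on the input if the values stay polynomially bounded. -/
theorem UNum.iter {f g c B : (ℕ → ℕ) → ℕ} (v : ℕ) (hg : UNum g) (hc : UNum c) (hf : UNum f)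
    (hB : UNum B) (h : ∀ e, ∀ j ≤ c e, (fun x => f (update e v x))^[j] (g e) ≤ B e) :
    UNum fun e => (fun x => f (update e v x))^[c e] (g e) := by
  obtain ⟨d₁, hd₁, hd₂, hgc⟩ := hg.pair hc
  -- The current iterate is kept on register `D`, and each round evaluates `f` with `v` bound to
  -- that register.
  have hf' := fun D : ℕ => UNum.letVar v (UNum.var D) hf
  obtain ⟨d, hd, hf⟩ := hf
  obtain ⟨dB, hdB, hB⟩ := hB
  refine ⟨max (max d₁ d) (max (v + 1) dB), fun e e' he => ?_, fun D hD => ?_⟩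
  · dsimp only
    rw [hd₁ e e' fun r hr => he r (by omega), hd₂ e e' fun r hr => he r (by omega)]
    congr 2
    funext x
    refine hd _ _ fun r hr => ?_
    simp only [update_apply]
    split_ifs
    · rfl
    · exact he r (by omega)
  obtain ⟨P, p, hP⟩ := hgc D (by omega)
  -- The number `B` is never computed; only the polynomial bound on its value is used, to bound the
  -- iterates.
  obtain ⟨_, b, hb⟩ := hB D (by omega)
  obtain ⟨d₃, -, hf₃⟩ := hf' D
  obtain ⟨Q, q, hQ⟩ := hf₃ (max (D + 2) d₃) (le_max_right _ _)
  generalize hE : max (D + 2) d₃ = E at hQ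
  refine ⟨.seq P (.loop (D + 1) (.seq (.pop (D + 1)) (.seq Q (.seq (.clear D) (.move E D))))),
    p + b + p * (20 + 6 * b + q.comp (Polynomial.X + b + p)) + 1, fun σ hσ => ?_⟩
  obtain ⟨h1, h2, h3⟩ := hP σ hσ
  have hBσ := (hb σ hσ).1
  set e := σ.heights with he
  set x : ℕ → ℕ := fun j => (fun x => f (update e v x))^[j] (g e) with hx
  have hxb : ∀ j ≤ c e, x j ≤ b.eval (σ.size D) := fun j hj => (h e j hj).trans hBσ
  have e1 := hσ (D + 1) (by omega)
  have e0 := hσ D le_rfl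
  have eE := hσ E (by omega)
  have hloop := Halts.loop (r := D + 1)
    (P := .seq (.pop (D + 1)) (.seq Q (.seq (.clear D) (.move E D)))) (c e)
    (fun j => update (update σ D (unary (x j))) (D + 1) (unary (c e - j))) (fun _ => [])
    (T := 10 + 6 * b.eval (σ.size D) + q.eval (σ.size D + b.eval (σ.size D) + p.eval (σ.size D)))
    (by simp) fun j hj => ⟨by simp; omega, by
      have a := Halts.pop (update (update σ D (unary (x j))) (D + 1) (unary (c e - j))) (D + 1)
      set τ : Store := update (update σ D (unary (x j))) (D + 1) (unary (c e - (j + 1))) with hτ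
      have ha : update (update (update σ D (unary (x j))) (D + 1) (unary (c e - j))) (D + 1)
          (update (update σ D (unary (x j))) (D + 1) (unary (c e - j)) (D + 1)).tail = τ := by
        rw [hτ]
        simp [Nat.sub_sub]
      rw [ha] at a
      have hem : τ.EmptyFrom E := fun r hr => by
        rw [hτ, update_of_ne (by omega), update_of_ne (by omega), hσ r (by omega)]
      obtain ⟨-, h4⟩ := hQ τ hem
      have hv : f (update τ.heights v (τ.heights D)) = x (j + 1) := by
        rw [hx]
        simp only [Function.iterate_succ_apply']
        refine hd _ _ fun r hr => ?_
        simp only [hτ, Store.heights_update, update_apply]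
        split_ifs <;> first | omega | simp [hx, he, List.length_replicate]
      dsimp only at h4
      rw [hv] at h4
      have hsz : τ.size E ≤ σ.size D + b.eval (σ.size D) + p.eval (σ.size D) := by
        have a := Store.size_update_le E (update σ D (unary (x j))) (D + 1)
          (unary (c e - (j + 1)))
        have b := Store.size_update_le E σ D (unary (x j))
        rw [List.length_replicate] at a b
        rw [← hτ] at a
        rw [hσ.size_eq (show D ≤ E by omega)] at b
        have := hxb j hj.le
        omega
      have hq := eval_mono q hsz
      have hcl := Halts.clear (update τ E (unary (x (j + 1)))) D
      have hm := Halts.move (update (update τ E (unary (x (j + 1)))) D []) (r := E) (s := D)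
        (by omega)
      have hb1 := hxb j hj.le
      have hb2 := hxb (j + 1) hj
      refine (a.seq' (h4.seq' (hcl.seq' hm))).cast ?_ rfl ?_
      · rw [hτ]
        funext q
        simp only [update_apply]
        split_ifs <;> first | (exfalso; omega) | rfl | (subst_vars; simp [*])
      · simp only [hτ, update_apply]
        rw [← hτ]
        simp only [if_neg (show ¬ E = D by omega), if_neg (show ¬ D = E by omega),
          if_neg (show ¬ D = D + 1 by omega), if_true, List.length_replicate]
        omega⟩
  simp only [Polynomial.eval_add, Polynomial.eval_mul, Polynomial.eval_ofNat, Polynomial.eval_X,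
    Polynomial.eval_comp, Polynomial.eval_one]
  have hmul : c e * (10 + 6 * b.eval (σ.size D) +
      q.eval (σ.size D + b.eval (σ.size D) + p.eval (σ.size D)) + 1) ≤ p.eval (σ.size D) *
      (20 + 6 * b.eval (σ.size D) +
        q.eval (σ.size D + b.eval (σ.size D) + p.eval (σ.size D))) :=
    Nat.mul_le_mul h2 (by omega)
  refine ⟨(hxb _ le_rfl).trans (by omega), show Halts _ σ (update σ D (unary (x (c e)))) [] _ from
    (h3.seq' hloop).cast ?_ (by simp) (by omega)⟩
  funext q
  simp only [update_apply]
  split_ifs <;> first | (exfalso; omega) | rfl | (subst_vars; simp [*])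

namespace UGen

variable {f f' : (ℕ → ℕ) → List (Op ℕ)} {g : (ℕ → ℕ) → ℕ}

theorem of_eq (hf : UGen f) (h : ∀ e, f e = f' e) : UGen f' := by
  rwa [← show f = f' from funext h]

theorem nil : UGen fun _ => [] :=
  ⟨0, fun _ _ _ => rfl, fun _ _ => ⟨.skip, 1, fun σ _ => (Halts.skip σ).mono (by simp)⟩⟩

theorem append (hf : UGen f) (hf' : UGen f') : UGen fun e => f e ++ f' e := by
  obtain ⟨d, hd, hf⟩ := hf
  obtain ⟨d', hd', hf'⟩ := hf'
  refine ⟨max d d', fun e e' h => ?_, fun D hD => ?_⟩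
  · exact congrArg₂ _ (hd e e' fun r hr => h r (by omega)) (hd' e e' fun r hr => h r (by omega))
  obtain ⟨P, p, hP⟩ := hf D (by omega)
  obtain ⟨Q, q, hQ⟩ := hf' D (by omega)
  exact ⟨.seq P Q, p + q, fun σ hσ => ((hP σ hσ).seq (hQ σ hσ)).mono (by simp)⟩

/-- One operation with computed addresses. -/
theorem op (o : Op (Fin 3)) {a b c : (ℕ → ℕ) → ℕ} (ha : UNum a) (hb : UNum b) (hc : UNum c) :
    UGen fun e => [o.map ![a e, b e, c e]] := by
  obtain ⟨d, hd, hd', hab⟩ := ha.pair hb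
  obtain ⟨d'', hd'', hc⟩ := hc
  refine ⟨max d d'', fun e e' h => ?_, fun D hD => ?_⟩
  · dsimp only
    rw [hd e e' fun r hr => h r (by omega), hd' e e' fun r hr => h r (by omega),
      hd'' e e' fun r hr => h r (by omega)]
  obtain ⟨P, p, hP⟩ := hab D (by omega)
  obtain ⟨Q, q, hQ⟩ := hc (D + 2) (by omega)
  refine ⟨.seq P (.seq Q (.seq (.emit (o.map ![[D], [D + 1], [D + 2]]))
    (.seq (.clear D) (.seq (.clear (D + 1)) (.clear (D + 2)))))),
    5 * p + 3 * q.comp (Polynomial.X + 2 * p) + 10, fun σ hσ => ?_⟩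
  obtain ⟨h1, h2, h3⟩ := hP σ hσ
  set x := a σ.heights
  set y := b σ.heights
  set τ : Store := update (update σ D (unary x)) (D + 1) (unary y) with hτ
  have hem : τ.EmptyFrom (D + 2) := fun r hr => by
    rw [hτ, update_of_ne (by omega), update_of_ne (by omega), hσ r (by omega)]
  obtain ⟨h4, h5⟩ := hQ τ hem
  rw [hτ, hd''.heights_update (by omega), hd''.heights_update (by omega), ← hτ] at h4 h5
  set z := c σ.heights
  have hsz : τ.size (D + 2) ≤ σ.size D + 2 * p.eval (σ.size D) := by
    have a := Store.size_update_le (D + 2) (update σ D (unary x)) (D + 1) (unary y)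
    have b := Store.size_update_le (D + 2) σ D (unary x)
    rw [List.length_replicate] at a b
    rw [← hτ] at a
    rw [hσ.size_eq (show D ≤ D + 2 by omega)] at b
    omega
  have hq := eval_mono q hsz
  have hemit : Halts (.emit (o.map ![[D], [D + 1], [D + 2]])) (update τ (D + 2) (unary z))
      (update τ (D + 2) (unary z)) [o.map ![x, y, z]] 1 := by
    refine ⟨1, le_rfl, ?_⟩
    have hh := Run.emit (update τ (D + 2) (unary z)) (o.map ![[D], [D + 1], [D + 2]])
    have hadr : ∀ i : Fin 3, Store.addr (update τ (D + 2) (unary z)) (![[D], [D + 1], [D + 2]] i)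
        = ![x, y, z] i := by
      intro i
      fin_cases i <;> simp [Store.addr, hτ]
    have : (o.map ![[D], [D + 1], [D + 2]]).map (Store.addr (update τ (D + 2) (unary z)))
        = o.map ![x, y, z] := by
      cases o with
      | gate g => cases g <;> simp only [Op.map, Gate.map, hadr]
      | query a b => simp only [Op.map, hadr]
    rwa [this] at hh
  have c1 := Halts.clear (update τ (D + 2) (unary z)) D
  have c2 := Halts.clear (update (update τ (D + 2) (unary z)) D []) (D + 1)
  have c3 := Halts.clear (update (update (update τ (D + 2) (unary z)) D []) (D + 1) []) (D + 2)
  refine show Halts _ σ σ [o.map ![x, y, z]] _ from (h3.seq' (h5.seq' (hemit.seq (c1.seq' (c2.seq' c3))))).cast ?_ (by simp) ?_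
  · have e0 := hσ D le_rfl
    have e1 := hσ (D + 1) (by omega)
    have e2 := hσ (D + 2) (by omega)
    rw [hτ]
    funext q
    simp only [update_apply]
    split_ifs <;> first | (exfalso; omega) | rfl | (subst_vars; simp [*])
  · simp only [Polynomial.eval_add, Polynomial.eval_mul, Polynomial.eval_ofNat, Polynomial.eval_X,
      Polynomial.eval_comp]
    simp only [hτ, update_apply]
    rw [← hτ]
    simp
    omega

theorem letVar (v : ℕ) (hg : UNum g) (hf : UGen f) : UGen fun e => f (update e v (g e)) := by
  obtain ⟨d', hd', hg⟩ := hg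
  obtain ⟨d, hd, hf⟩ := hf
  refine ⟨max (max d d') (v + 1), (hd.letVar hd' v).mono (le_max_left _ _), fun D hD => ?_⟩
  obtain ⟨P, p, hP⟩ := hg D (by omega)
  obtain ⟨Q, q, hQ⟩ := hf (D + 2) (by omega)
  refine ⟨.seq P (.seq (.seq (.move v (D + 1)) (.move D v)) (.seq Q
    (.seq (.clear v) (.move (D + 1) v)))),
    7 * p + 8 * Polynomial.X + q.comp (2 * Polynomial.X + p) + 4, fun σ hσ => ?_⟩
  obtain ⟨h1, h2⟩ := hP σ hσ
  set x := g σ.heights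
  set τ : Store := update (update σ v (unary x)) (D + 1) (σ v).reverse with hτ
  have hvs := Store.length_le_size σ (show v < D by omega)
  have hemp : τ.EmptyFrom (D + 2) := fun r hr => by
    rw [hτ, update_of_ne (by omega), update_of_ne (by omega), hσ r (by omega)]
  have h4 := hQ τ hemp
  have hval : f τ.heights = f (update σ.heights v x) := hd _ _ fun r hr => by
    rw [hτ, Store.heights_update, Store.heights_update, update_of_ne (by omega),
      List.length_replicate]
  have hsz : τ.size (D + 2) ≤ 2 * σ.size D + p.eval (σ.size D) := by
    have a := Store.size_update_le (D + 2) (update σ v (unary x)) (D + 1) (σ v).reverse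
    have b := Store.size_update_le (D + 2) σ v (unary x)
    rw [List.length_reverse, ← hτ] at a
    rw [List.length_replicate, hσ.size_eq (show D ≤ D + 2 by omega)] at b
    omega
  have hq := eval_mono q hsz
  rw [hval] at h4
  refine show Halts _ σ σ (f (update σ.heights v x)) _ from
    (h2.seq' ((Halts.enter σ (by omega) hσ).seq' (h4.seq
    (Halts.leave σ (by omega) hσ)))).cast rfl (by simp) ?_
  simp only [Polynomial.eval_add, Polynomial.eval_mul, Polynomial.eval_ofNat, Polynomial.eval_X,
    Polynomial.eval_comp]
  omega

/-- Register `D` counts the remaining iterations down while `D + 1` counts up; `v` is bound to the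
latter. -/
theorem loop (v : ℕ) (hg : UNum g) (hf : UGen f) :
    UGen fun e => (List.range (g e)).flatMap fun j => f (update e v j) := by
  have hf' := fun D : ℕ => UGen.letVar v (UNum.var D) hf
  obtain ⟨d', hd', hg⟩ := hg
  obtain ⟨d, hd, hf⟩ := hf
  refine ⟨max (max d d') (v + 1), fun e e' he => ?_, fun D hD => ?_⟩
  · dsimp only
    rw [hd' e e' fun r hr => he r (by omega)]
    congr 1
    funext x
    refine hd _ _ fun r hr => ?_
    simp only [update_apply]
    split_ifs
    · rfl
    · exact he r (by omega)
  obtain ⟨P, p, hP⟩ := hg D (by omega)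
  obtain ⟨d₃, -, hf₃⟩ := hf' (D + 1)
  obtain ⟨Q, q, hQ⟩ := hf₃ (max (D + 2) d₃) (le_max_right _ _)
  set E := max (D + 2) d₃ with hE
  refine ⟨.seq P (.seq (.loop D (.seq (.pop D) (.seq Q (.push (D + 1) true)))) (.clear (D + 1))),
    3 * p + p * (3 + q.comp (Polynomial.X + 2 * p)) + 2, fun σ hσ => ?_⟩
  obtain ⟨h1, h2⟩ := hP σ hσ
  set e := σ.heights with he
  have e1 := hσ (D + 1) (by omega)
  have e0 := hσ D le_rfl
  have hloop := Halts.loop (r := D) (P := .seq (.pop D) (.seq Q (.push (D + 1) true))) (g e)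
    (fun j => update (update σ D (unary (g e - j))) (D + 1) (unary j)) (fun j => f (update e v j))
    (T := 2 + q.eval (σ.size D + 2 * p.eval (σ.size D)))
    (by simp) fun j hj => ⟨by simp; omega, by
      have a := Halts.pop (update (update σ D (unary (g e - j))) (D + 1) (unary j)) D
      set τ : Store := update (update σ D (unary (g e - (j + 1)))) (D + 1) (unary j) with hτ
      have ha : update (update (update σ D (unary (g e - j))) (D + 1) (unary j)) D
          (update (update σ D (unary (g e - j))) (D + 1) (unary j) D).tail = τ := by
        rw [hτ]
        funext q
        simp only [update_apply]
        split_ifs <;> first | (exfalso; omega) | rfl | (subst_vars; simp [Nat.sub_sub])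
      rw [ha] at a
      have hem : τ.EmptyFrom E := fun r hr => by
        rw [hτ, update_of_ne (by omega), update_of_ne (by omega), hσ r (by omega)]
      have h4 := hQ τ hem
      have hv : f (update τ.heights v (τ.heights (D + 1))) = f (update e v j) := by
        refine hd _ _ fun r hr => ?_
        simp only [hτ, Store.heights_update, update_apply]
        split_ifs <;> first | omega | simp [he, List.length_replicate]
      dsimp only at h4
      rw [hv] at h4
      have hsz : τ.size E ≤ σ.size D + 2 * p.eval (σ.size D) := by
        have a := Store.size_update_le E (update σ D (unary (g e - (j + 1)))) (D + 1) (unary j)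
        have b := Store.size_update_le E σ D (unary (g e - (j + 1)))
        rw [List.length_replicate] at a b
        rw [← hτ] at a
        rw [hσ.size_eq (show D ≤ E by omega)] at b
        omega
      have hq := eval_mono q hsz
      refine (a.seq' (h4.seq (Halts.push _ _ true))).cast ?_ (by simp) (by omega)
      rw [hτ]
      funext q
      simp only [update_apply]
      split_ifs <;> first | (exfalso; omega) | rfl | (subst_vars; simp [List.replicate_succ])⟩
  have hc := Halts.clear (update (update σ D (unary (g e - g e))) (D + 1) (unary (g e))) (D + 1)
  have hs : update (update σ D (unary (g e - 0))) (D + 1) (unary 0) = update σ D (unary (g e)) := by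
    funext q
    simp only [update_apply]
    split_ifs <;> first | (exfalso; omega) | rfl | (subst_vars; simp [*])
  rw [hs] at hloop
  have hmul : g e * (2 + q.eval (σ.size D + 2 * p.eval (σ.size D)) + 1) ≤ p.eval (σ.size D) *
      (3 + q.eval (σ.size D + 2 * p.eval (σ.size D))) := Nat.mul_le_mul h1 (by omega)
  refine show Halts _ σ σ ((List.range (g e)).flatMap fun j => f (update e v j)) _ from
    (h2.seq' (hloop.seq hc)).cast ?_ (by simp) ?_
  · funext q
    simp only [update_apply]
    split_ifs <;> first | (exfalso; omega) | rfl | (subst_vars; simp [*])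
  · simp only [Polynomial.eval_add, Polynomial.eval_mul, Polynomial.eval_ofNat, Polynomial.eval_X,
      Polynomial.eval_comp]
    simp only [update_self, List.length_replicate]
    omega

/-- A printable family of circuits is uniform. -/
theorem uniform {C : ℕ → List (Op ℕ)} (h : UGen fun e => C (e 0)) : Uniform C := by
  obtain ⟨d, -, h⟩ := h
  obtain ⟨P, p, h⟩ := h (max d 1) (le_max_left _ _)
  refine ⟨P, p, fun n => ?_⟩
  obtain ⟨k, hk, hr⟩ := h (unaryInput n) fun r hr => by
    rw [unaryInput, update_of_ne (by omega)]
  have hs : Store.size (max d 1) (unaryInput n) ≤ n := by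
    refine (Store.size_update_le _ _ _ _).trans ?_
    simp [Store.size]
  refine ⟨unaryInput n, k, ?_, hk.trans (eval_mono p hs)⟩
  simpa [Store.heights, unaryInput] using hr

end UGen

end QCrypto

namespace QCrypto

open Function List

/-! ### Programs that rewrite the output of a program -/

/-- The circuit obtained by moving all gates by `z` and replacing the query number `c`, with
addresses `a` and `b`, by `h a b c`. -/
def splice (h : ℕ → ℕ → ℕ → List (Op ℕ)) (z : ℕ) : ℕ → List (Op ℕ) → List (Op ℕ)
  | _, [] => []
  | c, .gate g :: L => .gate (g.map (z + ·)) :: splice h z c L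
  | c, .query a b :: L => h a b c ++ splice h z (c + 1) L

/-- The number of queries. -/
def queries : List (Op ℕ) → ℕ
  | [] => 0
  | .gate _ :: L => queries L
  | .query _ _ :: L => queries L + 1

theorem queries_append (u v : List (Op ℕ)) : queries (u ++ v) = queries u + queries v := by
  induction u with
  | nil => simp [queries]
  | cons o u ih => cases o <;> simp [queries, ih]; omega

theorem queries_le_length (u : List (Op ℕ)) : queries u ≤ u.length := by
  induction u with
  | nil => simp [queries]
  | cons o u ih => cases o <;> simp [queries] <;> omega

theorem splice_append (h : ℕ → ℕ → ℕ → List (Op ℕ)) (z c : ℕ) (u v : List (Op ℕ)) :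
    splice h z c (u ++ v) = splice h z c u ++ splice h z (c + queries u) v := by
  induction u generalizing c with
  | nil => simp [splice, queries]
  | cons o u ih =>
    cases o <;> simp [splice, queries, ih, List.append_assoc, Nat.add_assoc, Nat.add_comm 1]

theorem splice_gates (h : ℕ → ℕ → ℕ → List (Op ℕ)) (z c : ℕ) (L : List (Gate ℕ)) :
    splice h z c (L.map .gate) = (L.map (Gate.map (z + ·))).map .gate := by
  induction L with
  | nil => rfl
  | cons g L ih => simp [splice, ih]

theorem Run.length_le {P : Prog} {σ σ' : Store} {out : List (Op ℕ)} {k : ℕ}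
    (h : Run P σ σ' out k) : out.length ≤ k := by
  induction h <;>
    (try simp only [List.length_append, List.length_nil, List.length_singleton]) <;> omega

theorem Run.size_le {P : Prog} {σ σ' : Store} {out : List (Op ℕ)} {k : ℕ}
    (h : Run P σ σ' out k) (m : ℕ) : σ'.size m ≤ σ.size m + k := by
  induction h with
  | push σ r b =>
    by_cases hr : r ∈ Finset.range m
    · unfold Store.size
      rw [Finset.sum_eq_sum_sdiff_singleton_add hr, Finset.sum_eq_sum_sdiff_singleton_add hr,
        update_self, List.length_cons, ← Nat.add_assoc]
      refine Nat.succ_le_succ (Nat.add_le_add_right (Finset.sum_le_sum fun x hx => ?_) _)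
      rw [update_of_ne]
      simp at hx
      exact hx.2
    · refine (Finset.sum_le_sum fun x hx => ?_).trans (Nat.le_succ _)
      rw [update_of_ne]
      rintro rfl
      exact hr hx
  | pop σ r =>
    refine (Finset.sum_le_sum fun x _ => ?_).trans (Nat.le_succ _)
    simp only [update_apply]
    split_ifs with h
    · subst h; simp
    · rfl
  | _ => omega

/-- The program uses only registers below `m`. -/
def Prog.Below (m : ℕ) : Prog → Prop
  | .skip => True
  | .push r _ => r < m
  | .pop r => r < m
  | .emit (.gate (.hadamard i)) => ∀ r ∈ i, r < m
  | .emit (.gate (.tgate i)) => ∀ r ∈ i, r < m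
  | .emit (.gate (.cnot i j)) => (∀ r ∈ i, r < m) ∧ ∀ r ∈ j, r < m
  | .emit (.gate (.toffoli i j k)) => (∀ r ∈ i, r < m) ∧ (∀ r ∈ j, r < m) ∧ ∀ r ∈ k, r < m
  | .emit (.query i j) => (∀ r ∈ i, r < m) ∧ ∀ r ∈ j, r < m
  | .seq P Q => P.Below m ∧ Q.Below m
  | .ite r P Q => r < m ∧ P.Below m ∧ Q.Below m
  | .loop r P => r < m ∧ P.Below m

theorem exists_forall_mem_lt (l : List ℕ) : ∃ m, ∀ r ∈ l, r < m :=
  ⟨l.sum + 1, fun _ hr => Nat.lt_succ_of_le (List.le_sum_of_mem hr)⟩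

theorem Prog.Below.mono {m m' : ℕ} (h : m ≤ m') {P : Prog} (hP : P.Below m) : P.Below m' := by
  induction P with
  | skip => trivial
  | push r b => exact lt_of_lt_of_le hP h
  | pop r => exact lt_of_lt_of_le hP h
  | emit o =>
    have key : ∀ l : List ℕ, (∀ r ∈ l, r < m) → ∀ r ∈ l, r < m' :=
      fun l hl r hr => (hl r hr).trans_le h
    match o with
    | .gate (.hadamard i) => exact key _ hP
    | .gate (.tgate i) => exact key _ hP
    | .gate (.cnot i j) => exact ⟨key _ hP.1, key _ hP.2⟩
    | .gate (.toffoli i j k) => exact ⟨key _ hP.1, key _ hP.2.1, key _ hP.2.2⟩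
    | .query i j => exact ⟨key _ hP.1, key _ hP.2⟩
  | seq P Q ihP ihQ => exact ⟨ihP hP.1, ihQ hP.2⟩
  | ite r P Q ihP ihQ => exact ⟨lt_of_lt_of_le hP.1 h, ihP hP.2.1, ihQ hP.2.2⟩
  | loop r P ih => exact ⟨lt_of_lt_of_le hP.1 h, ih hP.2⟩

theorem Prog.exists_below (P : Prog) : ∃ m, P.Below m := by
  induction P with
  | skip => exact ⟨0, trivial⟩
  | push r b => exact ⟨r + 1, Nat.lt_succ_self r⟩
  | pop r => exact ⟨r + 1, Nat.lt_succ_self r⟩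
  | emit o =>
    match o with
    | .gate (.hadamard i) => exact exists_forall_mem_lt i
    | .gate (.tgate i) => exact exists_forall_mem_lt i
    | .gate (.cnot i j) =>
      obtain ⟨m, hm⟩ := exists_forall_mem_lt (i ++ j)
      exact ⟨m, fun r hr => hm r (by simp [hr]), fun r hr => hm r (by simp [hr])⟩
    | .gate (.toffoli i j k) =>
      obtain ⟨m, hm⟩ := exists_forall_mem_lt (i ++ (j ++ k))
      exact ⟨m, fun r hr => hm r (by simp [hr]), fun r hr => hm r (by simp [hr]),
        fun r hr => hm r (by simp [hr])⟩
    | .query i j =>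
      obtain ⟨m, hm⟩ := exists_forall_mem_lt (i ++ j)
      exact ⟨m, fun r hr => hm r (by simp [hr]), fun r hr => hm r (by simp [hr])⟩
  | seq P Q ihP ihQ =>
    obtain ⟨m, hm⟩ := ihP
    obtain ⟨m', hm'⟩ := ihQ
    exact ⟨max m m', hm.mono (le_max_left _ _), hm'.mono (le_max_right _ _)⟩
  | ite r P Q ihP ihQ =>
    obtain ⟨m, hm⟩ := ihP
    obtain ⟨m', hm'⟩ := ihQ
    exact ⟨max (r + 1) (max m m'), Nat.lt_of_lt_of_le (Nat.lt_succ_self r) (le_max_left _ _),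
      hm.mono (by omega), hm'.mono (by omega)⟩
  | loop r P ih =>
    obtain ⟨m, hm⟩ := ih
    exact ⟨max (r + 1) m, Nat.lt_of_lt_of_le (Nat.lt_succ_self r) (le_max_left _ _),
      hm.mono (by omega)⟩

/-- The store of a program that simulates another one: the environment below `D`, the number `c` of
queries so far on `D`, the offset `z` on `D + 1`, and the `m` registers of the simulated program. -/
def Store.joint (D m : ℕ) (τ : Store) (z c : ℕ) (σ : Store) : Store := fun r =>
  if r < D then τ r else if r = D then unary c else if r = D + 1 then unary z
  else if r < D + 2 + m then σ (r - (D + 2)) else []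

namespace Store

variable (D m : ℕ) (τ : Store) (z c : ℕ) (σ : Store)

theorem joint_update {r : ℕ} (hr : r < m) (l : List Bool) :
    joint D m τ z c (update σ r l) = update (joint D m τ z c σ) (D + 2 + r) l := by
  funext q
  simp only [joint, update_apply]
  split_ifs <;> first | rfl | (exfalso; omega)

theorem joint_reg {r : ℕ} (hr : r < m) : joint D m τ z c σ (D + 2 + r) = σ r := by
  unfold joint
  rw [if_neg (by omega), if_neg (by omega), if_neg (by omega), if_pos (by omega)]
  congr 1
  omega

theorem joint_counter : joint D m τ z c σ D = unary c := by simp [joint]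

theorem joint_offset : joint D m τ z c σ (D + 1) = unary z := by simp [joint]

theorem joint_push : update (joint D m τ z c σ) D (true :: joint D m τ z c σ D) =
    joint D m τ z (c + 1) σ := by
  funext q
  simp only [joint, update_apply]
  split_ifs <;> first | rfl | (exfalso; omega)

theorem joint_emptyFrom : EmptyFrom (D + 2 + m) (joint D m τ z c σ) := fun r hr => by
  unfold joint
  rw [if_neg (by omega), if_neg (by omega), if_neg (by omega), if_neg (by omega)]

theorem size_joint : size (D + 2 + m) (joint D m τ z c σ) = size D τ + c + z + size m σ := by
  unfold size
  rw [Finset.sum_range_add, Finset.sum_range_succ, Finset.sum_range_succ, joint_counter,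
    joint_offset, List.length_replicate, List.length_replicate]
  congr 1
  · congr 2
    exact Finset.sum_congr rfl fun r hr => by simp [joint, Finset.mem_range.1 hr]
  · exact Finset.sum_congr rfl fun r hr => by rw [joint_reg _ _ _ _ _ _ (Finset.mem_range.1 hr)]

theorem addr_joint {A : List ℕ} (hA : ∀ r ∈ A, r < m) :
    addr (joint D m τ z c σ) (A.map (D + 2 + ·)) = addr σ A := by
  unfold addr
  rw [List.map_map]
  congr 1
  refine List.map_congr_left fun r hr => ?_
  simp [joint_reg _ _ _ _ _ _ (hA r hr)]

theorem addr_joint_offset {A : List ℕ} (hA : ∀ r ∈ A, r < m) :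
    addr (joint D m τ z c σ) ((D + 1) :: A.map (D + 2 + ·)) = z + addr σ A := by
  rw [← addr_joint D m τ z c σ hA]
  simp [addr, joint_offset]

end Store

/-- Simulation of a program, with queries replaced. -/
theorem Prog.exists_sim (D m : ℕ) (h : Store → ℕ → ℕ → ℕ → List (Op ℕ))
    (hQ : ∀ A B : List ℕ, (∀ r ∈ A, r < m) → (∀ r ∈ B, r < m) → ∃ (Q : Prog) (q : Polynomial ℕ),
      ∀ (τ : Store) (z c : ℕ) (σ : Store), Halts Q (.joint D m τ z c σ) (.joint D m τ z c σ)
        (h τ (σ.addr A) (σ.addr B) c) (q.eval (τ.size D + c + z + σ.size m)))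
    (P : Prog) (hP : P.Below m) :
    ∃ (P' : Prog) (p : Polynomial ℕ), ∀ (σ σ' : Store) (out : List (Op ℕ)) (k : ℕ),
      Run P σ σ' out k → ∀ (τ : Store) (z c S : ℕ), τ.size D + c + z + σ.size m + 2 * k ≤ S →
        Halts P' (.joint D m τ z c σ) (.joint D m τ z (c + queries out) σ')
          (splice (h τ) z c out) (k * p.eval S) := by
  -- All gates are treated alike: register `D + 1` holds the offset in unary, and an address is a
  -- sum of heights, so adding this register to an address list adds `z` to the address.
  have hgate : ∀ (g : Gate (List ℕ)) (f : List ℕ → List ℕ),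
      (∀ (τ : Store) (z c : ℕ) (σ : Store),
        (g.map f).map (Store.addr (.joint D m τ z c σ)) = (g.map σ.addr).map (z + ·)) →
      ∃ (P' : Prog) (p : Polynomial ℕ), ∀ (σ σ' : Store) (out : List (Op ℕ)) (k : ℕ),
      Run (.emit (.gate g)) σ σ' out k → ∀ (τ : Store) (z c S : ℕ),
        τ.size D + c + z + σ.size m + 2 * k ≤ S →
        Halts P' (.joint D m τ z c σ) (.joint D m τ z (c + queries out) σ')
          (splice (h τ) z c out) (k * p.eval S) := by
    intro g f hf
    refine ⟨.emit (.gate (g.map f)), 1, fun σ σ' out k hr τ z c S _ => ?_⟩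
    cases hr
    refine ⟨1, by simp, ?_⟩
    have := Run.emit (.joint D m τ z c σ) (.gate (g.map f))
    simp only [Op.map, hf] at this
    simpa [splice, queries, Op.map] using this
  induction P with
  | skip =>
    refine ⟨.skip, 1, fun σ σ' out k hr τ z c S _ => ?_⟩
    cases hr
    exact (Halts.skip _).cast (by simp [queries]) (by simp [splice]) (by simp)
  | push r b =>
    refine ⟨.push (D + 2 + r) b, 1, fun σ σ' out k hr τ z c S _ => ?_⟩
    cases hr
    refine (Halts.push _ _ _).cast ?_ (by simp [splice]) (by simp)
    rw [Store.joint_update _ _ _ _ _ _ hP, Store.joint_reg _ _ _ _ _ _ hP]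
    rfl
  | pop r =>
    refine ⟨.pop (D + 2 + r), 1, fun σ σ' out k hr τ z c S _ => ?_⟩
    cases hr
    refine (Halts.pop _ _).cast ?_ (by simp [splice]) (by simp)
    rw [Store.joint_update _ _ _ _ _ _ hP, Store.joint_reg _ _ _ _ _ _ hP]
    rfl
  | emit o =>
    match o with
    | .gate (.hadamard i) =>
      exact hgate _ (fun A => (D + 1) :: A.map (D + 2 + ·)) fun τ z c σ => by
        simp only [Gate.map, Store.addr_joint_offset _ _ _ _ _ _ (show ∀ r ∈ i, r < m from hP)]
    | .gate (.tgate i) =>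
      exact hgate _ (fun A => (D + 1) :: A.map (D + 2 + ·)) fun τ z c σ => by
        simp only [Gate.map, Store.addr_joint_offset _ _ _ _ _ _ (show ∀ r ∈ i, r < m from hP)]
    | .gate (.cnot i j) =>
      exact hgate _ (fun A => (D + 1) :: A.map (D + 2 + ·)) fun τ z c σ => by
        simp only [Gate.map, Store.addr_joint_offset _ _ _ _ _ _ hP.1,
          Store.addr_joint_offset _ _ _ _ _ _ hP.2]
    | .gate (.toffoli i j l) =>
      exact hgate _ (fun A => (D + 1) :: A.map (D + 2 + ·)) fun τ z c σ => by
        simp only [Gate.map, Store.addr_joint_offset _ _ _ _ _ _ hP.1,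
          Store.addr_joint_offset _ _ _ _ _ _ hP.2.1, Store.addr_joint_offset _ _ _ _ _ _ hP.2.2]
    | .query i j =>
      obtain ⟨Q, q, hQ⟩ := hQ i j hP.1 hP.2
      refine ⟨.seq Q (.push D true), q + 1, fun σ σ' out k hr τ z c S hS => ?_⟩
      cases hr
      refine ((hQ τ z c σ).seq (Halts.push _ D true)).cast ?_ ?_ ?_
      · rw [Store.joint_push]
        rfl
      · simp [splice, Op.map]
      · have := eval_mono q (show τ.size D + c + z + σ.size m ≤ S by omega)
        simp only [Polynomial.eval_add, Polynomial.eval_one]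
        omega
  | seq P Q ihP ihQ =>
    obtain ⟨P', p, hp⟩ := ihP hP.1
    obtain ⟨Q', q, hq⟩ := ihQ hP.2
    refine ⟨.seq P' Q', p + q, fun σ σ' out k hr τ z c S hS => ?_⟩
    cases hr with
    | seq h1 h2 =>
      rename_i σ₁ u v k₁ k₂
      have a := hp _ _ _ _ h1 τ z c S (by omega)
      -- In `k₁` steps the store grows by at most `k₁` bits and at most `k₁` queries are counted;
      -- the term `2 * k` in the hypothesis on `S` pays for both.
      have b := hq _ _ _ _ h2 τ z (c + queries u) S (by
        have := h1.size_le m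
        have := h1.length_le
        have := queries_le_length u
        omega)
      refine (a.seq b).cast (by rw [queries_append, Nat.add_assoc]) (by rw [splice_append]) ?_
      simp only [Polynomial.eval_add]
      nlinarith
  | ite r P Q ihP ihQ =>
    obtain ⟨P', p, hp⟩ := ihP hP.2.1
    obtain ⟨Q', q, hq⟩ := ihQ hP.2.2
    refine ⟨.ite (D + 2 + r) P' Q', p + q + 1, fun σ σ' out k hr τ z c S hS => ?_⟩
    simp only [Polynomial.eval_add, Polynomial.eval_one]
    cases hr with
    | iteTrue hr h1 =>
      refine (Halts.ite_true ?_ (hp _ _ _ _ h1 τ z c S (by omega))).mono (by nlinarith)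
      rwa [Store.joint_reg _ _ _ _ _ _ hP.1]
    | iteFalse hr h1 =>
      refine (Halts.ite_false ?_ (hq _ _ _ _ h1 τ z c S (by omega))).mono (by nlinarith)
      rwa [Store.joint_reg _ _ _ _ _ _ hP.1]
  | loop r P ih =>
    obtain ⟨P', p, hp⟩ := ih hP.2
    refine ⟨.loop (D + 2 + r) P', p + 1, fun σ σ' out k hr => ?_⟩
    -- The body is already simulated by `P'`; the loop itself needs a second induction, along its
    -- execution.
    generalize hL : Prog.loop r P = L at hr
    induction hr with
    | loopDone h0 =>
      rename_i r' P'' σ''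
      injection hL with e1 e2
      subst e1 e2
      intro τ z c S hS
      refine (Halts.loop_done ?_).cast (by simp [queries]) (by simp [splice]) (by simp)
      rwa [Store.joint_reg _ _ _ _ _ _ hP.1]
    | loopStep h0 h1 h2 _ ih2 =>
      rename_i r' P'' σ₁ σ₂ σ₃ u v k₁ k₂ _
      injection hL with e1 e2
      subst e1 e2
      intro τ z c S hS
      have a := hp _ _ _ _ h1 τ z c S (by omega)
      have b := ih2 rfl τ z (c + queries u) S (by
        have := h1.size_le m
        have := h1.length_le
        have := queries_le_length u
        omega)
      refine (Halts.loop_step ?_ a b).cast (by rw [queries_append, Nat.add_assoc])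
        (by rw [splice_append]) ?_
      · rwa [Store.joint_reg _ _ _ _ _ _ hP.1]
      · simp only [Polynomial.eval_add, Polynomial.eval_one]
        nlinarith
    | _ => cases hL

/-- Empty the `k` registers from `a` on. -/
def Prog.clearFrom (a : ℕ) : ℕ → Prog
  | 0 => .skip
  | k + 1 => .seq (.clear a) (.clearFrom (a + 1) k)

theorem Halts.clearFrom (a k : ℕ) (σ : Store) (B : ℕ) (hB : ∀ r, (σ r).length ≤ B) :
    Halts (.clearFrom a k) σ (fun r => if a ≤ r ∧ r < a + k then [] else σ r) []
      (k * (2 * B + 1) + 1) := by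
  induction k generalizing a σ with
  | zero =>
    refine (Halts.skip σ).cast ?_ rfl (by omega)
    funext r
    rw [if_neg (by omega)]
  | succ k ih =>
    refine ((Halts.clear σ a).seq' (ih (a + 1) _ fun r => ?_)).cast ?_ rfl ?_
    · simp only [update_apply]
      split_ifs
      · simp
      · exact hB r
    · funext r
      simp only [update_apply]
      split_ifs <;> first | rfl | (exfalso; omega)
    · have := hB a
      rw [Nat.add_mul k 1]
      omega

theorem UNum.addr (A : List ℕ) (D : ℕ) : UNum fun e => (A.map fun r => e (D + r)).sum := by
  induction A with
  | nil => exact UNum.const 0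
  | cons r A ih => exact (UNum.var (D + r)).add ih

/-- Splicing computed segments into the circuits of a uniform family. -/
theorem UGen.splice {C : ℕ → List (Op ℕ)} (hC : Uniform C) {g z : (ℕ → ℕ) → ℕ} (hg : UNum g)
    (hz : UNum z) (va vb vc : ℕ) {seg : (ℕ → ℕ) → List (Op ℕ)} (hseg : UGen seg) :
    UGen fun e => QCrypto.splice
      (fun a b c => seg (update (update (update e va a) vb b) vc c)) (z e) 0 (C (g e)) := by
  obtain ⟨P, p, hP⟩ := hC
  obtain ⟨m₀, hm₀⟩ := P.exists_below
  -- Register `0` has to be among the simulated registers because it carries the input.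
  set m := max m₀ 1 with hm
  replace hm₀ : P.Below m := hm₀.mono (le_max_left _ _)
  -- At a query the variables of the segment are bound to the two addresses, recomputed from the
  -- simulated registers, and to the number of queries so far, which stands on `D`.
  have hlet := fun (A B : List ℕ) (D : ℕ) => UGen.letVar va (UNum.addr A (D + 2))
    (UGen.letVar vb (UNum.addr B (D + 2)) (UGen.letVar vc (UNum.var D) hseg))
  obtain ⟨d, hd, hseg⟩ := hseg
  obtain ⟨d₁, hd₁, hz⟩ := hz
  obtain ⟨d₂, hd₂, hg⟩ := hg
  refine ⟨max (max d (max d₁ d₂)) (max va (max vb vc) + 1), fun e e' he => ?_, fun D hD => ?_⟩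
  · dsimp only
    rw [hd₁ e e' fun r hr => he r (by omega), hd₂ e e' fun r hr => he r (by omega)]
    congr 1
    funext a b c
    refine hd _ _ fun r hr => ?_
    simp only [update_apply]
    split_ifs <;> first | rfl | exact he r (by omega)
  -- The offset is written on `D + 1` and the input on `D + 2`, where register `0` of the simulated
  -- program lives; `D` is empty, which is the counter `0`. So the result is exactly the joint start
  -- store.
  obtain ⟨P₁, p₁, hP₁⟩ := hz (D + 1) (by omega)
  obtain ⟨P₂, p₂, hP₂⟩ := hg (D + 2) (by omega)
  obtain ⟨P', p', hP'⟩ := Prog.exists_sim D m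
    (fun τ a b c => seg (update (update (update τ.heights va a) vb b) vc c))
    (fun A B hA hB => by
      obtain ⟨d₃, hd₃, h₃⟩ := hlet A B D
      obtain ⟨Q, q, hq⟩ := h₃ (max (D + 2 + m) d₃) (le_max_right _ _)
      refine ⟨Q, q, fun τ z c σ => ?_⟩
      refine (hq (.joint D m τ z c σ)
        ((Store.joint_emptyFrom _ _ _ _ _ _).mono (le_max_left _ _))).cast rfl ?_ (by
          rw [(Store.joint_emptyFrom D m τ z c σ).size_eq (le_max_left _ _), Store.size_joint])
      refine hd _ _ fun r hr => ?_
      have e1 : ((A.map fun r => Store.heights (.joint D m τ z c σ) (D + 2 + r)).sum) =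
          σ.addr A := by
        rw [← Store.addr_joint D m τ z c σ hA, Store.addr, List.map_map]
        rfl
      have e2 : ((B.map fun r => Store.heights (.joint D m τ z c σ) (D + 2 + r)).sum) =
          σ.addr B := by
        rw [← Store.addr_joint D m τ z c σ hB, Store.addr, List.map_map]
        rfl
      have e3 : ((B.map fun r => update (Store.heights (.joint D m τ z c σ)) va (σ.addr A)
          (D + 2 + r)).sum) = σ.addr B := by
        rw [← e2]
        congr 1
        refine List.map_congr_left fun r _ => ?_
        rw [update_of_ne (by omega)]
      simp only [e1, e3]
      simp only [update_apply]
      split_ifs <;> first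
        | rfl
        | omega
        | (simp only [Store.heights, Store.joint]; rw [if_pos (by omega)])
        | (simp [Store.heights, Store.joint_counter])) P hm₀
  refine ⟨.seq P₁ (.seq P₂ (.seq P' (.clearFrom D (2 + m)))),
    p₁ + p₂.comp (Polynomial.X + p₁) +
      p.comp (p₂.comp (Polynomial.X + p₁)) * p'.comp (Polynomial.X + p₁ +
        p₂.comp (Polynomial.X + p₁) + 2 * p.comp (p₂.comp (Polynomial.X + p₁))) +
      Polynomial.C (2 + m) * (2 * (Polynomial.X + p₁ +
        p₂.comp (Polynomial.X + p₁) + 2 * p.comp (p₂.comp (Polynomial.X + p₁))) + 1) + 1,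
    fun σ hσ => ?_⟩
  obtain ⟨a1, a2⟩ := hP₁ σ (hσ.mono (by omega))
  rw [hσ.size_eq (show D ≤ D + 1 by omega)] at a1 a2
  obtain ⟨b1, b2⟩ := hP₂ (update σ (D + 1) (unary (z σ.heights)))
    (hσ.update _ (by omega) (by omega))
  rw [hd₂.heights_update (by omega)] at b1 b2
  set Z := z σ.heights
  set n := g σ.heights
  set S := σ.size D
  have hsz : Store.size (D + 2) (update σ (D + 1) (unary Z)) ≤ S + p₁.eval S := by
    have := Store.size_update_le (D + 2) σ (D + 1) (unary Z)
    rw [hσ.size_eq (show D ≤ D + 2 by omega), List.length_replicate] at this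
    omega
  have hsz' := eval_mono p₂ hsz
  obtain ⟨σ', k, hr, hk⟩ := hP n
  have hk' : k ≤ p.eval (p₂.eval (S + p₁.eval S)) := hk.trans (eval_mono p (b1.trans hsz'))
  have hin : (unaryInput n).size m ≤ n := by
    refine (Store.size_update_le _ _ _ _).trans ?_
    simp [Store.size]
  have hsim := hP' _ _ _ _ hr σ Z 0
    (S + p₁.eval S + p₂.eval (S + p₁.eval S) + 2 * p.eval (p₂.eval (S + p₁.eval S))) (by omega)
  have hstart : update (update σ (D + 1) (unary Z)) (D + 2) (unary n) =
      Store.joint D m σ Z 0 (unaryInput n) := by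
    funext q
    simp only [Store.joint, unaryInput, update_apply]
    split_ifs <;> first
      | rfl
      | (exfalso; omega)
      | (rw [hσ q (by omega)]; done)
      | (rw [hσ q (by omega)]; rfl)
  rw [hstart] at b2
  have hcl := Halts.clearFrom D (2 + m) (Store.joint D m σ Z (0 + queries (C n)) σ')
    (S + p₁.eval S + p₂.eval (S + p₁.eval S) + 2 * p.eval (p₂.eval (S + p₁.eval S))) fun r => by
      by_cases hr' : r < D + 2 + m
      · refine (Store.length_le_size _ hr').trans ?_
        rw [Store.size_joint]
        have := hr.size_le m
        have := hr.length_le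
        have := queries_le_length (C n)
        omega
      · rw [Store.joint_emptyFrom D m σ Z (0 + queries (C n)) σ' r (by omega)]
        simp
  refine show Halts _ σ σ (QCrypto.splice _ Z 0 (C n)) _ from
    (a2.seq' (b2.seq' (hsim.seq hcl))).cast ?_ (by simp) ?_
  · funext r
    simp only [Store.joint]
    split_ifs <;> first | rfl | (exfalso; omega) | exact (hσ r (by omega)).symm
  · simp only [Polynomial.eval_add, Polynomial.eval_mul, Polynomial.eval_ofNat, Polynomial.eval_X,
      Polynomial.eval_comp, Polynomial.eval_one, Polynomial.eval_C]
    have := Nat.mul_le_mul_right (p'.eval (S + p₁.eval S + p₂.eval (S + p₁.eval S) +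
      2 * p.eval (p₂.eval (S + p₁.eval S)))) hk'
    omega

end QCrypto

namespace QCrypto

open Function

/-! ### Bit strings -/

section Bits

variable {N k l : ℕ}

theorem bitAt_of_lt (x : Fin N → Bool) {i : ℕ} (h : i < N) : bitAt x i = x ⟨i, h⟩ := by
  simp [bitAt, h]

theorem bitAt_of_ge (x : Fin N → Bool) {i : ℕ} (h : N ≤ i) : bitAt x i = false := by
  simp [bitAt, Nat.not_lt.2 h]

@[simp] theorem bitAt_fin (x : Fin N → Bool) (i : Fin N) : bitAt x i = x i := by
  simp [bitAt]

theorem bits_ext {x y : Fin N → Bool} (h : ∀ i < N, bitAt x i = bitAt y i) : x = y := by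
  funext i
  simpa using h i i.2

theorem bitAt_overwrite (a : ℕ) (z : Fin k → Bool) (x : Fin N → Bool) (i : ℕ) :
    bitAt (overwrite a z x) i = if i < N ∧ a ≤ i ∧ i < a + k then bitAt z (i - a) else bitAt x i := by
  by_cases hi : i < N
  · rw [bitAt_of_lt _ hi]
    simp only [overwrite]
    by_cases h : a ≤ i ∧ i < a + k
    · rw [dif_pos ⟨h.1, by omega⟩, if_pos ⟨hi, h⟩, bitAt_of_lt z (show i - a < k by omega)]
    · rw [dif_neg (by omega), if_neg (by tauto), bitAt_of_lt _ hi]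
  · rw [bitAt_of_ge _ (by omega), if_neg (by tauto), bitAt_of_ge _ (by omega)]

theorem bitAt_block (a : ℕ) (x : Fin N → Bool) (i : ℕ) :
    bitAt (block k a x) i = if i < k then bitAt x (a + i) else false := by
  by_cases hi : i < k
  · rw [bitAt_of_lt _ hi, if_pos hi]; rfl
  · rw [bitAt_of_ge _ (by omega), if_neg hi]

theorem bitAt_flipIf (b : Bool) (t : ℕ) (x : Fin N → Bool) (i : ℕ) :
    bitAt (flipIf b t x) i = if i < N ∧ i = t then xor (bitAt x i) b else bitAt x i := by
  by_cases hi : i < N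
  · rw [bitAt_of_lt _ hi]
    simp only [flipIf, bitAt_of_lt x hi, hi, true_and]
  · rw [bitAt_of_ge _ (by omega), if_neg (by tauto), bitAt_of_ge _ (by omega)]

theorem bitAt_append (u : Fin k → Bool) (v : Fin l → Bool) (i : ℕ) :
    bitAt (Fin.append u v) i = if i < k then bitAt u i else bitAt v (i - k) := by
  by_cases hi : i < k + l
  · rw [bitAt_of_lt _ hi]
    by_cases h : i < k
    · rw [if_pos h, bitAt_of_lt _ h]
      exact Fin.append_left u v ⟨i, h⟩
    · rw [if_neg h, bitAt_of_lt _ (show i - k < l by omega)]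
      rw [← Fin.append_right u v ⟨i - k, by omega⟩]
      congr 1
      ext
      simp
      omega
  · rw [bitAt_of_ge _ (by omega), if_neg (by omega), bitAt_of_ge _ (by omega)]

theorem block_overwrite_self {a : ℕ} (h : a + k ≤ N) (z : Fin k → Bool) (x : Fin N → Bool) :
    block k a (overwrite a z x) = z := bits_ext fun i hi => by
  rw [bitAt_block, if_pos hi, bitAt_overwrite, if_pos (by omega)]
  congr 1
  omega

theorem overwrite_block (a : ℕ) (x : Fin N → Bool) : overwrite a (block k a x) x = x :=
  bits_ext fun i _ => by
    rw [bitAt_overwrite, bitAt_block]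
    split_ifs with h1 h2
    · congr 1; omega
    · omega
    · rfl

theorem overwrite_overwrite (a : ℕ) (z z' : Fin k → Bool) (x : Fin N → Bool) :
    overwrite a z (overwrite a z' x) = overwrite a z x := bits_ext fun i _ => by
  simp only [bitAt_overwrite]
  split_ifs <;> rfl

theorem overwrite_append (a : ℕ) (u : Fin k → Bool) (v : Fin l → Bool) (x : Fin N → Bool) :
    overwrite a (Fin.append u v) x = overwrite a u (overwrite (a + k) v x) := bits_ext fun i _ => by
  simp only [bitAt_overwrite, bitAt_append]
  split_ifs <;> first | rfl | (exfalso; omega) | (congr 1; omega)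

theorem block_append (a : ℕ) (x : Fin N → Bool) :
    block (k + l) a x = Fin.append (block k a x) (block l (a + k) x) := bits_ext fun i hi => by
  simp only [bitAt_block, bitAt_append]
  split_ifs <;> first | rfl | (exfalso; omega) | (congr 1; omega)

theorem sum_append {M : Type*} [AddCommMonoid M] (F : (Fin (k + l) → Bool) → M) :
    ∑ w, F w = ∑ u : Fin k → Bool, ∑ v : Fin l → Bool, F (Fin.append u v) := by
  rw [← Fintype.sum_prod_type']
  exact (Fintype.sum_equiv (Fin.appendEquiv k l) _ _ fun _ => rfl).symm

theorem append_inj {u u' : Fin k → Bool} {v v' : Fin l → Bool} :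
    Fin.append u v = Fin.append u' v' ↔ u = u' ∧ v = v' := by
  constructor
  · intro h
    exact Prod.ext_iff.1 ((Fin.appendEquiv k l).injective (a₁ := (u, v)) (a₂ := (u', v')) h)
  · rintro ⟨rfl, rfl⟩
    rfl

end Bits

/-! ### Execution of circuits -/

/-- Operators on `N` wires, as plain functions (with pointwise product). -/
abbrev Amp (N : ℕ) : Type := (Fin N → Bool) → (Fin N → Bool) → ℂ

section Exec

variable {N q m : ℕ} (O : (Fin q → Bool) → QState m)

/-- One operation. -/
noncomputable def step (g : Op ℕ) (ρ : Amp N) : Amp N := fun x y => g.apply O (Matrix.of ρ) x y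

/-- The result of a circuit. -/
noncomputable def exec (C : List (Op ℕ)) (ρ : Amp N) : Amp N := C.foldl (fun τ g => step O g τ) ρ

@[simp] theorem exec_nil (ρ : Amp N) : exec O [] ρ = ρ := rfl

theorem exec_append (C D : List (Op ℕ)) (ρ : Amp N) :
    exec O (C ++ D) ρ = exec O D (exec O C ρ) := List.foldl_append

theorem exec_cons (g : Op ℕ) (C : List (Op ℕ)) (ρ : Amp N) :
    exec O (g :: C) ρ = exec O C (step O g ρ) := rfl

theorem foldl_apply_eq_exec (C : List (Op ℕ)) (ρ : QState N) :
    C.foldl (fun τ g => g.apply O τ) ρ = Matrix.of (exec O C fun x y => ρ x y) := by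
  induction C generalizing ρ with
  | nil => rfl
  | cons g C ih => exact ih _

theorem Gate.apply_apply (g : Gate ℕ) (ρ : QState N) (x y : Fin N → Bool) :
    g.apply ρ x y = ∑ x', ∑ y', g.unitary N x x' * ρ x' y' * star (g.unitary N y y') := by
  rw [Gate.apply, Matrix.mul_apply, Finset.sum_comm]
  refine Finset.sum_congr rfl fun y' _ => ?_
  rw [Matrix.mul_apply, Finset.sum_mul, Matrix.conjTranspose_apply]

theorem step_gate (g : Gate ℕ) (ρ : Amp N) (x y : Fin N → Bool) :
    step O (.gate g) ρ x y = ∑ x', ∑ y', g.unitary N x x' * ρ x' y' * star (g.unitary N y y') :=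
  Gate.apply_apply g (Matrix.of ρ) x y

theorem step_query (a b : ℕ) (ρ : Amp N) (x y : Fin N → Bool) :
    step O (.query a b) ρ x y = if block q a x = block q a y then
      O (block q a x) (block m b x) (block m b y) *
        ∑ z : Fin m → Bool, ρ (overwrite b z x) (overwrite b z y) else 0 := rfl

theorem step_add (g : Op ℕ) (ρ σ : Amp N) : step O g (ρ + σ) = step O g ρ + step O g σ := by
  funext x y
  cases g with
  | gate g =>
    simp only [step_gate, Pi.add_apply, mul_add, add_mul, Finset.sum_add_distrib]
  | query a b =>
    simp only [step_query, Pi.add_apply, Finset.sum_add_distrib, mul_add]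
    split_ifs <;> simp

theorem step_smul (g : Op ℕ) (c : ℂ) (ρ : Amp N) : step O g (c • ρ) = c • step O g ρ := by
  funext x y
  cases g with
  | gate g =>
    simp only [step_gate, Pi.smul_apply, smul_eq_mul, Finset.mul_sum]
    refine Finset.sum_congr rfl fun _ _ => Finset.sum_congr rfl fun _ _ => by ring
  | query a b =>
    simp only [step_query, Pi.smul_apply, smul_eq_mul, ← Finset.mul_sum]
    split_ifs
    · ring
    · simp

theorem exec_add (C : List (Op ℕ)) (ρ σ : Amp N) :
    exec O C (ρ + σ) = exec O C ρ + exec O C σ := by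
  induction C generalizing ρ σ with
  | nil => rfl
  | cons g C ih => rw [exec_cons, step_add, ih]; rfl

theorem exec_smul (C : List (Op ℕ)) (c : ℂ) (ρ : Amp N) :
    exec O C (c • ρ) = c • exec O C ρ := by
  induction C generalizing ρ with
  | nil => rfl
  | cons g C ih => rw [exec_cons, step_smul, ih]; rfl

theorem exec_sum {ι : Type*} (s : Finset ι) (C : List (Op ℕ)) (f : ι → Amp N) :
    exec O C (∑ i ∈ s, f i) = ∑ i ∈ s, exec O C (f i) := by
  classical
  induction s using Finset.induction_on with
  | empty => simpa using exec_smul O C 0 (0 : Amp N)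
  | insert a s ha ih => rw [Finset.sum_insert ha, Finset.sum_insert ha, exec_add, ih]

/-! ### Gates on a block of wires -/

/-- Reindexes a sum over the strings that agree with `x` outside a block by the contents of the
block. The condition has the form in which `Gate.unitary_shift` delivers it. -/
theorem sum_overwrite {M : Type*} [AddCommMonoid M] {K z : ℕ} (hz : z + K ≤ N) (x : Fin N → Bool)
    (F : (Fin N → Bool) → M) :
    ∑ x', (if x' = overwrite z (block K z x') x then F x' else 0) =
      ∑ u : Fin K → Bool, F (overwrite z u x) := by
  rw [← Finset.sum_filter]
  refine Finset.sum_nbij' (fun x' => block K z x') (fun u => overwrite z u x) ?_ ?_ ?_ ?_ ?_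
  · simp
  · intro u _
    simp [block_overwrite_self hz]
  · intro x' hx'
    exact ((Finset.mem_filter.1 hx').2).symm
  · intro u _
    simp [block_overwrite_self hz]
  · intro x' hx'
    rw [← (Finset.mem_filter.1 hx').2]

theorem eq_overwrite_iff {K z : ℕ} (x x' : Fin N → Bool) :
    x' = overwrite z (block K z x') x ↔ ∀ i < N, ¬ (z ≤ i ∧ i < z + K) → bitAt x i = bitAt x' i := by
  constructor
  · intro h i hi hn
    rw [h, bitAt_overwrite, if_neg (by tauto)]
  · intro h
    refine bits_ext fun i hi => ?_
    rw [bitAt_overwrite, bitAt_block]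
    split_ifs with h1 h2
    · congr 1; omega
    · omega
    · exact (h i hi (by tauto)).symm

theorem bits_eq_iff {x y : Fin N → Bool} : x = y ↔ ∀ i < N, bitAt x i = bitAt y i :=
  ⟨fun h _ _ => by rw [h], bits_ext⟩

theorem forall_bits_split {K z : ℕ} (hz : z + K ≤ N) {p : ℕ → Prop} :
    (∀ i < N, p i) ↔ (∀ i < N, ¬ (z ≤ i ∧ i < z + K) → p i) ∧ ∀ i < K, p (z + i) := by
  constructor
  · exact fun h => ⟨fun i hi _ => h i hi, fun i hi => h _ (by omega)⟩
  · rintro ⟨h1, h2⟩ i hi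
    by_cases h : z ≤ i ∧ i < z + K
    · have := h2 (i - z) (by omega)
      rwa [show z + (i - z) = i by omega] at this
    · exact h1 i hi h

/-- On the wires outside the block the shifted gate is the identity, so its entries vanish unless
the two strings agree there. For each gate the equality of strings in its definition is split into
the wires inside and outside the block. -/
theorem Gate.unitary_shift {K z : ℕ} (hz : z + K ≤ N) {g : Gate ℕ} (hg : g.Valid K)
    (x x' : Fin N → Bool) :
    (g.map (z + ·)).unitary N x x' = if x' = overwrite z (block K z x') x then
      g.unitary K (block K z x) (block K z x') else 0 := by
  have hb : ∀ {i : ℕ} (x : Fin N → Bool), i < K → bitAt (block K z x) i = bitAt x (z + i) :=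
    fun x hi => by rw [bitAt_block, if_pos hi]
  rw [if_congr (eq_overwrite_iff x x') rfl rfl]
  cases g with
  | hadamard i =>
    have hi : i < K := hg
    simp only [Gate.map, Gate.unitary, Matrix.of_apply, hb _ hi]
    rw [← ite_and]
    refine if_congr ?_ rfl rfl
    have e1 : (∀ j : Fin N, (j : ℕ) ≠ z + i → x j = x' j) ↔
        ∀ j < N, j ≠ z + i → bitAt x j = bitAt x' j :=
      ⟨fun h j hj hne => by rw [bitAt_of_lt _ hj, bitAt_of_lt _ hj]; exact h ⟨j, hj⟩ hne,
        fun h j hne => by simpa using h j j.2 hne⟩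
    have e2 : (∀ j : Fin K, (j : ℕ) ≠ i → block K z x j = block K z x' j) ↔
        ∀ j < K, z + j ≠ z + i → bitAt x (z + j) = bitAt x' (z + j) :=
      ⟨fun h j hj hne => by
        have := h ⟨j, hj⟩ (by simpa using hne)
        simpa [block] using this,
        fun h j hne => h j j.2 (by omega)⟩
    rw [e1, e2, forall_bits_split hz]
    refine and_congr ⟨fun h j hj hn => h j hj hn (by omega), fun h j hj hn _ => h j hj hn⟩ Iff.rfl
  | tgate i =>
    have hi : i < K := hg
    simp only [Gate.map, Gate.unitary, Matrix.diagonal_apply, hb _ hi]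
    rw [← ite_and]
    refine if_congr ?_ rfl rfl
    rw [bits_eq_iff, forall_bits_split hz, bits_eq_iff]
    refine and_congr Iff.rfl (forall₂_congr fun j hj => ?_)
    rw [hb _ hj, hb _ hj]
  | cnot c t =>
    obtain ⟨hc, ht, -⟩ := hg
    simp only [Gate.map, Gate.unitary, Matrix.of_apply, hb _ hc]
    rw [← ite_and]
    refine if_congr ?_ rfl rfl
    rw [bits_eq_iff, forall_bits_split hz, bits_eq_iff]
    refine and_congr (forall₃_congr fun j hj hn => ?_) (forall₂_congr fun j hj => ?_)
    · rw [bitAt_flipIf, if_neg (by omega)]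
    · rw [bitAt_flipIf, bitAt_flipIf, hb _ hj, hb _ hj]
      have : (z + j < N ∧ z + j = z + t) ↔ (j < K ∧ j = t) := by omega
      rw [if_congr this rfl rfl]
  | toffoli a b t =>
    obtain ⟨ha, hbb, ht, -⟩ := hg
    simp only [Gate.map, Gate.unitary, Matrix.of_apply, hb _ ha, hb _ hbb]
    rw [← ite_and]
    refine if_congr ?_ rfl rfl
    rw [bits_eq_iff, forall_bits_split hz, bits_eq_iff]
    refine and_congr (forall₃_congr fun j hj hn => ?_) (forall₂_congr fun j hj => ?_)
    · rw [bitAt_flipIf, if_neg (by omega)]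
    · rw [bitAt_flipIf, bitAt_flipIf, hb _ hj, hb _ hj]
      have : (z + j < N ∧ z + j = z + t) ↔ (j < K ∧ j = t) := by omega
      rw [if_congr this rfl rfl]

/-- A gate on a block of wires acts on the block. -/
theorem Gate.apply_shift {K z : ℕ} (hz : z + K ≤ N) {g : Gate ℕ} (hg : g.Valid K) (ρ : QState N)
    (x y : Fin N → Bool) :
    (g.map (z + ·)).apply ρ x y =
      g.apply (Matrix.of fun u v => ρ (overwrite z u x) (overwrite z v y)) (block K z x)
        (block K z y) := by
  rw [Gate.apply_apply, Gate.apply_apply]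
  simp only [Gate.unitary_shift hz hg]
  have h1 : ∀ x' : Fin N → Bool, (∑ y', (if x' = overwrite z (block K z x') x then
      g.unitary K (block K z x) (block K z x') else 0) * ρ x' y' *
      star (if y' = overwrite z (block K z y') y then
        g.unitary K (block K z y) (block K z y') else 0)) =
      if x' = overwrite z (block K z x') x then ∑ v : Fin K → Bool,
        g.unitary K (block K z x) (block K z x') * ρ x' (overwrite z v y) *
        star (g.unitary K (block K z y) v) else 0 := by
    intro x'
    split_ifs with h
    · have := sum_overwrite hz y fun y' => g.unitary K (block K z x) (block K z x') * ρ x' y' *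
        star (g.unitary K (block K z y) (block K z y'))
      simp only [block_overwrite_self hz] at this
      rw [← this]
      refine Finset.sum_congr rfl fun y' _ => ?_
      split_ifs <;> simp
    · simp
  simp only [h1]
  rw [sum_overwrite hz x]
  simp only [block_overwrite_self hz]
  rfl

end Exec

end QCrypto

namespace QCrypto

open Function

/-! ### States as pointwise products, and triples with a frame rule -/

section Triples

variable {N q m : ℕ} (O : (Fin q → Bool) → QState m)

/-- The operator `σ` on the block of wires starting at `a`. -/
def blk (N : ℕ) {k : ℕ} (a : ℕ) (σ : QState k) : Amp N := fun x y =>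
  σ (block k a x) (block k a y)

/-- The wires `a, …, a + k - 1` are in state `|0⟩`. -/
noncomputable def zero (N a k : ℕ) : Amp N := blk N a (basis fun _ : Fin k => false)

/-- The wire `a` is in state `|b⟩`. -/
noncomputable def bit (N a : ℕ) (b : Bool) : Amp N := blk N a (basis fun _ : Fin 1 => b)

/-- `r` does not depend on the wires in `A`. -/
def Indep (A : Set ℕ) (r : Amp N) : Prop :=
  ∀ x x' y y' : Fin N → Bool, (∀ i < N, i ∉ A → bitAt x i = bitAt x' i) →
    (∀ i < N, i ∉ A → bitAt y i = bitAt y' i) → r x y = r x' y'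

namespace Indep

variable {A B : Set ℕ} {r s : Amp N}

theorem mono (h : Indep B r) (hAB : A ⊆ B) : Indep A r := fun x x' y y' hx hy =>
  h x x' y y' (fun i hi hn => hx i hi fun ha => hn (hAB ha)) fun i hi hn =>
    hy i hi fun ha => hn (hAB ha)

theorem mul (hr : Indep A r) (hs : Indep A s) : Indep A (r * s) := fun x x' y y' hx hy => by
  rw [Pi.mul_apply, Pi.mul_apply, Pi.mul_apply, Pi.mul_apply, hr x x' y y' hx hy,
    hs x x' y y' hx hy]

theorem one : Indep A (1 : Amp N) := fun _ _ _ _ _ _ => rfl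

theorem smul (c : ℂ) (hr : Indep A r) : Indep A (c • r) := fun x x' y y' hx hy => by
  rw [Pi.smul_apply, Pi.smul_apply, Pi.smul_apply, Pi.smul_apply, hr x x' y y' hx hy]

theorem prod {ι : Type*} {t : Finset ι} {f : ι → Amp N} (h : ∀ i ∈ t, Indep A (f i)) :
    Indep A (∏ i ∈ t, f i) := by
  classical
  induction t using Finset.induction_on with
  | empty => exact one
  | insert a t ha ih =>
    rw [Finset.prod_insert ha]
    exact (h _ (Finset.mem_insert_self _ _)).mul (ih fun i hi => h i (Finset.mem_insert_of_mem hi))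

theorem blk {k a : ℕ} (σ : QState k) (h : ∀ i ∈ A, i < a ∨ a + k ≤ i) :
    Indep A (blk N a σ) := fun x x' y y' hx hy => by
  have key : ∀ x x' : Fin N → Bool, (∀ i < N, i ∉ A → bitAt x i = bitAt x' i) →
      block k a x = block k a x' := fun x x' hx => bits_ext fun i hi => by
    rw [bitAt_block, bitAt_block, if_pos hi, if_pos hi]
    by_cases hN : a + i < N
    · exact hx _ hN fun ha => by have := h _ ha; omega
    · rw [bitAt_of_ge _ (by omega), bitAt_of_ge _ (by omega)]
  rw [QCrypto.blk, QCrypto.blk, key x x' hx, key y y' hy]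

theorem zero {k a : ℕ} (h : ∀ i ∈ A, i < a ∨ a + k ≤ i) : Indep A (zero N a k) := blk _ h

theorem bit {a : ℕ} (b : Bool) (h : a ∉ A) : Indep A (bit N a b) := blk _ fun i hi => by
  have : i ≠ a := fun h' => h (h' ▸ hi)
  omega

theorem overwrite {k a : ℕ} (hr : Indep A r) (hA : ∀ i, a ≤ i → i < a + k → i ∈ A)
    (u v : Fin k → Bool) (x y : Fin N → Bool) :
    r (QCrypto.overwrite a u x) (QCrypto.overwrite a v y) = r x y := by
  refine hr _ _ _ _ (fun i hi hn => ?_) fun i hi hn => ?_ <;>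
  · rw [bitAt_overwrite, if_neg]
    rintro ⟨-, h1, h2⟩
    exact hn (hA i h1 h2)

end Indep

theorem zero_add (a k l : ℕ) : zero N a (k + l) = zero N a k * zero N (a + k) l := by
  funext x y
  have : ∀ x : Fin N → Bool, block (k + l) a x = (fun _ => false) ↔
      block k a x = (fun _ => false) ∧ block l (a + k) x = fun _ => false := fun x => by
    rw [block_append, ← append_inj]
    have : (fun _ : Fin (k + l) => false) = Fin.append (fun _ => false) fun _ => false :=
      bits_ext fun i hi => by
        rw [bitAt_append]
        split_ifs <;> simp [bitAt]
    rw [this]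
  simp only [zero, blk, basis, Matrix.single_apply, Pi.mul_apply, eq_comm (a := fun _ => false),
    this]
  by_cases h1 : block k a x = (fun _ => false) <;> by_cases h2 : block l (a + k) x = (fun _ => false) <;>
    by_cases h3 : block k a y = (fun _ => false) <;>
    by_cases h4 : block l (a + k) y = (fun _ => false) <;> simp [h1, h2, h3, h4]

/-- Tensor products of adjacent blocks turn into products in the commutative ring of functions; from
here on, reordering of registers is a matter of `ring`. -/
theorem blk_tens {k l : ℕ} (a : ℕ) (σ : QState k) (τ : QState l) :
    blk N a (tens σ τ) = blk N a σ * blk N (a + k) τ := by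
  funext x y
  simp only [blk, tens, Pi.mul_apply, block_append, Fin.append_left, Fin.append_right]

theorem zero_zero (a : ℕ) : zero N a 0 = 1 := by
  funext x y
  simp only [zero, blk, basis, Matrix.single_apply]
  rw [if_pos ⟨Subsingleton.elim _ _, Subsingleton.elim _ _⟩]
  rfl

/-- On valid circuits: `C` transforms `α` to `β`, and does not affect the wires outside `A`. -/
def Tri (C : List (Op ℕ)) (A : Set ℕ) (α β : Amp N) : Prop :=
  (∀ g ∈ C, g.Valid N q m) ∧ ∀ r, Indep A r → exec O C (α * r) = β * r

namespace Tri

variable {O} {C D : List (Op ℕ)} {A B : Set ℕ} {α β γ : Amp N}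

theorem nil (A : Set ℕ) (α : Amp N) : Tri O [] A α α := ⟨by simp, fun _ _ => rfl⟩

theorem append (h : Tri O C A α β) (h' : Tri O D A β γ) : Tri O (C ++ D) A α γ :=
  ⟨fun g hg => (List.mem_append.1 hg).elim (h.1 g) (h'.1 g), fun r hr => by
    rw [exec_append, h.2 r hr, h'.2 r hr]⟩

theorem mono (h : Tri O C A α β) (hAB : A ⊆ B) : Tri O C B α β :=
  ⟨h.1, fun r hr => h.2 r (hr.mono hAB)⟩

/-- The factor `γ` can be absorbed into the arbitrary factor `r` of the definition: the frame rule
of separation logic, with the pointwise product as separating conjunction. -/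
theorem frame (h : Tri O C A α β) (hγ : Indep A γ) : Tri O C A (α * γ) (β * γ) :=
  ⟨h.1, fun r hr => by rw [mul_assoc, h.2 _ (hγ.mul hr), mul_assoc]⟩

/-- The general form of the frame rule. -/
theorem step {α' β' : Amp N} (h : Tri O C A α β) (γ : Amp N) (hAB : A ⊆ B) (hγ : Indep A γ)
    (hα : α' = α * γ) (hβ : β' = β * γ) : Tri O C B α' β' := by
  subst hα hβ
  exact (h.frame hγ).mono hAB

theorem exec_eq (h : Tri O C A α β) : exec O C α = β := by
  have := h.2 1 .one
  rwa [mul_one, mul_one] at this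

theorem smul (h : Tri O C A α β) (c : ℂ) : Tri O C A (c • α) (c • β) :=
  ⟨h.1, fun r hr => by rw [smul_mul_assoc, smul_mul_assoc, exec_smul, h.2 r hr]⟩

/-- Circuits act linearly. The index type is nonempty because validity of the circuit has to come
from the triple of some summand. -/
theorem sum {ι : Type*} [Nonempty ι] {s : Finset ι} {f g : ι → Amp N}
    (h : ∀ i, Tri O C A (f i) (g i)) : Tri O C A (∑ i ∈ s, f i) (∑ i ∈ s, g i) :=
  ⟨(h (Classical.arbitrary ι)).1, fun r hr => by
    rw [Finset.sum_mul, Finset.sum_mul, exec_sum]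
    exact Finset.sum_congr rfl fun i _ => (h i).2 r hr⟩

/-- Sequential loops. -/
theorem loop {n : ℕ} {S : ℕ → Amp N} {C : ℕ → List (Op ℕ)}
    (h : ∀ j < n, Tri O (C j) A (S j) (S (j + 1))) :
    Tri O ((List.range n).flatMap C) A (S 0) (S n) := by
  induction n with
  | zero => exact nil _ _
  | succ n ih =>
    rw [List.range_succ, List.flatMap_append, List.flatMap_singleton]
    exact (ih fun j hj => h j (by omega)).append (h n (by omega))

/-- Loops whose iterations work on disjoint wires, apart from the ones described by `γ`. -/
theorem parallel {n : ℕ} {S : ℕ → Set ℕ} {C : ℕ → List (Op ℕ)} {f g : ℕ → Amp N}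
    (h : ∀ j < n, Tri O (C j) (S j) (f j * γ) (g j * γ)) (hS : ∀ j < n, S j ⊆ A)
    (hf : ∀ i < n, ∀ j < n, j < i → Indep (S j) (f i))
    (hg : ∀ i < n, ∀ j < n, i < j → Indep (S j) (g i)) :
    Tri O ((List.range n).flatMap C) A ((∏ j ∈ Finset.range n, f j) * γ)
      ((∏ j ∈ Finset.range n, g j) * γ) := by
  -- After `k` rounds the first `k` factors are transformed and the others are still untouched; both
  -- kinds are independent of the wires of round `k` and go into the frame.
  have key : ∀ k ≤ n, Tri O ((List.range k).flatMap C) A ((∏ j ∈ Finset.range n, f j) * γ)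
      ((∏ j ∈ Finset.range k, g j) * (∏ j ∈ Finset.Ico k n, f j) * γ) := by
    intro k
    induction k with
    | zero =>
      intro _
      rw [Finset.prod_range_zero, one_mul, Finset.range_eq_Ico]
      exact nil _ _
    | succ k ih =>
      intro hk
      rw [List.range_succ, List.flatMap_append, List.flatMap_singleton]
      refine (ih (by omega)).append ((h k hk).step
        ((∏ j ∈ Finset.range k, g j) * ∏ j ∈ Finset.Ico (k + 1) n, f j) (hS k hk) ?_ ?_ ?_)
      · refine (Indep.prod fun i hi => hg i ?_ k hk ?_).mul (Indep.prod fun i hi => hf i ?_ k hk ?_)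
        all_goals simp at hi; omega
      · rw [Finset.prod_eq_prod_Ico_succ_bot (by omega : k < n)]
        ring
      · rw [Finset.prod_range_succ]
        ring
  simpa using key n le_rfl

/-- Gates on a block of wires. -/
theorem gates {K z : ℕ} (hz : z + K ≤ N) {L : List (Gate ℕ)} (hL : ∀ g ∈ L, g.Valid K)
    (τ : QState K) :
    Tri O ((L.map (Gate.map (z + ·))).map .gate) (Set.Ico z (z + K)) (blk N z τ)
      (blk N z (L.foldl (fun τ g => g.apply τ) τ)) := by
  induction L generalizing τ with
  | nil => exact nil _ _
  | cons g L ih =>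
    refine append (C := [.gate (g.map (z + ·))]) (β := blk N z (g.apply τ)) ⟨?_, fun r hr => ?_⟩
      (ih (fun g' hg' => hL g' (List.mem_cons_of_mem _ hg')) _)
    · have hg := hL g List.mem_cons_self
      simp only [List.mem_singleton, forall_eq]
      cases g <;> simp only [Gate.Valid, Gate.map, Op.Valid] at hg ⊢ <;> omega
    · funext x y
      have h1 := Gate.apply_shift hz (hL g List.mem_cons_self) (Matrix.of (blk N z τ * r)) x y
      refine h1.trans ?_
      have h2 : (Matrix.of fun u v => Matrix.of (blk N z τ * r) (overwrite z u x)
          (overwrite z v y) : QState K) = Matrix.of fun u v => r x y * τ u v := by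
        ext u v
        simp only [Matrix.of_apply, Pi.mul_apply, blk, block_overwrite_self hz]
        rw [hr.overwrite (fun i h1 h2 => ⟨h1, h2⟩), mul_comm]
      rw [h2]
      simp only [Gate.apply_apply, Pi.mul_apply, blk, Matrix.of_apply, Finset.sum_mul]
      refine Finset.sum_congr rfl fun _ _ => Finset.sum_congr rfl fun _ _ => by ring

end Tri

/-! ### Classical gates -/

/-- The circuit permutes the basis states. -/
def Permutes (N : ℕ) (C : List (Op ℕ)) (F : (Fin N → Bool) → Fin N → Bool) : Prop :=
  ∀ (ρ : Amp N) (x y : Fin N → Bool), exec O C ρ x y = ρ (F x) (F y)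

variable {O}

theorem Permutes.append {C D : List (Op ℕ)} {F G : (Fin N → Bool) → Fin N → Bool}
    (hC : Permutes O N C F) (hD : Permutes O N D G) : Permutes O N (C ++ D) (F ∘ G) :=
  fun ρ x y => by rw [exec_append, hD, hC]; rfl

/-- Conjugation by a permutation matrix evaluates the operator at the inverse permutation, which is
`F` itself for an involution. -/
theorem Permutes.of_unitary {g : Gate ℕ} {F : (Fin N → Bool) → Fin N → Bool}
    (h : ∀ x x', g.unitary N x x' = if x = F x' then 1 else 0) (hF : ∀ x, F (F x) = x) :
    Permutes O N [.gate g] F := fun ρ x y => by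
  have h' : ∀ x x', g.unitary N x x' = if F x = x' then 1 else 0 := fun x x' => by
    rw [h]
    refine if_congr ⟨fun e => ?_, fun e => ?_⟩ rfl rfl
    · rw [e, hF]
    · rw [← e, hF]
  rw [exec_cons, exec_nil, step_gate]
  simp [h']

theorem Permutes.cnot {c t : ℕ} (hct : c ≠ t) :
    Permutes O N [.gate (.cnot c t)] fun x => flipIf (bitAt x c) t x :=
  .of_unitary (fun _ _ => rfl) fun x => bits_ext fun i hi => by
    simp only [bitAt_flipIf]
    rw [if_neg (show ¬ (c < N ∧ c = t) by tauto)]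
    split_ifs <;> simp

theorem Permutes.toffoli {a b t : ℕ} (hat : a ≠ t) (hbt : b ≠ t) :
    Permutes O N [.gate (.toffoli a b t)] fun x => flipIf (bitAt x a && bitAt x b) t x :=
  .of_unitary (fun _ _ => rfl) fun x => bits_ext fun i hi => by
    simp only [bitAt_flipIf]
    rw [if_neg (show ¬ (a < N ∧ a = t) by tauto), if_neg (show ¬ (b < N ∧ b = t) by tauto)]
    split_ifs <;> simp

/-- Rearrange the bits. -/
def moveBits (π : ℕ → ℕ) (x : Fin N → Bool) : Fin N → Bool := fun i => bitAt x (π i)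

theorem bitAt_moveBits (π : ℕ → ℕ) (x : Fin N → Bool) {i : ℕ} (hi : i < N) :
    bitAt (moveBits π x) i = bitAt x (π i) := by
  rw [bitAt_of_lt _ hi]
  rfl

/-- Exchange of the blocks of length `k` starting at `a` and `b`. -/
def swapIndex (a b k i : ℕ) : ℕ :=
  if a ≤ i ∧ i < a + k then b + (i - a) else if b ≤ i ∧ i < b + k then a + (i - b) else i

/-- Swap the blocks of length `k` starting at `a` and `b`. -/
def swapB (a b k : ℕ) : List (Op ℕ) :=
  (List.range k).flatMap fun j =>
    [.gate (.cnot (a + j) (b + j)), .gate (.cnot (b + j) (a + j)), .gate (.cnot (a + j) (b + j))]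

/-- Swap the blocks of length `k` starting at `a` and `b` if wire `c` is `1`. -/
def cswapB (c a b k : ℕ) : List (Op ℕ) :=
  (List.range k).flatMap fun j =>
    [.gate (.cnot (b + j) (a + j)), .gate (.toffoli c (a + j) (b + j)),
      .gate (.cnot (b + j) (a + j))]

/-- Copy the `k` bits from `a` on to the `k` wires from `b` on. -/
def copyB (a b k : ℕ) : List (Op ℕ) :=
  (List.range k).flatMap fun j => [.gate (.cnot (a + j) (b + j))]

/-- Three CNOTs in alternating directions exchange two bits; the wires added in the last round are
not touched by the earlier rounds. -/
theorem Permutes.swapB {a b k : ℕ} (ha : a + k ≤ N) (hb : b + k ≤ N)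
    (hab : a + k ≤ b ∨ b + k ≤ a) : Permutes O N (swapB a b k) (moveBits (swapIndex a b k)) := by
  induction k with
  | zero =>
    intro ρ x y
    have : ∀ x : Fin N → Bool, moveBits (swapIndex a b 0) x = x := fun x => bits_ext fun i hi => by
      rw [bitAt_moveBits _ _ hi, swapIndex, if_neg (by omega), if_neg (by omega)]
    rw [this, this]
    rfl
  | succ k ih =>
    rw [QCrypto.swapB, List.range_succ, List.flatMap_append, List.flatMap_singleton]
    have h := (ih (by omega) (by omega) (by omega)).append (((Permutes.cnot (O := O) (N := N)
      (show a + k ≠ b + k by omega)).append (Permutes.cnot (show b + k ≠ a + k by omega))).append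
      (Permutes.cnot (show a + k ≠ b + k by omega)))
    intro ρ x y
    refine (h ρ x y).trans ?_
    congr 1 <;>
    · refine bits_ext fun i hi => ?_
      simp only [comp_apply]
      rw [bitAt_moveBits _ _ hi, bitAt_moveBits _ _ hi]
      have h1 : swapIndex a b k (a + k) = a + k := by
        rw [swapIndex, if_neg (by omega), if_neg (by omega)]
      have h2 : swapIndex a b k (b + k) = b + k := by
        rw [swapIndex, if_neg (by omega), if_neg (by omega)]
      have hA : swapIndex a b (k + 1) (a + k) = b + k := by
        rw [swapIndex, if_pos (by omega)]; omega
      have hB : swapIndex a b (k + 1) (b + k) = a + k := by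
        rw [swapIndex, if_neg (by omega), if_pos (by omega)]; omega
      have n1 : a + k ≠ b + k := by omega
      have n2 : b + k ≠ a + k := n1.symm
      have l1 : a + k < N := by omega
      have l2 : b + k < N := by omega
      by_cases e1 : i = a + k
      · subst e1
        rw [hA, h1]
        simp only [bitAt_flipIf, n1, n2, l1, l2, and_true, and_false, if_true, if_false]
        generalize bitAt _ (a + k) = u
        generalize bitAt _ (b + k) = v
        cases u <;> cases v <;> rfl
      by_cases e2 : i = b + k
      · subst e2
        rw [hB, h2]
        simp only [bitAt_flipIf, n1, n2, l1, l2, and_true, and_false, if_true, if_false]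
        generalize bitAt _ (a + k) = u
        generalize bitAt _ (b + k) = v
        cases u <;> cases v <;> rfl
      have h3 : swapIndex a b (k + 1) i = swapIndex a b k i := by
        simp only [swapIndex]
        split_ifs <;> omega
      have h4 : swapIndex a b k i ≠ a + k ∧ swapIndex a b k i ≠ b + k := by
        simp only [swapIndex]
        split_ifs <;> omega
      rw [h3]
      simp only [bitAt_flipIf, h4, and_false, if_false]

end Triples

end QCrypto

namespace QCrypto

open Function

/-! ### Triples for swaps, controlled swaps and copies -/

section Rules

variable {N q m : ℕ} {O : (Fin q → Bool) → QState m}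

/-- A permutation that preserves the bits outside `A` also preserves every factor independent of
`A`, so only its effect on `α` has to be computed. -/
theorem Permutes.tri {C : List (Op ℕ)} {F : (Fin N → Bool) → Fin N → Bool} {A : Set ℕ}
    {α β : Amp N} (hC : Permutes O N C F) (hv : ∀ g ∈ C, g.Valid N q m)
    (hF : ∀ x, ∀ i < N, i ∉ A → bitAt (F x) i = bitAt x i)
    (h : ∀ x y, α (F x) (F y) = β x y) : Tri O C A α β :=
  ⟨hv, fun r hr => by
    funext x y
    rw [hC]
    simp only [Pi.mul_apply]
    rw [h, hr _ x _ y (hF x) (hF y)]⟩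

/-! ### Swapping blocks -/

theorem valid_swapB {a b k : ℕ} (ha : a + k ≤ N) (hb : b + k ≤ N) (hab : a + k ≤ b ∨ b + k ≤ a) :
    ∀ g ∈ swapB a b k, g.Valid N q m := by
  intro g hg
  simp only [swapB, List.mem_flatMap, List.mem_range, List.mem_cons, List.not_mem_nil, or_false] at hg
  obtain ⟨j, hj, rfl | rfl | rfl⟩ := hg <;> simp only [Op.Valid, Gate.Valid] <;> omega

theorem valid_cswapB {c a b k : ℕ} (hc : c < N) (hca : c < a ∨ a + k ≤ c) (hcb : c < b ∨ b + k ≤ c)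
    (ha : a + k ≤ N) (hb : b + k ≤ N) (hab : a + k ≤ b ∨ b + k ≤ a) :
    ∀ g ∈ cswapB c a b k, g.Valid N q m := by
  intro g hg
  simp only [cswapB, List.mem_flatMap, List.mem_range, List.mem_cons, List.not_mem_nil,
    or_false] at hg
  obtain ⟨j, hj, rfl | rfl | rfl⟩ := hg <;> simp only [Op.Valid, Gate.Valid] <;> omega

theorem valid_copyB {a b k : ℕ} (ha : a + k ≤ N) (hb : b + k ≤ N) (hab : a + k ≤ b ∨ b + k ≤ a) :
    ∀ g ∈ copyB a b k, g.Valid N q m := by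
  intro g hg
  simp only [copyB, List.mem_flatMap, List.mem_range, List.mem_cons, List.not_mem_nil,
    or_false] at hg
  obtain ⟨j, hj, rfl⟩ := hg
  simp only [Op.Valid, Gate.Valid]
  omega

/-- Only the middle one of the three CNOTs of a swap needs the control: if it is not applied, the
outer two cancel. -/
theorem Permutes.cswapB {c a b k : ℕ} (hca : c < a ∨ a + k ≤ c) (hcb : c < b ∨ b + k ≤ c)
    (ha : a + k ≤ N) (hb : b + k ≤ N) (hab : a + k ≤ b ∨ b + k ≤ a) :
    Permutes O N (cswapB c a b k) fun x => moveBits (if bitAt x c then swapIndex a b k else id) x := by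
  induction k with
  | zero =>
    intro ρ x y
    have : ∀ x : Fin N → Bool, moveBits (if bitAt x c then swapIndex a b 0 else id) x = x :=
      fun x => bits_ext fun i hi => by
        rw [bitAt_moveBits _ _ hi]
        split_ifs
        · rw [swapIndex, if_neg (by omega), if_neg (by omega)]
        · rfl
    simp only [this]
    rfl
  | succ k ih =>
    rw [QCrypto.cswapB, List.range_succ, List.flatMap_append, List.flatMap_singleton]
    have h := (ih (by omega) (by omega) (by omega) (by omega) (by omega)).append
      (((Permutes.cnot (O := O) (N := N) (show b + k ≠ a + k by omega)).append
      (Permutes.toffoli (show c ≠ b + k by omega) (show a + k ≠ b + k by omega))).append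
      (Permutes.cnot (show b + k ≠ a + k by omega)))
    intro ρ x y
    refine (h ρ x y).trans ?_
    congr 1 <;>
    · refine bits_ext fun i hi => ?_
      simp only [comp_apply]
      rw [bitAt_moveBits _ _ hi, bitAt_moveBits _ _ hi]
      have h1 : swapIndex a b k (a + k) = a + k := by
        rw [swapIndex, if_neg (by omega), if_neg (by omega)]
      have h2 : swapIndex a b k (b + k) = b + k := by
        rw [swapIndex, if_neg (by omega), if_neg (by omega)]
      have hA : swapIndex a b (k + 1) (a + k) = b + k := by
        rw [swapIndex, if_pos (by omega)]; omega
      have hB : swapIndex a b (k + 1) (b + k) = a + k := by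
        rw [swapIndex, if_neg (by omega), if_pos (by omega)]; omega
      have n1 : a + k ≠ b + k := by omega
      have n2 : b + k ≠ a + k := n1.symm
      have n3 : c ≠ a + k := by omega
      have n4 : c ≠ b + k := by omega
      have l1 : a + k < N := by omega
      have l2 : b + k < N := by omega
      by_cases e1 : i = a + k
      · subst e1
        simp only [bitAt_flipIf, n1, n2, n3, n4, l1, l2, and_true, and_false, if_true, if_false]
        cases bitAt _ c
        · simp [l1]
        · simp only [hA, h1, if_true]
          simp only [bitAt_flipIf, n1, n2, n3, n4, l1, l2, and_true, and_false, if_true, if_false]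
          generalize bitAt _ (a + k) = u
          generalize bitAt _ (b + k) = v
          cases u <;> cases v <;> rfl
      by_cases e2 : i = b + k
      · subst e2
        simp only [bitAt_flipIf, n1, n2, n3, n4, l1, l2, and_true, and_false, if_true, if_false]
        cases bitAt _ c
        · simp only [Bool.false_eq_true, if_false, id, n2, false_and, and_false, Bool.false_and,
            Bool.xor_false, ite_self]
        · simp only [hB, h2, if_true]
          simp only [bitAt_flipIf, n1, n2, n3, n4, l1, l2, and_true, and_false, if_true, if_false]
          generalize bitAt _ (a + k) = u
          generalize bitAt _ (b + k) = v
          cases u <;> cases v <;> rfl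
      have h3 : swapIndex a b (k + 1) i = swapIndex a b k i := by
        simp only [swapIndex]
        split_ifs <;> omega
      have h4 : swapIndex a b k i ≠ a + k ∧ swapIndex a b k i ≠ b + k := by
        simp only [swapIndex]
        split_ifs <;> omega
      simp only [bitAt_flipIf, n3, n4, and_false, if_false]
      cases bitAt _ c
      · simp [bitAt_flipIf, e1, e2]
      · simp [bitAt_flipIf, h3, h4]

theorem block_moveBits {k a b : ℕ} {π : ℕ → ℕ} (x : Fin N → Bool) (ha : a + k ≤ N)
    (hπ : ∀ i < k, π (a + i) = b + i) : block k a (moveBits π x) = block k b x :=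
  bits_ext fun i hi => by
    rw [bitAt_block, bitAt_block, if_pos hi, if_pos hi, bitAt_moveBits _ _ (by omega), hπ i hi]

/-- `γ` is supported on the basis states in which wire `c` has value `u`. -/
def Ctrl (c : ℕ) (u : Bool) (γ : Amp N) : Prop :=
  ∀ x y, γ x y ≠ 0 → bitAt x c = u ∧ bitAt y c = u

theorem Ctrl.blk_basis {k a c : ℕ} (u : Fin k → Bool) (h1 : a ≤ c) (h2 : c < a + k) :
    Ctrl (N := N) c (bitAt u (c - a)) (blk N a (basis u)) := fun x y hxy => by
  simp only [blk, basis, Matrix.single_apply, ne_eq, ite_eq_right_iff, not_forall] at hxy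
  obtain ⟨⟨hx, hy⟩, -⟩ := hxy
  have key : ∀ x : Fin N → Bool, u = block k a x → bitAt x c = bitAt u (c - a) := fun x hx => by
    rw [hx, bitAt_block, if_pos (by omega)]
    congr 1; omega
  exact ⟨key x hx, key y hy⟩

theorem Ctrl.bit (c : ℕ) (u : Bool) : Ctrl (N := N) c u (bit N c u) := by
  have := Ctrl.blk_basis (N := N) (c := c) (fun _ : Fin 1 => u) le_rfl (by omega)
  rwa [Nat.sub_self] at this

theorem Tri.swap {a b k : ℕ} (ha : a + k ≤ N) (hb : b + k ≤ N) (hab : a + k ≤ b ∨ b + k ≤ a)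
    (σ τ : QState k) :
    Tri O (swapB a b k) (Set.Ico a (a + k) ∪ Set.Ico b (b + k)) (blk N a σ * blk N b τ)
      (blk N a τ * blk N b σ) := by
  refine (Permutes.swapB ha hb hab).tri (valid_swapB ha hb hab) (fun x i hi hA => ?_) fun x y => ?_
  · rw [bitAt_moveBits _ _ hi, swapIndex]
    simp only [Set.mem_union, Set.mem_Ico] at hA
    rw [if_neg (by omega), if_neg (by omega)]
  · have h1 : ∀ x : Fin N → Bool, block k a (moveBits (swapIndex a b k) x) = block k b x :=
      fun x => block_moveBits x ha fun i hi => by rw [swapIndex, if_pos (by omega)]; omega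
    have h2 : ∀ x : Fin N → Bool, block k b (moveBits (swapIndex a b k) x) = block k a x :=
      fun x => block_moveBits x hb fun i hi => by
        rw [swapIndex, if_neg (by omega), if_pos (by omega)]; omega
    simp only [Pi.mul_apply, blk, h1, h2, mul_comm]

/-- Wherever `γ` does not vanish, the control bit has the value `u` in the row and in the column
index, so the same permutation acts on both sides and the outcome is definite. -/
theorem Tri.cswap {a b c k : ℕ} {u : Bool} {γ : Amp N} (hc : c < N) (hca : c < a ∨ a + k ≤ c)
    (hcb : c < b ∨ b + k ≤ c) (ha : a + k ≤ N) (hb : b + k ≤ N) (hab : a + k ≤ b ∨ b + k ≤ a)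
    (hγ : Ctrl c u γ) (hi : Indep (Set.Ico a (a + k) ∪ Set.Ico b (b + k)) γ) (σ τ : QState k) :
    Tri O (cswapB c a b k) (Set.Ico a (a + k) ∪ Set.Ico b (b + k)) (γ * (blk N a σ * blk N b τ))
      (γ * (blk N a (if u then τ else σ) * blk N b (if u then σ else τ))) := by
  have hF : ∀ x : Fin N → Bool, ∀ i < N, i ∉ Set.Ico a (a + k) ∪ Set.Ico b (b + k) →
      bitAt (moveBits (if bitAt x c then swapIndex a b k else id) x) i = bitAt x i := by
    intro x i hi hA
    rw [bitAt_moveBits _ _ hi]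
    simp only [Set.mem_union, Set.mem_Ico] at hA
    split_ifs
    · rw [swapIndex, if_neg (by omega), if_neg (by omega)]
    · rfl
  refine (Permutes.cswapB hca hcb ha hb hab).tri (valid_cswapB hc hca hcb ha hb hab) hF
    fun x y => ?_
  simp only [Pi.mul_apply]
  rw [hi _ x _ y (hF x) (hF y)]
  by_cases h0 : γ x y = 0
  · rw [h0, zero_mul, zero_mul]
  obtain ⟨hx, hy⟩ := hγ x y h0
  rw [hx, hy]
  congr 1
  have h1 : ∀ x : Fin N → Bool, block k a (moveBits (swapIndex a b k) x) = block k b x :=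
    fun x => block_moveBits x ha fun i hi => by rw [swapIndex, if_pos (by omega)]; omega
  have h2 : ∀ x : Fin N → Bool, block k b (moveBits (swapIndex a b k) x) = block k a x :=
    fun x => block_moveBits x hb fun i hi => by
      rw [swapIndex, if_neg (by omega), if_pos (by omega)]; omega
  have h3 : ∀ x : Fin N → Bool, moveBits id x = x := fun x => bits_ext fun i hi => by
    rw [bitAt_moveBits _ _ hi]; rfl
  cases u
  · simp only [Bool.false_eq_true, if_false, h3]
  · simp only [if_true, blk, h1, h2, mul_comm]

theorem Permutes.copyB {a b k : ℕ} (hb : b + k ≤ N)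
    (hab : a + k ≤ b ∨ b + k ≤ a) : Permutes O N (copyB a b k) fun x => fun i =>
      if b ≤ (i : ℕ) ∧ (i : ℕ) < b + k then xor (x i) (bitAt x (a + (i - b))) else x i := by
  induction k with
  | zero =>
    intro ρ x y
    have : ∀ x : Fin N → Bool, (fun i : Fin N => if b ≤ (i : ℕ) ∧ (i : ℕ) < b + 0 then
        xor (x i) (bitAt x (a + (i - b))) else x i) = x := fun x => funext fun i => by
      rw [if_neg (by omega)]
    simp only [this]
    rfl
  | succ k ih =>
    rw [QCrypto.copyB, List.range_succ, List.flatMap_append, List.flatMap_singleton]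
    have h := (ih (by omega) (by omega)).append
      (Permutes.cnot (O := O) (N := N) (show a + k ≠ b + k by omega))
    intro ρ x y
    refine (h ρ x y).trans ?_
    congr 1 <;>
    · funext i
      simp only [comp_apply, flipIf, bitAt_flipIf]
      by_cases e : (i : ℕ) = b + k
      · rw [if_neg (by omega), if_pos e, if_pos (by omega)]
        congr 2; omega
      · have h1 : ¬ (a + ((i : ℕ) - b) < N ∧ a + ((i : ℕ) - b) = b + k) ∨ ¬ (b ≤ (i : ℕ) ∧ (i : ℕ) < b + k) := by omega
        have h2 : (b ≤ (i : ℕ) ∧ (i : ℕ) < b + (k + 1)) ↔ b ≤ (i : ℕ) ∧ (i : ℕ) < b + k := by omega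
        rw [if_neg e]
        simp only [h2]
        split_ifs <;> first | rfl | tauto

/-- CNOTs add the source to the target, which amounts to copying only for a basis state; a
superposition would become entangled with its copy. -/
theorem Tri.copy {a b k : ℕ} (ha : a + k ≤ N) (hb : b + k ≤ N) (hab : a + k ≤ b ∨ b + k ≤ a)
    (u : Fin k → Bool) :
    Tri O (copyB a b k) (Set.Ico b (b + k)) (blk N a (basis u) * zero N b k)
      (blk N a (basis u) * blk N b (basis u)) := by
  refine (Permutes.copyB hb hab).tri (valid_copyB ha hb hab) (fun x i hi hA => ?_) fun x y => ?_
  · rw [bitAt_of_lt _ hi, bitAt_of_lt _ hi]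
    simp only
    rw [if_neg (by simpa using hA)]
  · have h1 : ∀ x : Fin N → Bool, block k a (fun i : Fin N =>
        if b ≤ (i : ℕ) ∧ (i : ℕ) < b + k then xor (x i) (bitAt x (a + (i - b))) else x i) =
        block k a x := fun x => bits_ext fun i hi => by
      rw [bitAt_block, bitAt_block, if_pos hi, if_pos hi, bitAt_of_lt _ (by omega),
        bitAt_of_lt x (show a + i < N by omega)]
      exact if_neg (show ¬ (b ≤ a + i ∧ a + i < b + k) by omega)
    have h2 : ∀ x : Fin N → Bool, block k b (fun i : Fin N =>
        if b ≤ (i : ℕ) ∧ (i : ℕ) < b + k then xor (x i) (bitAt x (a + (i - b))) else x i) =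
        fun i => xor (block k b x i) (block k a x i) := fun x => bits_ext fun i hi => by
      rw [bitAt_block, if_pos hi, bitAt_of_lt _ (by omega), bitAt_of_lt _ hi]
      simp only [block]
      rw [if_pos (by omega), bitAt_of_lt x (show b + i < N by omega)]
      congr 2; omega
    have h3 : ∀ x : Fin N → Bool, u = block k a x →
        ((fun _ => false) = (fun i => xor (block k b x i) (block k a x i)) ↔ u = block k b x) := by
      intro x hx
      rw [← hx, funext_iff, funext_iff]
      refine forall_congr' fun i => ?_
      cases u i <;> cases block k b x i <;> decide
    simp only [Pi.mul_apply, zero, blk, basis, Matrix.single_apply, h1, h2]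
    by_cases hu : u = block k a x ∧ u = block k a y
    · rw [if_pos hu, one_mul, one_mul]
      exact if_congr (and_congr (h3 x hu.1) (h3 y hu.2)) rfl rfl
    · rw [if_neg hu, zero_mul, zero_mul]

end Rules

end QCrypto

namespace QCrypto

open Function

/-! ### Partial traces and measurements -/

section Discard

variable {N : ℕ}

/-- Trace out the `k` wires starting at `a`. -/
def discard (a k : ℕ) (α : Amp N) : Amp N := fun x y =>
  ∑ z : Fin k → Bool, α (overwrite a z x) (overwrite a z y)

theorem discard_mul {a k : ℕ} {A : Set ℕ} {r : Amp N} (α : Amp N) (hr : Indep A r)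
    (hA : Set.Ico a (a + k) ⊆ A) : discard a k (α * r) = discard a k α * r := by
  funext x y
  simp only [discard, Pi.mul_apply, Finset.sum_mul]
  refine Finset.sum_congr rfl fun z _ => ?_
  rw [hr.overwrite fun i h1 h2 => hA ⟨h1, h2⟩]

theorem discard_blk {a k : ℕ} (h : a + k ≤ N) (σ : QState k) :
    discard a k (blk N a σ) = σ.trace • 1 := by
  funext x y
  simp only [discard, blk, block_overwrite_self h, Matrix.trace, Matrix.diag, Pi.smul_apply,
    Pi.one_apply, smul_eq_mul, mul_one]

theorem discard_append (a k l : ℕ) (α : Amp N) :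
    discard a (k + l) α = discard (a + k) l (discard a k α) := by
  funext x y
  simp only [discard]
  rw [sum_append, Finset.sum_comm]
  simp only [overwrite_append]

theorem discard_zero (a : ℕ) (α : Amp N) : discard a 0 α = α := by
  funext x y
  have : ∀ (z : Fin 0 → Bool) (x : Fin N → Bool), overwrite a z x = x := fun z x =>
    bits_ext fun i _ => by rw [bitAt_overwrite, if_neg (by omega)]
  simp [discard, this]

theorem indep_discard (a k : ℕ) (α : Amp N) : Indep (Set.Ico a (a + k)) (discard a k α) := by
  intro x x' y y' hx hy
  have key : ∀ (z : Fin k → Bool) (x x' : Fin N → Bool),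
      (∀ i < N, i ∉ Set.Ico a (a + k) → bitAt x i = bitAt x' i) →
      overwrite a z x = overwrite a z x' := fun z x x' h => bits_ext fun i hi => by
    rw [bitAt_overwrite, bitAt_overwrite]
    split_ifs with h1
    · rfl
    · exact h i hi fun h2 => h1 ⟨hi, h2⟩
  refine Finset.sum_congr rfl fun z _ => ?_
  rw [key z x x' hx, key z y y' hy]

theorem Indep.discard {A : Set ℕ} {α : Amp N} (a k : ℕ) (h : Indep A α) :
    Indep A (discard a k α) := by
  intro x x' y y' hx hy
  refine Finset.sum_congr rfl fun z _ => h _ _ _ _ (fun i hi hA => ?_) fun i hi hA => ?_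
  · rw [bitAt_overwrite, bitAt_overwrite, hx i hi hA]
  · rw [bitAt_overwrite, bitAt_overwrite, hy i hi hA]

theorem sum_bits_one {M : Type*} [AddCommMonoid M] (F : (Fin 1 → Bool) → M) :
    ∑ z, F z = F (fun _ => true) + F fun _ => false := by
  rw [← Fintype.sum_bool fun b => F fun _ => b]
  refine Fintype.sum_equiv (Equiv.funUnique (Fin 1) Bool) _ _ fun z => congrArg F (funext fun i => ?_)
  rw [Subsingleton.elim i 0]
  rfl

theorem trace_basis {k : ℕ} (u : Fin k → Bool) : (basis u).trace = 1 := by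
  simp [basis]

/-- The `k` wires starting at `a` have the same value in the row and the column index. -/
def diagB (N a k : ℕ) : Amp N := fun x y => if block k a x = block k a y then 1 else 0

theorem diagB_eq_sum (a k : ℕ) : diagB N a k = ∑ u, blk N a (basis u : QState k) := by
  funext x y
  simp only [diagB, Finset.sum_apply, blk, basis, Matrix.single_apply]
  split_ifs with h
  · rw [h]; simp
  · refine (Finset.sum_eq_zero fun u _ => ?_).symm
    rw [if_neg]
    rintro ⟨rfl, h'⟩
    exact h h'

/-- Multiplication by the indicator of equal row and column bits deletes the off-diagonal blocks,
that is, measures the first `k` wires. The outcome is the sum over all results `u` of `|u⟩⟨u|` with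
the unnormalised remaining state. -/
theorem blk_mul_diagB {k l : ℕ} (a : ℕ) (σ : QState (k + l)) :
    blk N a σ * diagB N a k = ∑ u, blk N a (basis u) * blk N (a + k) (onOutcome σ u) := by
  rw [diagB_eq_sum, Finset.mul_sum]
  refine Finset.sum_congr rfl fun u _ => ?_
  funext x y
  simp only [Pi.mul_apply, blk, basis, Matrix.single_apply, onOutcome, block_append]
  split_ifs with h
  · rw [← h.1, ← h.2, mul_one, one_mul]
  · rw [mul_zero, zero_mul]

theorem diagB_append (a k l : ℕ) : diagB N a (k + l) = diagB N a k * diagB N (a + k) l := by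
  funext x y
  simp only [diagB, block_append, append_inj, Pi.mul_apply]
  by_cases h1 : block k a x = block k a y <;>
    by_cases h2 : block l (a + k) x = block l (a + k) y <;> simp [h1, h2]

theorem diagB_zero (a : ℕ) : diagB N a 0 = 1 := by
  funext x y
  simp only [diagB]
  rw [if_pos (Subsingleton.elim _ _)]
  rfl

theorem Indep.diagB {A : Set ℕ} {a k : ℕ} (h : ∀ i ∈ A, i < a ∨ a + k ≤ i) :
    Indep A (diagB N a k) := by
  rw [diagB_eq_sum]
  intro x x' y y' hx hy
  simp only [Finset.sum_apply]
  exact Finset.sum_congr rfl fun u _ => Indep.blk _ h _ _ _ _ hx hy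

theorem basis_append {k l : ℕ} (u : Fin k → Bool) (v : Fin l → Bool) :
    basis (Fin.append u v) = tens (basis u) (basis v) := by
  ext x y
  have key : ∀ x : Fin (k + l) → Bool, Fin.append u v = x ↔
      u = (fun j => x (Fin.castAdd l j)) ∧ v = fun j => x (Fin.natAdd k j) := fun x => by
    rw [← append_inj, Fin.append_castAdd_natAdd]
  simp only [basis, tens, Matrix.single_apply, key]
  simp only [mul_ite, mul_one, mul_zero, ← ite_and]
  exact if_congr (by tauto) rfl rfl

end Discard

/-! ### Queries, resets and dephasing -/

section Query

variable {N q m : ℕ} {O : (Fin q → Bool) → QState m}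

/-- The previous content of the reply block is traced out, which leaves the scalar `τ.trace`. -/
theorem Tri.query {a b : ℕ} (ha : a + q ≤ N) (hb : b + m ≤ N) (hab : a + q ≤ b ∨ b + m ≤ a)
    (u : Fin q → Bool) (τ : QState m) :
    Tri O [.query a b] (Set.Ico b (b + m)) (blk N a (basis u) * blk N b τ)
      (blk N a (basis u) * (τ.trace • blk N b (O u))) := by
  refine ⟨by simpa [Op.Valid] using ⟨ha, hb, hab⟩, fun r hr => ?_⟩
  rw [exec_cons, exec_nil]
  have h2 : discard b m (blk N a (basis u) * blk N b τ * r) =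
      (τ.trace • 1) * (blk N a (basis u) * r) := by
    rw [← discard_blk hb, ← discard_mul _ ((Indep.blk _ ?_).mul hr) subset_rfl]
    · congr 1; ring
    · intro i hi
      simp only [Set.mem_Ico] at hi
      omega
  funext x y
  have h3 : QCrypto.step O (Op.query a b) (blk N a (basis u) * blk N b τ * r) x y =
      if block q a x = block q a y then O (block q a x) (block m b x) (block m b y) *
        discard b m (blk N a (basis u) * blk N b τ * r) x y else 0 := rfl
  rw [h3, h2]
  simp only [Pi.mul_apply, Pi.smul_apply, blk, basis, Matrix.single_apply, Pi.one_apply,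
    smul_eq_mul]
  by_cases h4 : u = block q a x ∧ u = block q a y
  · rw [if_pos (h4.1.symm.trans h4.2), if_pos h4, ← h4.1]
    ring
  · rw [if_neg h4]
    simp

/-- The oracle that always replies `|0⟩`: a query resets the reply wire. -/
noncomputable def resetOracle : (Fin 0 → Bool) → QState 1 := fun _ => basis fun _ => false

/-- Reset the `k` wires starting at `a`. -/
def resetB (a k : ℕ) : List (Op ℕ) := (List.range k).flatMap fun j => [.query (a + j) (a + j)]

theorem valid_resetB {a k : ℕ} (h : a + k ≤ N) : ∀ g ∈ resetB a k, g.Valid N 0 1 := by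
  intro g hg
  simp only [resetB, List.mem_flatMap, List.mem_range, List.mem_singleton] at hg
  obtain ⟨j, hj, rfl⟩ := hg
  simp only [Op.Valid]
  omega

theorem step_reset (b : ℕ) (α : Amp N) :
    QCrypto.step resetOracle (.query b b) α = zero N b 1 * discard b 1 α := by
  funext x y
  rw [step_query, if_pos (Subsingleton.elim _ _)]
  rfl

/-- Here `α` may be entangled across the block and the other wires: a reset is a partial trace
followed by a fresh preparation, whatever the state. -/
theorem Tri.reset_discard {a k : ℕ} (h : a + k ≤ N) (α : Amp N) :
    Tri resetOracle (resetB a k) (Set.Ico a (a + k)) α (zero N a k * discard a k α) := by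
  refine ⟨valid_resetB h, fun r hr => ?_⟩
  rw [mul_assoc, ← discard_mul α hr subset_rfl]
  -- The factor `r` has been moved under the partial trace, so that it may be taken as a part of
  -- `α`.
  generalize α * r = α
  clear hr
  induction k with
  | zero =>
    rw [zero_zero, discard_zero, one_mul]
    rfl
  | succ k ih =>
    rw [resetB, List.range_succ, List.flatMap_append, List.flatMap_singleton, exec_append]
    rw [show exec resetOracle ((List.range k).flatMap fun j => [Op.query (a + j) (a + j)]) α =
      zero N a k * discard a k α from ih (by omega), exec_cons, exec_nil, step_reset,
      discard_append, QCrypto.zero_add, mul_comm (zero N a k) (discard a k α), discard_mul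
      (A := Set.Ico (a + k) (a + k + 1)) _ (Indep.zero fun i hi => Or.inr hi.1) subset_rfl]
    ring

theorem Tri.reset {a k : ℕ} (h : a + k ≤ N) (σ : QState k) :
    Tri resetOracle (resetB a k) (Set.Ico a (a + k)) (blk N a σ) (σ.trace • zero N a k) := by
  have := Tri.reset_discard h (blk N a σ)
  rwa [discard_blk h, mul_smul_comm, mul_one] at this

/-- Dephase the `k` wires starting at `a`, using the scratch wire `s`. -/
def dephB (a k s : ℕ) : List (Op ℕ) :=
  (List.range k).flatMap fun j => [.gate (.cnot (a + j) s), .query s s]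

/-- The bit on `c` is copied to `s`, and the copy is traced out by the reset; terms whose row and
column differ at `c` are lost. The wire `c` does not count as affected: its state stays in the frame
and merely acquires the factor `diagB N c 1`. -/
theorem Tri.deph_wire {c s : ℕ} (hc : c < N) (hs : s < N) (hcs : c ≠ s) :
    Tri resetOracle [.gate (.cnot c s), .query s s] {s} (zero N s 1)
      (diagB N c 1 * zero N s 1) := by
  have h1 : Tri resetOracle [.gate (.cnot c s)] {s} (zero N s 1)
      fun x y => if bitAt x s = bitAt x c ∧ bitAt y s = bitAt y c then 1 else 0 := by
    refine (Permutes.cnot hcs).tri ?_ (fun x i hi hA => ?_) fun x y => ?_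
    · simp only [List.mem_singleton, forall_eq, Op.Valid, Gate.Valid]
      exact ⟨hc, hs, hcs⟩
    · rw [bitAt_flipIf, if_neg]
      rintro ⟨-, rfl⟩
      exact hA rfl
    · simp only [zero, blk, basis, Matrix.single_apply]
      have key : ∀ x : Fin N → Bool, (fun _ => false) = block 1 s (flipIf (bitAt x c) s x) ↔
          bitAt x s = bitAt x c := fun x => by
        rw [funext_iff, Fin.forall_fin_one]
        simp only [block, Fin.val_zero, add_zero]
        rw [bitAt_flipIf, if_pos ⟨hs, rfl⟩]
        cases bitAt x s <;> cases bitAt x c <;> decide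
      simp only [key]
  refine h1.append (C := [_]) (D := [_]) ?_
  have h2 := Tri.reset_discard (N := N) (a := s) (k := 1) (by omega) fun x y =>
    if bitAt x s = bitAt x c ∧ bitAt y s = bitAt y c then 1 else 0
  have h3 : discard (N := N) s 1 (fun x y =>
      if bitAt x s = bitAt x c ∧ bitAt y s = bitAt y c then 1 else 0) = diagB N c 1 := by
    funext x y
    have e1 : ∀ (z : Fin 1 → Bool) (x : Fin N → Bool), bitAt (overwrite s z x) s = z 0 :=
      fun z x => by
        rw [bitAt_overwrite, if_pos (by omega), Nat.sub_self]
        rfl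
    have e2 : ∀ (z : Fin 1 → Bool) (x : Fin N → Bool), bitAt (overwrite s z x) c = bitAt x c :=
      fun z x => by rw [bitAt_overwrite, if_neg (by omega)]
    have e3 : block 1 c x = block 1 c y ↔ bitAt x c = bitAt y c := by
      rw [funext_iff, Fin.forall_fin_one]
      rfl
    simp only [discard, e1, e2, diagB, e3]
    rw [sum_bits_one]
    cases bitAt x c <;> cases bitAt y c <;> simp
  rw [h3, mul_comm] at h2
  refine Tri.mono (B := {s}) (C := resetB s 1) h2 ?_
  intro i hi
  simp only [Set.mem_Ico] at hi
  simp only [Set.mem_singleton_iff]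
  omega

theorem Tri.deph {a k s : ℕ} (h : a + k ≤ N) (hs : s < N) (has : s < a ∨ a + k ≤ s) :
    Tri resetOracle (dephB a k s) {s} (zero N s 1) (diagB N a k * zero N s 1) := by
  induction k with
  | zero =>
    rw [diagB_zero, one_mul]
    exact Tri.nil _ _
  | succ k ih =>
    rw [dephB, List.range_succ, List.flatMap_append, List.flatMap_singleton]
    refine (ih (by omega) (by omega)).append
      ((Tri.deph_wire (c := a + k) (by omega) hs (by omega)).step (diagB N a k) subset_rfl
        (Indep.diagB ?_) (mul_comm _ _) ?_)
    · rintro i rfl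
      omega
    · rw [diagB_append]
      ring

end Query

end QCrypto

namespace QCrypto

open Function

/-! ### The bit flip and the fair coin -/

section OneQubit

theorem bits_one_ext {x y : Fin 1 → Bool} (h : x 0 = y 0) : x = y :=
  funext fun i => by rw [Subsingleton.elim i 0, h]

theorem inv_sqrt_two_mul : (1 / (Real.sqrt 2 : ℂ)) * star (1 / (Real.sqrt 2 : ℂ)) = 1 / 2 := by
  have h : ((Real.sqrt 2 : ℝ) : ℂ) * ((Real.sqrt 2 : ℝ) : ℂ) = 2 := by
    rw [← Complex.ofReal_mul, Real.mul_self_sqrt (by norm_num)]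
    norm_num
  rw [star_div₀, star_one, show star ((Real.sqrt 2 : ℝ) : ℂ) = _ from Complex.conj_ofReal _,
    div_mul_div_comm, h, one_mul]

theorem hadamard_apply (ρ : QState 1) (x y : Fin 1 → Bool) :
    (Gate.hadamard 0).apply ρ x y = 1 / 2 * ∑ x', ∑ y',
      (if x 0 && x' 0 then -1 else 1) * ρ x' y' * (if y 0 && y' 0 then -1 else 1) := by
  have h1 : ∀ x x' : Fin 1 → Bool, (Gate.hadamard 0).unitary 1 x x' =
      (1 / (Real.sqrt 2 : ℂ)) * if x 0 && x' 0 then -1 else 1 := fun x x' => by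
    simp only [Gate.unitary, Matrix.of_apply, bitAt_of_lt x one_pos, bitAt_of_lt x' one_pos]
    rw [if_pos fun j hj => absurd (by omega) hj]
    simp only [Fin.mk_zero']
    rw [div_mul_eq_mul_div, one_mul]
  have h2 : ∀ b : Bool, star (if b then (-1 : ℂ) else 1) = if b then -1 else 1 := fun b => by
    cases b <;> simp
  rw [Gate.apply_apply]
  simp only [h1, star_mul', h2, Finset.mul_sum, ← inv_sqrt_two_mul]
  refine Finset.sum_congr rfl fun _ _ => Finset.sum_congr rfl fun _ _ => ?_
  ring

theorem tgate_apply (ρ : QState 1) (x y : Fin 1 → Bool) :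
    (Gate.tgate 0).apply ρ x y =
      (if x 0 then Complex.exp (Complex.I * Real.pi / 4) else 1) * ρ x y *
        star (if y 0 then Complex.exp (Complex.I * Real.pi / 4) else 1) := by
  rw [Gate.apply_apply]
  simp only [Gate.unitary, Matrix.diagonal_apply, bitAt_of_lt x one_pos, bitAt_of_lt y one_pos]
  rw [Finset.sum_eq_single x, Finset.sum_eq_single y]
  · simp
  · intro b _ hb
    simp [hb.symm]
  · simp
  · intro b _ hb
    simp [hb.symm]
  · simp

/-- Four `T` gates make a Pauli `Z`, and conjugating it by Hadamard gates gives the bit flip, which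
is not in the gate set. -/
theorem tgate_four (ρ : QState 1) (x y : Fin 1 → Bool) :
    (Gate.tgate 0).apply ((Gate.tgate 0).apply ((Gate.tgate 0).apply ((Gate.tgate 0).apply ρ))) x y =
      (if x 0 then -1 else 1) * ρ x y * (if y 0 then -1 else 1) := by
  have h : Complex.exp (Complex.I * Real.pi / 4) ^ 4 = -1 := by
    rw [← Complex.exp_nat_mul, show ((4 : ℕ) : ℂ) * (Complex.I * Real.pi / 4) = Real.pi * Complex.I by
      push_cast; ring, Complex.exp_pi_mul_I]
  have h' : ∀ b : Bool, (if b then Complex.exp (Complex.I * Real.pi / 4) else 1) ^ 4 =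
      if b then (-1 : ℂ) else 1 := fun b => by cases b <;> simp [h]
  have h2 : ∀ b : Bool, star (if b then (-1 : ℂ) else 1) = if b then -1 else 1 := fun b => by
    cases b <;> simp
  simp only [tgate_apply]
  rw [← h2 (y 0), ← h' (x 0), ← h' (y 0), star_pow]
  ring

variable {N q m : ℕ} {O : (Fin q → Bool) → QState m}

/-- Flip the wire `a`. -/
def flipB (a : ℕ) : List (Op ℕ) :=
  [.gate (.hadamard a), .gate (.tgate a), .gate (.tgate a), .gate (.tgate a), .gate (.tgate a),
    .gate (.hadamard a)]

theorem Tri.flip {a : ℕ} (ha : a < N) (b : Bool) :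
    Tri O (flipB a) {a} (bit N a b) (bit N a !b) := by
  have := Tri.gates (O := O) (N := N) (K := 1) (z := a) (by omega) (L := [.hadamard 0, .tgate 0,
    .tgate 0, .tgate 0, .tgate 0, .hadamard 0]) (by simp [Gate.Valid]) (basis fun _ => b)
  have h : [Gate.hadamard 0, .tgate 0, .tgate 0, .tgate 0, .tgate 0, .hadamard 0].foldl
      (fun (τ : QState 1) g => g.apply τ) (basis fun _ => b) = basis fun _ => !b := by
    ext x y
    have e1 : ∀ (b : Bool) (x : Fin 1 → Bool), (fun _ => b) = x ↔ x 0 = b := fun b x =>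
      ⟨fun h => by rw [← h], fun h => bits_one_ext h.symm⟩
    simp only [List.foldl_cons, List.foldl_nil]
    rw [hadamard_apply]
    simp only [tgate_four, hadamard_apply, sum_bits_one, basis, Matrix.single_apply, e1]
    cases b <;> cases x 0 <;> cases y 0 <;> norm_num
  rw [h] at this
  refine Tri.mono (C := flipB a) this fun i hi => ?_
  simp only [Set.mem_Ico] at hi
  simp only [Set.mem_singleton_iff]
  omega

/-- Put a uniformly random bit on wire `a`, using the scratch wire `s`. -/
def coinB (a s : ℕ) : List (Op ℕ) := .gate (.hadamard a) :: dephB a 1 s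

/-- The Hadamard gate prepares an equal superposition of `|0⟩` and `|1⟩`; dephasing turns it into
the uniform mixture, with weights exactly `1/2`. -/
theorem Tri.coin {a s : ℕ} (ha : a < N) (hs : s < N) (has : s ≠ a) :
    Tri resetOracle (coinB a s) {a, s} (zero N a 1 * zero N s 1)
      ((1 / 2 : ℂ) • (bit N a false + bit N a true) * zero N s 1) := by
  have h1 := Tri.gates (O := resetOracle) (N := N) (K := 1) (z := a) (by omega)
    (L := [.hadamard 0]) (by simp [Gate.Valid]) (basis fun _ => false)
  have hi : Indep {a} (zero N s 1) := Indep.zero fun i hi => by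
    rw [Set.mem_singleton_iff] at hi
    omega
  refine ((h1.mono (B := {a}) ?_).step (zero N s 1) (by simp) hi rfl rfl).append
    ((Tri.deph (k := 1) (by omega) hs (by omega)).step _ (by simp)
    (Indep.blk (k := 1) (a := a) _ ?_) (mul_comm _ _) (β' := _) ?_)
  · intro i hi
    simp only [Set.mem_Ico] at hi
    simp only [Set.mem_singleton_iff]
    omega
  · intro i hi
    rw [Set.mem_singleton_iff] at hi
    omega
  · rw [mul_right_comm]
    congr 1
    funext x y
    have e1 : ∀ (b : Bool) (x : Fin 1 → Bool), (fun _ => b) = x ↔ x 0 = b := fun b x =>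
      ⟨fun h => by rw [← h], fun h => bits_one_ext h.symm⟩
    have e2 : ∀ x y : Fin 1 → Bool, x = y ↔ x 0 = y 0 := fun x y =>
      ⟨fun h => by rw [h], bits_one_ext⟩
    simp only [List.foldl_cons, List.foldl_nil, Pi.mul_apply, blk, hadamard_apply, sum_bits_one,
      basis, Matrix.single_apply, e1, diagB, e2, Pi.smul_apply, Pi.add_apply, bit, smul_eq_mul]
    cases block 1 a x 0 <;> cases block 1 a y 0 <;> norm_num

end OneQubit

/-! ### Running circuits -/

section Call

variable {N : ℕ}

theorem blk_prepare {i o w : ℕ} (a : ℕ) (ρ : QState i) :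
    blk N a (prepare o w ρ) = blk N a ρ * zero N (a + i) (o + w) := by
  rw [prepare, blk_tens, blk_tens, QCrypto.zero_add, ← mul_assoc, ← add_assoc]
  rfl

theorem prepare_eq {i o w : ℕ} (ρ : QState i) :
    (fun x y => prepare o w ρ x y) = blk (i + o + w) 0 ρ * zero (i + o + w) i (o + w) := by
  have := blk_prepare (N := i + o + w) (o := o) (w := w) 0 ρ
  rw [Nat.zero_add] at this
  rw [← this]
  funext x y
  have : ∀ x : Fin (i + o + w) → Bool, block (i + o + w) 0 x = x := fun x =>
    bits_ext fun j hj => by rw [bitAt_block, if_pos hj, Nat.zero_add]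
  rw [blk, this, this]

theorem block_zero_self (x : Fin N → Bool) : block N 0 x = x :=
  bits_ext fun j hj => by rw [bitAt_block, if_pos hj, Nat.zero_add]

theorem block_append_right {k l : ℕ} (u : Fin k → Bool) (v : Fin l → Bool) :
    block l k (Fin.append u v) = v := bits_ext fun j hj => by
  rw [bitAt_block, if_pos hj, bitAt_append, if_neg (by omega)]
  congr 1; omega

theorem readOut_mul {i o w : ℕ} (σ : QState i) (β : QState o) (τ : QState w) :
    readOut (Matrix.of (blk (i + o + w) 0 σ * blk (i + o + w) i β * blk (i + o + w) (i + o) τ)) =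
      (σ.trace * τ.trace) • β := by
  ext u v
  have e1 : ∀ (x : Fin i → Bool) (u : Fin o → Bool) (z : Fin w → Bool),
      block i 0 (Fin.append (Fin.append x u) z) = x := fun x u z => bits_ext fun j hj => by
    rw [bitAt_block, if_pos hj, bitAt_append, if_pos (by omega), bitAt_append, if_pos (by omega),
      Nat.zero_add]
  have e2 : ∀ (x : Fin i → Bool) (u : Fin o → Bool) (z : Fin w → Bool),
      block o i (Fin.append (Fin.append x u) z) = u := fun x u z => bits_ext fun j hj => by
    rw [bitAt_block, if_pos hj, bitAt_append, if_pos (by omega), bitAt_append, if_neg (by omega)]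
    congr 1; omega
  simp only [readOut, Matrix.of_apply, Pi.mul_apply, blk, e1, e2, block_append_right,
    Matrix.smul_apply, smul_eq_mul, Matrix.trace, Matrix.diag, Finset.sum_mul, Finset.mul_sum]
  rw [Finset.sum_comm]
  refine Finset.sum_congr rfl fun _ _ => Finset.sum_congr rfl fun _ _ => by ring

theorem readOut_clean {i o w : ℕ} (β : QState o) :
    readOut (Matrix.of (zero (i + o + w) 0 i * blk (i + o + w) i β * zero (i + o + w) (i + o) w)) =
      β := by
  rw [zero, zero, readOut_mul, trace_basis, trace_basis, mul_one, one_smul]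

theorem OracleQPT.run_eq {q m i o : ℕ → ℕ} (A : OracleQPT q m i o) (n : ℕ)
    (O : (Fin (q n) → Bool) → QState (m n)) (ρ : QState (i n)) :
    A.run n O ρ = readOut (Matrix.of (exec O (A.circ n)
      (blk (i n + o n + A.work n) 0 ρ * zero (i n + o n + A.work n) (i n) (o n + A.work n)))) := by
  rw [OracleQPT.run, foldl_apply_eq_exec, prepare_eq]

/-- Expresses the output of an algorithm that runs somewhere among more wires by partial traces in
place; this links `QPT.run` to the calculus of triples. -/
theorem discard_readOut {i o w : ℕ} (a : ℕ) (h : a + (i + o + w) ≤ N) (τ : QState (i + o + w)) :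
    discard (a + i + o) w (discard a i (blk N a τ)) = blk N (a + i) (readOut τ) := by
  funext x y
  simp only [discard, blk, readOut]
  rw [Finset.sum_comm]
  refine Finset.sum_congr rfl fun z _ => Finset.sum_congr rfl fun u _ => ?_
  have key : ∀ x : Fin N → Bool, block (i + o + w) a (overwrite a z (overwrite (a + i + o) u x)) =
      Fin.append (Fin.append z (block o (a + i) x)) u := fun x => by
    refine bits_ext fun j hj => ?_
    simp only [bitAt_block, bitAt_append, bitAt_overwrite, hj, if_true]
    split_ifs <;> first | rfl | (exfalso; omega) | (congr 1; omega)
  rw [key, key]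

/-- Run the algorithm `A` on the wires starting at `z` (input, output and work wires, in this
order), and reset the input and work wires. -/
def callB {i o : ℕ → ℕ} (A : QPT i o) (n z : ℕ) : List (Op ℕ) :=
  ((A.circ n).map (Gate.map (z + ·))).map .gate ++
    (resetB z (i n) ++ resetB (z + i n + o n) (A.work n))

/-- Running an algorithm leaves garbage on its input and work wires. Resetting them traces the
garbage out, which is just how the output of the algorithm is defined. -/
theorem Tri.call {i o : ℕ → ℕ} (A : QPT i o) (n z : ℕ) (hz : z + (i n + o n + A.work n) ≤ N)
    (σ : QState (i n)) :
    Tri resetOracle (callB A n z) (Set.Ico z (z + (i n + o n + A.work n)))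
      (blk N z σ * zero N (z + i n) (o n + A.work n))
      (zero N z (i n) * blk N (z + i n) (A.run n σ) * zero N (z + i n + o n) (A.work n)) := by
  rw [← blk_prepare]
  refine (Tri.gates hz (A.valid n) _).append ?_
  rw [QPT.run, ← discard_readOut z (by omega)]
  -- The final state of the circuit may be entangled in any way; only its partial trace enters.
  generalize blk N z ((A.circ n).foldl _ _) = α
  refine ((Tri.reset_discard (by omega) α).mono (Set.Ico_subset_Ico le_rfl (by omega))).append
    (((Tri.reset_discard (a := z + i n + o n) (by omega) (discard z (i n) α)).step
      (zero N z (i n)) (Set.Ico_subset_Ico (by omega) (by omega)) (Indep.zero ?_) (mul_comm _ _) ?_))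
  · intro j hj
    simp only [Set.mem_Ico] at hj
    omega
  · ring

end Call

end QCrypto

namespace QCrypto

open Function

/-! ### Uniformity of the basic circuits -/

section Uniformity

variable {a b c k : (ℕ → ℕ) → ℕ}

theorem IsPoly.const (k : ℕ) : IsPoly fun _ => k := ⟨Polynomial.C k, fun n => by simp⟩

theorem IsPoly.add {f g : ℕ → ℕ} (hf : IsPoly f) (hg : IsPoly g) : IsPoly fun n => f n + g n := by
  obtain ⟨p, hp⟩ := hf
  obtain ⟨q, hq⟩ := hg
  exact ⟨p + q, fun n => by simp [hp, hq]⟩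

theorem IsPoly.mul {f g : ℕ → ℕ} (hf : IsPoly f) (hg : IsPoly g) : IsPoly fun n => f n * g n := by
  obtain ⟨p, hp⟩ := hf
  obtain ⟨q, hq⟩ := hg
  exact ⟨p * q, fun n => by simp [hp, hq]⟩

theorem IsPoly.unum {f : ℕ → ℕ} (hf : IsPoly f) : UNum fun e => f (e 0) := UNum.poly hf (UNum.var 0)

namespace UGen

theorem hadamard (ha : UNum a) : UGen fun e => [.gate (.hadamard (a e))] :=
  UGen.op (.gate (.hadamard 0)) ha ha ha

theorem tgate (ha : UNum a) : UGen fun e => [.gate (.tgate (a e))] :=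
  UGen.op (.gate (.tgate 0)) ha ha ha

theorem cnot (ha : UNum a) (hb : UNum b) : UGen fun e => [.gate (.cnot (a e) (b e))] :=
  UGen.op (.gate (.cnot 0 1)) ha hb hb

theorem toffoli (ha : UNum a) (hb : UNum b) (hc : UNum c) :
    UGen fun e => [.gate (.toffoli (a e) (b e) (c e))] :=
  UGen.op (.gate (.toffoli 0 1 2)) ha hb hc

theorem query (ha : UNum a) (hb : UNum b) : UGen fun e => [.query (a e) (b e)] :=
  UGen.op (.query 0 1) ha hb hb

/-- Loops over a fresh variable. -/
theorem range {F : ℕ → ℕ → ℕ → ℕ → List (Op ℕ)} (ha : UNum a) (hb : UNum b) (hc : UNum c)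
    (hk : UNum k)
    (hF : ∀ a b c j : (ℕ → ℕ) → ℕ, UNum a → UNum b → UNum c → UNum j →
      UGen fun e => F (a e) (b e) (c e) (j e)) :
    UGen fun e => (List.range (k e)).flatMap (F (a e) (b e) (c e)) := by
  obtain ⟨d₁, h₁, -⟩ := id ha
  obtain ⟨d₂, h₂, -⟩ := id hb
  obtain ⟨d₃, h₃, -⟩ := id hc
  set v := max d₁ (max d₂ d₃)
  refine (UGen.loop v hk (hF a b c (fun e => e v) ha hb hc (UNum.var v))).of_eq fun e => ?_
  congr 1
  funext j
  have key : ∀ {f : (ℕ → ℕ) → ℕ} {d : ℕ}, DependsBelow d f → d ≤ v → f (update e v j) = f e :=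
    fun h hd => h _ _ fun r hr => update_of_ne (by omega) _ _
  rw [key h₁ (by omega), key h₂ (by omega), key h₃ (by omega), update_self]

/-- Loops over the variable `1`, in circuits that depend on the variable `0`. -/
theorem range_one {F : ℕ → ℕ → List (Op ℕ)} (hk : UNum k) (hF : UGen fun e => F (e 0) (e 1)) :
    UGen fun e => (List.range (k e)).flatMap (F (e 0)) :=
  UGen.loop 1 hk hF

theorem swapB (ha : UNum a) (hb : UNum b) (hk : UNum k) :
    UGen fun e => QCrypto.swapB (a e) (b e) (k e) :=
  UGen.range (F := fun a b _ j => [.gate (.cnot (a + j) (b + j)), .gate (.cnot (b + j) (a + j)),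
    .gate (.cnot (a + j) (b + j))]) ha hb hb hk fun _ _ _ _ ha hb _ hj =>
    (UGen.cnot (ha.add hj) (hb.add hj)).append ((UGen.cnot (hb.add hj) (ha.add hj)).append
      (UGen.cnot (ha.add hj) (hb.add hj)))

theorem cswapB (hc : UNum c) (ha : UNum a) (hb : UNum b) (hk : UNum k) :
    UGen fun e => QCrypto.cswapB (c e) (a e) (b e) (k e) :=
  UGen.range (F := fun c a b j => [.gate (.cnot (b + j) (a + j)),
    .gate (.toffoli c (a + j) (b + j)), .gate (.cnot (b + j) (a + j))]) hc ha hb hk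
    fun _ _ _ _ hc ha hb hj =>
    (UGen.cnot (hb.add hj) (ha.add hj)).append ((UGen.toffoli hc (ha.add hj) (hb.add hj)).append
      (UGen.cnot (hb.add hj) (ha.add hj)))

theorem copyB (ha : UNum a) (hb : UNum b) (hk : UNum k) :
    UGen fun e => QCrypto.copyB (a e) (b e) (k e) :=
  UGen.range (F := fun a b _ j => [.gate (.cnot (a + j) (b + j))]) ha hb hb hk
    fun _ _ _ _ ha hb _ hj => UGen.cnot (ha.add hj) (hb.add hj)

theorem resetB (ha : UNum a) (hk : UNum k) : UGen fun e => QCrypto.resetB (a e) (k e) :=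
  UGen.range (F := fun a _ _ j => [.query (a + j) (a + j)]) ha ha ha hk
    fun _ _ _ _ ha _ _ hj => UGen.query (ha.add hj) (ha.add hj)

theorem dephB (ha : UNum a) (hk : UNum k) (hc : UNum c) :
    UGen fun e => QCrypto.dephB (a e) (k e) (c e) :=
  UGen.range (F := fun a s _ j => [.gate (.cnot (a + j) s), .query s s]) ha hc hc hk
    fun _ _ _ _ ha hs _ hj => (UGen.cnot (ha.add hj) hs).append (UGen.query hs hs)

theorem flipB (ha : UNum a) : UGen fun e => QCrypto.flipB (a e) :=
  (UGen.hadamard ha).append ((UGen.tgate ha).append ((UGen.tgate ha).append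
    ((UGen.tgate ha).append ((UGen.tgate ha).append (UGen.hadamard ha)))))

theorem coinB (ha : UNum a) (hc : UNum c) : UGen fun e => QCrypto.coinB (a e) (c e) :=
  (UGen.hadamard ha).append (UGen.dephB ha (UNum.const 1) hc)

theorem callB {i o : ℕ → ℕ} (hi : IsPoly i) (ho : IsPoly o) (A : QPT i o) (hk : UNum k)
    (ha : UNum a) : UGen fun e => QCrypto.callB A (k e) (a e) := by
  -- There are no queries to replace here: splicing serves to shift the addresses.
  refine UGen.append ((UGen.splice A.uniform hk ha 0 0 0 UGen.nil).of_eq fun e => ?_)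
    ((UGen.resetB ha (UNum.poly hi hk)).append
      (UGen.resetB ((ha.add (UNum.poly hi hk)).add (UNum.poly ho hk)) (UNum.poly A.work_poly hk)))
  exact splice_gates _ _ _ _

end UGen

end Uniformity

/-! ### Elimination of resets -/

section ResetElimination

variable {N q m : ℕ} {O : (Fin q → Bool) → QState m}

theorem Gate.map_zero_add (g : Gate ℕ) : g.map (0 + ·) = g := by
  cases g <;> simp [Gate.map]

theorem step_gate_block {K : ℕ} (hK : K ≤ N) {g : Gate ℕ} (hg : g.Valid K) (α : Amp N)
    (x y : Fin N → Bool) : QCrypto.step O (.gate g) α x y =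
      ∑ u, ∑ v, g.unitary K (block K 0 x) u * α (overwrite 0 u x) (overwrite 0 v y) *
        star (g.unitary K (block K 0 y) v) := by
  have := Gate.apply_shift (z := 0) (N := N) (by omega) hg (Matrix.of α) x y
  rw [Gate.map_zero_add, Gate.apply_apply (N := K)] at this
  exact this

theorem step_gate_mul {K : ℕ} (hK : K ≤ N) {g : Gate ℕ} (hg : g.Valid K) (α r : Amp N)
    (hr : Indep (Set.Ico 0 K) r) :
    QCrypto.step O (.gate g) (α * r) = QCrypto.step O (.gate g) α * r := by
  funext x y
  rw [Pi.mul_apply, Pi.mul_apply, step_gate_block hK hg, step_gate_block hK hg]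
  simp only [Finset.sum_mul, Pi.mul_apply]
  refine Finset.sum_congr rfl fun u _ => Finset.sum_congr rfl fun v _ => ?_
  rw [hr.overwrite fun i h1 h2 => ⟨h1, by omega⟩]
  ring

theorem Indep.step_gate {K : ℕ} (hK : K ≤ N) {g : Gate ℕ} (hg : g.Valid K) {α : Amp N} {A : Set ℕ}
    (hα : Indep A α) (hA : ∀ i ∈ A, K ≤ i) : Indep A (QCrypto.step O (.gate g) α) := by
  intro x x' y y' hx hy
  have key : ∀ x x' : Fin N → Bool, (∀ i < N, i ∉ A → bitAt x i = bitAt x' i) →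
      block K 0 x = block K 0 x' := fun x x' hx => bits_ext fun i hi => by
    rw [bitAt_block, bitAt_block, if_pos hi, if_pos hi]
    exact hx _ (by omega) fun h => by have := hA _ h; omega
  rw [step_gate_block hK hg, step_gate_block hK hg, key x x' hx, key y y' hy]
  refine Finset.sum_congr rfl fun u _ => Finset.sum_congr rfl fun v _ => ?_
  rw [hα (QCrypto.overwrite 0 u x) (QCrypto.overwrite 0 u x') (QCrypto.overwrite 0 v y)
    (QCrypto.overwrite 0 v y')]
  · intro i hi hn
    rw [bitAt_overwrite, bitAt_overwrite, hx i hi hn]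
  · intro i hi hn
    rw [bitAt_overwrite, bitAt_overwrite, hy i hi hn]

theorem overwrite_comm {a b k l : ℕ} (h : a + k ≤ b ∨ b + l ≤ a) (u : Fin k → Bool)
    (v : Fin l → Bool) (x : Fin N → Bool) :
    overwrite a u (overwrite b v x) = overwrite b v (overwrite a u x) := bits_ext fun i _ => by
  simp only [bitAt_overwrite]
  split_ifs <;> first | rfl | (exfalso; omega)

theorem discard_comm {a b k l : ℕ} (h : a + k ≤ b ∨ b + l ≤ a) (α : Amp N) :
    discard a k (discard b l α) = discard b l (discard a k α) := by
  funext x y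
  simp only [discard]
  rw [Finset.sum_comm]
  simp only [overwrite_comm h]

theorem step_gate_discard {K a k : ℕ} (hK : K ≤ a) (hN : a ≤ N) {g : Gate ℕ} (hg : g.Valid K)
    (α : Amp N) :
    QCrypto.step O (.gate g) (discard a k α) = discard a k (QCrypto.step O (.gate g) α) := by
  funext x y
  simp only [discard, step_gate_block (hK.trans hN) hg]
  have key : ∀ (z : Fin k → Bool) (x : Fin N → Bool),
      block K 0 (overwrite a z x) = block K 0 x := fun z x => bits_ext fun i hi => by
    rw [bitAt_block, bitAt_block, if_pos hi, if_pos hi, bitAt_overwrite, if_neg (by omega)]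
  simp only [key]
  symm
  rw [Finset.sum_comm]
  refine Finset.sum_congr rfl fun u _ => ?_
  rw [Finset.sum_comm]
  refine Finset.sum_congr rfl fun v _ => ?_
  rw [Finset.mul_sum, Finset.sum_mul]
  refine Finset.sum_congr rfl fun z _ => ?_
  rw [overwrite_comm (x := x) (by omega), overwrite_comm (x := y) (by omega)]

theorem block_block {K k a : ℕ} (h : a + k ≤ K) (x : Fin N → Bool) :
    block k a (block K 0 x) = block k a x := bits_ext fun i hi => by
  rw [bitAt_block, bitAt_block, bitAt_block, if_pos hi, if_pos hi, if_pos (by omega), Nat.zero_add]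

theorem block_overwrite {K k a : ℕ} (hK : K ≤ N) (z : Fin k → Bool) (x : Fin N → Bool) :
    block K 0 (overwrite a z x) = overwrite a z (block K 0 x) := bits_ext fun i hi => by
  rw [bitAt_block, if_pos hi, Nat.zero_add, bitAt_overwrite, bitAt_overwrite, bitAt_block,
    if_pos hi, Nat.zero_add]
  exact if_congr (by omega) rfl rfl

theorem blk_step {K : ℕ} (hK : K ≤ N) {g : Gate ℕ} (hg : g.Valid K) (β : Amp K) :
    QCrypto.step O (.gate g) (blk N 0 (Matrix.of β)) =
      blk N 0 (Matrix.of (QCrypto.step O (.gate g) β)) := by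
  funext x y
  rw [step_gate_block hK hg]
  simp only [blk, Matrix.of_apply, step_gate, block_overwrite_self (show 0 + K ≤ N by omega)]

theorem zero_eq_blk {K a k : ℕ} (h : a + k ≤ K) : zero N a k = blk N 0 (Matrix.of (zero K a k)) := by
  funext x y
  simp only [zero, blk, Matrix.of_apply, block_block h]

theorem discard_blk_zero {K a k : ℕ} (hK : K ≤ N) (β : Amp K) :
    discard a k (blk N 0 (Matrix.of β)) = blk N 0 (Matrix.of (discard a k β)) := by
  funext x y
  simp only [discard, blk, Matrix.of_apply, block_overwrite hK]

theorem step_reset_blk {K b : ℕ} (a : ℕ) (hK : K ≤ N) (hb : b + 1 ≤ K) (β : Amp K) :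
    zero N b 1 * discard b 1 (blk N 0 (Matrix.of β)) =
      blk N 0 (Matrix.of (QCrypto.step resetOracle (.query a b) β)) := by
  rw [zero_eq_blk hb, discard_blk_zero hK]
  funext x y
  simp only [Pi.mul_apply, blk, Matrix.of_apply, step_query]
  rw [if_pos (Subsingleton.elim _ _)]
  rfl

/-- Swapping a wire with a fresh wire in state `|0⟩`, which is then traced out, resets the wire. -/
theorem discard_swap {b s : ℕ} (hb : b < N) (hs : s < N) (hbs : b ≠ s) {α : Amp N}
    (hα : Indep {s} α) :
    discard s 1 (fun x y => (zero N s 1 * α) (moveBits (swapIndex b s 1) x)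
      (moveBits (swapIndex b s 1) y)) = zero N b 1 * discard b 1 α := by
  funext x y
  have h1 : ∀ x : Fin N → Bool, block 1 s (moveBits (swapIndex b s 1) x) = block 1 b x := fun x =>
    block_moveBits x (by omega) fun i hi => by
      rw [swapIndex, if_neg (by omega), if_pos (by omega)]; omega
  have h2 : ∀ (z : Fin 1 → Bool) (x : Fin N → Bool), block 1 b (overwrite s z x) = block 1 b x :=
    fun z x => bits_ext fun i hi => by
      rw [bitAt_block, bitAt_block, if_pos hi, if_pos hi, bitAt_overwrite, if_neg (by omega)]
  have h3 : ∀ (z : Fin 1 → Bool) (x : Fin N → Bool), ∀ i < N, i ∉ ({s} : Set ℕ) →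
      bitAt (moveBits (swapIndex b s 1) (overwrite s z x)) i = bitAt (overwrite b z x) i := by
    intro z x i hi his
    rw [Set.mem_singleton_iff] at his
    rw [bitAt_moveBits _ _ hi, bitAt_overwrite, bitAt_overwrite, swapIndex]
    split_ifs <;> first | rfl | (exfalso; omega) | (congr 1; omega)
  simp only [discard, Pi.mul_apply, zero, blk, h1, h2, Finset.mul_sum]
  exact Finset.sum_congr rfl fun z _ => congrArg _ (hα _ _ _ _ (h3 z x) (h3 z y))

/-- Replace every reset by a swap with a fresh wire, the first of which is `K`. -/
theorem discard_exec_splice {K T : ℕ} (hN : K + T ≤ N) (L : List (Op ℕ))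
    (hL : ∀ g ∈ L, g.Valid K 0 1) (c : ℕ) (hc : c + queries L ≤ T) (α : Amp N)
    (hα : Indep (Set.Ico (K + c) (K + T)) α) (β : Amp K)
    (h : discard K T (zero N (K + c) (T - c) * α) = blk N 0 (Matrix.of β)) :
    discard K T (exec O (splice (fun _ b c => swapB b (K + c) 1) 0 c L)
      (zero N (K + c) (T - c) * α)) = blk N 0 (Matrix.of (exec resetOracle L β)) := by
  -- Invariant: the fresh wires from `K + c` on are in state `|0⟩` and split off. The used ones may
  -- be entangled with everything else, but tracing out all `T` extra wires leaves the state `β` of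
  -- the circuit with resets.
  induction L generalizing c α β with
  | nil => exact h
  | cons g L ih =>
    have hL' : ∀ g ∈ L, g.Valid K 0 1 := fun g' hg' => hL g' (List.mem_cons_of_mem _ hg')
    have hg := hL g List.mem_cons_self
    cases g with
    | gate g =>
      replace hg : g.Valid K := hg
      rw [splice, exec_cons, exec_cons, Gate.map_zero_add, mul_comm,
        step_gate_mul (show K ≤ N by omega) hg _ _ (Indep.zero fun i hi => Or.inl (by
          have := hi.2; omega)), mul_comm]
      refine ih hL' c hc _ (hα.step_gate (by omega) hg fun i hi => ?_) _ ?_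
      · have := hi.1; omega
      · rw [← blk_step (by omega) hg, ← h, step_gate_discard le_rfl (by omega) hg, mul_comm,
          ← step_gate_mul (show K ≤ N by omega) hg _ _ (Indep.zero fun i hi => Or.inl (by
          have := hi.2; omega)), mul_comm]
        rfl
    | query a b =>
      obtain ⟨-, hb, -⟩ : a + 0 ≤ K ∧ b + 1 ≤ K ∧ _ := hg
      rw [queries] at hc
      obtain ⟨r, hr⟩ : ∃ r, T = c + 1 + r := ⟨T - c - 1, by omega⟩
      have hTc : T - c = 1 + r := by omega
      have hTc' : T - (c + 1) = r := by omega
      set F := moveBits (N := N) (swapIndex b (K + c) 1) with hF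
      have hout : ∀ x, ∀ i < N, i ≠ b → i ≠ K + c → bitAt (F x) i = bitAt x i := by
        intro x i hi h1 h2
        rw [hF, bitAt_moveBits _ _ hi, swapIndex, if_neg (by omega), if_neg (by omega)]
      set α₂ : Amp N := fun x y => (zero N (K + c) 1 * α) (F x) (F y) with hα₂
      have hZ : Indep {b, K + c} (zero N (K + c + 1) r) := Indep.zero fun i hi => by
        simp only [Set.mem_insert_iff, Set.mem_singleton_iff] at hi
        omega
      have e1 : exec O (swapB b (K + c) 1) (zero N (K + c) (T - c) * α) =
          zero N (K + (c + 1)) (T - (c + 1)) * α₂ := by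
        funext x y
        rw [Permutes.swapB (by omega) (by omega) (by omega), hTc, QCrypto.zero_add, hTc',
          ← add_assoc, mul_right_comm, mul_comm]
        refine congrArg (· * _) (hZ (F x) x (F y) y (fun i hi hn => ?_) fun i hi hn => ?_) <;>
        · simp only [Set.mem_insert_iff, Set.mem_singleton_iff, not_or] at hn
          exact hout _ i hi hn.1 hn.2
      rw [splice, exec_append, exec_cons, e1]
      refine ih hL' (c + 1) (by omega) α₂ ?_ _ ?_
      · have h1 : Indep (Set.Ico (K + (c + 1)) (K + T)) (zero N (K + c) 1 * α) :=
          (Indep.zero fun i hi => by have := hi.1; omega).mul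
            (hα.mono (Set.Ico_subset_Ico (by omega) le_rfl))
        have key : ∀ x x' : Fin N → Bool, (∀ i < N, i ∉ Set.Ico (K + (c + 1)) (K + T) →
            bitAt x i = bitAt x' i) → ∀ i < N, i ∉ Set.Ico (K + (c + 1)) (K + T) →
            bitAt (F x) i = bitAt (F x') i := by
          intro x x' hx i hi hn
          rw [hF, bitAt_moveBits _ _ hi, bitAt_moveBits _ _ hi]
          simp only [Set.mem_Ico] at hn hx
          rw [swapIndex]
          split_ifs <;> refine hx _ (by omega) (by omega)
        exact fun x x' y y' hx hy => h1 _ _ _ _ (key x x' hx) (key y y' hy)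
      · have hαs : Indep {K + c} α := hα.mono fun i hi => by
          rw [Set.mem_singleton_iff] at hi
          simp only [Set.mem_Ico]
          omega
        have hZs : Indep {K + c} (zero N (K + c + 1) r) := hZ.mono (by simp)
        have hIco : Set.Ico (K + c) (K + c + 1) ⊆ ({K + c} : Set ℕ) := fun i hi => by
          simp only [Set.mem_Ico] at hi
          simp only [Set.mem_singleton_iff]
          omega
        have hD : ∀ γ : Amp N, discard K T γ =
            discard (K + c + 1) r (discard K c (discard (K + c) 1 γ)) := fun γ => by
          rw [hr, discard_append, discard_append, discard_comm (a := K + c) (b := K) (by omega)]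
          rfl
        have hb1 : Set.Ico b (b + 1) ⊆ ({b} : Set ℕ) := fun i hi => by
          simp only [Set.mem_Ico] at hi
          simp only [Set.mem_singleton_iff]
          omega
        -- Tracing out the wire that has just been swapped in turns the swap into a reset of `b`.
        -- The other extra wires are traced out afterwards, as partial traces on disjoint wires
        -- commute.
        have e2 : discard (K + c) 1 (zero N (K + (c + 1)) (T - (c + 1)) * α₂) =
            zero N b 1 * discard b 1 (α * zero N (K + c + 1) r) := by
          rw [hTc', ← add_assoc, mul_comm, discard_mul _ hZs hIco, hα₂,
            discard_swap (by omega) (by omega) (by omega) hαs, mul_assoc,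
            discard_mul (A := {b}) α (hZ.mono (by simp)) hb1]
        have e3 : discard (K + c) 1 (zero N (K + c) (T - c) * α) = α * zero N (K + c + 1) r := by
          rw [hTc, QCrypto.zero_add, mul_assoc, discard_mul _ (hZs.mul hαs) hIco, zero,
            discard_blk (by omega), trace_basis, one_smul, one_mul, mul_comm]
        rw [← step_reset_blk a (by omega) hb, ← h, hD, hD, e2, e3, mul_comm, mul_comm (zero N b 1),
          discard_mul (A := Set.Ico K (K + c)) _ (Indep.zero fun i hi => Or.inr (by
            have := hi.1; omega)) subset_rfl,
          discard_mul (A := Set.Ico (K + c + 1) (K + c + 1 + r)) _ (Indep.zero fun i hi => Or.inr (by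
            have := hi.1; omega)) subset_rfl,
          discard_comm (a := b) (b := K + c + 1) (by omega),
          discard_comm (a := b) (b := K) (by omega)]

theorem QPT.run_eq {i o : ℕ → ℕ} (A : QPT i o) (n : ℕ) (ρ : QState (i n)) :
    A.run n ρ = readOut (Matrix.of (exec O ((A.circ n).map .gate)
      (blk (i n + o n + A.work n) 0 ρ * zero (i n + o n + A.work n) (i n) (o n + A.work n)))) := by
  rw [← prepare_eq, ← foldl_apply_eq_exec, List.foldl_map]
  rfl

theorem exists_map_gate {L : List (Op ℕ)} (h : queries L = 0) : ∃ G : List (Gate ℕ), G.map .gate = L := by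
  induction L with
  | nil => exact ⟨[], rfl⟩
  | cons g L ih =>
    cases g with
    | gate g =>
      obtain ⟨G, hG⟩ := ih h
      exact ⟨g :: G, by rw [List.map_cons, hG]⟩
    | query a b => simp [queries] at h

theorem blk_injective {a k : ℕ} (h : a + k ≤ N) {σ τ : QState k} (hst : blk N a σ = blk N a τ) :
    σ = τ := by
  ext u v
  have := congrFun (congrFun hst (overwrite a u fun _ => false)) (overwrite a v fun _ => false)
  simpa only [blk, block_overwrite_self h] using this

theorem blk_zero_self (α : Amp N) : blk N 0 (Matrix.of α) = α := by
  funext x y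
  simp only [blk, block_zero_self, Matrix.of_apply]

theorem queries_eq_zero {L : List (Op ℕ)} (h : ∀ a b, Op.query a b ∉ L) : queries L = 0 := by
  induction L with
  | nil => rfl
  | cons g L ih =>
    cases g with
    | gate g => exact ih fun a b hab => h a b (List.mem_cons_of_mem _ hab)
    | query a b => exact absurd List.mem_cons_self (h a b)

theorem queries_swapB (a b k : ℕ) : queries (swapB a b k) = 0 :=
  queries_eq_zero fun a' b' h => by simp [swapB] at h

theorem queries_splice {h : ℕ → ℕ → ℕ → List (Op ℕ)} (hh : ∀ a b c, queries (h a b c) = 0)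
    (z c : ℕ) (L : List (Op ℕ)) : queries (splice h z c L) = 0 := by
  induction L generalizing c with
  | nil => rfl
  | cons g L ih =>
    cases g with
    | gate g => exact ih c
    | query a b => rw [splice, queries_append, hh, ih]

theorem Gate.Valid.shift {K z : ℕ} {g : Gate ℕ} (hg : g.Valid K) (hz : z + K ≤ N) :
    (g.map (z + ·)).Valid N := by
  cases g <;> simp only [Gate.Valid, Gate.map] at hg ⊢ <;> omega

theorem valid_splice {K z c q' m' : ℕ} {h : ℕ → ℕ → ℕ → List (Op ℕ)} {L : List (Op ℕ)}
    (hz : z + K ≤ N) (hL : ∀ g ∈ L, g.Valid K q m)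
    (hh : ∀ a b c', Op.Valid K q m (.query a b) → c ≤ c' → c' < c + queries L →
      ∀ g ∈ h a b c', g.Valid N q' m') : ∀ g ∈ splice h z c L, g.Valid N q' m' := by
  induction L generalizing c with
  | nil => simp [splice]
  | cons g L ih =>
    have hL' : ∀ g ∈ L, g.Valid K q m := fun g' hg' => hL g' (List.mem_cons_of_mem _ hg')
    have hg := hL g List.mem_cons_self
    cases g with
    | gate g =>
      intro g' hg'
      rcases List.mem_cons.1 hg' with rfl | hg'
      · exact Gate.Valid.shift (g := g) hg hz
      · exact ih hL' hh g' hg'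
    | query a b =>
      intro g' hg'
      rcases List.mem_append.1 hg' with hg' | hg'
      · exact hh a b c hg le_rfl (by rw [queries]; omega) g' hg'
      · exact ih hL' (fun a b c' h1 h2 h3 => hh a b c' h1 (by omega) (by rw [queries]; omega)) g' hg'

/-- Resets can be eliminated. -/
theorem OracleQPT.exists_qpt {i o : ℕ → ℕ} (hi : IsPoly i) (ho : IsPoly o)
    (A : OracleQPT (fun _ => 0) (fun _ => 1) i o) :
    ∃ B : QPT i o, ∀ n ρ, B.run n ρ = A.run n resetOracle ρ := by
  obtain ⟨P, p, hP⟩ := A.uniform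
  -- Each printed operation costs a step, so the running time bounds the number of resets and
  -- thereby the number of fresh wires.
  have hT : ∀ n, queries (A.circ n) ≤ p.eval n := fun n => by
    obtain ⟨σ, k, h1, h2⟩ := hP n
    exact (queries_le_length _).trans (h1.length_le.trans h2)
  set K : ℕ → ℕ := fun n => i n + o n + A.work n with hK
  have hKn : ∀ n, K n = i n + o n + A.work n := fun _ => rfl
  have hKp : IsPoly K := (hi.add ho).add A.work_poly
  set C : ℕ → List (Op ℕ) := fun n => splice (fun _ b c => swapB b (K n + c) 1) 0 0 (A.circ n)
    with hC
  have hq : ∀ n, queries (C n) = 0 := fun n => queries_splice (fun _ _ _ => queries_swapB _ _ _) _ _ _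
  have hu : Uniform C := UGen.uniform ((UGen.splice A.uniform (UNum.var 0) (UNum.const 0) 1 2 3
    (seg := fun e => swapB (e 2) (K (e 0) + e 3) 1) (UGen.swapB (UNum.var 2)
      (hKp.unum.add (UNum.var 3)) (UNum.const 1))).of_eq fun e => rfl)
  choose G hG using fun n => exists_map_gate (hq n)
  have hv : ∀ n, ∀ g ∈ C n, g.Valid (i n + o n + (A.work n + p.eval n)) 0 1 := fun n =>
    valid_splice (K := K n) (by have := hKn n; omega) (A.valid n) fun a b c hab _ hc => by
      have := hT n
      have := hKn n
      change a + 0 ≤ K n ∧ b + 1 ≤ K n ∧ _ at hab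
      exact valid_swapB (by omega) (by omega) (by omega)
  refine ⟨⟨fun n => A.work n + p.eval n, A.work_poly.add ⟨p, fun _ => rfl⟩, G, fun n g hg => ?_, ?_⟩,
    fun n ρ => ?_⟩
  · exact hv n (.gate g) (by rw [← hG]; exact List.mem_map_of_mem hg)
  · simpa only [hG] using hu
  · rw [QPT.run_eq (O := resetOracle), OracleQPT.run_eq]
    simp only [hG]
    set w := A.work n
    set T := p.eval n with hTn
    set N := i n + o n + (w + T) with hN
    have hKN : K n + T = N := by rw [hN, hK]; ring
    set β : Amp (K n) := blk (K n) 0 ρ * zero (K n) (i n) (o n + w) with hβ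
    have hstart : (blk N 0 ρ * zero N (i n) (o n + (w + T)) : Amp N) =
        zero N (K n + 0) (T - 0) * blk N 0 (Matrix.of β) := by
      have : (blk N 0 (Matrix.of β) : Amp N) = blk N 0 ρ * zero N (i n) (o n + w) := by
        funext x y
        simp only [hβ, blk, Matrix.of_apply, Pi.mul_apply, zero]
        rw [block_block (by omega), block_block (by omega), block_block (by omega),
          block_block (by omega)]
      rw [this, ← add_assoc (o n), QCrypto.zero_add, Nat.sub_zero, Nat.add_zero, ← add_assoc (i n)]
      ring
    have key := discard_exec_splice (O := resetOracle) (N := N) (K := K n) (T := T) (by omega)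
      (A.circ n) (A.valid n) 0 (by have := hT n; omega) (blk N 0 (Matrix.of β))
      (Indep.blk _ fun j hj => by have := hj.1; omega) β (by
        rw [discard_mul _ (Indep.blk _ fun j hj => by have := hj.1; omega) subset_rfl, zero,
          Nat.sub_zero, Nat.add_zero, discard_blk (by omega), trace_basis, one_smul, one_mul])
    rw [hstart]
    have h1 := discard_readOut (N := N) (i := i n) (o := o n) (w := w + T) 0 (by omega)
      (Matrix.of (exec resetOracle (C n) (zero N (K n + 0) (T - 0) * blk N 0 (Matrix.of β))))
    have h2 := discard_readOut (N := N) (i := i n) (o := o n) (w := w) 0 (by omega)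
      (Matrix.of (exec resetOracle (A.circ n) β))
    refine blk_injective (N := N) (a := 0 + i n) (by omega) (h1.symm.trans (Eq.trans ?_ h2))
    rw [blk_zero_self, ← key, discard_append,
      discard_comm (a := 0 + i n + o n + w) (b := 0 + i n + o n) (by omega),
      discard_comm (a := 0 + i n + o n + w) (b := 0) (by omega)]
    congr 4
    omega

end ResetElimination

end QCrypto

namespace QCrypto

open Function

/-! ### Channels preserve positivity and the trace -/

section Positivity

open scoped ComplexOrder

variable {N : ℕ}

theorem posSemidef_tens {m n : ℕ} {ρ : QState m} {σ : QState n} (hρ : ρ.PosSemidef)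
    (hσ : σ.PosSemidef) : (tens ρ σ).PosSemidef :=
  (hρ.kronecker hσ).submatrix fun x : Fin (m + n) → Bool =>
    (fun j => x (Fin.castAdd n j), fun j => x (Fin.natAdd m j))

theorem posSemidef_basis {n : ℕ} (x : Fin n → Bool) : (basis x).PosSemidef := by
  have : basis x = Matrix.diagonal (Pi.single x 1) := by
    ext u v
    simp only [basis, Matrix.single_apply, Matrix.diagonal_apply, Pi.single_apply]
    by_cases h : u = v
    · subst h
      simp [eq_comm]
    · rw [if_neg h, if_neg]
      rintro ⟨rfl, rfl⟩
      exact h rfl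
  rw [this]
  refine Matrix.PosSemidef.diagonal fun u => ?_
  by_cases h : u = x
  · subst h; simp
  · simp [h]

theorem trace_tens {m n : ℕ} (ρ : QState m) (σ : QState n) :
    (tens ρ σ).trace = ρ.trace * σ.trace := by
  simp only [Matrix.trace, Matrix.diag, sum_append, Finset.sum_mul_sum, tens, Fin.append_left,
    Fin.append_right]

theorem posSemidef_readOut {i o w : ℕ} {τ : QState (i + o + w)} (h : τ.PosSemidef) :
    (readOut τ).PosSemidef := by
  have : readOut τ = ∑ x : Fin i → Bool, ∑ z : Fin w → Bool,
      τ.submatrix (fun u : Fin o → Bool => Fin.append (Fin.append x u) z)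
        fun u => Fin.append (Fin.append x u) z := by
    ext u v
    simp only [Matrix.sum_apply]
    rfl
  rw [this]
  exact Matrix.posSemidef_sum _ fun x _ => Matrix.posSemidef_sum _ fun z _ => h.submatrix _

theorem trace_readOut {i o w : ℕ} (τ : QState (i + o + w)) : (readOut τ).trace = τ.trace := by
  simp only [Matrix.trace, Matrix.diag, readOut, sum_append]
  rw [Finset.sum_comm]

theorem trace_gate_apply {g : Gate ℕ} (hg : (g.unitary N).conjTranspose * g.unitary N = 1)
    (ρ : QState N) : (g.apply ρ).trace = ρ.trace := by
  rw [Gate.apply, Matrix.trace_mul_cycle, hg, Matrix.one_mul]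

theorem Gate.unitary_perm {g : Gate ℕ} {F : (Fin N → Bool) → Fin N → Bool}
    (h : ∀ x x', g.unitary N x x' = if x = F x' then 1 else 0) (hF : ∀ x, F (F x) = x) :
    (g.unitary N).conjTranspose * g.unitary N = 1 := by
  ext x y
  have hinj : F x = F y ↔ x = y := (show Involutive F from hF).injective.eq_iff
  simp only [Matrix.mul_apply, Matrix.conjTranspose_apply, h, Matrix.one_apply]
  rw [Finset.sum_eq_single (F x)]
  · simp [hinj]
  · intro z _ hz
    simp [hz]
  · simp

/-- Distinctness of the wires matters: with equal control and target the matrix of a CNOT would not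
be a permutation matrix. The gates other than `T` are involutions; the Hadamard gate is reduced to
its 2×2 matrix. -/
theorem Gate.conjTranspose_unitary_mul {g : Gate ℕ} (hg : g.Valid N) :
    (g.unitary N).conjTranspose * g.unitary N = 1 := by
  cases g with
  | hadamard i =>
    have hi : i < N := hg
    ext x y
    -- The product of two Hadamard matrices on `N` wires is supported on pairs that agree outside
    -- wire `i`, and there it is the product of the one-wire matrices.
    have hshift := Gate.unitary_shift (N := N) (K := 1) (z := i) (by omega) (g := .hadamard 0)
      (by simp [Gate.Valid])
    simp only [Gate.map, add_zero] at hshift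
    have hs : ∀ x y : Fin N → Bool, star ((Gate.hadamard i).unitary N x y) =
        (Gate.hadamard i).unitary N y x := fun x y => by
      simp only [Gate.unitary, Matrix.of_apply]
      have e : (∀ j : Fin N, (j : ℕ) ≠ i → x j = y j) ↔ ∀ j : Fin N, (j : ℕ) ≠ i → y j = x j :=
        forall₂_congr fun _ _ => eq_comm
      have e' : star (1 / (Real.sqrt 2 : ℂ)) = 1 / (Real.sqrt 2 : ℂ) := by
        rw [star_div₀, star_one, show star ((Real.sqrt 2 : ℝ) : ℂ) = _ from Complex.conj_ofReal _]
      simp only [e]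
      split_ifs with h1 h2 h3 h3
      · rw [neg_div, star_neg, e']
      · rw [Bool.and_comm] at h3; exact absurd h2 h3
      · rw [Bool.and_comm] at h3; exact absurd h3 h2
      · exact e'
      · exact star_zero _
    simp only [Matrix.mul_apply, Matrix.conjTranspose_apply, hs]
    have e1 : ∀ x' : Fin N → Bool, (Gate.hadamard i).unitary N x x' *
        (Gate.hadamard i).unitary N x' y = if x' = overwrite i (block 1 i x') x then
        (Gate.hadamard 0).unitary 1 (block 1 i x) (block 1 i x') *
        (Gate.hadamard i).unitary N x' y else 0 := fun x' => by
      rw [hshift x x']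
      split_ifs
      · rfl
      · rw [zero_mul]
    simp only [e1]
    have := sum_overwrite (N := N) (K := 1) (z := i) (by omega) x fun x' =>
      (Gate.hadamard 0).unitary 1 (block 1 i x) (block 1 i x') * (Gate.hadamard i).unitary N x' y
    rw [this]
    simp only [hshift, block_overwrite_self (show i + 1 ≤ N by omega), overwrite_overwrite]
    have e2 : ∀ u v : Fin 1 → Bool, ∑ z, (Gate.hadamard 0).unitary 1 u z *
        (Gate.hadamard 0).unitary 1 z v = if u = v then 1 else 0 := by
      intro u v
      have h0 : ∀ u v : Fin 1 → Bool, (Gate.hadamard 0).unitary 1 u v =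
          (1 / (Real.sqrt 2 : ℂ)) * if u 0 && v 0 then -1 else 1 := fun u v => by
        simp only [Gate.unitary, Matrix.of_apply, bitAt_of_lt u one_pos, bitAt_of_lt v one_pos]
        rw [if_pos fun j hj => absurd (by omega) hj]
        simp only [Fin.mk_zero']
        rw [div_mul_eq_mul_div, one_mul]
      have h2 : (1 / (Real.sqrt 2 : ℂ)) * (1 / (Real.sqrt 2 : ℂ)) = 1 / 2 := by
        rw [← inv_sqrt_two_mul, star_div₀, star_one,
          show star ((Real.sqrt 2 : ℝ) : ℂ) = _ from Complex.conj_ofReal _]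
      have e : u = v ↔ u 0 = v 0 := ⟨fun h => by rw [h], bits_one_ext⟩
      simp only [h0, sum_bits_one, e, mul_mul_mul_comm _ _ (1 / (Real.sqrt 2 : ℂ)), h2]
      cases u 0 <;> cases v 0 <;> norm_num
    by_cases hxy : y = overwrite i (block 1 i y) x
    · simp only [← hxy, if_true]
      rw [e2, Matrix.one_apply]
      refine if_congr ⟨fun h => ?_, fun h => by rw [h]⟩ rfl rfl
      rw [hxy, ← h, overwrite_block]
    · simp only [hxy, if_false, mul_zero, Finset.sum_const_zero]
      rw [Matrix.one_apply, if_neg]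
      rintro rfl
      exact hxy (overwrite_block i x).symm
  | tgate i =>
    simp only [Gate.unitary, Matrix.diagonal_conjTranspose, Matrix.diagonal_mul_diagonal]
    rw [← Matrix.diagonal_one]
    congr 1
    funext x
    simp only [Pi.star_apply]
    split_ifs
    · rw [show star (Complex.exp (Complex.I * Real.pi / 4)) = _ from (Complex.exp_conj _).symm,
        ← Complex.exp_add]
      simp only [map_div₀, map_mul, Complex.conj_I, Complex.conj_ofReal, map_ofNat]
      rw [← Complex.exp_zero]
      congr 1
      ring
    · simp
  | cnot c t =>
    obtain ⟨-, -, hct⟩ := hg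
    exact Gate.unitary_perm (F := fun x => flipIf (bitAt x c) t x) (fun _ _ => rfl) fun x =>
      bits_ext fun i hi => by
        simp only [bitAt_flipIf]
        rw [if_neg (show ¬ (c < N ∧ c = t) by tauto)]
        split_ifs <;> simp
  | toffoli a b t =>
    obtain ⟨-, -, -, -, hat, hbt⟩ := hg
    exact Gate.unitary_perm (F := fun x => flipIf (bitAt x a && bitAt x b) t x) (fun _ _ => rfl)
      fun x => bits_ext fun i hi => by
        simp only [bitAt_flipIf]
        rw [if_neg (show ¬ (a < N ∧ a = t) by tauto), if_neg (show ¬ (b < N ∧ b = t) by tauto)]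
        split_ifs <;> simp

variable {i o : ℕ → ℕ}

theorem QPT.posSemidef_run (A : QPT i o) (n : ℕ) {ρ : QState (i n)} (h : ρ.PosSemidef) :
    (A.run n ρ).PosSemidef := by
  refine posSemidef_readOut ?_
  have h0 : (prepare (o n) (A.work n) ρ).PosSemidef :=
    posSemidef_tens (posSemidef_tens h (posSemidef_basis _)) (posSemidef_basis _)
  revert h0
  generalize prepare (o n) (A.work n) ρ = τ
  intro h0
  induction A.circ n generalizing τ with
  | nil => exact h0
  | cons g L ih => exact ih _ (h0.mul_mul_conjTranspose_same _)

theorem QPT.trace_run (A : QPT i o) (n : ℕ) (ρ : QState (i n)) :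
    (A.run n ρ).trace = ρ.trace := by
  rw [QPT.run, trace_readOut]
  have h0 : (prepare (o n) (A.work n) ρ).trace = ρ.trace := by
    simp only [prepare, trace_tens, trace_basis, mul_one]
  rw [← h0]
  generalize prepare (o n) (A.work n) ρ = τ
  have hv := A.valid n
  revert hv
  generalize A.circ n = L
  intro hv
  induction L generalizing τ with
  | nil => rfl
  | cons g L ih =>
    rw [List.foldl_cons, ih _ fun g hg => hv g (List.mem_cons_of_mem _ hg),
      trace_gate_apply (Gate.conjTranspose_unitary_mul (hv g List.mem_cons_self))]

theorem prob_nonneg {n : ℕ} {ρ : QState n} (h : ρ.PosSemidef) (x : Fin n → Bool) : 0 ≤ prob ρ x :=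
  (Complex.le_def.1 h.diag_nonneg).1

theorem sum_prob {n : ℕ} (ρ : QState n) : ∑ x, prob ρ x = ρ.trace.re := by
  simp only [prob, Matrix.trace, Matrix.diag, Complex.re_sum]

end Positivity

end QCrypto

namespace QCrypto

open Function

/-! ### Algorithms as subroutines -/

section Apply

variable {N : ℕ}

/-- A circuit with resets yields a QPT algorithm. -/
theorem exists_qpt_of_circuit {i o w : ℕ → ℕ} (hi : IsPoly i) (ho : IsPoly o) (hw : IsPoly w)
    (C : ℕ → List (Op ℕ)) (hC : UGen fun e => C (e 0))
    (hv : ∀ n, ∀ g ∈ C n, g.Valid (i n + o n + w n) 0 1) :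
    ∃ A : QPT i o, ∀ (n : ℕ) (ρ : QState (i n)) (β : QState (o n)),
      exec resetOracle (C n) (blk (i n + o n + w n) 0 ρ *
        zero (i n + o n + w n) (i n) (o n + w n)) = zero (i n + o n + w n) 0 (i n) *
        blk (i n + o n + w n) (i n) β * zero (i n + o n + w n) (i n + o n) (w n) →
      A.run n ρ = β := by
  obtain ⟨A, hA⟩ := OracleQPT.exists_qpt hi ho ⟨w, hw, C, hv, hC.uniform⟩
  refine ⟨A, fun n ρ β h => ?_⟩
  rw [hA, OracleQPT.run_eq]
  exact (congrArg (fun α => readOut (Matrix.of α)) h).trans (readOut_clean β)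

/-- Apply the algorithm `A` to the block at `a`, with the result on the block at `b`, using
the scratch zone at `z`. -/
def applyB {i o : ℕ → ℕ} (A : QPT i o) (n a b z : ℕ) : List (Op ℕ) :=
  swapB a z (i n) ++ (callB A n z ++ swapB (z + i n) b (o n))

/-- The number of wires of an algorithm. -/
def QPT.size {i o : ℕ → ℕ} (A : QPT i o) (n : ℕ) : ℕ := i n + o n + A.work n

theorem QPT.isPoly_size {i o : ℕ → ℕ} (hi : IsPoly i) (ho : IsPoly o) (A : QPT i o) :
    IsPoly A.size := (hi.add ho).add A.work_poly

theorem UGen.applyB {i o : ℕ → ℕ} (hi : IsPoly i) (ho : IsPoly o) (A : QPT i o)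
    {k a b z : (ℕ → ℕ) → ℕ} (hk : UNum k) (ha : UNum a) (hb : UNum b) (hz : UNum z) :
    UGen fun e => QCrypto.applyB A (k e) (a e) (b e) (z e) :=
  (UGen.swapB ha hz (UNum.poly hi hk)).append ((UGen.callB hi ho A hk hz).append
    (UGen.swapB (hz.add (UNum.poly hi hk)) hb (UNum.poly ho hk)))

/-- The input block and the scratch zone are returned clean, so that one zone can serve several
calls. The output block starts clean because its content is swapped into the zone. -/
theorem Tri.apply {i o : ℕ → ℕ} (A : QPT i o) (n : ℕ) {a b z : ℕ} (ha : a + i n ≤ N)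
    (hb : b + o n ≤ N) (hz : z + A.size n ≤ N) (haz : a + i n ≤ z ∨ z + A.size n ≤ a)
    (hbz : b + o n ≤ z ∨ z + A.size n ≤ b) (hab : a + i n ≤ b ∨ b + o n ≤ a) (σ : QState (i n)) :
    Tri resetOracle (applyB A n a b z)
      (Set.Ico a (a + i n) ∪ Set.Ico b (b + o n) ∪ Set.Ico z (z + A.size n))
      (blk N a σ * zero N b (o n) * zero N z (A.size n))
      (zero N a (i n) * blk N b (A.run n σ) * zero N z (A.size n)) := by
  have hs : A.size n = i n + o n + A.work n := rfl
  refine ((Tri.swap (O := resetOracle) ha (by omega) (by omega) σ (basis fun _ => false)).step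
    (zero N b (o n) * zero N (z + i n) (o n + A.work n)) ?_ ?_ ?_ rfl).append
    (((Tri.call A n z hz σ).step (zero N a (i n) * zero N b (o n)) ?_ ?_ ?_ rfl).append
    ((Tri.swap (O := resetOracle) (show z + i n + o n ≤ N by omega) hb (by omega) (A.run n σ)
      (basis fun _ => false)).step
      (zero N a (i n) * zero N z (i n) * zero N (z + i n + o n) (A.work n)) ?_ ?_ ?_ ?_))
  · intro j hj
    simp only [Set.mem_union, Set.mem_Ico] at hj ⊢
    omega
  · refine (Indep.zero fun j hj => ?_).mul (Indep.zero fun j hj => ?_) <;>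
    · simp only [Set.mem_union, Set.mem_Ico] at hj
      omega
  · rw [hs, show i n + o n + A.work n = i n + (o n + A.work n) by omega, QCrypto.zero_add,
      ← zero]
    ring
  · exact Set.subset_union_right
  · refine (Indep.zero fun j hj => ?_).mul (Indep.zero fun j hj => ?_) <;>
    · simp only [Set.mem_Ico] at hj
      omega
  · rw [← zero]
    ring
  · intro j hj
    simp only [Set.mem_union, Set.mem_Ico] at hj ⊢
    omega
  · refine ((Indep.zero fun j hj => ?_).mul (Indep.zero fun j hj => ?_)).mul
      (Indep.zero fun j hj => ?_) <;>
    · simp only [Set.mem_union, Set.mem_Ico] at hj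
      omega
  · rw [← zero]
    ring
  · rw [hs, QCrypto.zero_add, QCrypto.zero_add, ← zero, ← add_assoc]
    ring

theorem blk_basis_false (a k : ℕ) : blk N a (basis fun _ : Fin k => false) = zero N a k := rfl

theorem blk_copies {k : ℕ} (a t : ℕ) (σ : QState k) :
    blk N a (copies t σ) = ∏ j ∈ Finset.range t, blk N (a + j * k) σ := by
  funext x y
  have key : ∀ (i : Fin t) (x : Fin N → Bool),
      (fun j => block (t * k) a x (finProdFinEquiv (i, j))) = block k (a + i * k) x := fun i x => by
    funext j
    simp only [block, finProdFinEquiv_apply_val]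
    congr 1
    ring
  simp only [blk, copies, Finset.prod_apply, key]
  exact Fin.prod_univ_eq_prod_range (fun j => σ (block k (a + j * k) x) (block k (a + j * k) y)) t

theorem zero_mul_eq_prod (a t k : ℕ) :
    zero N a (t * k) = ∏ j ∈ Finset.range t, zero N (a + j * k) k := by
  induction t with
  | zero => rw [Nat.zero_mul, zero_zero, Finset.prod_range_zero]
  | succ t ih => rw [Nat.succ_mul, QCrypto.zero_add, ih, Finset.prod_range_succ]

/-- Reset `t` consecutive blocks of length `k`. -/
theorem Tri.reset_prod {a t k : ℕ} (h : a + t * k ≤ N) (σ : ℕ → QState k)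
    (hσ : ∀ j < t, (σ j).trace = 1) :
    Tri resetOracle ((List.range t).flatMap fun j => resetB (a + j * k) k)
      (Set.Ico a (a + t * k)) (∏ j ∈ Finset.range t, blk N (a + j * k) (σ j))
      (zero N a (t * k)) := by
  have hjk : ∀ j < t, j * k + k ≤ t * k := fun j hj => by
    rw [← Nat.succ_mul]; exact Nat.mul_le_mul_right _ hj
  have hij : ∀ i j, i < j → i * k + k ≤ j * k := fun i j hj => by
    rw [← Nat.succ_mul]; exact Nat.mul_le_mul_right _ hj
  have := Tri.parallel (O := resetOracle) (N := N) (n := t) (A := Set.Ico a (a + t * k)) (γ := 1)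
    (S := fun j => Set.Ico (a + j * k) (a + j * k + k)) (C := fun j => resetB (a + j * k) k)
    (f := fun j => blk N (a + j * k) (σ j)) (g := fun j => zero N (a + j * k) k)
    (fun j hj => by
      have h1 := Tri.reset (N := N) (a := a + j * k) (k := k) (by have := hjk j hj; omega) (σ j)
      rw [hσ j hj, one_smul] at h1
      rwa [mul_one, mul_one])
    (fun j hj => Set.Ico_subset_Ico (by omega) (by have := hjk j hj; omega))
    (fun i hi j hj hlt => Indep.blk _ fun l hl => by
      have := hij j i hlt
      simp only [Set.mem_Ico] at hl
      omega)
    (fun i hi j hj hlt => Indep.zero fun l hl => by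
      have := hij i j hlt
      simp only [Set.mem_Ico] at hl
      omega)
  rwa [mul_one, mul_one, ← zero_mul_eq_prod] at this

end Apply

/-! ### Simulation of oracles -/

section Simulation

variable {N q m : ℕ}

theorem block_block_add {K k a z : ℕ} (h : a + k ≤ K) (x : Fin N → Bool) :
    block k a (block K z x) = block k (z + a) x := bits_ext fun i hi => by
  rw [bitAt_block, bitAt_block, bitAt_block, if_pos hi, if_pos hi, if_pos (by omega), Nat.add_assoc]

theorem block_overwrite_add {K k a z : ℕ} (hK : z + K ≤ N) (u : Fin k → Bool) (x : Fin N → Bool) :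
    block K z (overwrite (z + a) u x) = overwrite a u (block K z x) := bits_ext fun i hi => by
  rw [bitAt_block, if_pos hi, bitAt_overwrite, bitAt_overwrite, bitAt_block, if_pos hi,
    Nat.add_sub_add_left]
  exact if_congr (by omega) rfl rfl

/-- It suffices that each replaced query acts on the zone of the simulated circuit like the query
while it advances the resources from `S c` to `S (c + 1)`. Gates stay inside the zone, and the
resources are in their frame. -/
theorem Tri.splice {q' m' K z T : ℕ} {O : (Fin q → Bool) → QState m}
    {O' : (Fin q' → Bool) → QState m'} {h : ℕ → ℕ → ℕ → List (Op ℕ)} {A : Set ℕ} {S : ℕ → Amp N}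
    (hz : z + K ≤ N) (hA : Set.Ico z (z + K) ⊆ A) (hS : ∀ c, Indep (Set.Ico z (z + K)) (S c))
    (hh : ∀ a b c, Op.Valid K q m (.query a b) → c < T → ∀ τ : QState K,
      Tri O' (h a b c) A (blk N z τ * S c) (blk N z (applyQuery O a b τ) * S (c + 1)))
    (L : List (Op ℕ)) (hL : ∀ g ∈ L, g.Valid K q m) (c : ℕ) (hc : c + queries L ≤ T)
    (τ : QState K) :
    Tri O' (QCrypto.splice h z c L) A (blk N z τ * S c)
      (blk N z (L.foldl (fun τ g => g.apply O τ) τ) * S (c + queries L)) := by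
  induction L generalizing c τ with
  | nil => exact Tri.nil _ _
  | cons g L ih =>
    have hL' : ∀ g ∈ L, g.Valid K q m := fun g' hg' => hL g' (List.mem_cons_of_mem _ hg')
    have hg := hL g List.mem_cons_self
    cases g with
    | gate g =>
      refine Tri.append (C := [.gate (g.map (z + ·))]) (β := blk N z (g.apply τ) * S c) ?_
        (ih hL' c hc _)
      have := Tri.gates (O := O') hz (L := [g]) (by simpa using show g.Valid K from hg) τ
      exact this.step (S c) hA (hS c) rfl rfl
    | query a b =>
      rw [queries] at hc ⊢
      have := ih hL' (c + 1) (by omega) (applyQuery O a b τ)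
      rw [show c + 1 + queries L = c + (queries L + 1) by omega] at this
      exact (hh a b c hg (by omega) τ).append this

/-- A query measures its input, so the resulting state is a sum over the outcomes `u`. In each
branch the query is a basis state, as required for copying it. -/
theorem blk_applyQuery {K a b z : ℕ} (hz : z + K ≤ N) (ha : a + q ≤ K) (hb : b + m ≤ K)
    (hab : a + q ≤ b ∨ b + m ≤ a) (O : (Fin q → Bool) → QState m) (τ : QState K) :
    blk N z (applyQuery O a b τ) = ∑ u, blk N (z + a) (basis u) * (blk N (z + b) (O u) *
      discard (z + b) m (blk N z (Matrix.of fun x y => τ (overwrite a u x) (overwrite a u y)))) := by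
  funext x y
  have key : ∀ (w : Fin m → Bool) (x : Fin K → Bool),
      overwrite a (block q a x) (overwrite b w x) = overwrite b w x := fun w x => by
    rw [overwrite_comm hab, overwrite_block]
  simp only [Finset.sum_apply, Pi.mul_apply, blk, discard, Matrix.of_apply, applyQuery,
    block_overwrite_add hz, block_block_add ha, block_block_add hb, basis, Matrix.single_apply]
  split_ifs with h
  · rw [Finset.sum_eq_single (block q (z + a) x)]
    · rw [if_pos ⟨rfl, h⟩, one_mul]
      refine congrArg _ (Finset.sum_congr rfl fun w _ => ?_)
      rw [← block_block_add ha, key w (block K z x), block_block_add ha, h, ← block_block_add ha,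
        key w (block K z y)]
    · intro u _ hu
      rw [if_neg, zero_mul]
      rintro ⟨rfl, -⟩
      exact hu rfl
    · simp
  · refine (Finset.sum_eq_zero fun u _ => ?_).symm
    rw [if_neg, zero_mul]
    rintro ⟨rfl, h'⟩
    exact h h'

/-- The counterpart of `blk_applyQuery` before the reply: dephasing the query wires inside the zone
produces the same branches. -/
theorem blk_mul_diagB_inner {K a z : ℕ} (ha : a + q ≤ K) (τ : QState K) :
    blk N z τ * diagB N (z + a) q = ∑ u, blk N (z + a) (basis u : QState q) *
      blk N z (Matrix.of fun x y => τ (overwrite a u x) (overwrite a u y)) := by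
  rw [diagB_eq_sum, Finset.mul_sum]
  refine Finset.sum_congr rfl fun u _ => ?_
  funext x y
  simp only [Pi.mul_apply, blk, Matrix.of_apply, basis, Matrix.single_apply]
  split_ifs with h
  · have key : ∀ x : Fin N → Bool, u = block q (z + a) x →
        overwrite a u (block K z x) = block K z x := fun x hx => by
      rw [hx, ← block_block_add ha, overwrite_block]
    rw [mul_one, one_mul, key x h.1, key y h.2]
  · rw [mul_zero, zero_mul]

/-- The wires are changed in two stages, through a string that already has the new values on `A` and
still has the old ones elsewhere. -/
theorem Indep.union {A B : Set ℕ} {r : Amp N} (hA : Indep A r) (hB : Indep B r) :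
    Indep (A ∪ B) r := by
  classical
  intro x x' y y' hx hy
  set mid : (Fin N → Bool) → (Fin N → Bool) → Fin N → Bool := fun x x' i =>
    if (i : ℕ) ∈ A then x' i else x i with hm
  have h1 : ∀ x x' : Fin N → Bool, ∀ i < N, i ∉ A → bitAt x i = bitAt (mid x x') i :=
    fun x x' i hi hn => by rw [bitAt_of_lt _ hi, bitAt_of_lt _ hi]; simp [hm, hn]
  have h2 : ∀ x x' : Fin N → Bool, (∀ i < N, i ∉ A ∪ B → bitAt x i = bitAt x' i) →
      ∀ i < N, i ∉ B → bitAt (mid x x') i = bitAt x' i := fun x x' h i hi hn => by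
    rw [bitAt_of_lt _ hi, bitAt_of_lt _ hi]
    simp only [hm]
    split_ifs with hA
    · rfl
    · have := h i hi (by simp [hA, hn])
      rwa [bitAt_of_lt _ hi, bitAt_of_lt _ hi] at this
  exact (hA _ _ _ _ (h1 x x') (h1 y y')).trans (hB _ _ _ _ (h2 x x' hx) (h2 y y' hy))

variable {p q m : ℕ → ℕ}

/-- Answer a query of the algorithm that runs on the zone at `z` by applying `E` to the state on
the block at `P` and the query. -/
def answerB (E : QPT (fun n => p n + q n) m) (n z X Y Z s P a b : ℕ) : List (Op ℕ) :=
  dephB (z + a) (q n) s ++ (copyB (z + a) (X + p n) (q n) ++ (swapB P X (p n) ++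
    (applyB E n X Y Z ++ (resetB (z + b) (m n) ++ swapB Y (z + b) (m n)))))

/-- Dephasing splits the state according to the query `u`. In each branch `u` is classical: it is
copied next to the state `σ`, `E` computes the reply, the old content of the reply block is reset,
and the reply is swapped in. The copy of `σ` is consumed and leaves zeros. -/
theorem Tri.answer (E : QPT (fun n => p n + q n) m) (n : ℕ) {K z X Y Z s P a b : ℕ}
    (hP : P + p n ≤ z) (hX : z + K ≤ X) (hY : X + (p n + q n) ≤ Y) (hZ : Y + m n ≤ Z)
    (hs : Z + E.size n ≤ s) (hN : s < N) (ha : a + q n ≤ K) (hb : b + m n ≤ K)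
    (hab : a + q n ≤ b ∨ b + m n ≤ a) (σ : QState (p n)) (τ : QState K) :
    Tri resetOracle (answerB E n z X Y Z s P a b)
      (Set.Ico z (z + K) ∪ Set.Ico P (P + p n) ∪ Set.Ico X (s + 1))
      (blk N z τ * (blk N P σ *
        (zero N X (p n + q n) * zero N Y (m n) * zero N Z (E.size n) * zero N s 1)))
      (blk N z (applyQuery (fun u => E.run n (tens σ (basis u))) a b τ) * (zero N P (p n) *
        (zero N X (p n + q n) * zero N Y (m n) * zero N Z (E.size n) * zero N s 1))) := by
  have e1 : diagB N (z + a) (q n) * zero N s 1 * (blk N z τ * (blk N P σ *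
      (zero N X (p n + q n) * zero N Y (m n) * zero N Z (E.size n)))) =
      ∑ u, (blk N (z + a) (basis u : QState (q n)) *
        blk N z (Matrix.of fun x y => τ (overwrite a u x) (overwrite a u y))) * (blk N P σ *
      (zero N X (p n + q n) * zero N Y (m n) * zero N Z (E.size n) * zero N s 1)) := by
    rw [← Finset.sum_mul, ← blk_mul_diagB_inner ha]
    ring
  refine ((Tri.deph (a := z + a) (k := q n) (by omega) hN (by omega)).step (blk N z τ * (blk N P σ *
    (zero N X (p n + q n) * zero N Y (m n) * zero N Z (E.size n))))
    (by
      intro j hj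
      simp only [Set.mem_union, Set.mem_Ico, Set.mem_singleton_iff] at hj ⊢
      omega)
    (by
      refine (Indep.blk _ ?_).mul ((Indep.blk _ ?_).mul (((Indep.blk _ ?_).mul (Indep.blk _ ?_)).mul
        (Indep.blk _ ?_))) <;>
      · intro j hj
        rw [Set.mem_singleton_iff] at hj
        omega)
    (by ring) e1.symm).append ?_
  rw [blk_applyQuery (by omega) ha hb hab, Finset.sum_mul]
  refine Tri.sum fun u => ?_
  -- In a branch the state of the simulated algorithm, possibly entangled, enters only through its
  -- being supported on the zone at `z`.
  have hG : Indep (Set.Ico z (z + K))ᶜ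
      (blk N z (Matrix.of fun x y => τ (overwrite a u x) (overwrite a u y))) :=
    Indep.blk _ fun j hj => by
      simp only [Set.mem_compl_iff, Set.mem_Ico] at hj
      omega
  generalize blk N z (Matrix.of fun x y => τ (overwrite a u x) (overwrite a u y)) = G at hG ⊢
  -- After the reply block is traced out, the state no longer depends on it either, so the swap of
  -- the reply can be framed.
  have hD : Indep (Set.Ico Y (Y + m n) ∪ Set.Ico (z + b) (z + b + m n))
      (discard (z + b) (m n) G) :=
    ((hG.discard _ _).mono fun j hj => by
      simp only [Set.mem_compl_iff, Set.mem_Ico] at hj ⊢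
      omega).union (indep_discard _ _ _)
  generalize hGD : discard (z + b) (m n) G = D at hD ⊢
  refine ((Tri.copy (O := resetOracle) (a := z + a) (b := X + p n) (k := q n) (by omega)
    (by omega) (by omega) u).step (G * (blk N P σ * (zero N X (p n) * zero N Y (m n) *
      zero N Z (E.size n) * zero N s 1))) ?_ ?_ ?_ rfl).append
    (((Tri.swap (O := resetOracle) (a := P) (b := X) (k := p n) (by omega) (by omega) (by omega) σ
      (basis fun _ => false)).step (G * (blk N (z + a) (basis u) *
      (blk N (X + p n) (basis u) * zero N Y (m n) * zero N Z (E.size n) * zero N s 1)))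
      ?_ ?_ ?_ rfl).append
    (((Tri.apply E n (a := X) (b := Y) (z := Z) (by omega) (by omega) (by omega) (by omega)
      (by omega) (by omega) (tens σ (basis u))).step
      (G * (blk N (z + a) (basis u) * zero N P (p n) * zero N s 1)) ?_ ?_ ?_ rfl).append
    (((Tri.reset_discard (a := z + b) (k := m n) (by omega) G).step (blk N (z + a) (basis u) *
      zero N P (p n) * zero N s 1 * (zero N X (p n + q n) *
      blk N Y (E.run n (tens σ (basis u))) * zero N Z (E.size n))) ?_ ?_ ?_ rfl).append
    ((Tri.swap (O := resetOracle) (a := Y) (b := z + b) (k := m n) (by omega) (by omega) (by omega)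
      (E.run n (tens σ (basis u))) (basis fun _ => false)).step
      (D * (blk N (z + a) (basis u) *
      zero N P (p n) * zero N s 1 * (zero N X (p n + q n) * zero N Z (E.size n)))) ?_ ?_ ?_ ?_))))
  all_goals first
    | (intro j hj
       simp only [Set.mem_union, Set.mem_Ico] at hj ⊢
       omega)
    | (simp only [blk_basis_false, blk_tens, QCrypto.zero_add, hGD]
       ring1)
    | ((repeat' apply Indep.mul) <;> first
        | exact hD
        | (refine hG.mono fun j hj => ?_
           simp only [Set.mem_compl_iff, Set.mem_union, Set.mem_Ico] at hj ⊢
           omega)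
        | (refine Indep.blk _ fun j hj => ?_
           simp only [Set.mem_union, Set.mem_Ico] at hj
           omega))

theorem UGen.answerB (hp : IsPoly p) (hq : IsPoly q) (hm : IsPoly m)
    (E : QPT (fun n => p n + q n) m) {n z X Y Z s P a b : (ℕ → ℕ) → ℕ} (hn : UNum n) (hz : UNum z)
    (hX : UNum X) (hY : UNum Y) (hZ : UNum Z) (hs : UNum s) (hP : UNum P) (ha : UNum a)
    (hb : UNum b) : UGen fun e => QCrypto.answerB E (n e) (z e) (X e) (Y e) (Z e) (s e) (P e) (a e)
      (b e) :=
  (UGen.dephB (hz.add ha) (UNum.poly hq hn) hs).append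
    ((UGen.copyB (hz.add ha) (hX.add (UNum.poly hp hn)) (UNum.poly hq hn)).append
    ((UGen.swapB hP hX (UNum.poly hp hn)).append ((UGen.applyB (hp.add hq) hm E hn hX hY hZ).append
    ((UGen.resetB (hz.add hb) (UNum.poly hm hn)).append
      (UGen.swapB hY (hz.add hb) (UNum.poly hm hn))))))

/-- If the replies of the oracle can be computed from the query and a state `σ`, then an oracle
algorithm can be simulated with sufficiently many copies of `σ`. -/
theorem OracleQPT.exists_simulation {i o : ℕ → ℕ} (hp : IsPoly p) (hq : IsPoly q) (hm : IsPoly m)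
    (hi : IsPoly i) (ho : IsPoly o) (E : QPT (fun n => p n + q n) m) (A : OracleQPT q m i o) :
    ∃ t, IsPoly t ∧ ∃ B : QPT (fun n => i n + t n * p n) o, ∀ n (ρ : QState (i n))
      (σ : QState (p n)), σ.trace = 1 → B.run n (tens ρ (copies (t n) σ)) =
        A.run n (fun x => E.run n (tens σ (basis x))) ρ := by
  obtain ⟨P, f, hP⟩ := A.uniform
  have hT : ∀ n, queries (A.circ n) ≤ f.eval n := fun n => by
    obtain ⟨σ, k, h1, h2⟩ := hP n
    exact (queries_le_length _).trans (h1.length_le.trans h2)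
  obtain ⟨t, ht, hT⟩ : ∃ t, IsPoly t ∧ ∀ n, queries (A.circ n) ≤ t n := ⟨_, ⟨f, fun _ => rfl⟩, hT⟩
  refine ⟨t, ht, ?_⟩
  -- Layout: input, copies of `σ`, output at `Ot`, zone of the simulated algorithm at `z`; then
  -- input, output and scratch zone of `E` at `X`, `Y`, `Z`, and a dephasing wire at `s`.
  obtain ⟨Ot, hOt, hOt'⟩ : ∃ Ot, IsPoly Ot ∧ ∀ n, Ot n = i n + t n * p n :=
    ⟨_, hi.add (ht.mul hp), fun _ => rfl⟩
  obtain ⟨z, hz, hz'⟩ : ∃ z, IsPoly z ∧ ∀ n, z n = Ot n + o n := ⟨_, hOt.add ho, fun _ => rfl⟩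
  obtain ⟨X, hX, hX'⟩ : ∃ X, IsPoly X ∧ ∀ n, X n = z n + (i n + o n + A.work n) :=
    ⟨_, hz.add ((hi.add ho).add A.work_poly), fun _ => rfl⟩
  obtain ⟨Y, hY, hY'⟩ : ∃ Y, IsPoly Y ∧ ∀ n, Y n = X n + (p n + q n) :=
    ⟨_, hX.add (hp.add hq), fun _ => rfl⟩
  obtain ⟨Z, hZ, hZ'⟩ : ∃ Z, IsPoly Z ∧ ∀ n, Z n = Y n + m n := ⟨_, hY.add hm, fun _ => rfl⟩
  obtain ⟨s, hs, hs'⟩ : ∃ s, IsPoly s ∧ ∀ n, s n = Z n + E.size n :=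
    ⟨_, hZ.add (E.isPoly_size (hp.add hq) hm), fun _ => rfl⟩
  obtain ⟨w, hw, hw'⟩ : ∃ w, IsPoly w ∧ ∀ n, w n = (i n + o n + A.work n) + (p n + q n) + m n +
      E.size n + 1 := ⟨_, ((((hi.add ho).add A.work_poly).add (hp.add hq)).add hm).add
        (E.isPoly_size (hp.add hq) hm) |>.add (.const 1), fun _ => rfl⟩
  set C : ℕ → List (Op ℕ) := fun n => swapB 0 (z n) (i n) ++
    (splice (fun a b c => answerB E n (z n) (X n) (Y n) (Z n) (s n) (i n + c * p n) a b) (z n) 0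
      (A.circ n) ++ ((List.range (t n)).flatMap (fun j => resetB (i n + j * p n) (p n)) ++
    (resetB (z n) (i n) ++ (resetB (z n + i n + o n) (A.work n) ++
      swapB (z n + i n) (Ot n) (o n))))) with hC
  have hCu : UGen fun e => C (e 0) := by
    refine (UGen.swapB (.const 0) hz.unum hi.unum).append (.append ?_ (.append ?_
      ((UGen.resetB hz.unum hi.unum).append ((UGen.resetB ((hz.add hi).add ho).unum
        A.work_poly.unum).append (UGen.swapB (hz.add hi).unum hOt.unum ho.unum)))))
    · exact (UGen.splice A.uniform (UNum.var 0) hz.unum 1 2 3 (UGen.answerB hp hq hm E (UNum.var 0)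
        hz.unum hX.unum hY.unum hZ.unum hs.unum (hi.unum.add ((UNum.var 3).mul hp.unum))
        (UNum.var 1) (UNum.var 2))).of_eq fun e => rfl
    · exact UGen.range_one (F := fun n j => resetB (i n + j * p n) (p n)) ht.unum
        (UGen.resetB (hi.unum.add ((UNum.var 1).mul hp.unum)) hp.unum)
  have hjk : ∀ n, ∀ j < t n, j * p n + p n ≤ t n * p n := fun n j hj => by
    rw [← Nat.succ_mul]; exact Nat.mul_le_mul_right _ hj
  have key : ∀ n (ρ : QState (i n)) (σ : QState (p n)), σ.trace = 1 → ∀ N, N = s n + 1 →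
      Tri (N := N) resetOracle (C n) Set.univ (blk N 0 ρ * blk N (i n) (copies (t n) σ) *
        zero N (Ot n) (o n + w n)) (zero N 0 (i n) * zero N (i n) (t n * p n) * blk N (Ot n)
        (A.run n (fun x => E.run n (tens σ (basis x))) ρ) * zero N (z n) (w n)) := by
    intro n ρ σ hσ N hN
    have := hOt' n; have := hz' n; have := hX' n; have := hY' n; have := hZ' n; have := hs' n
    have := hw' n; have := hT n
    have hsA : z n + (i n + o n + A.work n) ≤ N := by omega
    set R : Amp N := zero N (X n) (p n + q n) * zero N (Y n) (m n) * zero N (Z n) (E.size n) *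
      zero N (s n) 1 with hR
    -- The query number `c` consumes the copy number `c`: after `c` queries the first `c` blocks are
    -- zero.
    set f : ℕ → ℕ → Amp N := fun c j => blk N (i n + j * p n)
      (if j < c then basis fun _ => false else σ) with hf
    set S : ℕ → Amp N := fun c => (∏ j ∈ Finset.range (t n), f c j) * R with hS
    have eR : zero N (z n) (w n) = zero N (z n) (i n) * zero N (z n + i n) (o n + A.work n) * R := by
      rw [hw', QCrypto.zero_add, QCrypto.zero_add, QCrypto.zero_add, QCrypto.zero_add,
        QCrypto.zero_add (z n) (i n + o n), QCrypto.zero_add (z n) (i n), QCrypto.zero_add _ (o n)]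
      rw [show z n + (i n + o n + A.work n) = X n by omega,
        show z n + (i n + o n + A.work n + (p n + q n)) = Y n by omega,
        show z n + (i n + o n + A.work n + (p n + q n) + m n) = Z n by omega,
        show z n + (i n + o n + A.work n + (p n + q n) + m n + E.size n) = s n by omega,
        show z n + (i n + o n) = z n + i n + o n by omega, hR]
      ring
    have eO : zero N (Ot n) (o n + w n) = zero N (Ot n) (o n) * zero N (z n) (w n) := by
      rw [QCrypto.zero_add, ← hz']
    have hmul : ∀ (c j : ℕ), c < t n → j < t n → c ≠ j → i n + j * p n + p n ≤ i n + c * p n ∨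
        i n + c * p n + p n ≤ i n + j * p n := by
      intro c j hc hj hcj
      rcases Nat.lt_or_gt_of_ne hcj with h | h
      · right
        have := Nat.mul_le_mul_right (p n) (Nat.succ_le_of_lt h)
        rw [Nat.succ_mul] at this
        omega
      · left
        have := Nat.mul_le_mul_right (p n) (Nat.succ_le_of_lt h)
        rw [Nat.succ_mul] at this
        omega
    have hsim := Tri.splice (N := N) (O' := resetOracle) (T := t n)
      (O := fun x => E.run n (tens σ (basis x))) (S := S)
      (h := fun a b c => answerB E n (z n) (X n) (Y n) (Z n) (s n) (i n + c * p n) a b)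
      (A := Set.Ico (i n) (Ot n) ∪ Set.Ico (z n) (s n + 1)) hsA (fun j hj => by
        simp only [Set.mem_union, Set.mem_Ico] at hj ⊢
        omega)
      (fun c => by
        refine (Indep.prod fun j hj => Indep.blk _ fun l hl => ?_).mul
          ((((Indep.zero fun l hl => ?_).mul (Indep.zero fun l hl => ?_)).mul
          (Indep.zero fun l hl => ?_)).mul (Indep.zero fun l hl => ?_))
        · have := hjk n j (Finset.mem_range.1 hj)
          simp only [Set.mem_Ico] at hl
          omega
        all_goals
          simp only [Set.mem_Ico] at hl
          omega)
      (fun a b c hv hc τ => by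
        obtain ⟨h1, h2, h3⟩ : a + q n ≤ _ ∧ b + m n ≤ _ ∧ _ := hv
        have hcp := hjk n c hc
        have hprod : ∀ c', (∏ j ∈ Finset.range (t n), f c' j) =
            f c' c * ∏ j ∈ (Finset.range (t n)).erase c, f c' j := fun c' =>
          (Finset.mul_prod_erase _ _ (Finset.mem_range.2 hc)).symm
        have hrest : ∏ j ∈ (Finset.range (t n)).erase c, f (c + 1) j =
            ∏ j ∈ (Finset.range (t n)).erase c, f c j := by
          refine Finset.prod_congr rfl fun j hj => ?_
          have hne := Finset.ne_of_mem_erase hj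
          simp only [hf]
          rw [if_congr (show j < c + 1 ↔ j < c by omega) rfl rfl]
        have h0 : f c c = blk N (i n + c * p n) σ := by simp [hf]
        have h0' : f (c + 1) c = zero N (i n + c * p n) (p n) := by simp [hf, zero]
        refine (Tri.answer E n (N := N) (K := i n + o n + A.work n) (z := z n) (X := X n) (Y := Y n)
          (Z := Z n) (s := s n) (P := i n + c * p n) (a := a) (b := b) (by omega) (by omega)
          (by omega) (by omega) (by omega) (by omega) h1 h2 h3 σ τ).step
          (∏ j ∈ (Finset.range (t n)).erase c, f c j) ?_ ?_ ?_ ?_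
        · intro j hj
          simp only [Set.mem_union, Set.mem_Ico] at hj ⊢
          omega
        · refine Indep.prod fun j hj => Indep.blk _ fun l hl => ?_
          obtain ⟨hne, hj⟩ := Finset.mem_erase.1 hj
          have hj := Finset.mem_range.1 hj
          have := hmul c j hc hj hne.symm
          have := hjk n j hj
          simp only [Set.mem_union, Set.mem_Ico] at hl
          omega
        · simp only [hS]
          rw [hprod, h0]
          ring1
        · simp only [hS]
          rw [hprod, h0', hrest]
          ring1) (A.circ n) (A.valid n) 0 (by omega) (prepare (o n) (A.work n) ρ)
    have hrun : readOut ((A.circ n).foldl (fun τ g => g.apply (fun x => E.run n (tens σ (basis x))) τ)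
      (prepare (o n) (A.work n) ρ)) = A.run n (fun x => E.run n (tens σ (basis x))) ρ := rfl
    have hread := discard_readOut (N := N) (i := i n) (o := o n) (w := A.work n) (z n) hsA
      ((A.circ n).foldl (fun τ g => g.apply (fun x => E.run n (tens σ (basis x))) τ)
      (prepare (o n) (A.work n) ρ))
    rw [hrun] at hread
    generalize A.run n (fun x => E.run n (tens σ (basis x))) ρ = β at hread ⊢
    have hG : Indep (Set.Ico (z n) (z n + (i n + o n + A.work n)))ᶜ (blk N (z n)
        ((A.circ n).foldl (fun τ g => g.apply (fun x => E.run n (tens σ (basis x))) τ)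
      (prepare (o n) (A.work n) ρ))) := Indep.blk _ fun j hj => by
      simp only [Set.mem_compl_iff, Set.mem_Ico] at hj
      omega
    generalize blk N (z n) ((A.circ n).foldl (fun τ g => g.apply
      (fun x => E.run n (tens σ (basis x))) τ) (prepare (o n) (A.work n) ρ)) = G at hsim hread hG
    have hcop : blk N (i n) (copies (t n) σ) = ∏ j ∈ Finset.range (t n), f 0 j := by
      rw [blk_copies]
      simp [hf]
    -- Used and unused blocks are reset alike; both kinds hold states of trace one, so no scalar
    -- appears.
    have hreset := Tri.reset_prod (N := N) (a := i n) (t := t n) (k := p n) (by omega)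
      (fun j => if j < 0 + queries (A.circ n) then basis fun _ => false else σ)
      (fun j _ => by
        split_ifs
        · exact trace_basis _
        · exact hσ)
    rw [blk_prepare] at hsim
    refine ((Tri.swap (O := resetOracle) (a := 0) (b := z n) (k := i n) (by omega) (by omega)
      (by omega) ρ (basis fun _ => false)).step (blk N (i n) (copies (t n) σ) *
      (zero N (Ot n) (o n) * zero N (z n + i n) (o n + A.work n) * R)) ?_ ?_ ?_ rfl).append
      ((hsim.step (zero N 0 (i n) * zero N (Ot n) (o n)) ?_ ?_ ?_ rfl).append
      ((hreset.step (G * (zero N 0 (i n) * zero N (Ot n) (o n)) * R) ?_ ?_ ?_ rfl).append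
      (((Tri.reset_discard (a := z n) (k := i n) (by omega) G).step (zero N (i n) (t n * p n) *
        (zero N 0 (i n) * zero N (Ot n) (o n)) * R) ?_ ?_ ?_ rfl).append
      (((Tri.reset_discard (a := z n + i n + o n) (k := A.work n) (by omega)
        (discard (z n) (i n) G)).step (zero N (z n) (i n) * zero N (i n) (t n * p n) *
        (zero N 0 (i n) * zero N (Ot n) (o n)) * R) ?_ ?_ ?_ rfl).append
      ((Tri.swap (O := resetOracle) (a := z n + i n) (b := Ot n) (k := o n) (by omega) (by omega)
        (by omega) β (basis fun _ => false)).step (zero N (z n + i n + o n) (A.work n) *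
        zero N (z n) (i n) * zero N (i n) (t n * p n) * zero N 0 (i n) * R) ?_ ?_ ?_ ?_)))))
    all_goals first
      | exact Set.subset_univ _
      | ring1
      | (simp only [hcop, eO, eR, hS, hread, blk_basis_false, QCrypto.zero_add _ (o n) (A.work n)]
         ring1)
      | ((repeat' apply Indep.mul) <;> first
          | (refine hG.mono fun j hj => ?_
             simp only [Set.mem_compl_iff, Set.mem_union, Set.mem_Ico] at hj ⊢
             omega)
          | (refine Indep.blk _ fun j hj => ?_
             simp only [Set.mem_union, Set.mem_Ico] at hj
             omega))
  obtain ⟨B, hB⟩ := exists_qpt_of_circuit (hi.add (ht.mul hp)) ho hw C hCu fun n g hg => by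
    have := (key n (basis fun _ => false) (basis fun _ => false) (trace_basis _) _ rfl).1 g hg
    have := hOt' n; have := hz' n; have := hX' n; have := hY' n; have := hZ' n; have := hs' n
    have := hw' n
    rwa [show i n + t n * p n + o n + w n = s n + 1 by omega]
  refine ⟨B, fun n ρ σ hσ => hB n _ _ ?_⟩
  have := hOt' n; have := hz' n; have := hX' n; have := hY' n; have := hZ' n; have := hs' n
  have := hw' n
  have := (key n ρ σ hσ (i n + t n * p n + o n + w n) (by omega)).exec_eq
  rw [hz', hOt'] at this
  rw [blk_tens, Nat.zero_add, this, QCrypto.zero_add 0, Nat.zero_add]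

end Simulation

end QCrypto

namespace QCrypto

open Function

/-! ### Composition and reordering of inputs -/

section Combinators

variable {N : ℕ}

theorem blk_of_mul {k : ℕ} (a : ℕ) (α β : Amp k) :
    blk N a (Matrix.of (α * β)) = blk N a (Matrix.of α) * blk N a (Matrix.of β) := rfl

theorem blk_of_blk {k l a c : ℕ} (h : c + l ≤ k) (σ : QState l) :
    blk N a (Matrix.of (blk k c σ)) = blk N (a + c) σ := by
  funext x y
  simp only [blk, Matrix.of_apply, block_block_add h]

theorem blk_empty (a : ℕ) (σ : QState 0) : blk N a σ = σ.trace • 1 := by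
  funext x y
  simp only [blk, Matrix.trace, Matrix.diag, Pi.smul_apply, Pi.one_apply, smul_eq_mul, mul_one,
    Fintype.sum_unique]
  exact congrArg₂ σ (Subsingleton.elim _ _) (Subsingleton.elim _ _)

/-- A circuit that computes `β` from `ρ`, with resets, yields a QPT algorithm. -/
theorem exists_qpt_of_tri {i o w : ℕ → ℕ} (hi : IsPoly i) (ho : IsPoly o) (hw : IsPoly w)
    {C : ℕ → List (Op ℕ)} (hC : UGen fun e => C (e 0)) {ι : ℕ → Type} [∀ n, Nonempty (ι n)]
    (ρ : ∀ n, ι n → QState (i n)) (β : ∀ n, ι n → QState (o n))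
    (h : ∀ n N (v : ι n), N = i n + o n + w n → Tri (N := N) resetOracle (C n) Set.univ
      (blk N 0 (ρ n v) * zero N (i n) (o n + w n))
      (zero N 0 (i n) * blk N (i n) (β n v) * zero N (i n + o n) (w n))) :
    ∃ A : QPT i o, ∀ n v, A.run n (ρ n v) = β n v := by
  -- Validity of the circuit does not depend on its input, so it can be read off the triple for any
  -- one input.
  obtain ⟨A, hA⟩ := exists_qpt_of_circuit hi ho hw C hC fun n g hg =>
    (h n _ (Classical.arbitrary _) rfl).1 g hg
  exact ⟨A, fun n v => hA n _ _ (h n _ v rfl).exec_eq⟩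

/-- Apply `A` to the first part of the input, and `B` to the result and the rest. -/
theorem QPT.exists_comp {a a' b o : ℕ → ℕ} (ha : IsPoly a) (ha' : IsPoly a') (hb : IsPoly b)
    (ho : IsPoly o) (A : QPT a a') (B : QPT (fun n => a' n + b n) o) :
    ∃ C : QPT (fun n => a n + b n) o, ∀ n (ρ : QState (a n)) (σ : QState (b n)),
      C.run n (tens ρ σ) = B.run n (tens (A.run n ρ) σ) := by
  obtain ⟨w, hw, hw'⟩ : ∃ w, IsPoly w ∧ ∀ n, w n = a' n + b n + A.size n + B.size n :=
    ⟨_, ((ha'.add hb).add (A.isPoly_size ha ha')).add (B.isPoly_size (ha'.add hb) ho), fun _ => rfl⟩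
  obtain ⟨U, hU, hU'⟩ : ∃ U, IsPoly U ∧ ∀ n, U n = a n + b n + o n :=
    ⟨_, (ha.add hb).add ho, fun _ => rfl⟩
  obtain ⟨Z, hZ, hZ'⟩ : ∃ Z, IsPoly Z ∧ ∀ n, Z n = U n + (a' n + b n) :=
    ⟨_, hU.add (ha'.add hb), fun _ => rfl⟩
  obtain ⟨C, hC⟩ := exists_qpt_of_tri (ha.add hb) ho hw
    (C := fun n => applyB A n 0 (U n) (Z n) ++ (swapB (a n) (U n + a' n) (b n) ++
      applyB B n (U n) (a n + b n) (Z n + A.size n)))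
    ((UGen.applyB ha ha' A (UNum.var 0) (.const 0) hU.unum hZ.unum).append
      ((UGen.swapB ha.unum (hU.add ha').unum hb.unum).append
      (UGen.applyB (ha'.add hb) ho B (UNum.var 0) hU.unum (ha.add hb).unum
        (hZ.add (A.isPoly_size ha ha')).unum)))
    (ι := fun n => QState (a n) × QState (b n)) (fun n v => tens v.1 v.2)
    (fun n v => B.run n (tens (A.run n v.1) v.2)) (by
      rintro n N ⟨ρ, σ⟩ hN
      have := hU' n; have := hZ' n; have := hw' n
      refine ((Tri.apply A n (a := 0) (b := U n) (z := Z n) (by omega) (by omega) (by omega)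
        (by omega) (by omega) (by omega) ρ).step (blk N (a n) σ * zero N (a n + b n) (o n) *
        zero N (U n + a' n) (b n) * zero N (Z n + A.size n) (B.size n)) ?_ ?_ ?_ rfl).append
        (((Tri.swap (O := resetOracle) (a := a n) (b := U n + a' n) (k := b n) (by omega) (by omega)
        (by omega) σ (basis fun _ => false)).step (zero N 0 (a n) * zero N (a n + b n) (o n) *
        blk N (U n) (A.run n ρ) * zero N (Z n) (A.size n) * zero N (Z n + A.size n) (B.size n))
        ?_ ?_ ?_ rfl).append
        ((Tri.apply B n (a := U n) (b := a n + b n) (z := Z n + A.size n) (by omega) (by omega)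
        (by omega) (by omega) (by omega) (by omega) (tens (A.run n ρ) σ)).step
        (zero N 0 (a n) * zero N (a n) (b n) * zero N (Z n) (A.size n)) ?_ ?_ ?_ ?_))
      all_goals first
        | exact Set.subset_univ _
        | (simp only [hw', hU', hZ', blk_basis_false, blk_tens, QCrypto.zero_add, Nat.zero_add,
            ← Nat.add_assoc]
           ring1)
        | ((repeat' apply Indep.mul) <;>
            (refine Indep.blk _ fun j hj => ?_
             simp only [Set.mem_union, Set.mem_Ico] at hj
             omega)))
  exact ⟨C, fun n ρ σ => hC n (ρ, σ)⟩

/-- Exchange the last two parts of the input. -/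
theorem QPT.exists_exchange {a b c o : ℕ → ℕ} (ha : IsPoly a) (hb : IsPoly b) (hc : IsPoly c)
    (ho : IsPoly o) (B : QPT (fun n => (a n + c n) + b n) o) :
    ∃ C : QPT (fun n => (a n + b n) + c n) o, ∀ n (ρ : QState (a n)) (σ : QState (b n))
      (τ : QState (c n)), C.run n (tens (tens ρ σ) τ) = B.run n (tens (tens ρ τ) σ) := by
  have hB := B.isPoly_size ((ha.add hc).add hb) ho
  obtain ⟨w, hw, hw'⟩ : ∃ w, IsPoly w ∧ ∀ n, w n = a n + c n + b n + B.size n :=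
    ⟨_, ((ha.add hc).add hb).add hB, fun _ => rfl⟩
  obtain ⟨U, hU, hU'⟩ : ∃ U, IsPoly U ∧ ∀ n, U n = a n + b n + c n + o n :=
    ⟨_, ((ha.add hb).add hc).add ho, fun _ => rfl⟩
  obtain ⟨C, hC⟩ := exists_qpt_of_tri ((ha.add hb).add hc) ho hw
    (C := fun n => swapB 0 (U n) (a n) ++ (swapB (a n) (U n + a n + c n) (b n) ++
      (swapB (a n + b n) (U n + a n) (c n) ++
      applyB B n (U n) (a n + b n + c n) (U n + (a n + c n + b n)))))
    ((UGen.swapB (.const 0) hU.unum ha.unum).append ((UGen.swapB ha.unum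
      ((hU.add ha).add hc).unum hb.unum).append ((UGen.swapB (ha.add hb).unum (hU.add ha).unum
      hc.unum).append (UGen.applyB ((ha.add hc).add hb) ho B (UNum.var 0) hU.unum
      ((ha.add hb).add hc).unum (hU.add ((ha.add hc).add hb)).unum))))
    (ι := fun n => QState (a n) × QState (b n) × QState (c n)) (fun n v => tens (tens v.1 v.2.1) v.2.2)
    (fun n v => B.run n (tens (tens v.1 v.2.2) v.2.1)) (by
      rintro n N ⟨ρ, σ, τ⟩ hN
      have := hU' n; have := hw' n
      refine ((Tri.swap (O := resetOracle) (a := 0) (b := U n) (k := a n) (by omega) (by omega)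
        (by omega) ρ (basis fun _ => false)).step (blk N (a n) σ * blk N (a n + b n) τ *
        zero N (a n + b n + c n) (o n) * zero N (U n + a n) (c n) * zero N (U n + a n + c n) (b n) *
        zero N (U n + (a n + c n + b n)) (B.size n)) ?_ ?_ ?_ rfl).append
        (((Tri.swap (O := resetOracle) (a := a n) (b := U n + a n + c n) (k := b n) (by omega)
        (by omega) (by omega) σ (basis fun _ => false)).step (zero N 0 (a n) * blk N (U n) ρ *
        blk N (a n + b n) τ * zero N (a n + b n + c n) (o n) * zero N (U n + a n) (c n) *
        zero N (U n + (a n + c n + b n)) (B.size n)) ?_ ?_ ?_ rfl).append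
        (((Tri.swap (O := resetOracle) (a := a n + b n) (b := U n + a n) (k := c n) (by omega)
        (by omega) (by omega) τ (basis fun _ => false)).step (zero N 0 (a n) * blk N (U n) ρ *
        blk N (U n + a n + c n) σ * zero N (a n + b n + c n) (o n) * zero N (a n) (b n) *
        zero N (U n + (a n + c n + b n)) (B.size n)) ?_ ?_ ?_ rfl).append
        ((Tri.apply B n (a := U n) (b := a n + b n + c n) (z := U n + (a n + c n + b n)) (by omega)
        (by omega) (by omega) (by omega) (by omega) (by omega) (tens (tens ρ τ) σ)).step
        (zero N 0 (a n) * zero N (a n) (b n) * zero N (a n + b n) (c n)) ?_ ?_ ?_ ?_)))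
      all_goals first
        | exact Set.subset_univ _
        | (simp only [hw', hU', blk_basis_false, blk_tens, QCrypto.zero_add, Nat.zero_add,
            ← Nat.add_assoc]
           ring1)
        | ((repeat' apply Indep.mul) <;>
            (refine Indep.blk _ fun j hj => ?_
             simp only [Set.mem_union, Set.mem_Ico] at hj
             omega)))
  exact ⟨C, fun n ρ σ τ => hC n (ρ, σ, τ)⟩

end Combinators

end QCrypto

namespace QCrypto

open Function

/-! ### From public-key to secret-key encryption -/

section SecretFromPublic

variable {N : ℕ}

theorem trace_one_zero : (1 : QState 0).trace = 1 := by
  rw [Matrix.trace_one]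
  simp

theorem blk_copies_add {k : ℕ} (a t t' : ℕ) (σ : QState k) :
    blk N a (copies (t + t') σ) = blk N a (copies t σ) * blk N (a + t * k) (copies t' σ) := by
  rw [blk_copies, blk_copies, blk_copies, Finset.prod_range_add]
  congr 1
  refine Finset.prod_congr rfl fun j _ => ?_
  congr 1
  ring

/-- Measuring the two messages does not touch registers that are appended to the state; they stay a
tensor factor. -/
theorem onOutcome_onOutcome_of {a b s r k : ℕ} (X : QState (a + (b + s))) (Y : QState r)
    (hk : k = a + (b + s)) (x₀ : Fin a → Bool) (x₁ : Fin b → Bool) :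
    onOutcome (onOutcome (Matrix.of (blk (a + (b + (s + r))) 0 X *
      blk (a + (b + (s + r))) k Y) : QState (a + (b + (s + r)))) x₀) x₁ =
      tens (onOutcome (onOutcome X x₀) x₁) Y := by
  subst hk
  ext u v
  have e1 : ∀ u : Fin (s + r) → Bool, block (a + (b + s)) 0 (Fin.append x₀ (Fin.append x₁ u)) =
      Fin.append x₀ (Fin.append x₁ fun j => u (Fin.castAdd r j)) := fun u => by
    refine bits_ext fun j hj => ?_
    have e : ∀ i < s, bitAt (fun j => u (Fin.castAdd r j)) i = bitAt u i := fun i hi => by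
      rw [bitAt_of_lt _ hi, bitAt_of_lt _ (show i < s + r by omega)]
      rfl
    simp only [bitAt_block, bitAt_append, hj, if_true, Nat.zero_add]
    split_ifs <;> first | rfl | (rw [e _ (by omega)])
  have e2 : ∀ u : Fin (s + r) → Bool, block r (a + (b + s)) (Fin.append x₀ (Fin.append x₁ u)) =
      fun j => u (Fin.natAdd s j) := fun u => by
    refine bits_ext fun j hj => ?_
    simp only [bitAt_block, bitAt_append, hj, if_true]
    rw [if_neg (by omega), if_neg (by omega), bitAt_of_lt _ hj, bitAt_of_lt _ (by omega)]
    congr 1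
    ext
    simp
    omega
  simp only [onOutcome, Matrix.of_apply, Pi.mul_apply, blk, tens, e1, e2]

/-- Run `A` on some copies, and keep further copies. -/
theorem QPT.exists_keep_copies {a s p t t' : ℕ → ℕ} (ha : IsPoly a) (hs : IsPoly s) (hp : IsPoly p)
    (ht : IsPoly t) (ht' : IsPoly t')
    (A : QPT (fun n => 0 + t n * p n) (fun n => a n + (a n + s n))) :
    ∃ C : QPT (fun n => (t n + t' n) * p n) (fun n => a n + (a n + (s n + t' n * p n))),
      ∀ n (σ : QState (p n)) (x₀ x₁ : Fin (a n) → Bool),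
        onOutcome (onOutcome (C.run n (copies (t n + t' n) σ)) x₀) x₁ =
          tens (onOutcome (onOutcome (A.run n (tens 1 (copies (t n) σ))) x₀) x₁)
            (copies (t' n) σ) := by
  obtain ⟨i, hi, hi'⟩ : ∃ i, IsPoly i ∧ ∀ n, i n = (t n + t' n) * p n :=
    ⟨_, (ht.add ht').mul hp, fun _ => rfl⟩
  have htp := ht.mul hp
  have htp' := ht'.mul hp
  have has := ha.add (ha.add hs)
  have hA := A.isPoly_size ((IsPoly.const 0).add htp) has
  obtain ⟨C, hC⟩ := exists_qpt_of_tri ((ht.add ht').mul hp) (ha.add (ha.add (hs.add htp'))) hA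
    (C := fun n => applyB A n 0 (i n) (i n + (a n + (a n + (s n + t' n * p n)))) ++
      swapB (t n * p n) (i n + (a n + (a n + s n))) (t' n * p n))
    ((UGen.applyB ((IsPoly.const 0).add htp) has A (UNum.var 0) (.const 0) hi.unum
      (hi.add (ha.add (ha.add (hs.add htp')))).unum).append
      (UGen.swapB htp.unum (hi.add has).unum htp'.unum))
    (ι := fun n => QState (p n)) (fun n σ => copies (t n + t' n) σ)
    (fun n σ => Matrix.of (blk _ 0 (A.run n (tens 1 (copies (t n) σ))) *
      blk _ (a n + (a n + s n)) (copies (t' n) σ))) (by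
      intro n N σ hN
      have := hi' n
      have hadd := Nat.add_mul (t n) (t' n) (p n)
      refine ((Tri.apply A n (a := 0) (b := i n) (z := i n + (a n + (a n + (s n + t' n * p n))))
        (by omega) (by omega) (by omega) (by omega) (by omega) (by omega)
        (tens 1 (copies (t n) σ))).step (blk N (t n * p n) (copies (t' n) σ) *
        zero N (i n + (a n + (a n + s n))) (t' n * p n)) ?_ ?_ ?_ rfl).append
        ((Tri.swap (O := resetOracle) (a := t n * p n) (b := i n + (a n + (a n + s n)))
        (k := t' n * p n) (by omega) (by omega) (by omega) (copies (t' n) σ)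
        (basis fun _ => false)).step (zero N 0 (t n * p n) *
        blk N (i n) (A.run n (tens 1 (copies (t n) σ))) *
        zero N (i n + (a n + (a n + (s n + t' n * p n)))) (A.size n)) ?_ ?_ ?_ ?_)
      all_goals first
        | exact Set.subset_univ _
        | (rw [blk_copies_add, ← hi']
           simp only [blk_tens, blk_empty, trace_one_zero, one_smul, QCrypto.zero_add,
            Nat.zero_add, ← Nat.add_assoc]
           ring1)
        | (simp only [blk_basis_false, Nat.zero_add]
           ring1)
        | (rw [hadd, blk_of_mul, blk_of_blk (by omega), blk_of_blk (by omega), QCrypto.zero_add 0,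
            ← hadd, ← hi', Nat.zero_add, Nat.add_zero, blk_basis_false]
           ring1)
        | ((repeat' apply Indep.mul) <;>
            (refine Indep.blk _ fun j hj => ?_
             simp only [Set.mem_union, Set.mem_Ico] at hj
             omega)))
  refine ⟨C, fun n σ x₀ x₁ => ?_⟩
  rw [hC]
  exact onOutcome_onOutcome_of _ _ rfl x₀ x₁

/-- Encryption generates a public key from the secret key and encrypts under it. The oracle then
applies `P.enc` to a copy of the public key and the query, so both stages of an adversary can be
simulated with copies. -/
theorem ExistsQSKE.of_existsQPKE {ℓ : ℕ → ℕ} (hℓ : IsPoly ℓ) (h : ExistsQPKE ℓ) : ExistsQSKE ℓ := by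
  obtain ⟨κ, p, c, hκ, hp, hc, P, hP⟩ := h
  obtain ⟨E, hE⟩ := QPT.exists_comp hκ hp hℓ hc P.pkGen P.enc
  set S : QSKE ℓ κ c := ⟨P.skGen, E, P.dec⟩ with hS
  have hct : ∀ n sk x, S.ct n sk x = P.ct n (P.pk n sk) x := fun n sk x => by
    rw [QSKE.ct, basis_append]
    exact hE n _ _
  refine ⟨κ, c, hκ, hc, S, ?_, fun s hs A₁ A₂ => ?_⟩
  · obtain ⟨ε, hε, hc⟩ := hP.1
    refine ⟨ε, hε, fun n x => (hc n x).trans_eq ?_⟩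
    simp only [hct]
    rfl
  obtain ⟨t₁, ht₁, B₁, hB₁⟩ := OracleQPT.exists_simulation hp hℓ hc (IsPoly.const 0)
    (hℓ.add (hℓ.add hs)) P.enc A₁
  obtain ⟨t₂, ht₂, B₂, hB₂⟩ := OracleQPT.exists_simulation hp hℓ hc (hs.add hc)
    (IsPoly.const 1) P.enc A₂
  -- The first stage uses `t₁` copies and appends `t₂` further ones to its state for the second
  -- stage, whose input then has to be reordered.
  obtain ⟨D₁, hD₁⟩ := QPT.exists_keep_copies hℓ hs hp ht₁ ht₂ B₁
  obtain ⟨D₂, hD₂⟩ := QPT.exists_exchange hs (ht₂.mul hp) hc (IsPoly.const 1) B₂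
  have htr : ∀ n sk, (P.pk n sk).trace = 1 := fun n sk => by
    rw [QPKE.pk, QPT.trace_run, trace_basis]
  -- The simulation is perfect, so the two games have equal values and nothing is lost.
  have hgame : ∀ b n, S.game A₁ A₂ b n =
      P.game (t := fun n => t₁ n + t₂ n) (s := fun n => s n + t₂ n * p n) D₁ D₂ b n := by
    intro b n
    rw [QSKE.game, QPKE.game]
    refine Finset.sum_congr rfl fun sk _ => congrArg₂ _ rfl (Finset.sum_congr rfl fun x₀ _ =>
      Finset.sum_congr rfl fun x₁ _ => ?_)
    have hO : S.ct n sk = fun x => P.enc.run n (tens (P.pk n sk) (basis x)) := funext (hct n sk)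
    rw [hD₁, hD₂, hB₂ n _ _ (htr n sk), hB₁ n _ _ (htr n sk), hct, ← hO]
  have := hP.2 (fun n => t₁ n + t₂ n) (fun n => s n + t₂ n * p n) (ht₁.add ht₂)
    (hs.add (ht₂.mul hp)) D₁ D₂
  simpa only [hgame] using this

end SecretFromPublic

end QCrypto

namespace QCrypto

open Function

/-! ### Linearity -/

section Linearity

variable {N : ℕ} {i o : ℕ → ℕ}

theorem blk_readOut_exec {q m a b w : ℕ} (O : (Fin q → Bool) → QState m) (C : List (Op ℕ))
    (ρ : QState a) (hN : N = a + b + w) :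
    blk N a (readOut (Matrix.of (exec O C (blk (a + b + w) 0 ρ *
      zero (a + b + w) a (b + w)))) : QState b) =
      discard (a + b) w (discard 0 a (exec O C (blk N 0 ρ * zero N a (b + w)))) := by
  subst hN
  have := discard_readOut (N := a + b + w) (i := a) (o := b) (w := w) 0 (by omega)
    (Matrix.of (exec O C (blk (a + b + w) 0 ρ * zero (a + b + w) a (b + w))))
  rw [blk_zero_self, Nat.zero_add] at this
  exact this.symm

theorem OracleQPT.blk_run {q m : ℕ → ℕ} (A : OracleQPT q m i o) (n : ℕ)
    (O : (Fin (q n) → Bool) → QState (m n)) (ρ : QState (i n)) (hN : N = i n + o n + A.work n) :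
    blk N (i n) (A.run n O ρ) = discard (i n + o n) (A.work n) (discard 0 (i n)
      (exec O (A.circ n) (blk N 0 ρ * zero N (i n) (o n + A.work n)))) := by
  rw [OracleQPT.run_eq, blk_readOut_exec _ _ _ hN]

theorem QPT.blk_run (A : QPT i o) (n : ℕ) (ρ : QState (i n)) (hN : N = i n + o n + A.work n) :
    blk N (i n) (A.run n ρ) = discard (i n + o n) (A.work n) (discard 0 (i n)
      (exec resetOracle ((A.circ n).map .gate) (blk N 0 ρ * zero N (i n) (o n + A.work n)))) := by
  rw [QPT.run_eq (O := resetOracle), blk_readOut_exec _ _ _ hN]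

theorem discard_sum {ι : Type*} (s : Finset ι) (a k : ℕ) (f : ι → Amp N) :
    discard a k (∑ j ∈ s, f j) = ∑ j ∈ s, discard a k (f j) := by
  funext x y
  simp only [discard, Finset.sum_apply]
  exact Finset.sum_comm

theorem discard_smul (c : ℂ) (a k : ℕ) (α : Amp N) : discard a k (c • α) = c • discard a k α := by
  funext x y
  simp only [discard, Pi.smul_apply, smul_eq_mul, Finset.mul_sum]

theorem blk_sum {k : ℕ} {ι : Type*} (s : Finset ι) (a : ℕ) (f : ι → QState k) :
    blk N a (∑ j ∈ s, f j) = ∑ j ∈ s, blk N a (f j) := by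
  funext x y
  simp only [blk, Finset.sum_apply, Matrix.sum_apply]

theorem blk_smul {k : ℕ} (c : ℂ) (a : ℕ) (σ : QState k) : blk N a (c • σ) = c • blk N a σ := rfl

/-- On the full set of wires a run is a circuit followed by partial traces, all of which are linear,
and placing the output on its wires is injective. -/
theorem QPT.run_sum {ι : Type*} (s : Finset ι) (A : QPT i o) (n : ℕ) (f : ι → QState (i n)) :
    A.run n (∑ j ∈ s, f j) = ∑ j ∈ s, A.run n (f j) := by
  refine blk_injective (N := i n + o n + A.work n) (a := i n) (by omega) ?_
  rw [A.blk_run n _ rfl, blk_sum, blk_sum, Finset.sum_mul, exec_sum, discard_sum, discard_sum]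
  exact Finset.sum_congr rfl fun j _ => (A.blk_run n _ rfl).symm

theorem QPT.run_smul (A : QPT i o) (n : ℕ) (c : ℂ) (σ : QState (i n)) :
    A.run n (c • σ) = c • A.run n σ := by
  refine blk_injective (N := i n + o n + A.work n) (a := i n) (by omega) ?_
  rw [A.blk_run n _ rfl, blk_smul, blk_smul, smul_mul_assoc, exec_smul, discard_smul, discard_smul,
    A.blk_run n _ rfl]

theorem tens_sum_left {ι : Type*} {a b : ℕ} (s : Finset ι) (f : ι → QState a) (σ : QState b) :
    tens (∑ j ∈ s, f j) σ = ∑ j ∈ s, tens (f j) σ := by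
  ext x y
  simp only [tens, Matrix.sum_apply, Finset.sum_mul]

theorem tens_smul_left {a b : ℕ} (c : ℂ) (ρ : QState a) (σ : QState b) :
    tens (c • ρ) σ = c • tens ρ σ := by
  ext x y
  simp only [tens, Matrix.smul_apply, smul_eq_mul, mul_assoc]

theorem prob_sum {ι : Type*} {k : ℕ} (s : Finset ι) (f : ι → QState k) (x : Fin k → Bool) :
    prob (∑ j ∈ s, f j) x = ∑ j ∈ s, prob (f j) x := by
  simp only [prob, Matrix.sum_apply, Complex.re_sum]

theorem onOutcome_sum {ι : Type*} {a b : ℕ} (s : Finset ι) (f : ι → QState (a + b))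
    (x : Fin a → Bool) : onOutcome (∑ j ∈ s, f j) x = ∑ j ∈ s, onOutcome (f j) x := by
  ext u v
  simp only [onOutcome, Matrix.sum_apply]

theorem onOutcome_basis_tens {a b : ℕ} (u x : Fin a → Bool) (σ : QState b) :
    onOutcome (tens (basis u) σ) x = if x = u then σ else 0 := by
  ext v w
  simp only [onOutcome, tens, Fin.append_left, Fin.append_right, basis, Matrix.single_apply,
    eq_comm (a := u), and_self]
  split_ifs
  · rw [one_mul]
  · rw [zero_mul]; rfl

end Linearity

/-! ### From secret-key to public-key encryption -/

/-- The message of length `k` that starts with the bit `b`, followed by zeros. -/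
def firstBit (k : ℕ) (b : Bool) : Fin k → Bool := fun j => if (j : ℕ) = 0 then b else false

section FirstBit

variable {N : ℕ}

theorem blk_firstBit (a k : ℕ) (b : Bool) :
    blk N a (basis (firstBit (1 + k) b)) = bit N a b * zero N (a + 1) k := by
  have : firstBit (1 + k) b = Fin.append (fun _ : Fin 1 => b) fun _ => false :=
    bits_ext fun j hj => by
      rw [bitAt_append, bitAt_of_lt _ hj]
      by_cases h : j = 0
      · subst h; simp [firstBit, bitAt]
      · rw [if_neg (by omega), bitAt_of_lt _ (show j - 1 < k by omega)]
        simp [firstBit, h]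
  rw [this, basis_append, blk_tens]
  rfl

theorem firstBit_false (k : ℕ) : firstBit k false = fun _ => false := by
  funext j
  simp [firstBit]

/-- Flip the first wire of a block of length `k`, if there is one. -/
def setFirstB (a k : ℕ) : List (Op ℕ) := (List.range (1 - (1 - k))).flatMap fun j => flipB (a + j)

theorem UGen.setFirstB {a k : (ℕ → ℕ) → ℕ} (ha : UNum a) (hk : UNum k) :
    UGen fun e => QCrypto.setFirstB (a e) (k e) :=
  UGen.range (F := fun a _ _ j => QCrypto.flipB (a + j)) ha ha ha
    ((UNum.const 1).sub ((UNum.const 1).sub hk)) fun _ _ _ _ ha _ _ hj => UGen.flipB (ha.add hj)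

/-- The iteration count `1 - (1 - k)` is `1` unless `k = 0`. Blocks of length zero have to be
admitted because the message length may vanish at security parameter `0`. -/
theorem Tri.setFirst {q m : ℕ} {O : (Fin q → Bool) → QState m} {a k : ℕ} (h : a + k ≤ N) :
    Tri O (setFirstB a k) (Set.Ico a (a + k)) (zero N a k) (blk N a (basis (firstBit k true))) := by
  rcases Nat.eq_zero_or_pos k with rfl | hk
  · have : firstBit 0 true = fun _ => false := Subsingleton.elim _ _
    rw [this]
    exact Tri.nil _ _
  · obtain ⟨k, rfl⟩ : ∃ l, k = 1 + l := ⟨k - 1, by omega⟩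
    have h1 : setFirstB a (1 + k) = flipB a := by
      rw [setFirstB, show 1 - (1 - (1 + k)) = 1 by omega]
      simp
    rw [h1, blk_firstBit]
    refine (Tri.flip (O := O) (show a < N by omega) false).step (zero N (a + 1) k) ?_ ?_ ?_ rfl
    · intro j hj
      simp only [Set.mem_singleton_iff, Set.mem_Ico] at hj ⊢
      omega
    · exact Indep.zero fun j hj => by
        simp only [Set.mem_singleton_iff] at hj
        omega
    · rw [QCrypto.zero_add]
      rfl

/-- Move the wire `a` to the first wire of the block of length `k` at `b`, if there is one. -/
def toFirstB (a b k : ℕ) : List (Op ℕ) := swapB a b (1 - (1 - k)) ++ resetB a 1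

theorem UGen.toFirstB {a b k : (ℕ → ℕ) → ℕ} (ha : UNum a) (hb : UNum b) (hk : UNum k) :
    UGen fun e => QCrypto.toFirstB (a e) (b e) (k e) :=
  (UGen.swapB ha hb ((UNum.const 1).sub ((UNum.const 1).sub hk))).append
    (UGen.resetB ha (UNum.const 1))

/-- Turns a bit into the message that encodes it. If the block is empty, the bit is merely erased,
in accordance with there being only one string of length zero. -/
theorem Tri.toFirst {a b k : ℕ} (ha : a < N) (hb : b + k ≤ N) (hab : a < b ∨ b + k ≤ a)
    (u : Fin 1 → Bool) :
    Tri resetOracle (toFirstB a b k) (Set.Ico a (a + 1) ∪ Set.Ico b (b + k))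
      (blk N a (basis u) * zero N b k) (zero N a 1 * blk N b (basis (firstBit k (u 0)))) := by
  have hu : u = fun _ => u 0 := bits_one_ext rfl
  rcases Nat.eq_zero_or_pos k with rfl | hk
  · have h1 : toFirstB a b 0 = resetB a 1 := rfl
    have h2 : firstBit 0 (u 0) = fun _ => false := Subsingleton.elim _ _
    have h3 := Tri.reset (N := N) (a := a) (k := 1) (by omega) (basis u)
    rw [trace_basis, one_smul] at h3
    rw [h1, h2, blk_basis_false, zero_zero, mul_one, mul_one]
    exact h3.mono Set.subset_union_left
  · obtain ⟨k, rfl⟩ : ∃ l, k = 1 + l := ⟨k - 1, by omega⟩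
    have h3 := Tri.reset (N := N) (a := a) (k := 1) (by omega) (basis fun _ => false)
    rw [trace_basis, one_smul] at h3
    rw [toFirstB, show 1 - (1 - (1 + k)) = 1 by omega, blk_firstBit, QCrypto.zero_add]
    refine ((Tri.swap (O := resetOracle) (a := a) (b := b) (k := 1) (by omega) (by omega) (by omega)
      (basis u) (basis fun _ => false)).step (zero N (b + 1) k) ?_ ?_ ?_ rfl).append
      (h3.step (bit N b (u 0) * zero N (b + 1) k) ?_ ?_ ?_ ?_)
    all_goals first
      | ring1
      | (simp only [← blk_basis_false, bit]; ring1)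
      | (simp only [← blk_basis_false, bit, ← hu]; ring1)
      | (intro j hj
         simp only [Set.mem_union, Set.mem_Ico] at hj ⊢
         omega)
      | ((repeat' apply Indep.mul) <;>
          (refine Indep.blk _ fun j hj => ?_
           simp only [Set.mem_union, Set.mem_Ico] at hj
           omega))

end FirstBit

end QCrypto

namespace QCrypto

open Function

/-! ### Circuits of the one-bit public-key scheme -/

section PublicFromSecret

variable {N : ℕ} {ℓ κ c : ℕ → ℕ}

/-- Prepare encryptions of `0` and of `1`. -/
theorem QPT.exists_encrypt_both (hℓ : IsPoly ℓ) (hκ : IsPoly κ) (hc : IsPoly c)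
    (E : QPT (fun n => κ n + ℓ n) c) :
    ∃ C : QPT κ (fun n => c n + c n), ∀ n (sk : Fin (κ n) → Bool), C.run n (basis sk) =
      tens (E.run n (basis (Fin.append sk (firstBit (ℓ n) false))))
        (E.run n (basis (Fin.append sk (firstBit (ℓ n) true)))) := by
  have hE := E.isPoly_size (hκ.add hℓ) hc
  obtain ⟨w, hw, hw'⟩ : ∃ w, IsPoly w ∧ ∀ n, w n = κ n + ℓ n + E.size n :=
    ⟨_, (hκ.add hℓ).add hE, fun _ => rfl⟩
  obtain ⟨U, hU, hU'⟩ : ∃ U, IsPoly U ∧ ∀ n, U n = κ n + c n + c n :=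
    ⟨_, (hκ.add hc).add hc, fun _ => rfl⟩
  obtain ⟨Z, hZ, hZ'⟩ : ∃ Z, IsPoly Z ∧ ∀ n, Z n = U n + κ n + ℓ n :=
    ⟨_, (hU.add hκ).add hℓ, fun _ => rfl⟩
  have hκℓ := hκ.add hℓ
  refine exists_qpt_of_tri hκ (hc.add hc) hw
    (C := fun n => copyB 0 (U n) (κ n) ++ (applyB E n (U n) (κ n) (Z n) ++
      (copyB 0 (U n) (κ n) ++ (setFirstB (U n + κ n) (ℓ n) ++
      (applyB E n (U n) (κ n + c n) (Z n) ++ resetB 0 (κ n))))))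
    ((UGen.copyB (.const 0) hU.unum hκ.unum).append
      ((UGen.applyB hκℓ hc E (UNum.var 0) hU.unum hκ.unum hZ.unum).append
      ((UGen.copyB (.const 0) hU.unum hκ.unum).append
      ((UGen.setFirstB (hU.add hκ).unum hℓ.unum).append
      ((UGen.applyB hκℓ hc E (UNum.var 0) hU.unum (hκ.add hc).unum hZ.unum).append
      (UGen.resetB (.const 0) hκ.unum))))))
    (ι := fun n => Fin (κ n) → Bool) (fun n sk => basis sk) _ ?_
  intro n N sk hN
  have := hU' n; have := hZ' n; have := hw' n
  have hr := Tri.reset (N := N) (a := 0) (k := κ n) (by omega) (basis sk)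
  rw [trace_basis, one_smul] at hr
  set ct := fun b => E.run n (basis (Fin.append sk (firstBit (ℓ n) b))) with hct
  -- Applying `E` consumes its input, so the key is copied afresh for each of the two encryptions.
  refine ((Tri.copy (O := resetOracle) (a := 0) (b := U n) (k := κ n) (by omega) (by omega)
    (by omega) sk).step (zero N (κ n) (c n) * zero N (κ n + c n) (c n) * zero N (U n + κ n) (ℓ n) *
    zero N (Z n) (E.size n)) ?_ ?_ ?_ rfl).append
    (((Tri.apply E n (a := U n) (b := κ n) (z := Z n) (by omega) (by omega) (by omega) (by omega)
    (by omega) (by omega) (basis (Fin.append sk (firstBit (ℓ n) false)))).step (blk N 0 (basis sk) *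
    zero N (κ n + c n) (c n)) ?_ ?_ ?_ rfl).append
    (((Tri.copy (O := resetOracle) (a := 0) (b := U n) (k := κ n) (by omega) (by omega)
    (by omega) sk).step (blk N (κ n) (ct false) * zero N (κ n + c n) (c n) *
    zero N (U n + κ n) (ℓ n) * zero N (Z n) (E.size n)) ?_ ?_ ?_ rfl).append
    (((Tri.setFirst (O := resetOracle) (a := U n + κ n) (k := ℓ n) (by omega)).step
    (blk N 0 (basis sk) * blk N (U n) (basis sk) * blk N (κ n) (ct false) *
    zero N (κ n + c n) (c n) * zero N (Z n) (E.size n)) ?_ ?_ ?_ rfl).append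
    (((Tri.apply E n (a := U n) (b := κ n + c n) (z := Z n) (by omega) (by omega) (by omega)
    (by omega) (by omega) (by omega) (basis (Fin.append sk (firstBit (ℓ n) true)))).step
    (blk N 0 (basis sk) * blk N (κ n) (ct false)) ?_ ?_ ?_ rfl).append
    (hr.step (blk N (κ n) (ct false) * blk N (κ n + c n) (ct true) * zero N (U n) (κ n) *
    zero N (U n + κ n) (ℓ n) * zero N (Z n) (E.size n)) ?_ ?_ ?_ ?_)))))
  all_goals first
    | exact Set.subset_univ _
    | (simp only [hw', hU', hZ', hct, firstBit_false, basis_append, blk_basis_false, blk_tens,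
        QCrypto.zero_add, Nat.zero_add, ← Nat.add_assoc]
       ring1)
    | ((repeat' apply Indep.mul) <;>
        (refine Indep.blk _ fun j hj => ?_
         simp only [Set.mem_union, Set.mem_Ico] at hj
         omega))

/-- Keep one of two states, according to a bit. -/
theorem QPT.exists_select (hc : IsPoly c) :
    ∃ C : QPT (fun n => (c n + c n) + 1) c, ∀ n (ρ₀ ρ₁ : QState (c n)), ρ₀.trace = 1 →
      ρ₁.trace = 1 → ∀ x : Fin 1 → Bool,
        C.run n (tens (tens ρ₀ ρ₁) (basis x)) = if x 0 then ρ₁ else ρ₀ := by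
  have : ∀ n, Nonempty {ρ : QState (c n) // ρ.trace = 1} := fun n =>
    ⟨⟨_, trace_basis fun _ => false⟩⟩
  obtain ⟨C, hC⟩ := exists_qpt_of_tri ((hc.add hc).add (.const 1)) hc (.const 0)
    (C := fun n => cswapB (c n + c n) 0 (c n) (c n) ++ (swapB 0 (c n + c n + 1) (c n) ++
      (resetB (c n) (c n) ++ resetB (c n + c n) 1)))
    ((UGen.cswapB (hc.add hc).unum (.const 0) hc.unum hc.unum).append
      ((UGen.swapB (.const 0) ((hc.add hc).add (.const 1)).unum hc.unum).append
      ((UGen.resetB hc.unum hc.unum).append (UGen.resetB (hc.add hc).unum (.const 1)))))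
    (ι := fun n => {ρ : QState (c n) // ρ.trace = 1} × {ρ : QState (c n) // ρ.trace = 1} ×
      (Fin 1 → Bool))
    (fun n v => tens (tens v.1.1 v.2.1.1) (basis v.2.2))
    (fun n v => if v.2.2 0 then v.2.1.1 else v.1.1) (by
      rintro n N ⟨⟨ρ₀, h₀⟩, ⟨ρ₁, h₁⟩, x⟩ hN
      -- The state that is not selected gets erased; being normalised, it leaves no scalar behind.
      have hr := Tri.reset (N := N) (a := c n) (k := c n) (by omega) (if x 0 then ρ₀ else ρ₁)
      rw [show (if x 0 then ρ₀ else ρ₁).trace = 1 by split_ifs <;> assumption, one_smul] at hr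
      have hr' := Tri.reset (N := N) (a := c n + c n) (k := 1) (by omega) (basis x)
      rw [trace_basis, one_smul] at hr'
      have hx : bitAt x (c n + c n - (c n + c n)) = x 0 := by simp [bitAt]
      have hctrl := Ctrl.blk_basis (N := N) (a := c n + c n) (c := c n + c n) x le_rfl (by omega)
      rw [hx] at hctrl
      refine ((Tri.cswap (O := resetOracle) (c := c n + c n) (a := 0) (b := c n) (k := c n)
        (γ := blk N (c n + c n) (basis x)) (by omega)
        (by omega) (by omega) (by omega) (by omega) (by omega) hctrl ?_ ρ₀ ρ₁).step
        (zero N (c n + c n + 1) (c n)) ?_ ?_ ?_ rfl).append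
        (((Tri.swap (O := resetOracle) (a := 0) (b := c n + c n + 1) (k := c n) (by omega) (by omega)
        (by omega) (if x 0 then ρ₁ else ρ₀) (basis fun _ => false)).step
        (blk N (c n) (if x 0 then ρ₀ else ρ₁) * blk N (c n + c n) (basis x)) ?_ ?_ ?_ rfl).append
        ((hr.step (zero N 0 (c n) * blk N (c n + c n + 1) (if x 0 then ρ₁ else ρ₀) *
        blk N (c n + c n) (basis x)) ?_ ?_ ?_ rfl).append
        (hr'.step (zero N 0 (c n) * zero N (c n) (c n) *
        blk N (c n + c n + 1) (if x 0 then ρ₁ else ρ₀)) ?_ ?_ ?_ ?_)))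
      all_goals first
        | exact Set.subset_univ _
        | ring1
        | (simp only [blk_basis_false, blk_tens, QCrypto.zero_add, zero_zero, Nat.zero_add,
            ← Nat.add_assoc]
           ring1)
        | ((repeat' apply Indep.mul) <;>
            (refine Indep.blk _ fun j hj => ?_
             simp only [Set.mem_union, Set.mem_Ico] at hj
             omega)))
  exact ⟨C, fun n ρ₀ ρ₁ h₀ h₁ x => hC n (⟨ρ₀, h₀⟩, ⟨ρ₁, h₁⟩, x)⟩

/-- Measure the first two output bits, and turn them into messages of length `ℓ n`. -/
theorem QPT.exists_measure_bits {i s : ℕ → ℕ} (hi : IsPoly i) (hℓ : IsPoly ℓ) (hs : IsPoly s)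
    (A : QPT i (fun n => 1 + (1 + s n))) :
    ∃ C : QPT i (fun n => ℓ n + (ℓ n + s n)), ∀ n (ρ : QState (i n)), C.run n ρ =
      ∑ u : Fin 1 → Bool, ∑ v : Fin 1 → Bool, tens (basis (firstBit (ℓ n) (u 0)))
        (tens (basis (firstBit (ℓ n) (v 0))) (onOutcome (onOutcome (A.run n ρ) u) v)) := by
  have ho : IsPoly fun n => 1 + (1 + s n) := (IsPoly.const 1).add ((IsPoly.const 1).add hs)
  have hA := A.isPoly_size hi ho
  obtain ⟨w, hw, hw'⟩ : ∃ w, IsPoly w ∧ ∀ n, w n = 1 + (1 + s n) + 1 + A.size n :=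
    ⟨_, (ho.add (.const 1)).add hA, fun _ => rfl⟩
  obtain ⟨U, hU, hU'⟩ : ∃ U, IsPoly U ∧ ∀ n, U n = i n + ℓ n + ℓ n + s n :=
    ⟨_, ((hi.add hℓ).add hℓ).add hs, fun _ => rfl⟩
  obtain ⟨D, hD, hD'⟩ : ∃ D, IsPoly D ∧ ∀ n, D n = U n + 1 + 1 + s n :=
    ⟨_, ((hU.add (.const 1)).add (.const 1)).add hs, fun _ => rfl⟩
  refine exists_qpt_of_tri hi (hℓ.add (hℓ.add hs)) hw
    (C := fun n => applyB A n 0 (U n) (D n + 1) ++ (dephB (U n) 2 (D n) ++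
      (toFirstB (U n) (i n) (ℓ n) ++ (toFirstB (U n + 1) (i n + ℓ n) (ℓ n) ++
      swapB (U n + 1 + 1) (i n + ℓ n + ℓ n) (s n)))))
    ((UGen.applyB hi ho A (UNum.var 0) (.const 0) hU.unum (hD.add (.const 1)).unum).append
      ((UGen.dephB hU.unum (.const 2) hD.unum).append ((UGen.toFirstB hU.unum hi.unum hℓ.unum).append
      ((UGen.toFirstB (hU.add (.const 1)).unum (hi.add hℓ).unum hℓ.unum).append
      (UGen.swapB ((hU.add (.const 1)).add (.const 1)).unum ((hi.add hℓ).add hℓ).unum hs.unum)))))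
    (ι := fun n => QState (i n)) (fun n ρ => ρ) _ ?_
  intro n N ρ hN
  have := hU' n; have := hD' n; have := hw' n
  set R : Amp N := zero N 0 (i n) * zero N (i n) (ℓ n) * zero N (i n + ℓ n) (ℓ n) *
    zero N (i n + ℓ n + ℓ n) (s n) * zero N (D n + 1) (A.size n) with hR
  refine ((Tri.apply A n (a := 0) (b := U n) (z := D n + 1) (by omega) (by omega) (by omega)
    (by omega) (by omega) (by omega) ρ).step (zero N (i n) (ℓ n) * zero N (i n + ℓ n) (ℓ n) *
    zero N (i n + ℓ n + ℓ n) (s n) * zero N (D n) 1) ?_ ?_ ?_ rfl).append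
    (((Tri.deph (a := U n) (k := 2) (s := D n) (by omega) (by omega) (by omega)).step
    (blk N (U n) (A.run n ρ) * R) ?_ ?_ ?_ rfl).append (γ :=
      zero N 0 (i n) * blk N (i n) (∑ u : Fin 1 → Bool, ∑ v : Fin 1 → Bool,
        tens (basis (firstBit (ℓ n) (u 0))) (tens (basis (firstBit (ℓ n) (v 0)))
        (onOutcome (onOutcome (A.run n ρ) u) v))) * zero N (i n + (ℓ n + (ℓ n + s n))) (w n)) ?_)
  case refine_7 =>
    -- Dephasing the two message bits splits the state into four branches with definite bits; the
    -- rest of the circuit is verified in each branch and the results are added.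
    have e1 : diagB N (U n) 2 * zero N (D n) 1 * (blk N (U n) (A.run n ρ) * R) =
        ∑ u : Fin 1 → Bool, ∑ v : Fin 1 → Bool, (blk N (U n) (basis u) * blk N (U n + 1) (basis v) *
          blk N (U n + 1 + 1) (onOutcome (onOutcome (A.run n ρ) u) v)) * (zero N (D n) 1 * R) := by
      have e0 : diagB N (U n) 2 * zero N (D n) 1 * (blk N (U n) (A.run n ρ) * R) =
          ((blk N (U n) (A.run n ρ) * diagB N (U n) 1) * diagB N (U n + 1) 1) *
            (zero N (D n) 1 * R) := by
        rw [show 2 = 1 + 1 from rfl, diagB_append]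
        ring
      rw [e0, blk_mul_diagB, Finset.sum_mul, Finset.sum_mul]
      refine Finset.sum_congr rfl fun u _ => ?_
      rw [mul_assoc, mul_assoc, ← mul_assoc (blk N (U n + 1) _) (diagB N (U n + 1) 1),
        blk_mul_diagB, Finset.sum_mul, Finset.mul_sum]
      exact Finset.sum_congr rfl fun v _ => by ring
    rw [e1, blk_sum, Finset.mul_sum, Finset.sum_mul]
    refine Tri.sum fun u => ?_
    rw [blk_sum, Finset.mul_sum, Finset.sum_mul]
    refine Tri.sum fun v => ?_
    set σ := onOutcome (onOutcome (A.run n ρ) u) v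
    refine ((Tri.toFirst (a := U n) (b := i n) (k := ℓ n) (by omega) (by omega) (by omega) u).step
      (blk N (U n + 1) (basis v) * blk N (U n + 1 + 1) σ * zero N 0 (i n) *
      zero N (i n + ℓ n) (ℓ n) * zero N (i n + ℓ n + ℓ n) (s n) * zero N (D n) 1 *
      zero N (D n + 1) (A.size n)) ?_ ?_ ?_ rfl).append
      (((Tri.toFirst (a := U n + 1) (b := i n + ℓ n) (k := ℓ n) (by omega) (by omega) (by omega)
      v).step (zero N (U n) 1 * blk N (i n) (basis (firstBit (ℓ n) (u 0))) *
      blk N (U n + 1 + 1) σ * zero N 0 (i n) * zero N (i n + ℓ n + ℓ n) (s n) * zero N (D n) 1 *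
      zero N (D n + 1) (A.size n)) ?_ ?_ ?_ rfl).append
      ((Tri.swap (O := resetOracle) (a := U n + 1 + 1) (b := i n + ℓ n + ℓ n) (k := s n) (by omega)
      (by omega) (by omega) σ (basis fun _ => false)).step (zero N (U n) 1 * zero N (U n + 1) 1 *
      blk N (i n) (basis (firstBit (ℓ n) (u 0))) * blk N (i n + ℓ n) (basis (firstBit (ℓ n) (v 0))) *
      zero N 0 (i n) * zero N (D n) 1 * zero N (D n + 1) (A.size n)) ?_ ?_ ?_ ?_))
    all_goals first
      | exact Set.subset_univ _
      | (simp only [hR, hw', hU', hD', blk_basis_false, blk_tens, QCrypto.zero_add, Nat.zero_add,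
          ← Nat.add_assoc]
         ring1)
      | ((repeat' apply Indep.mul) <;>
          (refine Indep.blk _ fun j hj => ?_
           simp only [Set.mem_union, Set.mem_Ico] at hj
           omega))
  all_goals first
    | exact Set.subset_univ _
    | (simp only [hR, hw', hU', hD', blk_basis_false, blk_tens, QCrypto.zero_add, Nat.zero_add,
        ← Nat.add_assoc]
       ring1)
    | ((repeat' apply Indep.mul) <;>
        (refine Indep.blk _ fun j hj => ?_
         simp only [Set.mem_union, Set.mem_Ico, Set.mem_singleton_iff] at hj
         omega))

end PublicFromSecret

end QCrypto

namespace QCrypto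

open Function

/-! ### Delivering an output without resets -/

section SwapDiscard

variable {N q m : ℕ} {O : (Fin q → Bool) → QState m}

/-- Tracing out wires after a rearrangement is the same as tracing out, before it, the wires that
they come from. -/
theorem Permutes.discard_exec {C : List (Op ℕ)} {π : ℕ → ℕ} (hC : Permutes O N C (moveBits π))
    {a b k : ℕ} (hπ : ∀ i < N, π i < N)
    (h : ∀ i < N, (a ≤ π i ∧ π i < a + k ↔ b ≤ i ∧ i < b + k) ∧ (b ≤ i → i < b + k → π i - a = i - b))
    (α : Amp N) : discard a k (exec O C α) = exec O C (discard b k α) := by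
  have key : ∀ (z : Fin k → Bool) (x : Fin N → Bool),
      moveBits π (overwrite a z x) = overwrite b z (moveBits π x) := fun z x =>
    bits_ext fun i hi => by
      obtain ⟨h1, h2⟩ := h i hi
      simp only [bitAt_moveBits _ _ hi, bitAt_overwrite, hi, hπ i hi, true_and]
      by_cases hb : b ≤ i ∧ i < b + k
      · rw [if_pos hb, if_pos (h1.2 hb), h2 hb.1 hb.2]
      · rw [if_neg hb, if_neg fun ha => hb (h1.1 ha)]
  funext x y
  rw [hC]
  simp only [discard]
  refine Finset.sum_congr rfl fun z _ => ?_
  rw [hC, key, key]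

theorem swapIndex_lt {a b k i : ℕ} (ha : a + k ≤ N) (hb : b + k ≤ N) (hi : i < N) :
    swapIndex a b k i < N := by
  simp only [swapIndex]
  split_ifs <;> omega

theorem discard_exec_swapB {a b k : ℕ} (ha : a + k ≤ N) (hb : b + k ≤ N)
    (hab : a + k ≤ b ∨ b + k ≤ a) (α : Amp N) :
    discard a k (exec O (swapB a b k) α) = exec O (swapB a b k) (discard b k α) :=
  (Permutes.swapB ha hb hab).discard_exec (fun i hi => swapIndex_lt ha hb hi) (fun i hi => by
    simp only [swapIndex]
    split_ifs <;> omega) α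

theorem discard_exec_swapB_of_disjoint {a b k c l : ℕ} (ha : a + k ≤ N) (hb : b + k ≤ N)
    (hab : a + k ≤ b ∨ b + k ≤ a) (hca : c + l ≤ a ∨ a + k ≤ c) (hcb : c + l ≤ b ∨ b + k ≤ c)
    (α : Amp N) : discard c l (exec O (swapB a b k) α) = exec O (swapB a b k) (discard c l α) :=
  (Permutes.swapB ha hb hab).discard_exec (fun i hi => swapIndex_lt ha hb hi) (fun i hi => by
    simp only [swapIndex]
    split_ifs <;> omega) α

theorem exec_swapB_blk {a b k : ℕ} (ha : a + k ≤ N) (hb : b + k ≤ N)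
    (hab : a + k ≤ b ∨ b + k ≤ a) (σ : QState k) :
    exec O (swapB a b k) (blk N a σ) = blk N b σ := by
  funext x y
  rw [Permutes.swapB ha hb hab]
  have h : ∀ x : Fin N → Bool, block k a (moveBits (swapIndex a b k) x) = block k b x := fun x =>
    block_moveBits x ha fun i hi => by
      rw [swapIndex, if_pos (by omega)]
      omega
  simp only [blk, h]

theorem discard_blk_mul {a k : ℕ} (h : a + k ≤ N) {σ : QState k} (hσ : σ.trace = 1) {r : Amp N}
    (hr : Indep (Set.Ico a (a + k)) r) : discard a k (blk N a σ * r) = r := by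
  rw [discard_mul _ hr subset_rfl, discard_blk h, hσ, one_smul, one_mul]

/-- An algorithm with an encryption oracle has no resets at its disposal, so the embedded algorithm
leaves garbage. Its output is swapped to the output wires, and the garbage disappears when
everything else is traced out at the end. -/
theorem discard_exec_swapB_readOut {i o w l : ℕ} (τ : QState (i + o + w)) {σ : QState l}
    (hσ : σ.trace = 1) (hN : N = o + (l + (i + o + w))) :
    discard o (l + (i + o + w)) (exec O (swapB (o + l + i) 0 o)
      (blk N (o + l) τ * (blk N o σ * zero N 0 o))) = blk N 0 (readOut τ) := by
  have hread := discard_readOut (N := N) (o + l) (by omega) τ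
  have hG : Indep (Set.Ico 0 (o + l)) (blk N (o + l) τ) := Indep.blk _ fun j hj => by
    simp only [Set.mem_Ico] at hj
    omega
  generalize blk N (o + l) τ = G at hread hG ⊢
  have h1 : discard o l (G * (blk N o σ * zero N 0 o)) = G * zero N 0 o := by
    rw [mul_left_comm, discard_blk_mul (by omega) hσ]
    exact (hG.mono (Set.Ico_subset_Ico (by omega) le_rfl)).mul (Indep.zero fun j hj => by
      simp only [Set.mem_Ico] at hj
      omega)
  have h2 : discard (o + l) i (G * zero N 0 o) = discard (o + l) i G * zero N 0 o :=
    discard_mul _ (Indep.zero fun j hj => by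
      simp only [Set.mem_Ico] at hj
      omega) subset_rfl
  have h3 : discard 0 o (discard (o + l) i G * zero N 0 o) = discard (o + l) i G := by
    rw [mul_comm]
    exact discard_blk_mul (by omega) (trace_basis _)
      ((hG.mono (Set.Ico_subset_Ico le_rfl (by omega))).discard _ _)
  rw [discard_append, discard_append, discard_append,
    discard_exec_swapB_of_disjoint (by omega) (by omega) (by omega) (by omega) (by omega),
    discard_exec_swapB_of_disjoint (by omega) (by omega) (by omega) (by omega) (by omega),
    discard_exec_swapB (by omega) (by omega) (by omega),
    discard_exec_swapB_of_disjoint (by omega) (by omega) (by omega) (by omega) (by omega),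
    h1, h2, h3, ← Nat.add_assoc, hread, exec_swapB_blk (by omega) (by omega) (by omega)]

end SwapDiscard

/-! ### The reduction from public-key to secret-key security -/

section PublicFromSecret

variable {N : ℕ} {ℓ c : ℕ → ℕ}

theorem mul_add_le_mul {j t : ℕ} (k : ℕ) (h : j < t) : j * k + k ≤ t * k := by
  rw [← Nat.succ_mul]
  exact Nat.mul_le_mul_right _ h

/-- Obtain copies of `O 0…0 ⊗ O 10…0` from the oracle, and run `B` on them. -/
theorem OracleQPT.exists_run_copies {t o : ℕ → ℕ} (hℓ : IsPoly ℓ) (hc : IsPoly c) (ht : IsPoly t)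
    (ho : IsPoly o) (B : QPT (fun n => t n * (c n + c n)) o) :
    ∃ A : OracleQPT ℓ c (fun _ => 0) o, ∀ n O, A.run n O 1 =
      B.run n (copies (t n) (tens (O (firstBit (ℓ n) false)) (O (firstBit (ℓ n) true)))) := by
  obtain ⟨k, hk, hk'⟩ : ∃ k, IsPoly k ∧ ∀ n, k n = c n + c n := ⟨_, hc.add hc, fun _ => rfl⟩
  have htk := ht.mul hk
  obtain ⟨W, hW, hW'⟩ : ∃ W, IsPoly W ∧ ∀ n, W n = ℓ n + (t n * (c n + c n) + o n + B.work n) :=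
    ⟨_, hℓ.add (((ht.mul (hc.add hc)).add ho).add B.work_poly), fun _ => rfl⟩
  obtain ⟨z, hz, hz'⟩ : ∃ z, IsPoly z ∧ ∀ n, z n = o n + ℓ n := ⟨_, ho.add hℓ, fun _ => rfl⟩
  -- All queries use one message register at `o n`. It starts as `0…0`, which gives the first halves
  -- of all copies; then its first bit is flipped once, and the second halves are requested.
  set C : ℕ → List (Op ℕ) := fun n =>
    ((List.range (t n)).flatMap (fun j => [.query (o n) (z n + j * k n)]) ++
    (setFirstB (o n) (ℓ n) ++
    ((List.range (t n)).flatMap (fun j => [.query (o n) (z n + j * k n + c n)]) ++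
    ((B.circ n).map (Gate.map (z n + ·))).map .gate))) with hC
  have hCu : UGen fun e => C (e 0) ++ swapB (z (e 0) + t (e 0) * k (e 0)) 0 (o (e 0)) := by
    refine .append (.append ?_ (.append (UGen.setFirstB ho.unum hℓ.unum) (.append ?_ ?_)))
      (UGen.swapB (hz.add htk).unum (.const 0) ho.unum)
    · exact UGen.range_one (F := fun n j => [.query (o n) (z n + j * k n)]) ht.unum
        (UGen.query ho.unum (hz.unum.add ((UNum.var 1).mul hk.unum)))
    · exact UGen.range_one (F := fun n j => [.query (o n) (z n + j * k n + c n)]) ht.unum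
        (UGen.query ho.unum ((hz.unum.add ((UNum.var 1).mul hk.unum)).add hc.unum))
    · exact (UGen.splice B.uniform (UNum.var 0) hz.unum 0 0 0 UGen.nil).of_eq fun e =>
        splice_gates _ _ _ _
  have key : ∀ n N (O : (Fin (ℓ n) → Bool) → QState (c n)), N = 0 + o n + W n →
      Tri (N := N) O (C n) Set.univ (zero N 0 (o n + W n)) (blk N (z n)
        ((B.circ n).foldl (fun τ g => g.apply τ) (prepare (o n) (B.work n) (copies (t n)
          (tens (O (firstBit (ℓ n) false)) (O (firstBit (ℓ n) true)))))) *
        (blk N (o n) (basis (firstBit (ℓ n) true)) * zero N 0 (o n))) := by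
    intro n N O hN
    have := hk' n; have := hW' n; have := hz' n
    have hkm : t n * (c n + c n) = t n * k n := by rw [hk']
    have hle := fun j (hj : j < t n) => mul_add_le_mul (k n) hj
    have hlt := fun i j (hij : j < i) => mul_add_le_mul (k n) hij
    set ρ₀ := O (firstBit (ℓ n) false) with hρ₀
    set ρ₁ := O (firstBit (ℓ n) true) with hρ₁
    -- The wires that receive the replies: `d = 0` for the first halves of the copies, `d = c n` for
    -- the second halves.
    set A : ℕ → Set ℕ := fun d =>
      {i | ∃ j < t n, z n + j * k n + d ≤ i ∧ i < z n + j * k n + d + c n} with hAdef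
    have hquery : ∀ (d : ℕ) (u : Fin (ℓ n) → Bool), d = 0 ∨ d = c n →
        Tri O ((List.range (t n)).flatMap fun j => [.query (o n) (z n + j * k n + d)])
        (A d) ((∏ j ∈ Finset.range (t n), zero N (z n + j * k n + d) (c n)) * blk N (o n) (basis u))
        ((∏ j ∈ Finset.range (t n), blk N (z n + j * k n + d) (O u)) * blk N (o n) (basis u)) := by
      intro d u hd
      refine Tri.parallel (S := fun j => Set.Ico (z n + j * k n + d) (z n + j * k n + d + c n))
        (fun j hj => ?_) (fun j hj i hi => ⟨j, hj, hi⟩)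
        (fun i _ j _ hij => Indep.blk _ fun l hl => ?_) (fun i _ j _ hij => Indep.blk _ fun l hl => ?_)
      · have := hle j hj
        have h := Tri.query (N := N) (O := O) (a := o n) (b := z n + j * k n + d) (by omega)
          (by omega) (by omega) u (basis fun _ => false)
        rw [trace_basis, one_smul] at h
        exact h.step 1 subset_rfl Indep.one (by rw [mul_one, mul_comm]; rfl) (by rw [mul_one, mul_comm])
      · have := hlt i j hij
        simp only [Set.mem_Ico] at hl
        omega
      · have := hlt j i hij
        simp only [Set.mem_Ico] at hl
        omega
    have hzero : zero N (z n) (t n * k n) = (∏ j ∈ Finset.range (t n), zero N (z n + j * k n) (c n)) *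
        ∏ j ∈ Finset.range (t n), zero N (z n + j * k n + c n) (c n) := by
      rw [zero_mul_eq_prod, ← Finset.prod_mul_distrib]
      refine Finset.prod_congr rfl fun j _ => ?_
      rw [hk', QCrypto.zero_add]
    have hcop : blk N (z n) (copies (t n) (tens ρ₀ ρ₁)) =
        (∏ j ∈ Finset.range (t n), blk N (z n + j * k n) ρ₀) *
        ∏ j ∈ Finset.range (t n), blk N (z n + j * k n + c n) ρ₁ := by
      rw [blk_copies, ← Finset.prod_mul_distrib]
      refine Finset.prod_congr rfl fun j _ => ?_
      rw [blk_tens, ← hk']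
    have hprod : ∀ (d d' : ℕ) (f : ℕ → QState (c n)), d = 0 ∧ d' = c n ∨ d = c n ∧ d' = 0 →
        Indep (A d) (∏ j ∈ Finset.range (t n), blk N (z n + j * k n + d') (f j)) := by
      intro d d' f hd
      refine Indep.prod fun j _ => Indep.blk _ fun l ⟨i, _, hl⟩ => ?_
      rcases Nat.lt_trichotomy i j with h | rfl | h
      · have := hlt _ _ h
        omega
      · omega
      · have := hlt _ _ h
        omega
    have hA : ∀ d, d = 0 ∨ d = c n → ∀ i ∈ A d, z n ≤ i ∧ i < z n + t n * k n := by
      rintro d hd i ⟨j, hj, hi⟩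
      have := hle j hj
      omega
    have hA0 := hA 0 (.inl rfl)
    have hAc := hA (c n) (.inr rfl)
    have h0 := hquery 0 (firstBit (ℓ n) false) (.inl rfl)
    have hp0 := fun f => hprod 0 (c n) f (.inl ⟨rfl, rfl⟩)
    have hpc := fun f => hprod (c n) 0 f (.inr ⟨rfl, rfl⟩)
    simp only [Nat.add_zero] at h0 hpc
    have h1 := hquery (c n) (firstBit (ℓ n) true) (.inr rfl)
    rw [← hρ₀, show blk N (o n) (basis (firstBit (ℓ n) false)) = zero N (o n) (ℓ n) by
      rw [firstBit_false]; rfl] at h0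
    rw [← hρ₁] at h1
    have hgates := Tri.gates (N := N) (O := O) (z := z n) (by omega) (B.valid n)
      (prepare (o n) (B.work n) (copies (t n) (tens ρ₀ ρ₁)))
    rw [blk_prepare] at hgates
    set R : Amp N := zero N 0 (o n) * zero N (z n + t n * k n) (o n + B.work n) with hR
    have hRi : ∀ A : Set ℕ, (∀ i ∈ A, o n ≤ i ∧ i < z n + t n * k n) → Indep A R := fun A hA =>
      (Indep.blk _ fun i hi => by have := hA i hi; omega).mul
        (Indep.blk _ fun i hi => by have := hA i hi; omega)
    have hstart : zero N 0 (o n + W n) = (∏ j ∈ Finset.range (t n), zero N (z n + j * k n) (c n)) *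
        zero N (o n) (ℓ n) * ((∏ j ∈ Finset.range (t n), zero N (z n + j * k n + c n) (c n)) * R) := by
      rw [hW', QCrypto.zero_add, QCrypto.zero_add, QCrypto.zero_add _ _ (B.work n),
        QCrypto.zero_add _ _ (o n), hkm, Nat.zero_add, ← hz', hzero, hR,
        QCrypto.zero_add _ (o n) (B.work n), ← Nat.add_assoc]
      ring
    rw [hstart]
    refine (h0.step ((∏ j ∈ Finset.range (t n), zero N (z n + j * k n + c n) (c n)) * R) (Set.subset_univ _) ((hp0 _).mul (hRi _ fun i hi => ?_)) rfl rfl).append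
      (((Tri.setFirst (O := O) (a := o n) (k := ℓ n) (by omega)).step
      ((∏ j ∈ Finset.range (t n), blk N (z n + j * k n) ρ₀) *
      ((∏ j ∈ Finset.range (t n), zero N (z n + j * k n + c n) (c n)) * R)) (Set.subset_univ _)
      (.mul ?_ (.mul ?_ (hRi _ fun i hi => ?_))) ?_ rfl).append
      ((h1.step
      ((∏ j ∈ Finset.range (t n), blk N (z n + j * k n) ρ₀) * R) (Set.subset_univ _)
      ((hpc _).mul (hRi _ fun i hi => ?_)) ?_ rfl).append
      (hgates.step (blk N (o n) (basis (firstBit (ℓ n) true)) * zero N 0 (o n)) (Set.subset_univ _)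
      ?_ ?_ rfl)))
    · have := hA0 i hi; omega
    · refine Indep.prod fun j hj => Indep.blk _ fun l hl => ?_
      simp only [Set.mem_Ico] at hl
      omega
    · refine Indep.prod fun j hj => Indep.blk _ fun l hl => ?_
      simp only [Set.mem_Ico] at hl
      omega
    · simp only [Set.mem_Ico] at hi
      omega
    · ring1
    · have := hAc i hi; omega
    · ring1
    · refine (Indep.blk _ fun l hl => ?_).mul (Indep.blk _ fun l hl => ?_) <;>
      · simp only [Set.mem_Ico] at hl
        omega
    · rw [hcop, hR, hkm]
      ring
  have hv : ∀ n, ∀ g ∈ C n ++ swapB (z n + t n * k n) 0 (o n), g.Valid (0 + o n + W n) (ℓ n) (c n) := by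
    intro n g hg
    have := hz' n; have := hW' n
    have hkm : t n * (c n + c n) = t n * k n := by rw [hk']
    rcases List.mem_append.1 hg with hg | hg
    · exact (key n _ (fun _ => basis fun _ => false) rfl).1 g hg
    · exact valid_swapB (by omega) (by omega) (by omega) g hg
  set A : OracleQPT ℓ c (fun _ => 0) o := ⟨W, hW, _, hv, hCu.uniform⟩ with hAdef
  refine ⟨A, fun n O => ?_⟩
  have := hz' n; have := hW' n
  have hkm : t n * (c n + c n) = t n * k n := by rw [hk']
  refine blk_injective (N := 0 + o n + W n) (a := 0) (by omega)
    ((OracleQPT.blk_run (N := 0 + o n + W n) A n O (1 : QState 0) rfl).trans ?_)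
  change discard (0 + o n) (W n) (discard 0 0 (exec O (C n ++ swapB (z n + t n * k n) 0 (o n))
    (blk (0 + o n + W n) 0 (1 : QState 0) * zero (0 + o n + W n) 0 (o n + W n)))) = _
  rw [exec_append, blk_empty, trace_one_zero, one_smul, one_mul, (key n _ O rfl).exec_eq,
    discard_zero, hz', ← hkm]
  have h := discard_exec_swapB_readOut (N := 0 + o n + W n) (O := O) ((B.circ n).foldl
    (fun τ g => g.apply τ) (prepare (o n) (B.work n) (copies (t n)
    (tens (O (firstBit (ℓ n) false)) (O (firstBit (ℓ n) true))))))
    (trace_basis (firstBit (ℓ n) true)) (by omega)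
  rw [← hW'] at h
  simpa only [Nat.zero_add, QPT.run] using h

/-- The messages output by the first stage are encodings of single bits, so of all pairs of
measurement outcomes only those encoding a pair of bits contribute. The other outcomes leave the
state `0`. -/
theorem prob_sum_outcomes {s a o : ℕ → ℕ} (A : QPT (fun n => s n + a n) o) (n : ℕ)
    (ω : (Fin 1 → Bool) → (Fin 1 → Bool) → QState (s n)) (ct : Bool → Bool → QState (a n))
    (f : (Fin (ℓ n) → Bool) → (Fin (ℓ n) → Bool) → QState (a n))
    (hf : ∀ u v, f (firstBit (ℓ n) u) (firstBit (ℓ n) v) = ct u v) (y : Fin (o n) → Bool) :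
    ∑ x₀ : Fin (ℓ n) → Bool, ∑ x₁ : Fin (ℓ n) → Bool, prob (A.run n (tens (onOutcome (onOutcome
      (∑ u : Fin 1 → Bool, ∑ v : Fin 1 → Bool, tens (basis (firstBit (ℓ n) (u 0)))
        (tens (basis (firstBit (ℓ n) (v 0))) (ω u v))) x₀) x₁) (f x₀ x₁))) y =
      ∑ u, ∑ v, prob (A.run n (tens (ω u v) (ct (u 0) (v 0)))) y := by
  have h0 : ∀ τ : QState (a n), prob (A.run n (tens 0 τ)) y = 0 := fun τ => by
    have := A.run_smul n 0 (tens 0 τ)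
    rw [← tens_smul_left, smul_zero, zero_smul] at this
    rw [this]
    rfl
  have key : ∀ x₀ x₁ : Fin (ℓ n) → Bool, prob (A.run n (tens (onOutcome (onOutcome
      (∑ u : Fin 1 → Bool, ∑ v : Fin 1 → Bool, tens (basis (firstBit (ℓ n) (u 0)))
        (tens (basis (firstBit (ℓ n) (v 0))) (ω u v))) x₀) x₁) (f x₀ x₁))) y =
      ∑ u : Fin 1 → Bool, ∑ v : Fin 1 → Bool, if x₀ = firstBit (ℓ n) (u 0) then
        if x₁ = firstBit (ℓ n) (v 0) then prob (A.run n (tens (ω u v) (f x₀ x₁))) y else 0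
        else 0 := fun x₀ x₁ => by
    simp only [onOutcome_sum, tens_sum_left, QPT.run_sum, prob_sum]
    refine Finset.sum_congr rfl fun u _ => Finset.sum_congr rfl fun v _ => ?_
    rw [onOutcome_basis_tens]
    split_ifs with h1 h2
    · rw [onOutcome_basis_tens, if_pos h2]
    · rw [onOutcome_basis_tens, if_neg h2, h0]
    · exact h0 _
  simp only [key]
  have e : ∀ u v : Fin 1 → Bool, prob (A.run n (tens (ω u v) (ct (u 0) (v 0)))) y =
      ∑ x₀ : Fin (ℓ n) → Bool, ∑ x₁ : Fin (ℓ n) → Bool, if x₀ = firstBit (ℓ n) (u 0) then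
        if x₁ = firstBit (ℓ n) (v 0) then prob (A.run n (tens (ω u v) (f x₀ x₁))) y else 0
        else 0 := fun u v => by
    rw [Finset.sum_comm]
    simp only [Finset.sum_ite_eq', Finset.mem_univ, if_true, Finset.sum_ite_eq, hf]
  simp only [e]
  have hswap : ∀ F : (Fin (ℓ n) → Bool) → (Fin (ℓ n) → Bool) → (Fin 1 → Bool) → (Fin 1 → Bool) → ℝ,
      ∑ x₀, ∑ x₁, ∑ u, ∑ v, F x₀ x₁ u v = ∑ u, ∑ v, ∑ x₀, ∑ x₁, F x₀ x₁ u v := fun F => by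
    rw [Finset.sum_congr rfl fun x₀ _ => Finset.sum_comm]
    rw [Finset.sum_comm]
    refine Finset.sum_congr rfl fun u _ => ?_
    rw [Finset.sum_congr rfl fun x₀ _ => Finset.sum_comm]
    rw [Finset.sum_comm]
  exact hswap _

/-- The transformation of a secret-key scheme into a public-key scheme for bits, whose public keys
consist of an encryption of `0` and an encryption of `1`. -/
theorem QSKE.exists_qpke {κ : ℕ → ℕ} (hℓ : IsPoly ℓ) (hκ : IsPoly κ) (hc : IsPoly c)
    (S : QSKE ℓ κ c) (D : QPT (fun n => κ n + c n) fun _ => 1) :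
    ∃ P : QPKE (fun _ => 1) κ (fun n => c n + c n) c, P.skGen = S.keyGen ∧ P.dec = D ∧
      (∀ n sk, P.pk n sk = tens (S.ct n sk (firstBit (ℓ n) false)) (S.ct n sk (firstBit (ℓ n) true))) ∧
      (∀ n (ρ₀ ρ₁ : QState (c n)), ρ₀.trace = 1 → ρ₁.trace = 1 → ∀ x : Fin 1 → Bool,
        P.ct n (tens ρ₀ ρ₁) x = if x 0 then ρ₁ else ρ₀) ∧ (S.INDCPA → P.INDCPA) := by
  obtain ⟨G, hG⟩ := QPT.exists_encrypt_both hℓ hκ hc S.enc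
  obtain ⟨E, hE⟩ := QPT.exists_select hc
  refine ⟨⟨S.keyGen, G, E, D⟩, rfl, rfl, hG, hE, fun hS t s ht hs A₁ A₂ => ?_⟩
  obtain ⟨B, hB⟩ := QPT.exists_measure_bits (ht.mul (hc.add hc)) hℓ hs A₁
  obtain ⟨B₁, hB₁⟩ := OracleQPT.exists_run_copies hℓ hc ht (hℓ.add (hℓ.add hs)) B
  -- The second stage becomes an oracle algorithm that makes no queries.
  set B₂ : OracleQPT ℓ c (fun n => s n + c n) (fun _ => 1) :=
    ⟨A₂.work, A₂.work_poly, fun n => (A₂.circ n).map .gate, fun n g hg => by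
      obtain ⟨g, hg', rfl⟩ := List.mem_map.1 hg
      exact A₂.valid n g hg', A₂.uniform⟩ with hB₂
  have hB₂' : ∀ n O ρ, B₂.run n O ρ = A₂.run n ρ := fun n O ρ => by
    rw [OracleQPT.run_eq, QPT.run_eq (O := O)]
  refine (hS s hs B₁ B₂).congr fun n => ?_
  -- Copies of the public key are products of independent ciphertexts and the challenge is a
  -- ciphertext as well, so the games agree exactly.
  have hgame : ∀ b, S.game B₁ B₂ b n =
      (⟨S.keyGen, G, E, D⟩ : QPKE (fun _ => 1) κ (fun n => c n + c n) c).game A₁ A₂ b n := by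
    intro b
    rw [QSKE.game, QPKE.game]
    refine Finset.sum_congr rfl fun sk _ => congrArg₂ _ rfl ?_
    have htr : ∀ x, (S.ct n sk x).trace = 1 := fun x => by rw [QSKE.ct, QPT.trace_run, trace_basis]
    have hpk : (⟨S.keyGen, G, E, D⟩ : QPKE (fun _ => 1) κ (fun n => c n + c n) c).pk n sk =
      tens (S.ct n sk (firstBit (ℓ n) false)) (S.ct n sk (firstBit (ℓ n) true)) := hG n sk
    simp only [hB₂', hB₁, hB, hpk]
    rw [prob_sum_outcomes (ℓ := ℓ) (a := c) A₂ n _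
      (fun u v => S.ct n sk (firstBit (ℓ n) (if b then v else u)))
      (fun x₀ x₁ => S.ct n sk (if b then x₁ else x₀)) (fun u v => by cases b <;> rfl)]
    refine Finset.sum_congr rfl fun u _ => Finset.sum_congr rfl fun v _ => ?_
    congr 3
    rw [QPKE.ct]
    refine (Eq.trans (hE n _ _ (htr _) (htr _) _) ?_).symm
    cases b
    · cases h : u 0 <;> simp [h]
    · cases h : v 0 <;> simp [h]
  rw [hgame, hgame]

end PublicFromSecret

end QCrypto

namespace QCrypto

open Function

/-! ### Keeping the first bit of a decrypted message -/

section FirstOutput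

variable {N q m : ℕ} {O : (Fin q → Bool) → QState m}

theorem Tri.copyFirst {a b k : ℕ} (ha : a + k ≤ N) (hb : b + 1 ≤ N) (hab : a + k ≤ b ∨ b + 1 ≤ a)
    (u : Fin k → Bool) : Tri O (copyB a b (1 - (1 - k))) (Set.Ico b (b + 1))
      (blk N a (basis u) * zero N b 1) (blk N a (basis u) * bit N b (bitAt u 0)) := by
  rcases Nat.eq_zero_or_pos k with rfl | hk
  -- With `k = 0` nothing is copied and the target stays `false`, the default value of `bitAt u 0`.
  · exact Tri.nil _ _
  · obtain ⟨k, rfl⟩ : ∃ l, k = 1 + l := ⟨k - 1, by omega⟩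
    have hu : u = Fin.append (fun _ : Fin 1 => bitAt u 0) fun j => u (Fin.natAdd 1 j) :=
      bits_ext fun j hj => by
        rw [bitAt_append]
        split_ifs with h
        · obtain rfl : j = 0 := by omega
          simp [bitAt]
        · rw [bitAt_of_lt _ hj, bitAt_of_lt _ (by omega)]
          congr 1
          ext
          simp
          omega
    generalize bitAt u 0 = v at hu ⊢
    rw [show 1 - (1 - (1 + k)) = 1 by omega, hu, basis_append, blk_tens]
    exact (Tri.copy (O := O) (a := a) (b := b) (k := 1) (by omega) (by omega) (by omega)
      (fun _ => v)).step (blk N (a + 1) (basis fun j => u (Fin.natAdd 1 j))) subset_rfl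
      (Indep.blk _ fun j hj => by
        simp only [Set.mem_Ico] at hj
        omega) (by ring) (by rw [bit]; ring)

/-- Output the first bit of the outcome of a measurement. -/
theorem QPT.exists_first {i ℓ : ℕ → ℕ} (hi : IsPoly i) (hℓ : IsPoly ℓ) (A : QPT i ℓ) :
    ∃ C : QPT i (fun _ => 1), ∀ n ρ,
      C.run n ρ = ∑ u, A.run n ρ u u • basis fun _ : Fin 1 => bitAt u 0 := by
  have hA := A.isPoly_size hi hℓ
  obtain ⟨w, hw, hw'⟩ : ∃ w, IsPoly w ∧ ∀ n, w n = ℓ n + 1 + A.size n :=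
    ⟨_, (hℓ.add (.const 1)).add hA, fun _ => rfl⟩
  obtain ⟨U, hU, hU'⟩ : ∃ U, IsPoly U ∧ ∀ n, U n = i n + 1 := ⟨_, hi.add (.const 1), fun _ => rfl⟩
  obtain ⟨D, hD, hD'⟩ : ∃ D, IsPoly D ∧ ∀ n, D n = U n + ℓ n := ⟨_, hU.add hℓ, fun _ => rfl⟩
  refine exists_qpt_of_tri hi (.const 1) hw
    (C := fun n => applyB A n 0 (U n) (D n + 1) ++ (dephB (U n) (ℓ n) (D n) ++
      (copyB (U n) (i n) (1 - (1 - ℓ n)) ++ resetB (U n) (ℓ n))))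
    ((UGen.applyB hi hℓ A (UNum.var 0) (.const 0) hU.unum (hD.add (.const 1)).unum).append
      ((UGen.dephB hU.unum hℓ.unum hD.unum).append ((UGen.copyB hU.unum hi.unum
        ((UNum.const 1).sub ((UNum.const 1).sub hℓ.unum))).append (UGen.resetB hU.unum hℓ.unum))))
    (ι := fun n => QState (i n)) (fun n ρ => ρ) _ ?_
  intro n N ρ hN
  have := hU' n; have := hD' n; have := hw' n
  set R : Amp N := zero N 0 (i n) * zero N (i n) 1 * zero N (D n) 1 *
    zero N (D n + 1) (A.size n) with hR
  have e : diagB N (U n) (ℓ n) * zero N (D n) 1 * (blk N (U n) (A.run n ρ) * (zero N 0 (i n) *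
      zero N (i n) 1 * zero N (D n + 1) (A.size n))) =
      ∑ u, (A.run n ρ u u • blk N (U n) (basis u)) * R := by
    -- All output wires are measured: with `l := 0` the remaining state is a scalar, the diagonal
    -- entry at `u`.
    have h := blk_mul_diagB (N := N) (k := ℓ n) (l := 0) (U n) (A.run n ρ)
    rw [← Finset.sum_mul, show ∑ u, A.run n ρ u u • blk N (U n) (basis u) =
      blk N (U n) (A.run n ρ) * diagB N (U n) (ℓ n) from ?_, hR]
    · ring
    · refine Eq.trans (Finset.sum_congr rfl fun u _ => ?_) h.symm
      rw [blk_empty, mul_smul_comm, mul_one]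
      congr 1
      rw [Matrix.trace, Fintype.sum_unique]
      simp only [Matrix.diag, onOutcome]
      congr 1 <;> exact (bits_ext fun j hj => by rw [bitAt_append, if_pos hj])
  refine ((Tri.apply A n (a := 0) (b := U n) (z := D n + 1) (by omega) (by omega) (by omega)
    (by omega) (by omega) (by omega) ρ).step (zero N (i n) 1 * zero N (D n) 1) ?_ ?_ ?_ rfl).append
    (((Tri.deph (a := U n) (k := ℓ n) (s := D n) (by omega) (by omega) (by omega)).step
    (blk N (U n) (A.run n ρ) * (zero N 0 (i n) * zero N (i n) 1 *
    zero N (D n + 1) (A.size n))) ?_ ?_ ?_ e.symm).append ?_)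
  case refine_7 =>
    rw [blk_sum, Finset.mul_sum, Finset.sum_mul]
    refine Tri.sum fun u => ?_
    have hr := Tri.reset (N := N) (a := U n) (k := ℓ n) (by omega) (basis u)
    rw [trace_basis, one_smul] at hr
    rw [smul_mul_assoc, blk_smul, mul_smul_comm, smul_mul_assoc]
    refine Tri.smul ?_ _
    refine ((Tri.copyFirst (O := resetOracle) (a := U n) (b := i n) (k := ℓ n) (by omega) (by omega)
      (by omega) u).step (zero N 0 (i n) * zero N (D n) 1 * zero N (D n + 1) (A.size n))
      ?_ ?_ ?_ rfl).append
      (hr.step (bit N (i n) (bitAt u 0) * zero N 0 (i n) * zero N (D n) 1 *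
      zero N (D n + 1) (A.size n)) ?_ ?_ ?_ ?_)
    all_goals first
      | exact Set.subset_univ _
      | ring1
      | (simp only [hw', hD', hU', bit, QCrypto.zero_add, ← Nat.add_assoc]
         ring1)
      | ((repeat' apply Indep.mul) <;>
          (refine Indep.blk _ fun j hj => ?_
           simp only [Set.mem_union, Set.mem_Ico] at hj
           omega))
  all_goals first
    | exact Set.subset_univ _
    | (simp only [hw', hU', hD', QCrypto.zero_add, ← Nat.add_assoc]
       ring1)
    | ((repeat' apply Indep.mul) <;>
        (refine Indep.blk _ fun j hj => ?_
         simp only [Set.mem_union, Set.mem_Ico, Set.mem_singleton_iff] at hj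
         omega))

theorem firstBit_one (x : Fin 1 → Bool) : firstBit 1 (x 0) = x :=
  bits_one_ext (by simp [firstBit])

open scoped ComplexOrder in
-- Decrypting the whole encoded message correctly implies that its first bit is correct, and
-- diagonal entries are nonnegative. For `ℓ = 0` the first bit would always read `false`.
theorem prob_first {ℓ : ℕ} (hℓ : 1 ≤ ℓ) {σ : QState ℓ} (hσ : σ.PosSemidef) (x : Fin 1 → Bool) :
    prob σ (firstBit ℓ (x 0)) ≤ prob (∑ u, σ u u • basis fun _ : Fin 1 => bitAt u 0) x := by
  have h : ∀ u, prob (σ u u • basis fun _ : Fin 1 => bitAt u 0) x =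
      if bitAt u 0 = x 0 then prob σ u else 0 := fun u => by
    have e : (fun _ : Fin 1 => bitAt u 0) = x ↔ bitAt u 0 = x 0 :=
      ⟨fun h => congrFun h 0, fun h => bits_one_ext h⟩
    simp only [prob, Matrix.smul_apply, basis, Matrix.single_apply, and_self, e]
    split_ifs <;> simp
  rw [prob_sum]
  have hx : bitAt (firstBit ℓ (x 0)) 0 = x 0 := by
    rw [bitAt_of_lt _ (show 0 < ℓ by omega)]
    simp [firstBit]
  refine le_of_eq_of_le ?_ (Finset.single_le_sum (fun u _ => ?_)
    (Finset.mem_univ (firstBit ℓ (x 0))))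
  · rw [h, if_pos hx]
  · rw [h]
    split_ifs
    · exact prob_nonneg hσ u
    · exact le_rfl

end FirstOutput

/-! ### Secret-key encryption yields one-bit public-key encryption -/

open scoped ComplexOrder

variable {ℓ κ c : ℕ → ℕ}

theorem QSKE.keyProb_nonneg (S : QSKE ℓ κ c) (n : ℕ) (sk : Fin (κ n) → Bool) :
    0 ≤ S.keyProb n sk :=
  prob_nonneg (S.keyGen.posSemidef_run n Matrix.PosSemidef.one) sk

theorem QSKE.posSemidef_ct (S : QSKE ℓ κ c) (n : ℕ) (sk : Fin (κ n) → Bool) (x : Fin (ℓ n) → Bool) :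
    (S.ct n sk x).PosSemidef :=
  S.enc.posSemidef_run n (posSemidef_basis _)

theorem Negligible.congr_of_pos {f g : ℕ → ℝ} (hf : Negligible f) (h : ∀ n, 1 ≤ n → f n = g n) :
    Negligible g :=
  Asymptotics.SuperpolynomialDecay.congr' hf (Filter.eventually_atTop.2 ⟨1, h⟩)

/-- The bit `x` is encrypted as the message `x0…0`, and decryption keeps the first bit. -/
theorem ExistsQPKE.of_existsQSKE (hℓ : IsPoly ℓ) (h1 : ∀ n, 1 ≤ n → 1 ≤ ℓ n) (h : ExistsQSKE ℓ) :
    ExistsQPKE fun _ => 1 := by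
  obtain ⟨κ, c, hκ, hc, S, hS⟩ := h
  obtain ⟨D, hD⟩ := QPT.exists_first (hκ.add hc) hℓ S.dec
  obtain ⟨P, hP1, hP2, hpk, hct, hP⟩ := S.exists_qpke hℓ hκ hc D
  refine ⟨κ, _, c, hκ, hc.add hc, hc, P, ?_, hP hS.2⟩
  obtain ⟨ε, hε, hcor⟩ := hS.1
  -- Nothing forces messages to be nonempty at `n = 0`; the error is set to `1` there, which does
  -- not affect negligibility.
  refine ⟨fun n => if n = 0 then 1 else ε n, hε.congr_of_pos fun n hn => (if_neg (by omega)).symm,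
    fun n x => ?_⟩
  have hkey : ∀ sk, P.keyProb n sk = S.keyProb n sk := fun sk => by
    rw [QPKE.keyProb, hP1]; rfl
  have hctx : ∀ sk, P.ct n (P.pk n sk) x = S.ct n sk (firstBit (ℓ n) (x 0)) := fun sk => by
    have htr : ∀ x, (S.ct n sk x).trace = 1 := fun x => by rw [QSKE.ct, QPT.trace_run, trace_basis]
    rw [hpk, hct _ _ _ (htr _) (htr _)]
    cases x 0 <;> rfl
  have hpsd : ∀ sk x, (tens (basis sk) (S.ct n sk x)).PosSemidef := fun sk x =>
    posSemidef_tens (posSemidef_basis _) (S.posSemidef_ct n sk x)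
  rcases Nat.eq_zero_or_pos n with rfl | hn
  · rw [show (fun n => if n = 0 then 1 else ε n) 0 = 1 from if_pos rfl, sub_self]
    refine Finset.sum_nonneg fun sk _ => mul_nonneg ?_ (prob_nonneg (QPT.posSemidef_run _ _ ?_) _)
    · rw [hkey]
      exact S.keyProb_nonneg _ _
    · rw [hctx]
      exact hpsd _ _
  · rw [show (fun n => if n = 0 then 1 else ε n) n = ε n from if_neg (by omega)]
    refine (hcor n (firstBit (ℓ n) (x 0))).trans (Finset.sum_le_sum fun sk _ => ?_)
    rw [hkey, hctx, hP2, hD]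
    exact mul_le_mul_of_nonneg_left (prob_first (h1 n hn) (S.dec.posSemidef_run n (hpsd _ _)) x)
      (S.keyProb_nonneg _ _)

/-- For one-bit messages the encoding `firstBit` is the identity, so the given decryption algorithm
can be kept. -/
theorem QSKE.exists_qpke_one (hκ : IsPoly κ) (hc : IsPoly c) (S : QSKE (fun _ => 1) κ c)
    (hS : S.Secure) : ∃ P : QPKE (fun _ => 1) κ (fun n => c n + c n) c,
      P.skGen = S.keyGen ∧ P.dec = S.dec ∧
      (∀ n sk, P.pk n sk = tens (S.ct n sk fun _ => false) (S.ct n sk fun _ => true)) ∧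
      (∀ n (ρ₀ ρ₁ : QState (c n)), IsDensity ρ₀ → IsDensity ρ₁ →
        P.ct n (tens ρ₀ ρ₁) (fun _ => false) = ρ₀ ∧ P.ct n (tens ρ₀ ρ₁) (fun _ => true) = ρ₁) ∧
      P.Secure := by
  obtain ⟨P, hP1, hP2, hpk, hct, hP⟩ := S.exists_qpke (.const 1) hκ hc S.dec
  refine ⟨P, hP1, hP2, fun n sk => ?_, fun n ρ₀ ρ₁ h₀ h₁ => ⟨?_, ?_⟩, ?_, hP hS.2⟩
  · rw [hpk, firstBit_one fun _ => false, firstBit_one fun _ => true]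
  · rw [hct _ _ _ h₀.2 h₁.2]; rfl
  · rw [hct _ _ _ h₀.2 h₁.2]; rfl
  · obtain ⟨ε, hε, hcor⟩ := hS.1
    refine ⟨ε, hε, fun n x => (hcor n x).trans_eq (Finset.sum_congr rfl fun sk _ => ?_)⟩
    have htr : ∀ x, (S.ct n sk x).trace = 1 := fun x => by rw [QSKE.ct, QPT.trace_run, trace_basis]
    have hctx : P.ct n (P.pk n sk) x = S.ct n sk x := by
      rw [hpk, hct _ _ _ (htr _) (htr _)]
      conv_rhs => rw [← firstBit_one x]
      cases x 0 <;> rfl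
    rw [hctx, hP2, QPKE.keyProb, hP1]
    rfl

end QCrypto

namespace QCrypto

open Function

/-! ### A random index -/

/-- Double `x` if it is less than `L`. -/
def doubleBelow (L x : ℕ) : ℕ := x + x * (1 - (1 - (L - x)))

theorem doubleBelow_of_lt {L x : ℕ} (h : x < L) : doubleBelow L x = x + x := by
  rw [doubleBelow, show 1 - (1 - (L - x)) = 1 by omega, mul_one]

theorem doubleBelow_of_le {L x : ℕ} (h : L ≤ x) : doubleBelow L x = x := by
  rw [doubleBelow, show 1 - (1 - (L - x)) = 0 by omega, mul_zero, Nat.add_zero]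

/-- The `m`-th power of two, stopping at the first one that is at least `L`. -/
def powBelow (L m : ℕ) : ℕ := (doubleBelow L)^[m] 1

theorem powBelow_succ (L m : ℕ) : powBelow L (m + 1) = doubleBelow L (powBelow L m) :=
  iterate_succ_apply' _ _ _

/-- Until `L` is reached the value doubles and so stays ahead of the number of rounds; for `m = L`
the last clause gives `L ≤ powBelow L L`. The `+ 1` in the upper bound is needed for `L = 0`. -/
theorem powBelow_bounds (L m : ℕ) : 0 < powBelow L m ∧ powBelow L m ≤ 2 * L + 1 ∧
    (L ≤ powBelow L m ∨ m < powBelow L m) := by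
  induction m with
  | zero => exact ⟨one_pos, by simp [powBelow], .inr one_pos⟩
  | succ m ih =>
    rw [powBelow_succ]
    rcases Nat.lt_or_ge (powBelow L m) L with h | h
    · rw [doubleBelow_of_lt h]
      omega
    · rw [doubleBelow_of_le h]
      omega

/-- Plain powers of two are too large to be written in unary in polynomial time; stopping at `L`
keeps all iterates below `2 * L + 1` or equal to it. -/
theorem UNum.powBelow {L m : (ℕ → ℕ) → ℕ} (hL : UNum L) (hm : UNum m) :
    UNum fun e => QCrypto.powBelow (L e) (m e) := by
  obtain ⟨d, hd, -⟩ := id hL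
  have key : ∀ e x, L (update e d x) = L e := fun e x =>
    hd _ _ fun r hr => update_of_ne (by omega) _ _
  have hit : ∀ e j, (fun x => (update e d x) d + (update e d x) d * (1 - (1 - (L (update e d x) -
      (update e d x) d))))^[j] 1 = QCrypto.powBelow (L e) j := fun e j => by
    simp only [key, update_self]
    rfl
  refine (UNum.iter (g := fun _ => 1) (c := m) (B := fun e => 2 * L e + 1) d (.const 1) hm
    (f := fun e => e d + e d * (1 - (1 - (L e - e d)))) ((UNum.var d).add ((UNum.var d).mul
    ((UNum.const 1).sub ((UNum.const 1).sub (hL.sub (UNum.var d)))))) (((UNum.const 2).mul hL).add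
    (.const 1)) fun e j _ => ?_).of_eq fun e => hit e _
  rw [hit]
  exact (powBelow_bounds _ _).2.1

/-- The string of length `k` whose only `1` is at position `i`. -/
def onehot (k i : ℕ) : Fin k → Bool := fun j => (j : ℕ) = i

theorem bitAt_onehot {k j : ℕ} (i : ℕ) (hj : j < k) : bitAt (onehot k i) j = decide (j = i) := by
  rw [bitAt_of_lt _ hj]
  rfl

section Sampler

variable {N q m : ℕ} {O : (Fin q → Bool) → QState m}

theorem Tri.sum_mem {C : List (Op ℕ)} {A : Set ℕ} {ι : Type*} {s : Finset ι} {f g : ι → Amp N}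
    (hs : s.Nonempty) (h : ∀ i ∈ s, Tri O C A (f i) (g i)) :
    Tri O C A (∑ i ∈ s, f i) (∑ i ∈ s, g i) :=
  ⟨(h _ hs.choose_spec).1, fun r hr => by
    rw [Finset.sum_mul, Finset.sum_mul, exec_sum]
    exact Finset.sum_congr rfl fun i hi => (h i hi).2 r hr⟩

theorem Indep.sum {A : Set ℕ} {ι : Type*} {t : Finset ι} {f : ι → Amp N}
    (h : ∀ i ∈ t, Indep A (f i)) : Indep A (∑ i ∈ t, f i) := fun x x' y y' hx hy => by
  simp only [Finset.sum_apply]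
  exact Finset.sum_congr rfl fun i hi => h i hi x x' y y' hx hy

theorem blk_onehot_add_of_lt {k i : ℕ} (a l : ℕ) (h : i < k) :
    blk N a (basis (onehot (k + l) i)) = blk N a (basis (onehot k i)) * zero N (a + k) l := by
  have : onehot (k + l) i = Fin.append (onehot k i) fun _ => false := bits_ext fun j hj => by
    rw [bitAt_append, bitAt_onehot _ hj]
    split_ifs with h'
    · rw [bitAt_onehot _ h']
    · rw [bitAt_of_lt _ (by omega)]
      simp
      omega
  rw [this, basis_append, blk_tens]
  rfl

theorem blk_onehot_add (a k l i : ℕ) :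
    blk N a (basis (onehot (k + l) (k + i))) = zero N a k * blk N (a + k) (basis (onehot l i)) := by
  have : onehot (k + l) (k + i) = Fin.append (fun _ => false) (onehot l i) := bits_ext fun j hj => by
    rw [bitAt_append, bitAt_onehot _ hj]
    split_ifs with h'
    · rw [bitAt_of_lt _ (by omega)]
      simp
      omega
    · rw [bitAt_onehot _ (by omega)]
      exact decide_eq_decide.2 (by omega)
  rw [this, basis_append, blk_tens]
  rfl

/-- One round of sampling: a coin decides whether the two halves of the range are exchanged, which
moves the index from `i` to `l + i`. With `l = 0` the range is already large enough and the round
does nothing. -/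
theorem Tri.cswap_onehot {a c k l E i : ℕ} (hl : l = 0 ∨ l = k) (hi : i < k) (hE : k + l ≤ E)
    (ha : a + E ≤ N) (hc : c < N) (hca : c < a ∨ a + E ≤ c) (b : Bool) :
    Tri O (cswapB c a (a + k) l) (Set.Ico a (a + E)) (bit N c b * blk N a (basis (onehot E i)))
      (bit N c b * blk N a (basis (onehot E (if b then l + i else i)))) := by
  rcases hl with rfl | rfl
  · rw [Nat.zero_add, ite_self]
    exact Tri.nil _ _
  · obtain ⟨r, rfl⟩ : ∃ r, E = l + l + r := ⟨E - (l + l), by omega⟩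
    have e : blk N a (basis (onehot (l + l + r) (if b then l + i else i))) =
        blk N a (if b then basis (fun _ => false) else basis (onehot l i)) *
        blk N (a + l) (if b then basis (onehot l i) else basis fun _ => false) *
        zero N (a + (l + l)) r := by
      cases b
      · rw [if_neg Bool.false_ne_true, if_neg Bool.false_ne_true, if_neg Bool.false_ne_true,
          blk_onehot_add_of_lt _ _ (show i < l + l by omega), blk_onehot_add_of_lt _ _ hi]
        rfl
      · rw [if_pos rfl, if_pos rfl, if_pos rfl,
          blk_onehot_add_of_lt _ _ (show l + i < l + l by omega), blk_onehot_add]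
        rfl
    rw [e, blk_onehot_add_of_lt _ _ (show i < l + l by omega), blk_onehot_add_of_lt _ _ hi]
    refine (Tri.cswap (O := O) (c := c) (a := a) (b := a + l) (k := l) hc (by omega) (by omega)
      (by omega) (by omega) (by omega) (Ctrl.bit c b) (Indep.blk _ fun j hj => ?_)
      (basis (onehot l i)) (basis fun _ => false)).step (zero N (a + (l + l)) r)
      (fun j hj => ?_) (Indep.blk _ fun j hj => ?_) ?_ ?_
    · simp only [Set.mem_union, Set.mem_Ico] at hj
      omega
    · simp only [Set.mem_union, Set.mem_Ico] at hj ⊢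
      omega
    · simp only [Set.mem_union, Set.mem_Ico] at hj
      omega
    · simp only [zero]
      ring1
    · ring1

/-- Adding `0` or `l` at random to a uniform index below `k` gives a uniform index below `k + l`, in
both admissible cases. -/
theorem sum_range_doubled {M : Type*} [AddCommMonoid M] [Module ℂ M] {k l : ℕ}
    (hl : l = 0 ∨ l = k) (hk : 0 < k) (F : ℕ → M) :
    ∑ i ∈ Finset.range k, (1 / k : ℂ) • (1 / 2 : ℂ) • ∑ b : Bool, F (if b then l + i else i) =
      ∑ i ∈ Finset.range (k + l), (1 / (k + l : ℕ) : ℂ) • F i := by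
  have hk' : (k : ℂ) ≠ 0 := Nat.cast_ne_zero.2 hk.ne'
  simp only [Fintype.sum_bool, if_true, Bool.false_eq_true, if_false]
  rcases hl with rfl | rfl
  · refine Finset.sum_congr rfl fun i _ => ?_
    rw [Nat.zero_add, Nat.add_zero, ← two_smul ℂ (F i), smul_smul, smul_smul]
    congr 1
    ring
  · rw [Finset.sum_range_add, ← Finset.sum_add_distrib]
    refine Finset.sum_congr rfl fun i _ => ?_
    rw [smul_smul, ← smul_add, add_comm (F i)]
    congr 1
    push_cast
    field_simp
    norm_num

/-- A random index, written in unary. -/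
theorem QPT.exists_sampler {ℓ E : ℕ → ℕ} (hℓ : IsPoly ℓ) (hE : IsPoly E)
    (hE' : ∀ n, E n = 2 * ℓ n + 1) :
    ∃ A : QPT (fun _ => 0) E, ∀ n, A.run n 1 = ∑ i ∈ Finset.range (powBelow (ℓ n) (ℓ n)),
      (1 / (powBelow (ℓ n) (ℓ n) : ℕ) : ℂ) • basis (onehot (E n) i) := by
  obtain ⟨A, hA⟩ := exists_qpt_of_tri (.const 0) hE (.const 2)
    (C := fun n => flipB 0 ++ (List.range (ℓ n)).flatMap fun m => coinB (E n) (E n + 1) ++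
      (cswapB (E n) 0 (0 + powBelow (ℓ n) m) (powBelow (ℓ n) (m + 1) - powBelow (ℓ n) m) ++
      resetB (E n) 1))
    ((UGen.flipB (.const 0)).append (UGen.range_one (F := fun n m => coinB (E n) (E n + 1) ++
      (cswapB (E n) 0 (0 + powBelow (ℓ n) m) (powBelow (ℓ n) (m + 1) - powBelow (ℓ n) m) ++
      resetB (E n) 1)) hℓ.unum ((UGen.coinB hE.unum (hE.add (.const 1)).unum).append
      ((UGen.cswapB hE.unum (.const 0) ((UNum.const 0).add (UNum.powBelow hℓ.unum (UNum.var 1)))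
        ((UNum.powBelow hℓ.unum ((UNum.var 1).add (.const 1))).sub
          (UNum.powBelow hℓ.unum (UNum.var 1)))).append
        (UGen.resetB hE.unum (.const 1))))))
    (ι := fun _ => Unit) (fun _ _ => 1) (fun n _ => ∑ i ∈ Finset.range (powBelow (ℓ n) (ℓ n)),
      (1 / (powBelow (ℓ n) (ℓ n) : ℕ) : ℂ) • basis (onehot (E n) i)) (by
      intro n N _ hN
      have := hE' n
      set D := powBelow (ℓ n) with hD
      -- After `m` rounds the index is uniform below `D m`. The wires `E n` and `E n + 1`, for the
      -- coin and its dephasing, are clean between rounds.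
      set S : ℕ → Amp N := fun m => (∑ i ∈ Finset.range (D m),
        (1 / (D m : ℕ) : ℂ) • blk N 0 (basis (onehot (E n) i))) * zero N (E n) 2 with hS
      have hstep : ∀ m < ℓ n, Tri resetOracle (coinB (E n) (E n + 1) ++ (cswapB (E n) 0 (0 + D m)
          (D (m + 1) - D m) ++ resetB (E n) 1)) Set.univ (S m) (S (m + 1)) := by
        intro m _
        obtain ⟨l, hl, hDl⟩ : ∃ l, (l = 0 ∨ l = D m) ∧ D (m + 1) = D m + l := by
          rw [hD, powBelow_succ]
          rcases Nat.lt_or_ge (powBelow (ℓ n) m) (ℓ n) with h | h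
          · exact ⟨_, .inr rfl, doubleBelow_of_lt h⟩
          · exact ⟨0, .inl rfl, doubleBelow_of_le h⟩
        have hb := powBelow_bounds (ℓ n) m
        have hb' := powBelow_bounds (ℓ n) (m + 1)
        rw [← hD] at hb hb'
        set ζ := zero N (E n) 1 * zero N (E n + 1) 1 with hζ
        have e2 : ∀ α : Amp N, α * zero N (E n) 2 = α * ζ := fun α => by
          rw [show 2 = 1 + 1 from rfl, QCrypto.zero_add]
        have hS1 : S (m + 1) = ∑ i ∈ Finset.range (D m), (1 / (D m : ℕ) : ℂ) • (1 / 2 : ℂ) •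
            ∑ b : Bool, blk N 0 (basis (onehot (E n) (if b then l + i else i))) * ζ := by
          simp only [hS, e2, hDl]
          rw [sum_range_doubled hl hb.1 fun i => blk N 0 (basis (onehot (E n) i)) * ζ,
            Finset.sum_mul]
          exact Finset.sum_congr rfl fun i _ => smul_mul_assoc _ _ _
        have hmid : ∑ i ∈ Finset.range (D m), (1 / (D m : ℕ) : ℂ) • (1 / 2 : ℂ) • ∑ b : Bool,
            blk N 0 (basis (onehot (E n) i)) * (bit N (E n) b * zero N (E n + 1) 1) =
            (1 / 2 : ℂ) • (bit N (E n) false + bit N (E n) true) * zero N (E n + 1) 1 *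
            ∑ i ∈ Finset.range (D m), (1 / (D m : ℕ) : ℂ) • blk N 0 (basis (onehot (E n) i)) := by
          rw [Finset.mul_sum]
          refine Finset.sum_congr rfl fun i _ => ?_
          simp only [Fintype.sum_bool, smul_mul_assoc, mul_smul_comm]
          congr 2
          ring
        rw [hS1, hDl, Nat.add_sub_cancel_left]
        refine ((Tri.coin (a := E n) (s := E n + 1) (by omega) (by omega) (by omega)).step
          (∑ i ∈ Finset.range (D m), (1 / (D m : ℕ) : ℂ) • blk N 0 (basis (onehot (E n) i)))
          (Set.subset_univ _) ?_ ?_ hmid).append (Tri.sum_mem ⟨0, Finset.mem_range.2 hb.1⟩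
          fun i hi => (Tri.smul (Tri.smul (Tri.sum fun b => ?_) _) _))
        · exact Indep.sum fun i _ => (Indep.blk _ fun j hj => by
            simp only [Set.mem_insert_iff, Set.mem_singleton_iff] at hj
            omega).smul _
        · simp only [hS, e2, hζ]
          ring
        · have hi := Finset.mem_range.1 hi
          have hr := Tri.reset (N := N) (a := E n) (k := 1) (by omega) (basis fun _ => b)
          rw [trace_basis, one_smul] at hr
          refine ((Tri.cswap_onehot (O := resetOracle) (a := 0) (c := E n) (k := D m) (l := l)
            (E := E n) (i := i) hl hi (by omega) (by omega) (by omega) (by omega) b).step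
            (zero N (E n + 1) 1) (Set.subset_univ _) (Indep.blk _ fun j hj => ?_) ?_ rfl).append
            (hr.step (blk N 0 (basis (onehot (E n) (if b then l + i else i))) *
            zero N (E n + 1) 1) (Set.subset_univ _) ((Indep.blk _ fun j hj => ?_).mul
            (Indep.blk _ fun j hj => ?_)) ?_ ?_)
          all_goals first
            | ring1
            | (rw [bit]; ring1)
            | (simp only [Set.mem_Ico] at hj
               omega)
      have hS0 : ∀ e k, e = 1 + k → blk N 0 (basis (onehot e 0)) = bit N 0 true * zero N 1 k := by
        rintro _ k rfl
        rw [blk_onehot_add_of_lt _ _ one_pos, bit,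
          show onehot 1 0 = fun _ => true from bits_one_ext (by simp [onehot]), Nat.zero_add]
      have h0 : S 0 = bit N 0 true * (zero N 1 (2 * ℓ n) * zero N (E n) 2) := by
        simp only [hS, hD, powBelow, iterate_zero, id, Finset.sum_range_one, Nat.cast_one, div_one,
          one_smul]
        rw [hS0 _ (2 * ℓ n) (by omega), mul_assoc]
      have hend : zero N 0 ((fun _ => 0) n) * blk N ((fun _ => 0) n) (∑ i ∈ Finset.range (D (ℓ n)),
          (1 / (D (ℓ n) : ℕ) : ℂ) • basis (onehot (E n) i)) * zero N ((fun _ => 0) n + E n) 2 =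
          S (ℓ n) := by
        simp only [hS, blk_sum, blk_smul, zero_zero, one_mul, Nat.zero_add]
      refine ((Tri.flip (O := resetOracle) (a := 0) (by omega) false).step
        (zero N 1 (2 * ℓ n) * zero N (E n) 2) (Set.subset_univ _) ?_ ?_ h0).append ?_
      · exact (Indep.blk _ fun j hj => by
          simp only [Set.mem_singleton_iff] at hj
          omega).mul (Indep.blk _ fun j hj => by
          simp only [Set.mem_singleton_iff] at hj
          omega)
      · rw [blk_empty, trace_one_zero, one_smul, one_mul, QCrypto.zero_add, Nat.zero_add,
          show zero N 0 (E n) = zero N 0 (1 + 2 * ℓ n) by rw [hE', Nat.add_comm],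
          QCrypto.zero_add, Nat.zero_add, mul_assoc]
        rfl
      · rw [hend]
        exact Tri.loop hstep)
  exact ⟨A, fun n => hA n ()⟩

end Sampler

end QCrypto

namespace QCrypto

open Function

/-! ### Hybrids of two messages -/

section Mixer

variable {N q m : ℕ} {O : (Fin q → Bool) → QState m}

theorem blk_basis_eq_prod {k : ℕ} (a : ℕ) (f : ℕ → Bool) :
    blk N a (basis fun j : Fin k => f j) = ∏ j ∈ Finset.range k, bit N (a + j) (f j) := by
  induction k with
  | zero =>
    rw [Finset.prod_range_zero, blk_empty, trace_basis, one_smul]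
  | succ k ih =>
    rw [Finset.prod_range_succ, ← ih, bit, ← blk_tens, ← basis_append]
    congr 2
    refine bits_ext fun j hj => ?_
    rw [bitAt_append, bitAt_of_lt _ hj]
    split_ifs with h
    · rw [bitAt_of_lt _ h]
    · obtain rfl : j = k := by omega
      rw [bitAt_of_lt _ (by omega)]

theorem Tri.cswap_bit {a b c : ℕ} {u : Bool} {γ : Amp N} (hc : c < N) (hca : c ≠ a) (hcb : c ≠ b)
    (ha : a < N) (hb : b < N) (hab : a ≠ b) (hγ : Ctrl c u γ) (hi : Indep {a, b} γ) (v w : Bool) :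
    Tri O (cswapB c a b 1) {a, b} (γ * (bit N a v * bit N b w))
      (γ * (bit N a (if u then w else v) * bit N b (if u then v else w))) := by
  have hs : Set.Ico a (a + 1) ∪ Set.Ico b (b + 1) = {a, b} := by
    ext j
    simp only [Set.mem_union, Set.mem_Ico, Set.mem_insert_iff, Set.mem_singleton_iff]
    omega
  have := Tri.cswap (O := O) (k := 1) hc (by omega) (by omega) (by omega) (by omega) (by omega) hγ
    (hs ▸ hi) (basis fun _ => v) (basis fun _ => w)
  rw [hs] at this
  cases u <;> exact this

/-- The values during the first `j` rounds of the selection of the position `i`. -/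
def mixed (i j : ℕ) (f g : ℕ → Bool) (k : ℕ) : Bool :=
  if k < j then if k < i then g k else if k = i then false else f k else f k

theorem mixed_succ_of_ne {i j k : ℕ} (f g : ℕ → Bool) (h : k ≠ j) :
    mixed i (j + 1) f g k = mixed i j f g k := by
  simp only [mixed]
  rw [if_congr (show k < j + 1 ↔ k < j by omega) rfl rfl]

theorem mixed_self (i j : ℕ) (f g : ℕ → Bool) : mixed i j f g j = f j := by
  rw [mixed, if_neg (lt_irrefl _)]

/-- One round of the selection circuit. -/
def mixB (X Y j s t F G : ℕ) : List (Op ℕ) :=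
  cswapB j (X + j) s 1 ++ (cswapB j (Y + j) t 1 ++ (cswapB j F G 1 ++ cswapB F (X + j) (Y + j) 1))

/-- The flags `F` and `G` say whether position `i` is still to come or has been passed. At `j = i`
the one-hot index triggers three swaps: the two bits move out to `s` and `t`, leaving zeros, and the
flags are exchanged. Then `F`, now equal to `decide (j + 1 ≤ i)`, controls the exchange of the two
strings at `j`, so exactly the positions before `i` are exchanged. -/
theorem Tri.mix {E L X Y s t F G i j : ℕ} (hj : j < L) (hL : L ≤ E) (hX : E ≤ X) (hY : X + L ≤ Y)
    (hs : Y + L ≤ s) (ht : s < t) (hF : t < F) (hG : F < G) (hN : G < N) (f g : ℕ → Bool) :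
    Tri O (mixB X Y j s t F G) (Set.Ico X (Y + L) ∪ {s, t, F, G})
      (blk N 0 (basis (onehot E i)) * blk N X (basis fun k : Fin L => mixed i j f g k) *
        blk N Y (basis fun k : Fin L => mixed i j g f k) * bit N s (decide (i < j) && f i) *
        bit N t (decide (i < j) && g i) * bit N F (decide (j ≤ i)) * bit N G (decide (i < j)))
      (blk N 0 (basis (onehot E i)) * blk N X (basis fun k : Fin L => mixed i (j + 1) f g k) *
        blk N Y (basis fun k : Fin L => mixed i (j + 1) g f k) *
        bit N s (decide (i < j + 1) && f i) * bit N t (decide (i < j + 1) && g i) *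
        bit N F (decide (j + 1 ≤ i)) * bit N G (decide (i < j + 1))) := by
  have hprod : ∀ (a : ℕ) (f : ℕ → Bool), blk N a (basis fun k : Fin L => f k) =
      bit N (a + j) (f j) * ∏ k ∈ (Finset.range L).erase j, bit N (a + k) (f k) := fun a f => by
    rw [blk_basis_eq_prod]
    exact (Finset.mul_prod_erase _ (fun k => bit N (a + k) (f k)) (Finset.mem_range.2 hj)).symm
  have hrest : ∀ (a : ℕ) (f g : ℕ → Bool),
      ∏ k ∈ (Finset.range L).erase j, bit N (a + k) (mixed i (j + 1) f g k) =
      ∏ k ∈ (Finset.range L).erase j, bit N (a + k) (mixed i j f g k) := fun a f g =>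
    Finset.prod_congr rfl fun k hk => by rw [mixed_succ_of_ne f g (Finset.ne_of_mem_erase hk)]
  have hind : ∀ (a : ℕ) (f : ℕ → Bool) (A : Set ℕ), (∀ l ∈ A, l < a ∨ a + L ≤ l ∨ l = a + j) →
      Indep A (∏ k ∈ (Finset.range L).erase j, bit N (a + k) (f k)) := fun a f A hA =>
    Indep.prod fun k hk => Indep.blk _ fun l hl => by
      obtain ⟨hne, hk⟩ := Finset.mem_erase.1 hk
      have := Finset.mem_range.1 hk
      have := hA l hl
      omega
  rw [hprod X, hprod Y, hprod X, hprod Y, hrest, hrest, mixed_self, mixed_self]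
  have hX' := hind X (mixed i j f g)
  have hY' := hind Y (mixed i j g f)
  generalize ∏ k ∈ (Finset.range L).erase j, bit N (X + k) (mixed i j f g k) = R at hX' ⊢
  generalize ∏ k ∈ (Finset.range L).erase j, bit N (Y + k) (mixed i j g f k) = R' at hY' ⊢
  have hctrl := Ctrl.blk_basis (N := N) (a := 0) (c := j) (onehot E i) (by omega) (by omega)
  rw [Nat.sub_zero, bitAt_onehot _ (show j < E by omega)] at hctrl
  set u := decide (j = i) with hu
  set γ := blk N 0 (basis (onehot E i)) with hγ
  have hγi : ∀ A : Set ℕ, (∀ l ∈ A, E ≤ l) → Indep A γ := fun A hA =>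
    Indep.blk _ fun l hl => by have := hA l hl; omega
  set x₁ := if u then decide (i < j) && f i else f j with hx₁
  set s₁ := if u then f j else decide (i < j) && f i with hs₁
  set y₁ := if u then decide (i < j) && g i else g j with hy₁
  set t₁ := if u then g j else decide (i < j) && g i with ht₁
  set F₁ := if u then decide (i < j) else decide (j ≤ i) with hF₁
  set G₁ := if u then decide (j ≤ i) else decide (i < j) with hG₁
  refine ((Tri.cswap_bit (O := O) (c := j) (a := X + j) (b := s) (by omega) (by omega) (by omega)
    (by omega) (by omega) (by omega) hctrl ?_ (f j) (decide (i < j) && f i)).step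
    (R * bit N (Y + j) (g j) * R' * bit N t (decide (i < j) && g i) * bit N F (decide (j ≤ i)) *
    bit N G (decide (i < j))) ?_ ?_ ?_ rfl).append
    (((Tri.cswap_bit (O := O) (c := j) (a := Y + j) (b := t) (by omega) (by omega) (by omega)
    (by omega) (by omega) (by omega) hctrl ?_ (g j) (decide (i < j) && g i)).step
    (R * bit N (X + j) x₁ * R' * bit N s s₁ * bit N F (decide (j ≤ i)) *
    bit N G (decide (i < j))) ?_ ?_ ?_ rfl).append
    (((Tri.cswap_bit (O := O) (c := j) (a := F) (b := G) (by omega) (by omega) (by omega)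
    (by omega) (by omega) (by omega) hctrl ?_ (decide (j ≤ i)) (decide (i < j))).step
    (R * bit N (X + j) x₁ * R' * bit N s s₁ * bit N (Y + j) y₁ * bit N t t₁) ?_ ?_ ?_ rfl).append
    ((Tri.cswap_bit (O := O) (c := F) (a := X + j) (b := Y + j) (by omega) (by omega) (by omega)
    (by omega) (by omega) (by omega) (Ctrl.bit F F₁) ?_ x₁ y₁).step
    (R * R' * γ * bit N s s₁ * bit N t t₁ * bit N G G₁) ?_ ?_ ?_ ?_)))
  case refine_17 =>
    have e1 : mixed i (j + 1) f g j = if F₁ then y₁ else x₁ := by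
      rcases Nat.lt_trichotomy j i with h | rfl | h <;>
        simp [mixed, hF₁, hx₁, hy₁, hu, *, Nat.ne_of_lt, Nat.ne_of_gt, Nat.le_of_lt, Nat.not_lt_of_gt]
    have e2 : mixed i (j + 1) g f j = if F₁ then x₁ else y₁ := by
      rcases Nat.lt_trichotomy j i with h | rfl | h <;>
        simp [mixed, hF₁, hx₁, hy₁, hu, *, Nat.ne_of_lt, Nat.ne_of_gt, Nat.le_of_lt, Nat.not_lt_of_gt]
    have e3 : ∀ f : ℕ → Bool, (decide (i < j + 1) && f i) =
        if u then f j else decide (i < j) && f i := fun f => by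
      rcases Nat.lt_trichotomy j i with h | rfl | h <;>
        simp [hu, *, Nat.ne_of_lt, Nat.ne_of_gt, Nat.le_of_lt, Nat.not_lt_of_gt, Nat.lt_succ_iff]
    have e4 : decide (j + 1 ≤ i) = F₁ := by
      rcases Nat.lt_trichotomy j i with h | rfl | h <;>
        simp [hF₁, hu, *, Nat.ne_of_lt, Nat.ne_of_gt, Nat.le_of_lt, Nat.not_lt_of_gt]
    have e5 : decide (i < j + 1) = G₁ := by
      rcases Nat.lt_trichotomy j i with h | rfl | h <;>
        simp [hG₁, hu, *, Nat.ne_of_lt, Nat.ne_of_gt, Nat.le_of_lt, Nat.not_lt_of_gt, Nat.lt_succ_iff]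
    rw [e1, e2, e3, e3, e4, e5]
    ring1
  all_goals first
    | (intro l hl
       simp only [Set.mem_union, Set.mem_Ico, Set.mem_insert_iff, Set.mem_singleton_iff] at hl ⊢
       omega)
    | ring1
    | ((repeat' apply Indep.mul) <;> first
        | (refine hX' _ fun l hl => ?_
           simp only [Set.mem_insert_iff, Set.mem_singleton_iff] at hl
           omega)
        | (refine hY' _ fun l hl => ?_
           simp only [Set.mem_insert_iff, Set.mem_singleton_iff] at hl
           omega)
        | (refine hγi _ fun l hl => ?_
           simp only [Set.mem_insert_iff, Set.mem_singleton_iff] at hl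
           omega)
        | (refine Indep.bit _ ?_
           simp only [Set.mem_insert_iff, Set.mem_singleton_iff]
           omega))

/-- From an index `i` and two strings, prepare the bits at position `i`, and the string that has the
bits of the second string before position `i` and the bits of the first one after it. -/
theorem QPT.exists_mixer {ℓ E : ℕ → ℕ} (hℓ : IsPoly ℓ) (hE : IsPoly E) (hle : ∀ n, ℓ n ≤ E n) :
    ∃ A : QPT (fun n => E n + (ℓ n + ℓ n)) (fun n => 1 + (1 + (E n + ℓ n))),
      ∀ n i (x y : Fin (ℓ n) → Bool),
        A.run n (tens (basis (onehot (E n) i)) (tens (basis x) (basis y))) =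
          tens (basis fun _ => bitAt x i) (tens (basis fun _ => bitAt y i)
            (tens (basis (onehot (E n) i))
              (basis fun k => mixed i (ℓ n) (bitAt x) (bitAt y) k))) := by
  obtain ⟨X, hX, hX'⟩ : ∃ X, IsPoly X ∧ ∀ n, X n = E n := ⟨_, hE, fun _ => rfl⟩
  obtain ⟨s, hs, hs'⟩ : ∃ s, IsPoly s ∧ ∀ n, s n = E n + ℓ n + ℓ n :=
    ⟨_, (hE.add hℓ).add hℓ, fun _ => rfl⟩
  obtain ⟨F, hF, hF'⟩ : ∃ F, IsPoly F ∧ ∀ n, F n = s n + 1 + 1 + E n + ℓ n :=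
    ⟨_, (((hs.add (.const 1)).add (.const 1)).add hE).add hℓ, fun _ => rfl⟩
  obtain ⟨A, hA⟩ := exists_qpt_of_tri (hE.add (hℓ.add hℓ))
    ((IsPoly.const 1).add ((IsPoly.const 1).add (hE.add hℓ))) (.const 2)
    (C := fun n => flipB (F n) ++ ((List.range (ℓ n)).flatMap (fun j =>
        mixB (E n) (E n + ℓ n) j (s n) (s n + 1) (F n) (F n + 1)) ++
      (swapB 0 (s n + 1 + 1) (E n) ++ (swapB (E n) (s n + 1 + 1 + E n) (ℓ n) ++
      (resetB (E n + ℓ n) (ℓ n) ++ (resetB (F n) 1 ++ resetB (F n + 1) 1))))))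
    (by
      refine (UGen.flipB hF.unum).append (.append ?_ ((UGen.swapB (.const 0)
        ((hs.add (.const 1)).add (.const 1)).unum hE.unum).append ((UGen.swapB hE.unum
        (((hs.add (.const 1)).add (.const 1)).add hE).unum hℓ.unum).append
        ((UGen.resetB (hE.add hℓ).unum hℓ.unum).append ((UGen.resetB hF.unum (.const 1)).append
        (UGen.resetB (hF.add (.const 1)).unum (.const 1)))))))
      have hv := UNum.var 1
      have hFu := hF.unum
      have hsu := hs.unum
      exact UGen.range_one (F := fun n j => mixB (E n) (E n + ℓ n) j (s n) (s n + 1) (F n) (F n + 1))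
        hℓ.unum ((UGen.cswapB hv (hE.unum.add hv) hsu (.const 1)).append ((UGen.cswapB hv
        ((hE.add hℓ).unum.add hv) (hs.add (.const 1)).unum (.const 1)).append ((UGen.cswapB hv hFu
        (hF.add (.const 1)).unum (.const 1)).append (UGen.cswapB hFu (hE.unum.add hv)
        ((hE.add hℓ).unum.add hv) (.const 1))))))
    (ι := fun n => ℕ × (Fin (ℓ n) → Bool) × (Fin (ℓ n) → Bool))
    (fun n v => tens (basis (onehot (E n) v.1)) (tens (basis v.2.1) (basis v.2.2)))
    (fun n v => tens (basis fun _ => bitAt v.2.1 v.1) (tens (basis fun _ => bitAt v.2.2 v.1)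
      (tens (basis (onehot (E n) v.1))
        (basis fun k => mixed v.1 (ℓ n) (bitAt v.2.1) (bitAt v.2.2) k)))) (by
      rintro n N ⟨i, x, y⟩ hN
      have := hX' n; have := hs' n; have := hF' n; have := hle n
      have hloop := Tri.loop (O := resetOracle) fun j (hj : j < ℓ n) =>
        Tri.mix (O := resetOracle) (N := N) (E := E n) (X := E n) (Y := E n + ℓ n) (s := s n)
        (t := s n + 1) (F := F n) (G := F n + 1) (i := i) hj (by omega) (by omega) (by omega)
        (by omega) (by omega) (by omega) (by omega) (by omega) (bitAt x) (bitAt y)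
      have hr : ∀ (a k : ℕ) (u : Fin k → Bool), a + k ≤ N → Tri resetOracle (resetB a k)
          (Set.Ico a (a + k)) (blk N a (basis u)) (zero N a k) := fun a k u h => by
        have := Tri.reset h (basis u)
        rwa [trace_basis, one_smul] at this
      have hx : ∀ x : Fin (ℓ n) → Bool, (fun k : Fin (ℓ n) => bitAt x k) = x := fun x =>
        funext fun k => bitAt_of_lt _ k.2
      -- If `i` lies beyond the strings, no bit was moved out, and `bitAt` has its default value
      -- `false` as well.
      have hbit : ∀ x : Fin (ℓ n) → Bool, (decide (i < ℓ n) && bitAt x i) = bitAt x i := fun x => by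
        by_cases h : i < ℓ n
        · simp [h]
        · simp [h, bitAt_of_ge x (show ℓ n ≤ i by omega)]
      have hm : ∀ (f g : ℕ → Bool) (k : ℕ), mixed i 0 f g k = f k := fun f g k => by
        rw [mixed, if_neg (Nat.not_lt_zero k)]
      simp only [hm, hx, hbit, Nat.not_lt_zero, decide_false, Bool.false_and, Nat.zero_le,
        decide_true] at hloop
      have h2 : ∀ a, zero N a 2 = zero N a 1 * zero N (a + 1) 1 := fun a => QCrypto.zero_add a 1 1
      set e := basis (onehot (E n) i) with he
      set y' := fun k : Fin (ℓ n) => mixed i (ℓ n) (bitAt x) (bitAt y) k with hy'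
      set j' := fun k : Fin (ℓ n) => mixed i (ℓ n) (bitAt y) (bitAt x) k with hj'
      set u := decide (ℓ n ≤ i)
      set v := decide (i < ℓ n)
      set ζ := zero N (s n + 1 + 1) (E n) * zero N (s n + 1 + 1 + E n) (ℓ n) with hζ
      set β := bit N (s n) (bitAt x i) * bit N (s n + 1) (bitAt y i) with hβ
      refine ((Tri.flip (O := resetOracle) (a := F n) (by omega) false).step (blk N 0 e *
        blk N (E n) (basis x) * blk N (E n + ℓ n) (basis y) * bit N (s n) false *
        bit N (s n + 1) false * bit N (F n + 1) false * ζ) ?_ ?_ ?_ rfl).append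
        ((hloop.step ζ ?_ ?_ ?_ rfl).append
        (((Tri.swap (O := resetOracle) (a := 0) (b := s n + 1 + 1) (k := E n) (by omega) (by omega)
        (by omega) e (basis fun _ => false)).step (blk N (E n) (basis y') *
        blk N (E n + ℓ n) (basis j') * β * bit N (F n) u * bit N (F n + 1) v *
        zero N (s n + 1 + 1 + E n) (ℓ n)) ?_ ?_ ?_ rfl).append
        (((Tri.swap (O := resetOracle) (a := E n) (b := s n + 1 + 1 + E n) (k := ℓ n) (by omega)
        (by omega) (by omega) (basis y') (basis fun _ => false)).step (zero N 0 (E n) *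
        blk N (s n + 1 + 1) e * blk N (E n + ℓ n) (basis j') * β * bit N (F n) u *
        bit N (F n + 1) v) ?_ ?_ ?_ rfl).append
        (((hr (E n + ℓ n) (ℓ n) j' (by omega)).step (zero N 0 (E n) * zero N (E n) (ℓ n) *
        blk N (s n + 1 + 1) e * blk N (s n + 1 + 1 + E n) (basis y') * β * bit N (F n) u *
        bit N (F n + 1) v) ?_ ?_ ?_ rfl).append
        (((hr (F n) 1 (fun _ => u) (by omega)).step (zero N 0 (E n) * zero N (E n) (ℓ n) *
        zero N (E n + ℓ n) (ℓ n) * blk N (s n + 1 + 1) e * blk N (s n + 1 + 1 + E n) (basis y') *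
        β * bit N (F n + 1) v) ?_ ?_ ?_ rfl).append
        ((hr (F n + 1) 1 (fun _ => v) (by omega)).step (zero N 0 (E n) * zero N (E n) (ℓ n) *
        zero N (E n + ℓ n) (ℓ n) * blk N (s n + 1 + 1) e * blk N (s n + 1 + 1 + E n) (basis y') *
        β * zero N (F n) 1) ?_ ?_ ?_ ?_))))))
      all_goals first
        | exact Set.subset_univ _
        | ring1
        | (simp only [Bool.not_false]
           ring1)
        | (simp only [hF', hs', hβ, hζ, bit, h2, blk_basis_false, blk_tens, QCrypto.zero_add, zero_zero,
            Nat.zero_add, ← Nat.add_assoc]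
           ring1)
        | ((repeat' apply Indep.mul) <;>
            (refine Indep.blk _ fun j hj => ?_
             simp only [Set.mem_union, Set.mem_Ico, Set.mem_insert_iff, Set.mem_singleton_iff] at hj
             omega)))
  exact ⟨A, fun n i x y => hA n (i, x, y)⟩

end Mixer

end QCrypto

namespace QCrypto

open Function

/-! ### Messages of several bits -/

section Blocks

variable {N k l : ℕ}

/-- The states `σ 0, …, σ (t - 1)` on consecutive blocks, from wire `a` on. -/
noncomputable def blks (N a t : ℕ) (σ : ℕ → QState k) : Amp N :=
  ∏ j ∈ Finset.range t, blk N (a + j * k) (σ j)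

theorem blks_congr (a : ℕ) {t : ℕ} {σ τ : ℕ → QState k} (h : ∀ j < t, σ j = τ j) :
    blks N a t σ = blks N a t τ :=
  Finset.prod_congr rfl fun j hj => by rw [h j (Finset.mem_range.1 hj)]

theorem blk_of_blks {K a c t : ℕ} (h : c + t * k ≤ K) (σ : ℕ → QState k) :
    blk N a (Matrix.of (blks K c t σ)) = blks N (a + c) t σ := by
  funext x y
  simp only [blk, blks, Matrix.of_apply, Finset.prod_apply]
  refine Finset.prod_congr rfl fun j hj => ?_
  have := mul_add_le_mul k (Finset.mem_range.1 hj)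
  rw [block_block_add (by omega), block_block_add (by omega), Nat.add_assoc]

/-- Compound states are rewritten as products of blocks, the form in which the algorithms below are
specified. -/
theorem of_tens (σ : QState k) (τ : QState l) :
    tens σ τ = Matrix.of (blk (k + l) 0 σ * blk (k + l) k τ) := by
  refine blk_injective (N := k + l) (a := 0) (by omega) ?_
  rw [blk_of_mul, blk_of_blk (by omega), blk_of_blk (by omega), blk_tens]

theorem of_copies (t : ℕ) (σ : QState k) :
    copies t σ = Matrix.of (blks (t * k) 0 t fun _ => σ) := by
  refine blk_injective (N := t * k) (a := 0) (by omega) ?_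
  rw [blk_of_blks (by omega), blk_copies]
  rfl

theorem of_basis (x : Fin k → Bool) :
    basis x = Matrix.of (blks k 0 k fun j => basis fun _ : Fin 1 => bitAt x j) := by
  refine blk_injective (N := k) (a := 0) (by omega) ?_
  rw [blk_of_blks (by omega), show x = fun j : Fin k => bitAt x j from
    funext fun j => (bitAt_of_lt _ j.2).symm, blk_basis_eq_prod]
  refine Finset.prod_congr rfl fun j hj => ?_
  rw [mul_one, Nat.add_zero, bit, bitAt_of_lt x (Finset.mem_range.1 hj)]
  simp only [bitAt_of_lt _ (Finset.mem_range.1 hj)]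

end Blocks

/-! ### Blockwise application of an algorithm -/

section Map

variable {N : ℕ}

/-- Apply `B` blockwise. -/
theorem QPT.exists_map {h a b o t i i' o' : ℕ → ℕ} (hh : IsPoly h) (ha : IsPoly a) (hb : IsPoly b)
    (ho : IsPoly o) (ht : IsPoly t) (hi : ∀ n, i n = h n + a n + b n)
    (hi' : ∀ n, i' n = h n + t n * a n + t n * b n) (ho' : ∀ n, o' n = t n * o n) (B : QPT i o) :
    ∃ A : QPT i' o', ∀ n u (σ : ℕ → QState (a n)) (τ : ℕ → QState (b n)),
      A.run n (Matrix.of (blk (i' n) 0 (basis u : QState (h n)) * blks (i' n) (h n) (t n) σ *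
        blks (i' n) (h n + t n * a n) (t n) τ)) =
      Matrix.of (blks (o' n) 0 (t n) fun j => B.run n (Matrix.of
        (blk (i n) 0 (basis u : QState (h n)) * blk (i n) (h n) (σ j) *
          blk (i n) (h n + a n) (τ j)))) := by
  have hip : IsPoly i := by
    obtain rfl : i = _ := funext hi
    exact (hh.add ha).add hb
  have hip' : IsPoly i' := by
    obtain rfl : i' = _ := funext hi'
    exact (hh.add (ht.mul ha)).add (ht.mul hb)
  have hop' : IsPoly o' := by
    obtain rfl : o' = _ := funext ho'
    exact ht.mul ho
  have hB := B.isPoly_size hip ho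
  obtain ⟨w, hw, hw'⟩ : ∃ w, IsPoly w ∧ ∀ n, w n = i n + B.size n := ⟨_, hip.add hB, fun _ => rfl⟩
  obtain ⟨K, hK, hK'⟩ : ∃ K, IsPoly K ∧ ∀ n, K n = i' n + o' n := ⟨_, hip'.add hop', fun _ => rfl⟩
  obtain ⟨Y, hY, hY'⟩ : ∃ Y, IsPoly Y ∧ ∀ n, Y n = h n + t n * a n :=
    ⟨_, hh.add (ht.mul ha), fun _ => rfl⟩
  -- The header `u` is a basis state since it is copied for every block. It will be the secret key
  -- for key generation and decryption, and empty for encryption.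
  obtain ⟨A, hA⟩ := exists_qpt_of_tri hip' hop' hw
    (C := fun n => (List.range (t n)).flatMap (fun j => copyB 0 (K n) (h n) ++
      (swapB (h n + j * a n) (K n + h n) (a n) ++ (swapB (Y n + j * b n) (K n + h n + a n) (b n) ++
      applyB B n (K n) (i' n + j * o n) (K n + i n)))) ++ resetB 0 (h n))
    (UGen.append (by
      have hv := UNum.var 1
      exact UGen.range_one (F := fun n j => copyB 0 (K n) (h n) ++
        (swapB (h n + j * a n) (K n + h n) (a n) ++ (swapB (Y n + j * b n) (K n + h n + a n) (b n) ++
        applyB B n (K n) (i' n + j * o n) (K n + i n)))) ht.unum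
        ((UGen.copyB (.const 0) hK.unum hh.unum).append ((UGen.swapB (hh.unum.add (hv.mul ha.unum))
        (hK.add hh).unum ha.unum).append ((UGen.swapB (hY.unum.add (hv.mul hb.unum))
        ((hK.add hh).add ha).unum hb.unum).append (UGen.applyB hip ho B (UNum.var 0) hK.unum
        (hip'.unum.add (hv.mul ho.unum)) (hK.add hip).unum))))) (UGen.resetB (.const 0) hh.unum))
    (ι := fun n => (Fin (h n) → Bool) × (ℕ → QState (a n)) × (ℕ → QState (b n)))
    (fun n v => Matrix.of (blk (i' n) 0 (basis v.1) * blks (i' n) (h n) (t n) v.2.1 *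
        blks (i' n) (h n + t n * a n) (t n) v.2.2))
    (fun n v => Matrix.of (blks (o' n) 0 (t n) fun j => B.run n (Matrix.of
        (blk (i n) 0 (basis v.1) * blk (i n) (h n) (v.2.1 j) * blk (i n) (h n + a n) (v.2.2 j))))) (by
      rintro n N ⟨u, σ, τ⟩ hN
      have := hi n; have := hi' n; have := ho' n; have := hK' n; have := hw' n; have := hY' n
      set ξ : ℕ → QState (i n) := fun j => Matrix.of (blk (i n) 0 (basis u) *
        blk (i n) (h n) (σ j) * blk (i n) (h n + a n) (τ j)) with hξ
      have hle := fun (d j : ℕ) (hj : j < t n) => mul_add_le_mul d hj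
      have hlt := fun (d i j : ℕ) (hij : j < i) => mul_add_le_mul d hij
      have eξ : ∀ j, blk N (K n) (ξ j) = blk N (K n) (basis u) * blk N (K n + h n) (σ j) *
          blk N (K n + h n + a n) (τ j) := fun j => by
        rw [hξ, blk_of_mul, blk_of_mul, blk_of_blk (by omega), blk_of_blk (by omega),
          blk_of_blk (by omega), Nat.add_zero, ← Nat.add_assoc]
      have eK : zero N (K n) (i n) = zero N (K n) (h n) * zero N (K n + h n) (a n) *
          zero N (K n + h n + a n) (b n) := by
        rw [hi, QCrypto.zero_add, QCrypto.zero_add, ← Nat.add_assoc]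
      -- What all rounds share and restore: the header and the clean zone in which `B` is run.
      set γ := blk N 0 (basis u) * zero N (K n) (i n) * zero N (K n + i n) (B.size n) with hγ
      have hloop := Tri.parallel (O := resetOracle) (n := t n) (γ := γ)
        (C := fun j => copyB 0 (K n) (h n) ++
        (swapB (h n + j * a n) (K n + h n) (a n) ++ (swapB (Y n + j * b n) (K n + h n + a n) (b n) ++
        applyB B n (K n) (i' n + j * o n) (K n + i n))))
        (A := Set.Ici (h n)) (S := fun j => Set.Ici (K n) ∪
          Set.Ico (h n + j * a n) (h n + j * a n + a n) ∪
          Set.Ico (Y n + j * b n) (Y n + j * b n + b n) ∪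
          Set.Ico (i' n + j * o n) (i' n + j * o n + o n))
        (f := fun j => blk N (h n + j * a n) (σ j) * blk N (Y n + j * b n) (τ j) *
          zero N (i' n + j * o n) (o n))
        (g := fun j => zero N (h n + j * a n) (a n) * zero N (Y n + j * b n) (b n) *
          blk N (i' n + j * o n) (B.run n (ξ j)))
        (fun j hj => by
          have := hle (a n) j hj; have := hle (b n) j hj; have := hle (o n) j hj
          refine ((Tri.copy (O := resetOracle) (a := 0) (b := K n) (k := h n) (by omega) (by omega)
            (by omega) u).step (blk N (h n + j * a n) (σ j) * blk N (Y n + j * b n) (τ j) *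
            zero N (i' n + j * o n) (o n) * zero N (K n + h n) (a n) *
            zero N (K n + h n + a n) (b n) * zero N (K n + i n) (B.size n)) ?_ ?_ ?_ rfl).append
            (((Tri.swap (O := resetOracle) (a := h n + j * a n) (b := K n + h n) (k := a n)
            (by omega) (by omega) (by omega) (σ j) (basis fun _ => false)).step (blk N 0 (basis u) *
            blk N (K n) (basis u) * blk N (Y n + j * b n) (τ j) * zero N (i' n + j * o n) (o n) *
            zero N (K n + h n + a n) (b n) * zero N (K n + i n) (B.size n)) ?_ ?_ ?_ rfl).append
            (((Tri.swap (O := resetOracle) (a := Y n + j * b n) (b := K n + h n + a n) (k := b n)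
            (by omega) (by omega) (by omega) (τ j) (basis fun _ => false)).step (blk N 0 (basis u) *
            blk N (K n) (basis u) * blk N (K n + h n) (σ j) * zero N (h n + j * a n) (a n) *
            zero N (i' n + j * o n) (o n) * zero N (K n + i n) (B.size n)) ?_ ?_ ?_ rfl).append
            ((Tri.apply B n (a := K n) (b := i' n + j * o n) (z := K n + i n) (by omega) (by omega)
            (by omega) (by omega) (by omega) (by omega) (ξ j)).step (blk N 0 (basis u) *
            zero N (h n + j * a n) (a n) * zero N (Y n + j * b n) (b n)) ?_ ?_ ?_ ?_)))
          all_goals first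
            | (intro l hl
               simp only [Set.mem_union, Set.mem_Ico, Set.mem_Ici] at hl ⊢
               omega)
            | (simp only [hγ, eξ, eK, blk_basis_false]
               ring1)
            | ((repeat' apply Indep.mul) <;>
                (refine Indep.blk _ fun j hj => ?_
                 simp only [Set.mem_union, Set.mem_Ico] at hj
                 omega)))
        (fun j hj l hl => by
          have := hle (a n) j hj; have := hle (b n) j hj; have := hle (o n) j hj
          simp only [Set.mem_union, Set.mem_Ico, Set.mem_Ici] at hl ⊢
          omega)
        (fun l hl j hj hij => by
          have := hlt (a n) _ _ hij; have := hlt (b n) _ _ hij; have := hlt (o n) _ _ hij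
          have := hle (a n) l hl; have := hle (b n) l hl; have := hle (o n) l hl
          refine ((Indep.blk _ fun m hm => ?_).mul (Indep.blk _ fun m hm => ?_)).mul
            (Indep.blk _ fun m hm => ?_) <;>
          · simp only [Set.mem_union, Set.mem_Ico, Set.mem_Ici] at hm
            omega)
        (fun l hl j hj hij => by
          have := hlt (a n) _ _ hij; have := hlt (b n) _ _ hij; have := hlt (o n) _ _ hij
          have := hle (a n) j hj; have := hle (b n) j hj; have := hle (o n) j hj
          refine ((Indep.blk _ fun m hm => ?_).mul (Indep.blk _ fun m hm => ?_)).mul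
            (Indep.blk _ fun m hm => ?_) <;>
          · simp only [Set.mem_union, Set.mem_Ico, Set.mem_Ici] at hm
            omega)
      have hr := Tri.reset (N := N) (a := 0) (k := h n) (by omega) (basis u)
      rw [trace_basis, one_smul] at hr
      have e1 : zero N (i' n) (o' n + w n) = (∏ j ∈ Finset.range (t n),
          zero N (i' n + j * o n) (o n)) * zero N (K n) (i n) * zero N (K n + i n) (B.size n) := by
        rw [hw', QCrypto.zero_add, QCrypto.zero_add, ← hK', ho', zero_mul_eq_prod, mul_assoc]
      have e2 : zero N 0 (i' n) = zero N 0 (h n) * (∏ j ∈ Finset.range (t n),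
          zero N (h n + j * a n) (a n)) * ∏ j ∈ Finset.range (t n), zero N (Y n + j * b n) (b n) := by
        rw [hi', QCrypto.zero_add, QCrypto.zero_add, zero_mul_eq_prod, zero_mul_eq_prod, Nat.zero_add,
          Nat.zero_add, ← hY']
      rw [blk_of_mul, blk_of_mul, blk_of_blk (by omega), blk_of_blks (by omega),
        blk_of_blks (by omega), blk_of_blks (by omega), e1, e2, hw',
        QCrypto.zero_add _ (i n) (B.size n), ← hK', Nat.zero_add, Nat.zero_add, Nat.zero_add,
        Nat.add_zero, ← hY']
      rw [Finset.prod_mul_distrib, Finset.prod_mul_distrib, Finset.prod_mul_distrib,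
        Finset.prod_mul_distrib] at hloop
      refine (hloop.step 1 (Set.subset_univ _) Indep.one ?_ rfl).append
        (hr.step (((∏ j ∈ Finset.range (t n), zero N (h n + j * a n) (a n)) *
        (∏ j ∈ Finset.range (t n), zero N (Y n + j * b n) (b n)) *
        ∏ j ∈ Finset.range (t n), blk N (i' n + j * o n) (B.run n (ξ j))) *
        (zero N (K n) (i n) * zero N (K n + i n) (B.size n))) (Set.subset_univ _) ?_ ?_ ?_)
      · rw [hγ, blks, blks]
        ring1
      · refine (((Indep.prod fun j _ => ?_).mul (Indep.prod fun j _ => ?_)).mul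
          (Indep.prod fun j _ => ?_)).mul (Indep.mul ?_ ?_) <;>
        · refine Indep.blk _ fun l hl => ?_
          simp only [Set.mem_Ico] at hl
          omega
      · rw [hγ]
        ring1
      · rw [blks]
        ring1)
  exact ⟨A, fun n u σ τ => hA n (u, σ, τ)⟩

end Map

end QCrypto

namespace QCrypto

open Function

/-! ### Bitwise encryption and its correctness -/

section Bitwise

open scoped ComplexOrder

variable {N : ℕ} {ℓ κ p c : ℕ → ℕ}

theorem blk_one_zero (a : ℕ) : blk N a (1 : QState 0) = 1 := by
  rw [blk_empty, trace_one_zero, one_smul]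

theorem blk_basis_zero (a : ℕ) (u : Fin 0 → Bool) : blk N a (basis u) = 1 := by
  rw [blk_empty, trace_basis, one_smul]

theorem blks_one_zero (a t : ℕ) : blks N a t (fun _ => (1 : QState 0)) = 1 :=
  Finset.prod_eq_one fun _ _ => blk_one_zero _

/-- Encryption of several bits, bit by bit. -/
theorem QPKE.exists_bitwise (hℓ : IsPoly ℓ) (hκ : IsPoly κ) (hp : IsPoly p) (hc : IsPoly c)
    (P : QPKE (fun _ => 1) κ p c) :
    ∃ P' : QPKE ℓ κ (fun n => ℓ n * p n) (fun n => ℓ n * c n), P'.skGen = P.skGen ∧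
      (∀ n sk, P'.pk n sk = copies (ℓ n) (P.pk n sk)) ∧
      (∀ n ρ x, P'.ct n (copies (ℓ n) ρ) x =
        Matrix.of (blks _ 0 (ℓ n) fun j => P.ct n ρ fun _ => bitAt x j)) ∧
      ∀ n (sk : Fin (κ n) → Bool) (σ : ℕ → QState (c n)),
        P'.dec.run n (tens (basis sk) (Matrix.of (blks _ 0 (ℓ n) σ))) =
          Matrix.of (blks (ℓ n) 0 (ℓ n) fun j => P.dec.run n (tens (basis sk) (σ j))) := by
  -- Unused slots of the blockwise construction are filled with blocks of zero qubits.
  obtain ⟨G, hG⟩ := QPT.exists_map (i := κ) (i' := κ) (o' := fun n => ℓ n * p n) hκ (.const 0)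
    (.const 0) hp hℓ (fun n => by simp) (fun n => by simp) (fun _ => rfl) P.pkGen
  obtain ⟨E, hE⟩ := QPT.exists_map (i := fun n => p n + 1) (i' := fun n => ℓ n * p n + ℓ n)
    (o' := fun n => ℓ n * c n) (.const 0) hp (.const 1) hc hℓ
    (fun n => by simp) (fun n => by simp) (fun _ => rfl) P.enc
  obtain ⟨D, hD⟩ := QPT.exists_map (i := fun n => κ n + c n) (i' := fun n => κ n + ℓ n * c n) (o' := ℓ) hκ hc (.const 0)
    (.const 1) hℓ (fun n => by simp) (fun n => by simp) (fun n => by simp) P.dec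
  refine ⟨⟨P.skGen, G, E, D⟩, rfl, fun n sk => ?_, fun n ρ x => ?_, fun n sk σ => ?_⟩
  · have e := hG n sk (fun _ => 1) (fun _ => 1)
    have e1 : Matrix.of (blk (κ n) 0 (basis sk)) = basis sk := blk_zero_self _
    simp only [blks_one_zero, blk_one_zero, mul_one, e1] at e
    exact e.trans (of_copies (ℓ n) (P.pk n sk)).symm
  · have e := hE n (fun _ => false) (fun _ => ρ) (fun j => basis fun _ => bitAt x j)
    have e1 : tens (copies (ℓ n) ρ) (basis x) = Matrix.of (blks (ℓ n * p n + ℓ n) 0 (ℓ n)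
        (fun _ => ρ) * blks (ℓ n * p n + ℓ n) (ℓ n * p n) (ℓ n) fun j =>
          basis fun _ : Fin 1 => bitAt x j) := by
      rw [of_tens, of_copies, blk_of_blks (by omega), of_basis, blk_of_blks (by omega),
        Nat.add_zero, Nat.add_zero]
    have e2 : ∀ j, tens ρ (basis fun _ : Fin 1 => bitAt x j) = Matrix.of (blk (p n + 1) 0 ρ *
        blk (p n + 1) (p n) (basis fun _ : Fin 1 => bitAt x j)) := fun j => of_tens _ _
    simp only [blk_basis_zero, one_mul, Nat.zero_add] at e
    refine (congrArg (E.run n) e1).trans (e.trans ?_)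
    refine congrArg (fun f => Matrix.of (blks (ℓ n * c n) 0 (ℓ n) f)) ?_
    exact funext fun j => (congrArg (P.enc.run n) (e2 j)).symm
  · have e := hD n sk σ (fun _ => 1)
    have e1 : tens (basis sk) (Matrix.of (blks (ℓ n * c n) 0 (ℓ n) σ)) =
        Matrix.of (blk (κ n + ℓ n * c n) 0 (basis sk) *
          blks (κ n + ℓ n * c n) (κ n) (ℓ n) σ) := by
      rw [of_tens, blk_of_blks (by omega), Nat.add_zero]
    have e2 : ∀ j, tens (basis sk) (σ j) = Matrix.of (blk (κ n + c n) 0 (basis sk) *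
        blk (κ n + c n) (κ n) (σ j)) := fun j => of_tens _ _
    simp only [blks_one_zero, blk_one_zero, mul_one] at e
    refine (congrArg (D.run n) e1).trans (e.trans ?_)
    refine congrArg (fun f => Matrix.of (blks (ℓ n) 0 (ℓ n) f)) ?_
    exact funext fun j => (congrArg (P.dec.run n) (e2 j)).symm

/-- Diagonal entries of positive semidefinite matrices are real, so the real part of their product
is the product of the real parts. -/
theorem prob_blks {t : ℕ} (σ : ℕ → QState 1) (hσ : ∀ j, (σ j).PosSemidef) (x : Fin t → Bool) :
    prob (Matrix.of (blks t 0 t σ)) x = ∏ j ∈ Finset.range t, prob (σ j) fun _ => bitAt x j := by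
  have h : ∀ j (u : Fin 1 → Bool), σ j u u = (prob (σ j) u : ℝ) := fun j u =>
    Complex.ext (by simp [prob]) (by
      simpa using (Complex.le_def.1 ((hσ j).diag_nonneg (i := u))).2.symm)
  have hb : ∀ j, block 1 (0 + j * 1) x = fun _ => bitAt x j := fun j => by
    funext i
    rw [block, Subsingleton.elim i 0, Nat.zero_add, mul_one]
    rfl
  rw [prob, Matrix.of_apply, blks, Finset.prod_apply, Finset.prod_apply]
  simp only [blk, hb, h]
  rw [← Complex.ofReal_prod, Complex.ofReal_re]

/-- The union bound: the probability that all of several independent events occur is at least one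
minus the sum of the failure probabilities. -/
theorem one_sub_sum_le_prod {ι : Type*} (s : Finset ι) (f : ι → ℝ) (h0 : ∀ i, 0 ≤ f i)
    (h1 : ∀ i, f i ≤ 1) : 1 - ∑ i ∈ s, (1 - f i) ≤ ∏ i ∈ s, f i := by
  classical
  induction s using Finset.induction_on with
  | empty => simp
  | insert a s ha ih =>
    rw [Finset.sum_insert ha, Finset.prod_insert ha]
    have hp : ∏ i ∈ s, f i ≤ 1 := Finset.prod_le_one (fun i _ => h0 i) fun i _ => h1 i
    nlinarith [h0 a, h1 a]

theorem Negligible.poly_mul {f : ℕ → ℝ} (hf : Negligible f) {k : ℕ → ℕ} (hk : IsPoly k) :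
    Negligible fun n => (k n : ℝ) * f n := by
  obtain ⟨q, hq⟩ := hk
  have := Asymptotics.SuperpolynomialDecay.polynomial_mul hf (q.map (Nat.castRingHom ℝ))
  refine this.congr fun n => ?_
  rw [hq]
  simp

theorem QPKE.keyProb_nonneg (P : QPKE ℓ κ p c) (n : ℕ) (sk : Fin (κ n) → Bool) :
    0 ≤ P.keyProb n sk :=
  prob_nonneg (P.skGen.posSemidef_run n Matrix.PosSemidef.one) sk

theorem QPKE.sum_keyProb (P : QPKE ℓ κ p c) (n : ℕ) : ∑ sk, P.keyProb n sk = 1 := by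
  have h := P.skGen.trace_run n (1 : QState 0)
  rw [trace_one_zero] at h
  refine (sum_prob (P.skGen.run n (1 : QState 0))).trans ?_
  rw [h, Complex.one_re]

/-- All bits share one secret key, so their success probabilities multiply only for a fixed key. The
union bound makes the estimate linear, and it can then be averaged over the key; the error grows by
the factor `ℓ`. -/
theorem QPKE.Correct.bitwise {p' c' : ℕ → ℕ} (hℓ : IsPoly ℓ) {P : QPKE (fun _ => 1) κ p c}
    (hP : P.Correct) {P' : QPKE ℓ κ p' c'} (hkey : P'.skGen = P.skGen)
    (h : ∀ n sk x, P'.dec.run n (tens (basis sk) (P'.ct n (P'.pk n sk) x)) =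
      Matrix.of (blks (ℓ n) 0 (ℓ n) fun j => P.dec.run n
        (tens (basis sk) (P.ct n (P.pk n sk) fun _ => bitAt x j)))) : P'.Correct := by
  obtain ⟨ε, hε, hcor⟩ := hP
  refine ⟨_, hε.poly_mul hℓ, fun n x => ?_⟩
  have hpsd : ∀ sk x, (P.dec.run n (tens (basis sk) (P.ct n (P.pk n sk) x))).PosSemidef :=
    fun sk x => P.dec.posSemidef_run n (posSemidef_tens (posSemidef_basis _)
      (P.enc.posSemidef_run n (posSemidef_tens (P.pkGen.posSemidef_run n (posSemidef_basis _))
        (posSemidef_basis _))))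
  have htr : ∀ sk x, (P.dec.run n (tens (basis sk) (P.ct n (P.pk n sk) x))).trace = 1 :=
    fun sk x => by
      rw [QPT.trace_run, trace_tens, QPKE.ct, QPT.trace_run, trace_tens, QPKE.pk, QPT.trace_run,
        trace_basis, trace_basis, mul_one, mul_one]
  set π : (Fin (κ n) → Bool) → ℕ → ℝ := fun sk j =>
    prob (P.dec.run n (tens (basis sk) (P.ct n (P.pk n sk) fun _ => bitAt x j))) fun _ => bitAt x j
    with hπ
  have h0 : ∀ sk j, 0 ≤ π sk j := fun sk j => prob_nonneg (hpsd _ _) _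
  have h1 : ∀ sk j, π sk j ≤ 1 := fun sk j => by
    have := sum_prob (P.dec.run n (tens (basis sk) (P.ct n (P.pk n sk) fun _ => bitAt x j)))
    rw [htr, Complex.one_re] at this
    rw [← this]
    exact Finset.single_le_sum (f := prob _) (fun y _ => prob_nonneg (hpsd _ _) y)
      (Finset.mem_univ _)
  have hk : ∀ sk, P'.keyProb n sk = P.keyProb n sk := fun sk => by
    rw [QPKE.keyProb, hkey]
    rfl
  calc 1 - (ℓ n : ℝ) * ε n ≤ 1 - ∑ j ∈ Finset.range (ℓ n), (1 - ∑ sk, P.keyProb n sk * π sk j) := by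
        have : ∑ j ∈ Finset.range (ℓ n), (1 - ∑ sk, P.keyProb n sk * π sk j) ≤
            ∑ j ∈ Finset.range (ℓ n), ε n := Finset.sum_le_sum fun j _ => by
          have := hcor n fun _ => bitAt x j
          linarith
        rw [Finset.sum_const, Finset.card_range, nsmul_eq_mul] at this
        linarith
    _ = ∑ sk, P.keyProb n sk * (1 - ∑ j ∈ Finset.range (ℓ n), (1 - π sk j)) := by
        simp only [mul_sub, mul_one, Finset.sum_sub_distrib (f := fun sk => P.keyProb n sk),
          P.sum_keyProb, Finset.mul_sum]
        rw [Finset.sum_comm (s := Finset.univ)]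
        simp only [Finset.sum_sub_distrib, P.sum_keyProb]
    _ ≤ ∑ sk, P.keyProb n sk * ∏ j ∈ Finset.range (ℓ n), π sk j :=
        Finset.sum_le_sum fun sk _ => mul_le_mul_of_nonneg_left
          (one_sub_sum_le_prod _ _ (h0 sk) (h1 sk)) (P.keyProb_nonneg n sk)
    _ = _ := Finset.sum_congr rfl fun sk _ => by
        rw [hk, h, prob_blks _ fun j => hpsd _ _]

end Bitwise

end QCrypto

namespace QCrypto

open Function

/-! ### Pipelines of algorithms on parts of a register -/

section Pipeline

variable {N : ℕ} {a b i o h I J : ℕ → ℕ}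

theorem tens_one_zero {k : ℕ} (σ : QState k) : tens σ (1 : QState 0) = σ :=
  blk_injective (N := k) (a := 0) (by omega) (by
    refine (blk_tens (N := k) 0 σ (1 : QState 0)).trans ?_
    rw [blk_one_zero, mul_one])

theorem QPT.exists_then (hi : IsPoly i) (ho : IsPoly o) (hJ : IsPoly J) (A : QPT i o)
    (B : QPT o J) : ∃ C : QPT i J, ∀ n ρ, C.run n ρ = B.run n (A.run n ρ) := by
  obtain ⟨C, hC⟩ := QPT.exists_comp (b := fun _ => 0) hi ho (.const 0) hJ A B
  refine ⟨C, fun n ρ => ?_⟩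
  have e := hC n ρ 1
  rw [tens_one_zero, tens_one_zero] at e
  exact e

/-- Apply `A` to the wires from `a` on. -/
theorem QPT.exists_apply_at (ha : IsPoly a) (hb : IsPoly b) (hi : IsPoly i) (ho : IsPoly o)
    (hI : ∀ n, I n = a n + i n + b n) (hJ : ∀ n, J n = a n + o n + b n) (A : QPT i o) :
    ∃ C : QPT I J, ∀ n (α : QState (a n)) (σ : QState (i n)) (β : QState (b n)),
      C.run n (Matrix.of (blk (I n) 0 α * blk (I n) (a n) σ * blk (I n) (a n + i n) β)) =
        Matrix.of (blk (J n) 0 α * blk (J n) (a n) (A.run n σ) * blk (J n) (a n + o n) β) := by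
  have hIp : IsPoly I := by
    obtain rfl : I = _ := funext hI
    exact (ha.add hi).add hb
  have hJp : IsPoly J := by
    obtain rfl : J = _ := funext hJ
    exact (ha.add ho).add hb
  have hA := A.isPoly_size hi ho
  obtain ⟨C, hC⟩ := exists_qpt_of_tri hIp hJp hA
    (C := fun n => applyB A n (a n) (I n + a n) (I n + J n) ++ (swapB 0 (I n) (a n) ++
      swapB (a n + i n) (I n + a n + o n) (b n)))
    ((UGen.applyB hi ho A (UNum.var 0) ha.unum (hIp.add ha).unum (hIp.add hJp).unum).append
      ((UGen.swapB (.const 0) hIp.unum ha.unum).append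
      (UGen.swapB (ha.add hi).unum ((hIp.add ha).add ho).unum hb.unum)))
    (ι := fun n => QState (a n) × QState (i n) × QState (b n))
    (fun n v => Matrix.of (blk (I n) 0 v.1 * blk (I n) (a n) v.2.1 * blk (I n) (a n + i n) v.2.2))
    (fun n v => Matrix.of (blk (J n) 0 v.1 * blk (J n) (a n) (A.run n v.2.1) *
      blk (J n) (a n + o n) v.2.2)) (by
      rintro n N ⟨α, σ, β⟩ hN
      have := hI n; have := hJ n
      have e1 : zero N (I n) (J n + A.size n) = zero N (I n) (a n) * zero N (I n + a n) (o n) *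
          zero N (I n + a n + o n) (b n) * zero N (I n + J n) (A.size n) := by
        rw [hJ, QCrypto.zero_add, QCrypto.zero_add, QCrypto.zero_add]
        simp only [Nat.add_assoc]
      have e2 : zero N 0 (I n) = zero N 0 (a n) * zero N (a n) (i n) * zero N (a n + i n) (b n) := by
        rw [hI, QCrypto.zero_add, QCrypto.zero_add, Nat.zero_add, Nat.zero_add]
      rw [blk_of_mul, blk_of_mul, blk_of_mul, blk_of_mul, blk_of_blk (by omega),
        blk_of_blk (by omega), blk_of_blk (by omega), blk_of_blk (by omega), blk_of_blk (by omega),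
        blk_of_blk (by omega), e1, e2]
      simp only [Nat.zero_add, Nat.add_zero, ← Nat.add_assoc (I n)]
      refine ((Tri.apply A n (a := a n) (b := I n + a n) (z := I n + J n) (by omega) (by omega)
        (by omega) (by omega) (by omega) (by omega) σ).step (blk N 0 α * blk N (a n + i n) β *
        zero N (I n) (a n) * zero N (I n + a n + o n) (b n)) ?_ ?_ ?_ rfl).append
        (((Tri.swap (O := resetOracle) (a := 0) (b := I n) (k := a n) (by omega) (by omega)
        (by omega) α (basis fun _ => false)).step (zero N (a n) (i n) * blk N (a n + i n) β *
        blk N (I n + a n) (A.run n σ) * zero N (I n + a n + o n) (b n) *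
        zero N (I n + J n) (A.size n)) ?_ ?_ ?_ rfl).append
        ((Tri.swap (O := resetOracle) (a := a n + i n) (b := I n + a n + o n) (k := b n) (by omega)
        (by omega) (by omega) β (basis fun _ => false)).step (zero N 0 (a n) * zero N (a n) (i n) *
        blk N (I n) α * blk N (I n + a n) (A.run n σ) * zero N (I n + J n) (A.size n)) ?_ ?_ ?_ ?_))
      all_goals first
        | exact Set.subset_univ _
        | ring1
        | (simp only [blk_basis_false]
           ring1)
        | ((repeat' apply Indep.mul) <;>
            (refine Indep.blk _ fun j hj => ?_
             simp only [Set.mem_union, Set.mem_Ico] at hj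
             omega)))
  exact ⟨C, fun n α σ β => hC n (α, σ, β)⟩

/-- Apply `A` to some wires of the output of `Q`. -/
theorem QPT.exists_then_at (hh : IsPoly h) (ha : IsPoly a) (hb : IsPoly b) (hi : IsPoly i)
    (ho : IsPoly o) (hI : ∀ n, I n = a n + i n + b n) (hJ : ∀ n, J n = a n + o n + b n)
    (Q : QPT h I) (A : QPT i o) :
    ∃ C : QPT h J, ∀ n ρ {ι : Type} (s : Finset ι) (c : ι → ℂ) (α : ι → QState (a n))
      (σ : ι → QState (i n)) (β : ι → QState (b n)), Q.run n ρ = ∑ j ∈ s, c j •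
        Matrix.of (blk (I n) 0 (α j) * blk (I n) (a n) (σ j) * blk (I n) (a n + i n) (β j)) →
      C.run n ρ = ∑ j ∈ s, c j • Matrix.of (blk (J n) 0 (α j) * blk (J n) (a n) (A.run n (σ j)) *
        blk (J n) (a n + o n) (β j)) := by
  have hIp : IsPoly I := by
    obtain rfl : I = _ := funext hI
    exact (ha.add hi).add hb
  have hJp : IsPoly J := by
    obtain rfl : J = _ := funext hJ
    exact (ha.add ho).add hb
  obtain ⟨F, hF⟩ := QPT.exists_apply_at ha hb hi ho hI hJ A
  obtain ⟨C, hC⟩ := QPT.exists_then hh hIp hJp Q F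
  refine ⟨C, fun n ρ ι s c α σ β e => ?_⟩
  rw [hC, e, QPT.run_sum]
  exact Finset.sum_congr rfl fun j _ => by rw [QPT.run_smul, hF]

theorem QPT.exists_flip (ha : IsPoly a) (hb : IsPoly b) :
    ∃ C : QPT (fun n => a n + b n) (fun n => b n + a n), ∀ n (σ : QState (a n)) (τ : QState (b n)),
      C.run n (tens σ τ) = tens τ σ := by
  obtain ⟨I, hI, hI'⟩ : ∃ I, IsPoly I ∧ ∀ n, I n = a n + b n := ⟨_, ha.add hb, fun _ => rfl⟩
  obtain ⟨C, hC⟩ := exists_qpt_of_tri (ha.add hb) (hb.add ha) (.const 0)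
    (C := fun n => swapB 0 (I n + b n) (a n) ++ swapB (a n) (I n) (b n))
    ((UGen.swapB (.const 0) (hI.add hb).unum ha.unum).append
      (UGen.swapB ha.unum hI.unum hb.unum))
    (ι := fun n => QState (a n) × QState (b n)) (fun n v => tens v.1 v.2)
    (fun n v => tens v.2 v.1) (by
      rintro n N ⟨σ, τ⟩ hN
      have := hI' n
      refine ((Tri.swap (O := resetOracle) (a := 0) (b := I n + b n) (k := a n) (by omega) (by omega)
        (by omega) σ (basis fun _ => false)).step (blk N (a n) τ * zero N (I n) (b n)) ?_ ?_ ?_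
        rfl).append ((Tri.swap (O := resetOracle) (a := a n) (b := I n) (k := b n) (by omega)
        (by omega) (by omega) τ (basis fun _ => false)).step (zero N 0 (a n) *
        blk N (I n + b n) σ) ?_ ?_ ?_ ?_)
      all_goals first
        | exact Set.subset_univ _
        | (simp only [hI', blk_basis_false, blk_tens, QCrypto.zero_add, zero_zero, Nat.zero_add,
            Nat.add_zero, mul_one, ← Nat.add_assoc]
           ring1)
        | ((repeat' apply Indep.mul) <;>
            (refine Indep.blk _ fun j hj => ?_
             simp only [Set.mem_union, Set.mem_Ico] at hj
             omega)))
  exact ⟨C, fun n σ τ => hC n (σ, τ)⟩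

/-- Measure two blocks. -/
theorem QPT.exists_measure_two (ha : IsPoly a) (hb : IsPoly b) :
    ∃ C : QPT (fun n => a n + (a n + b n)) (fun n => a n + (a n + b n)), ∀ n τ, C.run n τ =
      ∑ x : (Fin (a n) → Bool) × (Fin (a n) → Bool),
        tens (basis x.1) (tens (basis x.2) (onOutcome (onOutcome τ x.1) x.2)) := by
  obtain ⟨I, hI, hI'⟩ : ∃ I, IsPoly I ∧ ∀ n, I n = a n + (a n + b n) :=
    ⟨_, ha.add (ha.add hb), fun _ => rfl⟩
  refine exists_qpt_of_tri (ha.add (ha.add hb)) (ha.add (ha.add hb)) (.const 1)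
    (C := fun n => dephB 0 (a n + a n) (I n + I n) ++ swapB 0 (I n) (I n))
    ((UGen.dephB (.const 0) (ha.add ha).unum (hI.add hI).unum).append
      (UGen.swapB (.const 0) hI.unum hI.unum))
    (ι := fun n => QState (a n + (a n + b n))) (fun n τ => τ) _ ?_
  intro n N τ hN
  have := hI' n
  have e : blk N 0 τ * diagB N 0 (a n + a n) = blk N 0 (∑ x : (Fin (a n) → Bool) ×
      (Fin (a n) → Bool), tens (basis x.1) (tens (basis x.2) (onOutcome (onOutcome τ x.1) x.2))) := by
    rw [diagB_append, ← mul_assoc, blk_mul_diagB, Finset.sum_mul, blk_sum, Fintype.sum_prod_type]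
    refine Finset.sum_congr rfl fun x _ => ?_
    rw [mul_assoc, Nat.zero_add, blk_mul_diagB, Finset.mul_sum]
    refine Finset.sum_congr rfl fun y _ => ?_
    rw [blk_tens, blk_tens, Nat.zero_add]
  have e1 : zero N (a n + (a n + b n)) (a n + (a n + b n) + 1) =
      zero N (I n) (I n) * zero N (I n + I n) 1 := by
    rw [QCrypto.zero_add, hI']
  have e2 : swapB 0 (I n) (I n) = swapB 0 (a n + (a n + b n)) (a n + (a n + b n)) := by rw [hI']
  simp only [e1, e2]
  refine ((Tri.deph (a := 0) (k := a n + a n) (s := I n + I n) (by omega) (by omega) (by omega)).step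
    (blk N 0 τ * zero N (I n) (I n)) ?_ ?_ ?_ rfl).append
    ((Tri.swap (O := resetOracle) (a := 0) (b := a n + (a n + b n)) (k := a n + (a n + b n)) (by omega) (by omega)
    (by omega) (∑ x : (Fin (a n) → Bool) × (Fin (a n) → Bool), tens (basis x.1)
      (tens (basis x.2) (onOutcome (onOutcome τ x.1) x.2))) (basis fun _ => false)).step
    (zero N (I n + I n) 1) ?_ ?_ ?_ ?_)
  · exact Set.subset_univ _
  · refine (Indep.blk _ fun j hj => ?_).mul (Indep.blk _ fun j hj => ?_) <;>
    · simp only [Set.mem_singleton_iff] at hj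
      omega
  · ring1
  · exact Set.subset_univ _
  · refine Indep.blk _ fun j hj => ?_
    simp only [Set.mem_union, Set.mem_Ico] at hj
    omega
  · rw [← e, hI', blk_basis_false]
    ring1
  · rw [hI', blk_basis_false]

end Pipeline

end QCrypto

namespace QCrypto

open Function

/-! ### First stage of the hybrid reduction -/

section MixedChallenge

variable {N : ℕ} {ℓ E s k l i : ℕ → ℕ}

theorem of_sum {ι : Type*} {k : ℕ} (s : Finset ι) (f : ι → Amp k) :
    (Matrix.of (∑ j ∈ s, f j) : QState k) = ∑ j ∈ s, Matrix.of (f j) := by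
  ext u v
  simp only [Matrix.of_apply, Matrix.sum_apply, Finset.sum_apply]

theorem of_blk_self {k : ℕ} (σ : QState k) : Matrix.of (blk k 0 σ) = σ := blk_zero_self σ

/-- Choose `i` at random, return the `i`-th bits of the messages, and encrypt a mixture of the
messages. -/
theorem QPT.exists_mix_encrypt (hℓ : IsPoly ℓ) (hE : IsPoly E) (hE' : ∀ n, E n = 2 * ℓ n + 1)
    (hs : IsPoly s) (hk : IsPoly k) (hl : IsPoly l) (hi : IsPoly i)
    (M : QPT i (fun n => ℓ n + (ℓ n + s n) + k n)) (A : QPT (fun n => k n + ℓ n) l) :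
    ∃ C : QPT i (fun n => 1 + (1 + (s n + (E n + l n)))), ∀ n ρ {ι : Type} [Fintype ι]
      (x y : ι → Fin (ℓ n) → Bool) (ω : ι → QState (s n)) (κ : ι → QState (k n)),
      M.run n ρ = ∑ j, tens (tens (basis (x j)) (tens (basis (y j)) (ω j))) (κ j) →
      C.run n ρ = ∑ j : ι × Fin (powBelow (ℓ n) (ℓ n)), (1 / (powBelow (ℓ n) (ℓ n) : ℕ) : ℂ) •
        tens (basis fun _ : Fin 1 => bitAt (x j.1) j.2) (tens (basis fun _ : Fin 1 => bitAt (y j.1) j.2)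
          (tens (ω j.1) (tens (basis (onehot (E n) j.2)) (A.run n (tens (κ j.1)
            (basis fun m => mixed j.2 (ℓ n) (bitAt (x j.1)) (bitAt (y j.1)) m)))))) := by
  obtain ⟨S, hS⟩ := QPT.exists_sampler hℓ hE hE'
  obtain ⟨X, hX⟩ := QPT.exists_mixer hℓ hE fun n => by have := hE' n; omega
  obtain ⟨T₁, hT₁⟩ := QPT.exists_flip hℓ (hs.add hk)
  obtain ⟨T₂, hT₂⟩ := QPT.exists_flip hE hs
  have c0 := IsPoly.const 0
  have c1 := IsPoly.const 1
  -- The pipeline: `F₂` prepends a random index, `F₃` forms the mixed message, `F₄` and `F₅` move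
  -- the kept keys next to it, and `F₆` encrypts it.
  obtain ⟨F₂, h₂⟩ := QPT.exists_then_at (J := fun n => E n + (ℓ n + (ℓ n + s n) + k n)) hi c0
    ((hℓ.add (hℓ.add hs)).add hk) c0 hE (fun n => by omega) (fun n => by omega) M S
  obtain ⟨F₃, h₃⟩ := QPT.exists_then_at (J := fun n => 1 + (1 + (E n + ℓ n)) + (s n + k n)) hi c0
    (hs.add hk) (hE.add (hℓ.add hℓ)) (c1.add (c1.add (hE.add hℓ)))
    (fun n => by omega) (fun n => by omega) F₂ X
  obtain ⟨F₄, h₄⟩ := QPT.exists_then_at (J := fun n => 1 + 1 + E n + (s n + k n + ℓ n)) hi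
    ((c1.add c1).add hE) c0 (hℓ.add (hs.add hk)) ((hs.add hk).add hℓ)
    (fun n => by omega) (fun n => by omega) F₃ T₁
  obtain ⟨F₅, h₅⟩ := QPT.exists_then_at (J := fun n => 1 + 1 + (s n + E n) + (k n + ℓ n)) hi
    (c1.add c1) (hk.add hℓ) (hE.add hs) (hs.add hE)
    (fun n => by omega) (fun n => by omega) F₄ T₂
  obtain ⟨F₆, h₆⟩ := QPT.exists_then_at (J := fun n => 1 + (1 + (s n + (E n + l n)))) hi
    ((c1.add c1).add (hs.add hE)) c0 (hk.add hℓ) hl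
    (fun n => by omega) (fun n => by omega) F₅ A
  refine ⟨F₆, fun n ρ ι _ x y ω κ hM => ?_⟩
  set D := powBelow (ℓ n) (ℓ n) with hD
  have hS' : S.run n 1 = ∑ j : Fin D, (1 / (D : ℕ) : ℂ) • basis (onehot (E n) j) := by
    rw [hS, ← Fin.sum_univ_eq_sum_range fun j => (1 / (D : ℕ) : ℂ) • basis (onehot (E n) j)]
  have e₂ := h₂ n ρ (Finset.univ : Finset ι) (fun _ => 1) (fun _ => (1 : QState 0))
    (fun _ => (1 : QState 0)) (fun j => tens (tens (basis (x j)) (tens (basis (y j)) (ω j))) (κ j)) (by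
      rw [hM]
      refine Finset.sum_congr rfl fun j _ => ?_
      rw [one_smul, blk_one_zero, one_mul, one_mul]
      exact (of_blk_self _).symm)
  -- From here on the branches are indexed by the measured messages together with the sampled
  -- position.
  have e₃ := h₃ n ρ (Finset.univ : Finset (ι × Fin D)) (fun _ => (1 / (D : ℕ) : ℂ))
    (fun _ => (1 : QState 0)) (fun j => tens (basis (onehot (E n) j.2))
      (tens (basis (x j.1)) (basis (y j.1)))) (fun j => tens (ω j.1) (κ j.1)) (by
      rw [e₂, Fintype.sum_prod_type]
      refine Finset.sum_congr rfl fun j _ => ?_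
      rw [one_smul, hS', blk_sum, Finset.mul_sum, Finset.sum_mul, of_sum]
      refine Finset.sum_congr rfl fun m _ => ?_
      rw [blk_smul, mul_smul_comm, smul_mul_assoc, ← Matrix.smul_of]
      refine congrArg (HSMul.hSMul _) (congrArg Matrix.of ?_)
      simp only [blk_tens, ← Nat.add_assoc, Nat.zero_add]
      ring1)
  have e₄ := h₄ n ρ (Finset.univ : Finset (ι × Fin D)) (fun _ => (1 / (D : ℕ) : ℂ))
    (fun j => tens (tens (basis fun _ : Fin 1 => bitAt (x j.1) j.2)
      (basis fun _ : Fin 1 => bitAt (y j.1) j.2)) (basis (onehot (E n) j.2)))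
    (fun j => tens (basis fun m : Fin (ℓ n) => mixed j.2 (ℓ n) (bitAt (x j.1)) (bitAt (y j.1)) m)
      (tens (ω j.1) (κ j.1))) (fun _ => (1 : QState 0)) (by
      rw [e₃]
      refine Finset.sum_congr rfl fun j _ => congrArg _ (congrArg Matrix.of ?_)
      simp only [hX, blk_tens, blk_one_zero, ← Nat.add_assoc, Nat.zero_add]
      ring1)
  have e₅ := h₅ n ρ (Finset.univ : Finset (ι × Fin D)) (fun _ => (1 / (D : ℕ) : ℂ))
    (fun j => tens (basis fun _ : Fin 1 => bitAt (x j.1) j.2)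
      (basis fun _ : Fin 1 => bitAt (y j.1) j.2))
    (fun j => tens (basis (onehot (E n) j.2)) (ω j.1)) (fun j => tens (κ j.1)
      (basis fun m : Fin (ℓ n) => mixed j.2 (ℓ n) (bitAt (x j.1)) (bitAt (y j.1)) m)) (by
      rw [e₄]
      refine Finset.sum_congr rfl fun j _ => congrArg _ (congrArg Matrix.of ?_)
      simp only [hT₁, blk_tens, blk_one_zero, ← Nat.add_assoc, Nat.zero_add]
      ring1)
  have e₆ := h₆ n ρ (Finset.univ : Finset (ι × Fin D)) (fun _ => (1 / (D : ℕ) : ℂ))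
    (fun j => tens (tens (basis fun _ : Fin 1 => bitAt (x j.1) j.2)
      (basis fun _ : Fin 1 => bitAt (y j.1) j.2)) (tens (ω j.1) (basis (onehot (E n) j.2))))
    (fun j => tens (κ j.1)
      (basis fun m : Fin (ℓ n) => mixed j.2 (ℓ n) (bitAt (x j.1)) (bitAt (y j.1)) m))
    (fun _ => (1 : QState 0)) (by
      rw [e₅]
      refine Finset.sum_congr rfl fun j _ => congrArg _ (congrArg Matrix.of ?_)
      simp only [hT₂, blk_tens, blk_one_zero, ← Nat.add_assoc, Nat.zero_add]
      ring1)
  rw [e₆]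
  refine Finset.sum_congr rfl fun j _ => congrArg (HSMul.hSMul _) (Eq.trans (congrArg Matrix.of ?_)
    (of_blk_self (tens (basis fun _ : Fin 1 => bitAt (x j.1) j.2)
      (tens (basis fun _ : Fin 1 => bitAt (y j.1) j.2)
        (tens (ω j.1) (tens (basis (onehot (E n) j.2)) (A.run n (tens (κ j.1)
          (basis fun m => mixed j.2 (ℓ n) (bitAt (x j.1)) (bitAt (y j.1)) m)))))))))
  simp only [blk_tens, blk_one_zero, ← Nat.add_assoc, Nat.zero_add]
  ring1

end MixedChallenge

end QCrypto

namespace QCrypto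

open Function

/-! ### Second stage of the hybrid reduction: inserting the challenge -/

section Splice

variable {N : ℕ} {ℓ E s p c t : ℕ → ℕ}

/-- Replace the block indicated by a one-hot string. -/
theorem QPT.exists_replace (hℓ : IsPoly ℓ) (hE : IsPoly E) (hc : IsPoly c) (hle : ∀ n, ℓ n ≤ E n) :
    ∃ A : QPT (fun n => E n + (ℓ n * c n + c n)) (fun n => ℓ n * c n), ∀ n i (σ : ℕ → QState (c n))
      (τ : QState (c n)), (∀ j, (σ j).trace = 1) → τ.trace = 1 →
      A.run n (tens (basis (onehot (E n) i)) (tens (Matrix.of (blks (ℓ n * c n) 0 (ℓ n) σ)) τ)) =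
        Matrix.of (blks (ℓ n * c n) 0 (ℓ n) fun j => if j = i then τ else σ j) := by
  obtain ⟨Y, hY, hY'⟩ : ∃ Y, IsPoly Y ∧ ∀ n, Y n = E n + ℓ n * c n :=
    ⟨_, hE.add (hℓ.mul hc), fun _ => rfl⟩
  obtain ⟨A, hA⟩ := exists_qpt_of_tri (hE.add ((hℓ.mul hc).add hc)) (hℓ.mul hc) (.const 0)
    (C := fun n => (List.range (ℓ n)).flatMap (fun j => cswapB j (E n + j * c n) (Y n) (c n)) ++
      (resetB 0 (E n) ++ (resetB (Y n) (c n) ++ swapB (E n) (Y n + c n) (ℓ n * c n))))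
    (UGen.append (by
      have hv := UNum.var 1
      exact UGen.range_one (F := fun n j => cswapB j (E n + j * c n) (Y n) (c n)) hℓ.unum
        (UGen.cswapB hv (hE.unum.add (hv.mul hc.unum)) hY.unum hc.unum))
      ((UGen.resetB (.const 0) hE.unum).append ((UGen.resetB hY.unum hc.unum).append
      (UGen.swapB hE.unum (hY.add hc).unum (hℓ.mul hc).unum))))
    (ι := fun n => ℕ × (ℕ → QState (c n)) × QState (c n))
    (fun n v => tens (basis (onehot (E n) v.1))
      (tens (Matrix.of (blks (ℓ n * c n) 0 (ℓ n) v.2.1)) v.2.2))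
    -- The scalar is the trace of what is finally erased: the replaced block, or the new state
    -- itself if the index lies beyond the last block.
    (fun n v => (if v.1 < ℓ n then v.2.1 v.1 else v.2.2).trace •
      Matrix.of (blks (ℓ n * c n) 0 (ℓ n) fun j => if j = v.1 then v.2.2 else v.2.1 j)) (by
      rintro n N ⟨i, σ, τ⟩ hN
      have := hY' n; have := hle n
      have hj := fun j (h : j < ℓ n) => mul_add_le_mul (c n) h
      have hlt := fun i j (h : j < i) => mul_add_le_mul (c n) h
      -- The blocks after `j` rounds: the exchange happens in round `i` only, since just one bit of
      -- the control string is set.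
      set κ : ℕ → ℕ → QState (c n) := fun j m => if m < j ∧ m = i then τ else σ m with hκ
      set R := zero N (Y n + c n) (ℓ n * c n) with hR
      set S : ℕ → Amp N := fun j => blk N 0 (basis (onehot (E n) i)) *
        (∏ m ∈ Finset.range (ℓ n), blk N (E n + m * c n) (κ j m)) *
        blk N (Y n) (if i < j then σ i else τ) * R with hS
      have hloop : Tri (N := N) resetOracle ((List.range (ℓ n)).flatMap fun j =>
          cswapB j (E n + j * c n) (Y n) (c n)) Set.univ (S 0) (S (ℓ n)) := by
        refine Tri.loop fun j hjℓ => ?_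
        have := hj j hjℓ
        have hmem : j ∈ Finset.range (ℓ n) := Finset.mem_range.2 hjℓ
        have hP : ∀ d, S d = blk N 0 (basis (onehot (E n) i)) * (blk N (E n + j * c n) (κ d j) *
            blk N (Y n) (if i < d then σ i else τ)) *
            ((∏ m ∈ (Finset.range (ℓ n)).erase j, blk N (E n + m * c n) (κ d m)) * R) := fun d => by
          simp only [hS]
          rw [← Finset.mul_prod_erase _ _ hmem]
          ring1
        have hQ : ∏ m ∈ (Finset.range (ℓ n)).erase j, blk N (E n + m * c n) (κ (j + 1) m) =
            ∏ m ∈ (Finset.range (ℓ n)).erase j, blk N (E n + m * c n) (κ j m) :=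
          Finset.prod_congr rfl fun m hm => by
            have := Finset.ne_of_mem_erase hm
            have e : m < j + 1 ∧ m = i ↔ m < j ∧ m = i := by omega
            simp only [hκ, e]
        have h := Tri.cswap (N := N) (O := resetOracle) (a := E n + j * c n) (b := Y n) (c := j)
          (k := c n) (by omega) (by omega) (by omega) (by omega) (by omega) (by omega)
          (Ctrl.blk_basis (a := 0) (onehot (E n) i) (by omega) (by omega))
          (Indep.blk _ fun m hm => by
            simp only [Set.mem_union, Set.mem_Ico] at hm
            omega) (κ j j) (if i < j then σ i else τ)
        rw [hP j, hP (j + 1), hQ]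
        refine h.step _ (Set.subset_univ _) (Indep.mul (Indep.prod fun m hm => Indep.blk _
          fun l hl => ?_) (Indep.blk _ fun l hl => ?_)) rfl ?_
        · have h1 := Finset.ne_of_mem_erase hm
          have h2 := hj m (Finset.mem_range.1 (Finset.mem_of_mem_erase hm))
          have h3 := hlt m j
          have h4 := hlt j m
          simp only [Set.mem_union, Set.mem_Ico] at hl
          omega
        · simp only [Set.mem_union, Set.mem_Ico] at hl
          omega
        · have e : bitAt (onehot (E n) i) (j - 0) = decide (j = i) := bitAt_onehot i (by omega)
          have e' : (if i < j + 1 then σ i else τ) =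
              if decide (j = i) then κ j j else if i < j then σ i else τ := by
            by_cases h : j = i
            · subst h
              simp [hκ]
            · have : i < j + 1 ↔ i < j := by omega
              simp [h, this]
          have e'' : κ (j + 1) j = if decide (j = i) then if i < j then σ i else τ else κ j j := by
            by_cases h : j = i
            · subst h
              simp [hκ]
            · simp [h, hκ]
          rw [e, e', e'']
          rfl
      have hr := Tri.reset (N := N) (a := 0) (k := E n) (by omega) (basis (onehot (E n) i))
      rw [trace_basis, one_smul] at hr
      set f : ℕ → QState (c n) := fun j => if j = i then τ else σ j with hf
      set β := (if i < ℓ n then σ i else τ).trace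
      have e0 : S 0 = blk N 0 (basis (onehot (E n) i)) * blks N (E n) (ℓ n) σ * blk N (Y n) τ * R := by
        simp only [hS, hκ, blks, Nat.not_lt_zero, false_and, if_false]
      have e1 : S (ℓ n) = blk N 0 (basis (onehot (E n) i)) * blks N (E n) (ℓ n) f *
          blk N (Y n) (if i < ℓ n then σ i else τ) * R := by
        simp only [hS]
        rw [show (∏ m ∈ Finset.range (ℓ n), blk N (E n + m * c n) (κ (ℓ n) m)) =
          blks N (E n) (ℓ n) f from Finset.prod_congr rfl fun m hm => by
            simp only [hκ, hf, Finset.mem_range.1 hm, true_and]]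
      have e2 : ∀ g : ℕ → QState (c n), blk N (E n) (Matrix.of (blks (ℓ n * c n) 0 (ℓ n) g)) =
          blks N (E n) (ℓ n) g := fun g => by rw [blk_of_blks (by omega), Nat.add_zero]
      rw [e0, e1] at hloop
      have hi : ∀ g : ℕ → QState (c n), ∀ B : Set ℕ, (∀ i ∈ B, i < E n ∨ Y n ≤ i) →
          Indep B (blks N (E n) (ℓ n) g) := fun g B hB => by
        rw [← e2]
        refine Indep.blk _ fun j hj => ?_
        have := hB j hj
        omega
      refine (hloop.step 1 subset_rfl Indep.one ?_ rfl).append ((hr.step (blks N (E n) (ℓ n) f *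
        blk N (Y n) (if i < ℓ n then σ i else τ) * R) (Set.subset_univ _) ?_ ?_ rfl).append
        (((Tri.reset (N := N) (a := Y n) (k := c n) (by omega) (if i < ℓ n then σ i else τ)).step
        (zero N 0 (E n) * blks N (E n) (ℓ n) f * R) (Set.subset_univ _) ?_ ?_ rfl).append
        (((Tri.swap (O := resetOracle) (a := E n) (b := Y n + c n) (k := ℓ n * c n) (by omega)
        (by omega) (by omega) (Matrix.of (blks (ℓ n * c n) 0 (ℓ n) f)) (basis fun _ => false)).smul
        β).step (zero N 0 (E n) * zero N (Y n) (c n)) (Set.subset_univ _) ?_ ?_ ?_)))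
      · rw [blk_tens, blk_tens, Nat.zero_add, e2, ← hY', hR, Nat.add_zero, ← Nat.add_assoc, ← hY']
        ring1
      · refine ((hi _ _ fun j hj => ?_).mul (Indep.blk _ fun j hj => ?_)).mul
          (Indep.blk _ fun j hj => ?_) <;>
        · simp only [Set.mem_Ico] at hj
          omega
      · ring1
      · refine ((Indep.blk _ fun j hj => ?_).mul (hi _ _ fun j hj => ?_)).mul
          (Indep.blk _ fun j hj => ?_) <;>
        · simp only [Set.mem_Ico] at hj
          omega
      · ring1
      · refine (Indep.blk _ fun j hj => ?_).mul (Indep.blk _ fun j hj => ?_) <;>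
        · simp only [Set.mem_union, Set.mem_Ico] at hj
          omega
      · rw [e2, blk_basis_false, smul_mul_assoc, smul_mul_assoc]
        congr 1
        ring1
      · rw [blk_smul, QCrypto.zero_add, QCrypto.zero_add, Nat.zero_add, ← hY', ← Nat.add_assoc,
          ← hY', zero_zero, blk_basis_false, mul_one, mul_smul_comm, smul_mul_assoc]
        congr 1
        ring1)
  refine ⟨A, fun n i σ τ hσ hτ => (hA n (i, σ, τ)).trans ?_⟩
  have : (if i < ℓ n then σ i else τ).trace = 1 := by split_ifs <;> simp [hσ, hτ]
  simp only [this, one_smul]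

end Splice

end QCrypto

namespace QCrypto

open Function

/-! ### Assembling the two stages -/

section Hybrid

variable {N : ℕ} {ℓ E s p c t k l : ℕ → ℕ}

theorem prod_range_mul {M : Type*} [CommMonoid M] (t m : ℕ) (f : ℕ → M) :
    ∏ j ∈ Finset.range (t * m), f j =
      ∏ i ∈ Finset.range t, ∏ j ∈ Finset.range m, f (i * m + j) := by
  induction t with
  | zero => simp
  | succ t ih => rw [Nat.succ_mul, Finset.prod_range_add, ih, Finset.prod_range_succ]

theorem blk_copies_mul {k : ℕ} (a t m : ℕ) (σ : QState k) :
    blk N a (copies (t * m) σ) = blk N a (copies t (copies m σ)) := by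
  rw [blk_copies, blk_copies, prod_range_mul]
  refine Finset.prod_congr rfl fun i _ => ?_
  rw [blk_copies]
  refine Finset.prod_congr rfl fun j _ => ?_
  congr 1
  ring

/-- A public key of the bitwise scheme consists of `m` one-bit keys: `t` such keys go to the
adversary's first stage, and one more is kept for encrypting the hybrid message. -/
theorem copies_add_one_mul {k K : ℕ} (t m : ℕ) (hK : K = (t + 1) * m * k) (σ : QState k) :
    blk K 0 (copies ((t + 1) * m) σ) =
      blk K 0 (copies t (copies m σ)) * blk K (t * (m * k)) (copies m σ) := by
  rw [Nat.add_mul, Nat.one_mul, blk_copies_add, blk_copies_mul, Nat.zero_add, Nat.mul_assoc]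

/-- Run the first stage of an adversary and keep fresh copies of the public key. -/
theorem QPT.exists_measure_keep (hℓ : IsPoly ℓ) (hs : IsPoly s) (hp : IsPoly p) (ht : IsPoly t)
    (A : QPT (fun n => t n * (ℓ n * p n)) (fun n => ℓ n + (ℓ n + s n))) :
    ∃ C : QPT (fun n => (t n + 1) * ℓ n * p n) (fun n => ℓ n + (ℓ n + s n) + ℓ n * p n),
      ∀ n (ρ : QState (p n)), C.run n (copies ((t n + 1) * ℓ n) ρ) =
        ∑ x : (Fin (ℓ n) → Bool) × (Fin (ℓ n) → Bool), tens (tens (basis x.1) (tens (basis x.2)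
          (onOutcome (onOutcome (A.run n (copies (t n) (copies (ℓ n) ρ))) x.1) x.2)))
          (copies (ℓ n) ρ) := by
  obtain ⟨D, hD⟩ := QPT.exists_measure_two hℓ hs
  have c0 := IsPoly.const 0
  have hK := hℓ.mul hp
  have ho := hℓ.add (hℓ.add hs)
  obtain ⟨F, hF⟩ := QPT.exists_apply_at (I := fun n => (t n + 1) * ℓ n * p n)
    (J := fun n => ℓ n + (ℓ n + s n) + ℓ n * p n) c0 hK (ht.mul hK) ho (fun n => by ring)
    (fun n => by ring) A
  obtain ⟨G, hG⟩ := QPT.exists_then_at (J := fun n => ℓ n + (ℓ n + s n) + ℓ n * p n)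
    (((ht.add (.const 1)).mul hℓ).mul hp) c0 hK ho ho (fun n => by ring) (fun n => by ring) F D
  refine ⟨G, fun n ρ => ?_⟩
  have e := hF n (1 : QState 0) (copies (t n) (copies (ℓ n) ρ)) (copies (ℓ n) ρ)
  rw [blk_one_zero, blk_one_zero, one_mul, one_mul, Nat.zero_add, ← copies_add_one_mul _ _ rfl,
    of_blk_self] at e
  have e' := hG n (copies ((t n + 1) * ℓ n) ρ) (Finset.univ : Finset Unit) (fun _ => 1)
    (fun _ => (1 : QState 0)) (fun _ => A.run n (copies (t n) (copies (ℓ n) ρ)))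
    (fun _ => copies (ℓ n) ρ) (by
      rw [e, Fintype.sum_unique, one_smul, blk_one_zero, one_mul, Nat.zero_add])
  rw [e', Fintype.sum_unique, one_smul, blk_one_zero, one_mul, hD, blk_sum, Finset.sum_mul, of_sum]
  refine Finset.sum_congr rfl fun x _ => ?_
  rw [of_tens (tens _ _), Nat.zero_add]

/-- Replace the block indicated by a one-hot string by the challenge, and run `A`. -/
theorem QPT.exists_replace_run (hℓ : IsPoly ℓ) (hE : IsPoly E) (hs : IsPoly s) (hc : IsPoly c)
    (hle : ∀ n, ℓ n ≤ E n) (A : QPT (fun n => s n + ℓ n * c n) (fun _ => 1)) :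
    ∃ C : QPT (fun n => (s n + (E n + ℓ n * c n)) + c n) (fun _ => 1), ∀ n (ω : QState (s n)) i
      (σ : ℕ → QState (c n)) (τ : QState (c n)), (∀ j, (σ j).trace = 1) → τ.trace = 1 →
      C.run n (tens (tens ω (tens (basis (onehot (E n) i))
        (Matrix.of (blks (ℓ n * c n) 0 (ℓ n) σ)))) τ) =
      A.run n (tens ω (Matrix.of (blks (ℓ n * c n) 0 (ℓ n) fun j => if j = i then τ else σ j))) := by
  obtain ⟨X, hX⟩ := QPT.exists_replace hℓ hE hc hle
  have hL := hℓ.mul hc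
  obtain ⟨F, hF⟩ := QPT.exists_apply_at (I := fun n => (s n + (E n + ℓ n * c n)) + c n)
    (J := fun n => s n + ℓ n * c n) hs (.const 0) (hE.add (hL.add hc)) hL (fun n => by ring)
    (fun n => by ring) X
  obtain ⟨C, hC⟩ := QPT.exists_then ((hs.add (hE.add hL)).add hc) (hs.add hL) (.const 1) F A
  refine ⟨C, fun n ω i σ τ hσ hτ => ?_⟩
  have e := hF n ω (tens (basis (onehot (E n) i))
    (tens (Matrix.of (blks (ℓ n * c n) 0 (ℓ n) σ)) τ)) (1 : QState 0)
  rw [hX n i σ τ hσ hτ, blk_one_zero, blk_one_zero, mul_one, mul_one, ← of_tens] at e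
  rw [hC, ← e]
  refine congrArg (fun ξ => A.run n (F.run n ξ)) ((of_blk_self _).symm.trans (congrArg Matrix.of ?_))
  simp only [blk_tens, ← Nat.add_assoc, Nat.zero_add]
  ring1

theorem prob_smul_real {k : ℕ} (r : ℝ) (σ : QState k) (x : Fin k → Bool) :
    prob ((r : ℂ) • σ) x = r * prob σ x := by
  simp [prob]

/-- In each branch `j` the measured registers are basis states, so the sum over outcomes collapses
to the outcomes `f j` and `g j`. -/
theorem prob_sum_onOutcome {s a : ℕ → ℕ} (A : QPT (fun n => s n + a n) fun _ => 1) (n : ℕ) {m : ℕ}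
    {ι : Type*} [Fintype ι] (r : ℝ) (f g : ι → Fin m → Bool) (ω : ι → QState (s n))
    (F : (Fin m → Bool) → (Fin m → Bool) → QState (a n)) (y : Fin 1 → Bool) :
    ∑ x₀ : Fin m → Bool, ∑ x₁ : Fin m → Bool, prob (A.run n (tens (onOutcome (onOutcome
      (∑ j, (r : ℂ) • tens (basis (f j)) (tens (basis (g j)) (ω j))) x₀) x₁) (F x₀ x₁))) y =
      ∑ j, r * prob (A.run n (tens (ω j) (F (f j) (g j)))) y := by
  have h0 : ∀ τ : QState (a n), prob (A.run n (tens 0 τ)) y = 0 := fun τ => by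
    have := A.run_smul n 0 (tens 0 τ)
    rw [← tens_smul_left, smul_zero, zero_smul] at this
    rw [this]
    rfl
  have key : ∀ x₀ x₁, prob (A.run n (tens (onOutcome (onOutcome
      (∑ j, (r : ℂ) • tens (basis (f j)) (tens (basis (g j)) (ω j))) x₀) x₁) (F x₀ x₁))) y =
      ∑ j, if x₁ = g j then if x₀ = f j then
        r * prob (A.run n (tens (ω j) (F x₀ x₁))) y else 0 else 0 := fun x₀ x₁ => by
    simp only [onOutcome_sum, tens_sum_left, QPT.run_sum, prob_sum]
    refine Finset.sum_congr rfl fun j _ => ?_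
    have e : onOutcome (onOutcome ((r : ℂ) • tens (basis (f j)) (tens (basis (g j)) (ω j))) x₀) x₁ =
        (r : ℂ) • onOutcome (onOutcome (tens (basis (f j)) (tens (basis (g j)) (ω j))) x₀) x₁ := rfl
    rw [e, tens_smul_left, QPT.run_smul, prob_smul_real, onOutcome_basis_tens]
    by_cases h1 : x₀ = f j
    · rw [if_pos h1, onOutcome_basis_tens, if_pos h1]
      by_cases h2 : x₁ = g j
      · rw [if_pos h2, if_pos h2]
      · rw [if_neg h2, if_neg h2, h0, mul_zero]
    · have e' : onOutcome (0 : QState (m + s n)) x₁ = 0 := rfl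
      rw [if_neg h1, e', h0, mul_zero, if_neg h1, ite_self]
  simp only [key]
  rw [Finset.sum_congr rfl fun x₀ _ => Finset.sum_comm, Finset.sum_comm]
  refine Finset.sum_congr rfl fun j _ => ?_
  simp only [Finset.sum_ite_eq', Finset.mem_univ, if_true]

end Hybrid

end QCrypto

namespace QCrypto

open Function

/-! ### The hybrid argument -/

section HybridArgument

variable {ℓ κ p c : ℕ → ℕ}

theorem QPKE.trace_ct (P : QPKE ℓ κ p c) (n : ℕ) (sk : Fin (κ n) → Bool) (x : Fin (ℓ n) → Bool) :
    (P.ct n (P.pk n sk) x).trace = 1 := by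
  rw [QPKE.ct, QPT.trace_run, trace_tens, QPKE.pk, QPT.trace_run, trace_basis, trace_basis, mul_one]

/-- In hybrid `d` the first `d` bits come from the second message. The mixed message agrees with
hybrids `i` and `i + 1` off position `i`, where the challenge is inserted; so the challenge bit
decides between these two. If `i` lies beyond the message, nothing is inserted, and the two hybrids
agree. -/
theorem prob_sum_hybrid {E s : ℕ → ℕ} {D : ℕ} (n : ℕ) (A : QPT (fun n => s n + ℓ n * c n) fun _ => 1)
    (B : QPT (fun n => (s n + (E n + ℓ n * c n)) + c n) fun _ => 1)
    (hB : ∀ (ω : QState (s n)) i (σ : ℕ → QState (c n)) (τ : QState (c n)),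
      (∀ j, (σ j).trace = 1) → τ.trace = 1 → B.run n (tens (tens ω (tens (basis (onehot (E n) i))
        (Matrix.of (blks (ℓ n * c n) 0 (ℓ n) σ)))) τ) =
      A.run n (tens ω (Matrix.of (blks (ℓ n * c n) 0 (ℓ n) fun j => if j = i then τ else σ j))))
    (τ : QState (1 + (1 + (s n + (E n + ℓ n * c n)))))
    (ω : (Fin (ℓ n) → Bool) × (Fin (ℓ n) → Bool) → QState (s n)) (ct : (Fin 1 → Bool) → QState (c n))
    (hct : ∀ x, (ct x).trace = 1)
    (hτ : τ = ∑ j : ((Fin (ℓ n) → Bool) × (Fin (ℓ n) → Bool)) × Fin D, ((1 / (D : ℝ) : ℝ) : ℂ) •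
      tens (basis fun _ : Fin 1 => bitAt j.1.1 j.2) (tens (basis fun _ : Fin 1 => bitAt j.1.2 j.2)
        (tens (ω j.1) (tens (basis (onehot (E n) j.2)) (Matrix.of (blks (ℓ n * c n) 0 (ℓ n) fun m =>
          ct fun _ => bitAt (fun m : Fin (ℓ n) => mixed j.2 (ℓ n) (bitAt j.1.1) (bitAt j.1.2) m) m))))))
    (b : Bool) :
    ∑ x₀ : Fin 1 → Bool, ∑ x₁ : Fin 1 → Bool, prob (B.run n (tens (onOutcome (onOutcome τ x₀) x₁)
        (ct (if b then x₁ else x₀)))) (fun _ => true) =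
      ∑ j : ((Fin (ℓ n) → Bool) × (Fin (ℓ n) → Bool)) × Fin D, 1 / (D : ℝ) *
        prob (A.run n (tens (ω j.1) (Matrix.of (blks (ℓ n * c n) 0 (ℓ n) fun m => ct fun _ =>
          bitAt (if m < (if b then (j.2 : ℕ) + 1 else j.2) then j.1.2 else j.1.1) m))))
          (fun _ => true) := by
  rw [hτ, prob_sum_onOutcome (s := fun n => s n + (E n + ℓ n * c n)) (a := c) B n (1 / (D : ℝ))
    (fun j : ((Fin (ℓ n) → Bool) × (Fin (ℓ n) → Bool)) × Fin D => fun _ => bitAt j.1.1 j.2)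
    (fun j => fun _ => bitAt j.1.2 j.2) _ (fun x₀ x₁ => ct (if b then x₁ else x₀)) fun _ => true]
  refine Finset.sum_congr rfl fun j _ => congrArg _ ?_
  rw [hB (ω j.1) j.2 _ _ (fun _ => hct _) (hct _)]
  refine congrArg (fun ξ => prob (A.run n (tens (ω j.1) (Matrix.of ξ))) fun _ => true)
    (blks_congr _ fun m hm => ?_)
  by_cases h : m = j.2
  · rw [if_pos h]
    cases b <;> simp [h]
  · rw [if_neg h, bitAt_of_lt _ hm]
    refine congrArg ct (funext fun _ => ?_)
    have e : (m < if b = true then (j.2 : ℕ) + 1 else j.2) ↔ m < j.2 := by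
      cases b <;> simp <;> omega
    simp only [mixed, hm, if_true, e]
    by_cases h' : m < j.2
    · rw [if_pos h', if_pos h']
    · rw [if_neg h', if_neg h, if_neg h']

/-- The hybrid argument. -/
theorem QPKE.INDCPA.bitwise (hℓ : IsPoly ℓ) (hp : IsPoly p) (hc : IsPoly c)
    {P : QPKE (fun _ => 1) κ p c} (hP : P.INDCPA)
    {P' : QPKE ℓ κ (fun n => ℓ n * p n) (fun n => ℓ n * c n)} (hkey : P'.skGen = P.skGen)
    (hpk : ∀ n sk, P'.pk n sk = copies (ℓ n) (P.pk n sk))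
    (hct : ∀ n ρ x, P'.ct n (copies (ℓ n) ρ) x =
      Matrix.of (blks _ 0 (ℓ n) fun j => P.ct n ρ fun _ => bitAt x j)) : P'.INDCPA := by
  intro t s ht hs A₁ A₂
  -- The width of the one-hot index: large enough for all of the at most `2 * ℓ n + 1` positions.
  obtain ⟨E, hE, hE'⟩ : ∃ E, IsPoly E ∧ ∀ n, E n = 2 * ℓ n + 1 :=
    ⟨_, ((IsPoly.const 2).mul hℓ).add (.const 1), fun _ => rfl⟩
  obtain ⟨M, hM⟩ := QPT.exists_measure_keep hℓ hs hp ht A₁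
  obtain ⟨B₁, hB₁⟩ := QPT.exists_mix_encrypt hℓ hE hE' hs (hℓ.mul hp) (hℓ.mul hc)
    (((ht.add (.const 1)).mul hℓ).mul hp) M P'.enc
  obtain ⟨B₂, hB₂⟩ := QPT.exists_replace_run hℓ hE hs hc (fun n => by have := hE' n; omega) A₂
  set Q := fun b n => P.game (t := fun n => (t n + 1) * ℓ n) (s := fun n => s n + (E n + ℓ n * c n))
    B₁ B₂ b n with hQ
  have hneg : Negligible fun n => |Q false n - Q true n| :=
    hP (fun n => (t n + 1) * ℓ n) (fun n => s n + (E n + ℓ n * c n)) ((ht.add (.const 1)).mul hℓ)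
      (hs.add (hE.add (hℓ.mul hc))) B₁ B₂
  set ω : ∀ n, (Fin (κ n) → Bool) → (Fin (ℓ n) → Bool) × (Fin (ℓ n) → Bool) → QState (s n) :=
    fun n sk x => onOutcome (onOutcome (A₁.run n (copies (t n) (copies (ℓ n) (P.pk n sk)))) x.1) x.2
    with hω
  set H : ∀ n, (Fin (κ n) → Bool) → (Fin (ℓ n) → Bool) × (Fin (ℓ n) → Bool) → ℕ → ℝ :=
    fun n sk x d => prob (A₂.run n (tens (ω n sk x) (Matrix.of (blks (ℓ n * c n) 0 (ℓ n) fun m =>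
      P.ct n (P.pk n sk) fun _ => bitAt (if m < d then x.2 else x.1) m)))) fun _ => true with hH
  set G : ℕ → ℕ → ℝ := fun n d => ∑ sk, P.keyProb n sk * ∑ x, H n sk x d with hG
  set D : ℕ → ℕ := fun n => powBelow (ℓ n) (ℓ n) with hD
  have hgame : ∀ n b, P'.game A₁ A₂ b n = G n (if b then D n else 0) := fun n b => by
    rw [QPKE.game, hG]
    refine Finset.sum_congr rfl fun sk _ => ?_
    have e : P'.keyProb n sk = P.keyProb n sk := by
      rw [QPKE.keyProb, hkey]
      rfl
    rw [e, Fintype.sum_prod_type]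
    refine congrArg _ (Finset.sum_congr rfl fun x₀ _ => Finset.sum_congr rfl fun x₁ _ => ?_)
    rw [hpk, hct]
    refine congrArg (fun ξ => prob (A₂.run n (tens _ (Matrix.of ξ))) fun _ => true)
      (blks_congr _ fun m hm => ?_)
    -- These bounds give `ℓ n ≤ D n`, so that hybrid `D n` is the second message on all positions.
    have hb := powBelow_bounds (ℓ n) (ℓ n)
    cases b
    · rfl
    · have : m < D n := by simp only [hD]; omega
      simp only [if_true, if_pos this]
  -- For a random position, the one-bit game averages the hybrids `0, …, D - 1` for one value of the
  -- challenge bit and `1, …, D` for the other.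
  have hQG : ∀ n b, Q b n = (1 / (D n : ℝ)) * ∑ i ∈ Finset.range (D n),
      G n (if b then i + 1 else i) := fun n b => by
    have hsk : ∀ sk, ∑ x₀ : Fin 1 → Bool, ∑ x₁ : Fin 1 → Bool, prob (B₂.run n (tens
        (onOutcome (onOutcome (B₁.run n (copies ((t n + 1) * ℓ n) (P.pk n sk))) x₀) x₁)
        (P.ct n (P.pk n sk) (if b then x₁ else x₀)))) (fun _ => true) =
        ∑ j : ((Fin (ℓ n) → Bool) × (Fin (ℓ n) → Bool)) × Fin (D n),
          1 / (D n : ℝ) * H n sk j.1 (if b then j.2 + 1 else j.2) := fun sk => by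
      have e1 : (1 / (powBelow (ℓ n) (ℓ n) : ℕ) : ℂ) = ((1 / (D n : ℝ) : ℝ) : ℂ) := by
        push_cast
        rfl
      have e0 : M.run n (copies ((t n + 1) * ℓ n) (P.pk n sk)) =
          ∑ x : (Fin (ℓ n) → Bool) × (Fin (ℓ n) → Bool),
            tens (tens (basis x.1) (tens (basis x.2) (ω n sk x))) (copies (ℓ n) (P.pk n sk)) :=
        hM n (P.pk n sk)
      have e2 := hB₁ n (copies ((t n + 1) * ℓ n) (P.pk n sk))
        (ι := (Fin (ℓ n) → Bool) × (Fin (ℓ n) → Bool)) (fun x => x.1) (fun x => x.2) (ω n sk)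
        (fun _ => copies (ℓ n) (P.pk n sk)) e0
      have e3 := fun x : Fin (ℓ n) → Bool => hct n (P.pk n sk) x
      simp only [QPKE.ct] at e3
      simp only [e1, e3] at e2
      exact prob_sum_hybrid n A₂ B₂ (hB₂ n) _ (ω n sk) (fun x => P.ct n (P.pk n sk) x)
        (P.trace_ct n sk) e2 b
    refine (Finset.sum_congr rfl fun sk _ => congrArg _ (hsk sk)).trans ?_
    simp only [hG, Finset.mul_sum]
    rw [Finset.sum_comm (s := Finset.range (D n))]
    refine Finset.sum_congr rfl fun sk _ => ?_
    rw [Fintype.sum_prod_type, Finset.sum_comm (s := Finset.range (D n))]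
    refine Finset.sum_congr rfl fun x _ => ?_
    rw [← Fin.sum_univ_eq_sum_range fun i =>
      1 / (D n : ℝ) * (P.keyProb n sk * H n sk x (if b then i + 1 else i))]
    exact Finset.sum_congr rfl fun i _ => mul_left_comm _ _ _
  have hmain : ∀ n, |P'.game A₁ A₂ false n - P'.game A₁ A₂ true n| =
      (D n : ℝ) * |Q false n - Q true n| := fun n => by
    have hpos : (0 : ℝ) < D n := Nat.cast_pos.2 (powBelow_bounds (ℓ n) (ℓ n)).1
    -- The difference of the two averages telescopes to the two extreme hybrids, divided by `D n`.
    have e : ∑ i ∈ Finset.range (D n), G n i - ∑ i ∈ Finset.range (D n), G n (i + 1) =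
        G n 0 - G n (D n) := by
      rw [← Finset.sum_sub_distrib (s := Finset.range (D n)), Finset.sum_range_sub']
    rw [hgame, hgame, hQG, hQG, ← mul_sub]
    simp only [if_true, Bool.false_eq_true, if_false]
    rw [e, abs_mul, abs_of_pos (one_div_pos.2 hpos), ← mul_assoc,
      mul_one_div_cancel hpos.ne', one_mul]
  -- The loss factor `D n` is bounded by the polynomial `E n`, which preserves negligibility.
  refine Asymptotics.SuperpolynomialDecay.trans_abs_le (hneg.poly_mul hE) fun n => ?_
  rw [hmain, abs_mul, abs_mul, abs_abs, Nat.abs_cast, Nat.abs_cast]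
  refine mul_le_mul_of_nonneg_right (Nat.cast_le.2 ?_) (abs_nonneg _)
  rw [hE']
  exact (powBelow_bounds (ℓ n) (ℓ n)).2.1

theorem ExistsQPKE.of_one (hℓ : IsPoly ℓ) (h : ExistsQPKE fun _ => 1) : ExistsQPKE ℓ := by
  obtain ⟨κ, p, c, hκ, hp, hc, P, hcor, hsec⟩ := h
  obtain ⟨P', hkey, hpk, hct, hdec⟩ := QPKE.exists_bitwise hℓ hκ hp hc P
  refine ⟨κ, _, _, hκ, hℓ.mul hp, hℓ.mul hc, P', hcor.bitwise hℓ hkey fun n sk x => ?_,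
    hsec.bitwise hℓ hp hc hkey hpk hct⟩
  rw [hpk, hct, hdec]

end HybridArgument

end QCrypto

theorem mainTheorem10 :
    (∀ ℓ ℓ' : ℕ → ℕ, QCrypto.IsPoly ℓ → QCrypto.IsPoly ℓ' →
      (∀ n, 1 ≤ n → 1 ≤ ℓ n) → (∀ n, 1 ≤ n → 1 ≤ ℓ' n) →
      (QCrypto.ExistsQPKE ℓ ↔ QCrypto.ExistsQSKE ℓ')) ∧
    (∀ κ c : ℕ → ℕ, QCrypto.IsPoly κ → QCrypto.IsPoly c →
      ∀ S : QCrypto.QSKE (fun _ => 1) κ c, S.Secure →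
        ∃ P : QCrypto.QPKE (fun _ => 1) κ (fun n => c n + c n) c,
          P.skGen = S.keyGen ∧
          P.dec = S.dec ∧
          (∀ (n : ℕ) (sk : Fin (κ n) → Bool),
            P.pk n sk = QCrypto.tens (S.ct n sk fun _ => false) (S.ct n sk fun _ => true)) ∧
          (∀ (n : ℕ) (ρ₀ ρ₁ : QCrypto.QState (c n)),
            QCrypto.IsDensity ρ₀ → QCrypto.IsDensity ρ₁ →
            P.ct n (QCrypto.tens ρ₀ ρ₁) (fun _ => false) = ρ₀ ∧
            P.ct n (QCrypto.tens ρ₀ ρ₁) (fun _ => true) = ρ₁) ∧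
          P.Secure) := by
  refine ⟨fun ℓ ℓ' hℓ hℓ' h1 h1' => ⟨fun h => ?_, fun h => ?_⟩, fun κ c hκ hc S hS => ?_⟩
  -- The length is changed from `ℓ` to `ℓ'` by passing through one-bit public-key encryption, which
  -- requires a secret-key scheme of length `ℓ` first.
  · exact QCrypto.ExistsQSKE.of_existsQPKE hℓ' (QCrypto.ExistsQPKE.of_one hℓ'
      (QCrypto.ExistsQPKE.of_existsQSKE hℓ h1 (QCrypto.ExistsQSKE.of_existsQPKE hℓ h)))
  · exact QCrypto.ExistsQPKE.of_one hℓ (QCrypto.ExistsQPKE.of_existsQSKE hℓ' h1' h)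
  · exact QCrypto.QSKE.exists_qpke_one hκ hc S hS
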